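/- **Notation.** Let $G=\mathrm{PSL}_2(\mathbf C)$ act on the upper half-space $\mathbf H^3=\mathbf C\times\mathbf R_{>0}$; identify $G$ with the frame bundle of $\mathbf H^3$ through the base frame at $p_0=(0,1)$ with first vector $u_0=(0,1)$ (vertical) and second vector $n_0=(1,0)$. Put $a_t=\mathrm{diag}(e^{t/2},e^{-t/2})$, let $R_\theta=\begin{pmatrix}\cos(\theta/2)&-i\sin(\theta/2)\\-i\sin(\theta/2)&\cos(\theta/2)\end{pmatrix}$ be the rotation of angle $\theta$ about $n_0$, and for $x\in G$, $k\in\mathbf Z/3$, $r\in\mathbf R$ put $x_{(k,r)}=xR_{2k\pi/3}a_{r/4}$. Fix a Riemannian metric on $G$ that is left invariant, right invariant under the stabilizer $K$ of $p_0$ and lifts the hyperbolic metric (i.e. $g\mapsto g p_0$ is a Riemannian submersion); $d$ is its distance. Let $\Gamma\subset G$ be a discrete torsion-free subgroup with $\Gamma\backslash G$ compact, and $\nu$ the Haar measure of $G$ that induces a probability measure on $\Gamma\backslash G$. For $\varepsilon>0$ let $\chi_\varepsilon\ge 0$ be a $C^\infty$ function on $G$ supported in the ball $\{d(1,g)\le\varepsilon/2\}$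 with $\chi_\varepsilon(1)>0$ and $\int\chi_\varepsilon\,d\nu=1$, and put $$a_{\varepsilon,r}(x,y)=\int_G\chi_\varepsilon(x^{-1}ga_r)\,\chi_\varepsilon(y^{-1}g)\,d\nu(g).$$ Let $\Gamma$ act on $G\times G\times\Gamma^3$ by $\gamma\cdot(x,y,(A_k))=(\gamma x,\gamma y,(\gamma A_k\gamma^{-1}))$. For $r>0$, let $\beta_{\varepsilon,r}$ be the measure on $\Gamma\backslash(G\times G\times\Gamma^3)$ induced by the $\Gamma$-invariant measure $$\prod_{k\in\mathbf Z/3}a_{\varepsilon,r/2}\big(x_{(-k,-r)},A_ky_{(k,r)}\big)\,d\nu(x)\,d\nu(y)\,dn(A),$$ where $dn$ is the counting measure on $\Gamma^3$. Let $\widehat{\mathcal P}$ be the discrete space of triples $(\gamma_1,\gamma_2,\gamma_3)\in\Gamma^3$ with $\gamma_1\gamma_2\gamma_3=1$, modulo simultaneous conjugation by $\Gamma$, and let $\Phi$ send the class of $(x,y,A)$ to the class of $(A_0A_1^{-1},A_1A_2^{-1},A_2A_0^{-1})$. **Flat pants.** Let $\Pi$ be a pair of pants with $\pi_1(\Pi)=\langle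 c_1,c_2,c_3\mid c_1c_2c_3=1\rangle$, the $c_n$ being the classes of the oriented boundary components. A class $[\gamma_1,\gamma_2,\gamma_3]\in\widehat{\mathcal P}$ is an $(R,\varepsilon')$-flat pair of pants if the morphism $\rho:c_n\mapsto\gamma_n$ is injective; $\rho$ is the holonomy of a $\mathrm{PSL}_2(\mathbf C)$-surface structure on $\Pi$, i.e. there is a smooth $\rho$-equivariant immersion $\widetilde\Pi\to\mathbf H^3$ of the universal cover that maps each boundary component onto a geodesic; the endpoints of the axes of the (loxodromic) $\gamma_n$ are pairwise distinct; and for $n=1,2,3$ the complex half-length $\sigma_n$ equals $\tfrac12\ell_n$ modulo $2i\pi$ and $|\tfrac12\ell_n-R/2|\le\varepsilon'$. Here $\ell_n$ is the complex translation length of $\gamma_n$ with $\mathrm{Re}\,\ell_n>0$ and $-\pi<\mathrm{Im}\,\ell_n\le\pi$, and $\sigma_n$ ($\mathrm{Re}\,\sigma_n>0$) is the complex translation length, modulo $2i\pi$, of the translation along the oriented axis of $\gamma_n$ that takes the first to the second of the two unit normal vectors to this axis that point along the common perpendiculars to the axes of the two other $\gamma_m$. **Proposition.** Given the metric, there is a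 constant $D>0$ such that for every $\Gamma$, every $\varepsilon>0$ with $D\varepsilon\le 1$ and every $\chi_\varepsilon$ as above there is a real $r_\varepsilon>0$ such that for every $r\ge r_\varepsilon$ the measure $\Phi_*\beta_{\varepsilon,r}$ on $\widehat{\mathcal P}$ is supported in the set of $(2r-2\log\frac43,\,D\varepsilon)$-flat pairs of pants. -/

import Mathlib

open scoped MatrixGroups ContDiff Matrix
open MeasureTheory

noncomputable section

namespace KahnMarkovic

/-! ### The group `PSL₂(ℂ)`, identified with the frame bundle of hyperbolic 3-space

The frame `(p₀, u₀, n₀, u₀ ∧ n₀)` of the upper half-space `ℂ × ℝ_{>0}` with `p₀ = (0,1)`,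
`u₀ = (0,1)`, `n₀ = (1,0)` is the base frame; `g` stands for the image of the base frame by `g`. -/

/-- `PSL₂(ℂ)`, with the quotient topology of `SL₂(ℂ)`. -/
abbrev G : Type := PSL(2, ℂ)

/-- The projection `SL₂(ℂ) → PSL₂(ℂ)`. -/
def proj (g : SL(2, ℂ)) : G := QuotientGroup.mk g

instance : MeasurableSpace G := borel G
instance : BorelSpace G := ⟨rfl⟩

/-- `diag(e^{ζ/2}, e^{-ζ/2})`, the isometry `z ↦ e^ζ z`. -/
def diagSL (ζ : ℂ) : SL(2, ℂ) :=
  ⟨!![Complex.exp (ζ / 2), 0; 0, Complex.exp (-(ζ / 2))], by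
    rw [Matrix.det_fin_two_of, ← Complex.exp_add]; simp⟩

/-- The element `A_ζ` of `PSL₂(ℂ)`. For real `ζ = t` this is `a_t`; right multiplication by `a_t`
is the frame flow (parallel transport for a time `t` in the direction of the first vector). -/
def A (ζ : ℂ) : G := proj (diagSL ζ)

/-- The matrix of `R_θ`. -/
def rotSL (θ : ℝ) : SL(2, ℂ) :=
  ⟨!![Complex.cos (θ / 2), -Complex.I * Complex.sin (θ / 2);
      -Complex.I * Complex.sin (θ / 2), Complex.cos (θ / 2)], by
    rw [Matrix.det_fin_two_of]
    linear_combination Complex.cos_sq_add_sin_sq ((θ : ℂ) / 2)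
      - Complex.sin ((θ : ℂ) / 2) ^ 2 * Complex.I_sq⟩

/-- `R_θ`: rotation of angle `θ` about the geodesic through `p₀` directed by `n₀`. -/
def R (θ : ℝ) : G := proj (rotSL θ)

/-- The matrix of `B_δ`. -/
def transSL (δ : ℝ) : SL(2, ℂ) :=
  ⟨!![Complex.cosh (δ / 2), Complex.sinh (δ / 2); Complex.sinh (δ / 2), Complex.cosh (δ / 2)], by
    rw [Matrix.det_fin_two_of]
    linear_combination Complex.cosh_sq_sub_sinh_sq ((δ : ℂ) / 2)⟩

/-- `B_δ`: translation by `δ` along the geodesic through `p₀` directed by `n₀`. Right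
multiplication by `B_δ` is parallel transport of a frame for a time `δ` in the direction of its
second vector. -/
def B (δ : ℝ) : G := proj (transSL δ)

/-! ### Left invariant metrics and bump functions on `PSL₂(ℂ)` -/

/-- Velocity at `p₀` of the curve `s ↦ exp(sX) · p₀` in the upper half-space, for `X` traceless,
as a vector of `ℂ × ℝ` (where the hyperbolic metric at `p₀ = (0,1)` is the Euclidean one). -/
def velocity (X : Matrix (Fin 2) (Fin 2) ℂ) : ℂ × ℝ :=
  (X 0 1 + (starRingEnd ℂ) (X 1 0), 2 * (X 0 0).re)

/-- A Riemannian metric on `PSL₂(ℂ)` that is left invariant, right invariant under the stabilizer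
`K = PSU(2)` of `p₀`, and lifts the hyperbolic metric (that is, `g ↦ g · p₀` is a Riemannian
submersion), given by its quadratic form on the Lie algebra of traceless matrices. Only the values
of `Q` on traceless matrices are used. -/
structure FrameMetric where
  /-- the quadratic form -/
  Q : QuadraticForm ℝ (Matrix (Fin 2) (Fin 2) ℂ)
  pos : ∀ X : Matrix (Fin 2) (Fin 2) ℂ, X.trace = 0 → X ≠ 0 → 0 < Q X
  ad_inv : ∀ k : SL(2, ℂ), (k : Matrix (Fin 2) (Fin 2) ℂ) ∈ Matrix.unitaryGroup (Fin 2) ℂ →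
    ∀ X : Matrix (Fin 2) (Fin 2) ℂ, X.trace = 0 →
      Q ((k : Matrix (Fin 2) (Fin 2) ℂ) * X * ((k⁻¹ : SL(2, ℂ)) : Matrix (Fin 2) (Fin 2) ℂ)) = Q X
  lifts : ∀ X : Matrix (Fin 2) (Fin 2) ℂ, X.trace = 0 →
    IsLeast (Q '' {Y | Y.trace = 0 ∧ velocity Y = velocity X})
      (‖(velocity X).1‖ ^ 2 + (velocity X).2 ^ 2)

/-- `C¹` paths in `SL₂(ℂ)`. -/
def IsC1Path (c : ℝ → SL(2, ℂ)) : Prop :=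
  ∀ i j, ContDiff ℝ 1 fun t => (c t : Matrix (Fin 2) (Fin 2) ℂ) i j

/-- Length of the restriction of a path to `[0,1]`, for the left invariant metric `m`. -/
def pathLength (m : FrameMetric) (c : ℝ → SL(2, ℂ)) : ℝ :=
  ∫ t in (0 : ℝ)..1, Real.sqrt (m.Q
    ((((c t)⁻¹ : SL(2, ℂ)) : Matrix (Fin 2) (Fin 2) ℂ) *
      Matrix.of fun i j => deriv (fun s => (c s : Matrix (Fin 2) (Fin 2) ℂ) i j) t))

/-- The Riemannian distance on `PSL₂(ℂ)`: infimum of the lengths of `C¹` paths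
(a path in `PSL₂(ℂ)` is the projection of a path in `SL₂(ℂ)`). -/
def FrameMetric.dist (m : FrameMetric) (x y : G) : ℝ :=
  sInf {L | ∃ c : ℝ → SL(2, ℂ), IsC1Path c ∧ proj (c 0) = x ∧ proj (c 1) = y ∧ L = pathLength m c}

/-- Smooth real functions on `PSL₂(ℂ)`: their lift to the closed submanifold `SL₂(ℂ)` of the space
of matrices extends to a smooth function. -/
def IsSmooth (f : G → ℝ) : Prop :=
  ∃ F : (Fin 2 → Fin 2 → ℂ) → ℝ, ContDiff ℝ ∞ F ∧
    ∀ g : SL(2, ℂ), f (proj g) = F fun i j => (g : Matrix (Fin 2) (Fin 2) ℂ) i j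

/-- The functions `χ_ε`: nonnegative, smooth, supported in the ball of radius `ε/2` about the
identity, positive at the identity and of integral one. -/
structure IsBump (m : FrameMetric) (ν : Measure G) (ε : ℝ) (χ : G → ℝ) : Prop where
  nonneg : ∀ g, 0 ≤ χ g
  smooth : IsSmooth χ
  support : ∀ g, χ g ≠ 0 → m.dist 1 g ≤ ε / 2
  pos_one : 0 < χ 1
  integral_eq : ∫ g, χ g ∂ν = 1

/-! ### Quotient measures -/

/-- `β` is the measure on `Γ \ X` induced by the (`Γ`-invariant) measure `μ` on `X`. -/
def IsInducedMeasure (Γ : Type*) [Group Γ] {X : Type*} [MulAction Γ X] [MeasurableSpace X]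
    (μ : Measure X) (β : Measure (MulAction.orbitRel.Quotient Γ X)) : Prop :=
  ∃ F : Set X, IsFundamentalDomain Γ F μ ∧
    β = (μ.restrict F).map (fun x => (Quotient.mk _ x : MulAction.orbitRel.Quotient Γ X))

/-- `ν` is the Haar measure of `PSL₂(ℂ)` which induces a probability measure on
`Γ \ PSL₂(ℂ)`. -/
def IsNormalizedHaar (Γ : Subgroup G) (ν : Measure G) : Prop :=
  ν.IsHaarMeasure ∧ ∃ ν' : Measure (MulAction.orbitRel.Quotient Γ G),
    IsInducedMeasure Γ ν ν' ∧ IsProbabilityMeasure ν'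

/-- `Γ` is discrete and torsion free, and `Γ \ PSL₂(ℂ)` is compact: `Γ` uniformizes a closed
oriented hyperbolic 3-manifold. -/
structure IsClosedHyperbolic (Γ : Subgroup G) : Prop where
  discrete : DiscreteTopology Γ
  torsionFree : ∀ γ ∈ Γ, ∀ n : ℕ, 0 < n → γ ^ n = 1 → γ = 1
  compact : CompactSpace (MulAction.orbitRel.Quotient Γ G)

/-! ### The kernels and the measure on pairs of frames and triples of elements of `Γ` -/

/-- The kernel `a_{ε,r}(x,y) = ∫ k_ε(x, g a_r) k_ε(y, g) dν(g)`, where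
`k_ε(x,y) = χ_ε(x⁻¹y)`. -/
def kernel (ν : Measure G) (χ : G → ℝ) (r : ℝ) (x y : G) : ℝ :=
  ∫ g, χ (x⁻¹ * (g * A r)) * χ (y⁻¹ * g) ∂ν

/-- `x_{(k,r)} = x R_{2kπ/3} a_{r/4}`. -/
def leg (x : G) (k : ZMod 3) (r : ℝ) : G :=
  x * R (2 * (k.val : ℝ) * Real.pi / 3) * A ((r / 4 : ℝ) : ℂ)

/-- The space `PSL₂(ℂ) × PSL₂(ℂ) × Γ³`. -/
def FramePairs (Γ : Subgroup G) : Type := G × G × (ZMod 3 → Γ)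

instance (Γ : Subgroup G) : MeasurableSpace (FramePairs Γ) :=
  inferInstanceAs (MeasurableSpace (G × G × (ZMod 3 → Γ)))

/-- The diagonal left action of `Γ`: by translation on frames, by conjugation on `Γ³`. -/
instance (Γ : Subgroup G) : MulAction Γ (FramePairs Γ) where
  smul γ p := (γ * p.1, γ * p.2.1, fun k => γ * p.2.2 k * γ⁻¹)
  one_smul p := by
    change ((((1 : Γ) : G) * p.1, ((1 : Γ) : G) * p.2.1, fun k => 1 * p.2.2 k * 1⁻¹) :
      G × G × (ZMod 3 → Γ)) = (p.1, p.2.1, p.2.2)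
    simp
  mul_smul γ γ' p := by
    change (((γ * γ' : Γ) * p.1, (γ * γ' : Γ) * p.2.1, fun k => γ * γ' * p.2.2 k * (γ * γ')⁻¹) :
      G × G × (ZMod 3 → Γ)) = (γ * (γ' * p.1), γ * (γ' * p.2.1),
        fun k => γ * (γ' * p.2.2 k * γ'⁻¹) * γ⁻¹)
    simp [mul_assoc]

/-- The measure `∏_k a_{ε,r/2}(x_{(-k,-r)}, A_k y_{(k,r)}) dν(x) ⊗ dν(y) ⊗ dn(A)`, where `dn` is
the counting measure. -/
def betaHat (Γ : Subgroup G) (ν : Measure G) (χ : G → ℝ) (r : ℝ) : Measure (FramePairs Γ) :=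
  (ν.prod (ν.prod (Measure.count : Measure (ZMod 3 → Γ)))).withDensity fun p =>
    ENNReal.ofReal (∏ k : ZMod 3,
      kernel ν χ (r / 2) (leg p.1 (-k) (-r)) ((p.2.2 k : G) * leg p.2.1 k r))

/-! ### The space of triples and the map `Φ` -/

/-- Triples `(γ₁, γ₂, γ₃)` of elements of `Γ` with `γ₁γ₂γ₃ = 1`; the index `n` of the triple is
`n - 1` here. -/
def Triples (Γ : Subgroup G) : Type := {γ : ZMod 3 → Γ // γ 0 * γ 1 * γ 2 = 1}

instance (Γ : Subgroup G) : MeasurableSpace (Triples Γ) := ⊤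

/-- Simultaneous conjugation. -/
instance (Γ : Subgroup G) : MulAction Γ (Triples Γ) where
  smul h t := ⟨fun n => h * t.1 n * h⁻¹, by
    have e : h * t.1 0 * h⁻¹ * (h * t.1 1 * h⁻¹) * (h * t.1 2 * h⁻¹)
        = h * (t.1 0 * t.1 1 * t.1 2) * h⁻¹ := by group
    rw [e, t.2]; group⟩
  one_smul t := Subtype.ext (funext fun n => by change 1 * t.1 n * 1⁻¹ = t.1 n; group)
  mul_smul h h' t := Subtype.ext (funext fun n => by
    change h * h' * t.1 n * (h * h')⁻¹ = h * (h' * t.1 n * h'⁻¹) * h⁻¹; group)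

/-- Conjugacy classes of triples, a discrete space. -/
abbrev PHat (Γ : Subgroup G) : Type := MulAction.orbitRel.Quotient Γ (Triples Γ)

/-- The triple `ρ_A(c_n) = A_{n-1} A_n⁻¹`, `n = 1, 2, 3`. -/
def tripleOf (Γ : Subgroup G) (a : ZMod 3 → Γ) : Triples Γ :=
  ⟨fun n => a n * (a (n + 1))⁻¹, by
    have h1 : (0 + 1 : ZMod 3) = 1 := by decide
    have h2 : (1 + 1 : ZMod 3) = 2 := by decide
    have h3 : (2 + 1 : ZMod 3) = 0 := by decide
    change a 0 * (a (0 + 1))⁻¹ * (a 1 * (a (1 + 1))⁻¹) * (a 2 * (a (2 + 1))⁻¹) = 1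
    rw [h1, h2, h3]; group⟩

/-- The map `Φ`, which sends the class of `(x, y, A)` to the class of `ρ_A`. -/
def Phi (Γ : Subgroup G) : MulAction.orbitRel.Quotient Γ (FramePairs Γ) → PHat Γ :=
  Quotient.map (fun p => tripleOf Γ p.2.2) (by
    rintro p q ⟨γ, rfl⟩
    refine ⟨γ, Subtype.ext (funext fun n => ?_)⟩
    change γ * (q.2.2 n * (q.2.2 (n + 1))⁻¹) * γ⁻¹
      = (γ * q.2.2 n * γ⁻¹) * (γ * q.2.2 (n + 1) * γ⁻¹)⁻¹
    group)

/-! ### Complex lengths, axes and complex half-lengths -/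

/-- `ℓ` is the complex translation length of `γ` (with `-π < Im ℓ ≤ π`): `γ` is conjugate to
`z ↦ e^ℓ z` with `Re ℓ > 0`; in particular `γ` is loxodromic. -/
def IsComplexLength (γ : G) (ℓ : ℂ) : Prop :=
  0 < ℓ.re ∧ -Real.pi < ℓ.im ∧ ℓ.im ≤ Real.pi ∧ ∃ g : G, γ = g * A ℓ * g⁻¹

/-- `γ` is loxodromic, the base point of the frame `g` is on its axis and the first vector of `g`
is tangent to the axis, in the direction of translation. -/
def IsAxisFrame (γ g : G) : Prop :=
  ∃ ℓ : ℂ, 0 < ℓ.re ∧ γ = g * A ℓ * g⁻¹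

/-- The first vector of the frame `g` is tangent to the oriented axis of `γ` at its foot on the
common perpendicular to the axes of `γ` and `γ'`, and the second vector of `g` is the unit normal
vector that points along this perpendicular to the axis of `γ'`: if `g` is transported for some
time `δ > 0` in the direction of its second vector and then turned about this vector, its first
vector becomes tangent to the axis of `γ'`. -/
def IsFoot (γ γ' g : G) : Prop :=
  IsAxisFrame γ g ∧ ∃ δ θ : ℝ, 0 < δ ∧ IsAxisFrame γ' (g * B δ * R θ)

/-- `σ` (defined modulo `2iπ`, with `Re σ > 0`) is the complex half-length at `γ`, where `γ'` and
`γ''` are the two other boundary elements: of the two unit normal vectors to the axis of `γ` given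
by the common perpendiculars to the axes of `γ'` and of `γ''`, the first one along the oriented axis
is sent to the second one by the translation of complex length `σ` along the axis of `γ`. -/
def IsHalfLength (γ γ' γ'' : G) (σ : ℂ) : Prop :=
  0 < σ.re ∧ ∃ g : G,
    (IsFoot γ γ' g ∧ IsFoot γ γ'' (g * A σ)) ∨ (IsFoot γ γ'' g ∧ IsFoot γ γ' (g * A σ))

/-- `γ` and `γ'` have a common fixed point in `P₁(ℂ)` (a common eigenline). -/
def HaveCommonFixedPoint (γ γ' : G) : Prop :=
  ∃ v : Fin 2 → ℂ, v ≠ 0 ∧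
    (∃ M : SL(2, ℂ), proj M = γ ∧ ∃ a : ℂ, (M : Matrix (Fin 2) (Fin 2) ℂ) *ᵥ v = a • v) ∧
    (∃ M : SL(2, ℂ), proj M = γ' ∧ ∃ a : ℂ, (M : Matrix (Fin 2) (Fin 2) ℂ) *ᵥ v = a • v)

/-! ### `PSL₂(ℂ)`-surface structures on a pair of pants -/

/-- The Poincaré extension, acting on the upper half-space `{(z,t) : t > 0}` of `ℂ × ℝ`. -/
def poincare (g : SL(2, ℂ)) (p : ℂ × ℝ) : ℂ × ℝ :=
  let N : ℝ := ‖g 1 0 * p.1 + g 1 1‖ ^ 2 + ‖g 1 0‖ ^ 2 * p.2 ^ 2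
  (((g 0 0 * p.1 + g 0 1) * (starRingEnd ℂ) (g 1 0 * p.1 + g 1 1)
      + g 0 0 * (starRingEnd ℂ) (g 1 0) * (p.2 : ℂ) ^ 2) / (N : ℂ), p.2 / N)

/-- Complete geodesics of the upper half-space: the images of the vertical geodesic. -/
def IsGeodesicLine (L : Set (ℂ × ℝ)) : Prop :=
  ∃ g : SL(2, ℂ), L = poincare g '' {p | p.1 = 0 ∧ 0 < p.2}

/-- The fundamental group of the pair of pants `⟨c₁, c₂, c₃ | c₁c₂c₃ = 1⟩`, free on `c₁, c₂`. -/
abbrev PantsGroup : Type := FreeGroup (Fin 2)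

/-- The boundary elements `c₁, c₂, c₃` (with indices shifted by one). -/
def bdry (n : Fin 3) : PantsGroup :=
  ![FreeGroup.of 0, FreeGroup.of 1, (FreeGroup.of 0 * FreeGroup.of 1)⁻¹] n

/-- Parameters of a hyperbolic pair of pants with geodesic boundary: half-lengths of the first two
boundary components and their distance. -/
structure PantsData where
  s : ℝ
  t : ℝ
  d : ℝ
  s_pos : 0 < s
  t_pos : 0 < t
  d_pos : 0 < d
  hyp : Real.cosh s * Real.cosh t + 1 < Real.cosh d * (Real.sinh s * Real.sinh t)

/-- Holonomy of `c₁`: translation of length `2s` whose axis has endpoints `±e^{d/2}`. -/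
def PantsData.hol₁ (P : PantsData) : SL(2, ℝ) :=
  ⟨!![Real.cosh P.s, Real.exp (P.d / 2) * Real.sinh P.s;
      Real.exp (-(P.d / 2)) * Real.sinh P.s, Real.cosh P.s], by
    rw [Matrix.det_fin_two_of]
    have h : Real.exp (P.d / 2) * Real.exp (-(P.d / 2)) = 1 := by
      rw [← Real.exp_add]; simp
    linear_combination Real.cosh_sq_sub_sinh_sq P.s - Real.sinh P.s ^ 2 * h⟩

/-- Holonomy of `c₂`: translation of length `2t` whose axis has endpoints `±e^{-d/2}`. -/
def PantsData.hol₂ (P : PantsData) : SL(2, ℝ) :=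
  ⟨!![Real.cosh P.t, -(Real.exp (-(P.d / 2)) * Real.sinh P.t);
      -(Real.exp (P.d / 2) * Real.sinh P.t), Real.cosh P.t], by
    rw [Matrix.det_fin_two_of]
    have h : Real.exp (P.d / 2) * Real.exp (-(P.d / 2)) = 1 := by
      rw [← Real.exp_add]; simp
    linear_combination Real.cosh_sq_sub_sinh_sq P.t - Real.sinh P.t ^ 2 * h⟩

/-- The Fuchsian holonomy of the hyperbolic pair of pants. By `hyp`, the product of the two
generators has trace less than `-2`; the group is free and discrete and uniformizes a pair of
pants with boundary elements `c₁, c₂, c₃`. -/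
def PantsData.hol (P : PantsData) : PantsGroup →* SL(2, ℝ) :=
  FreeGroup.lift ![P.hol₁, P.hol₂]

/-- A quadratic function which vanishes on the axis of the hyperbolic element `M`, and whose sign
distinguishes the right and the left side of this axis, oriented by `M` as an isometry. -/
def side (M : SL(2, ℝ)) (z : UpperHalfPlane) : ℝ :=
  (M 0 0 + M 1 1) * (M 1 0 * Complex.normSq (z : ℂ) + (M 1 1 - M 0 0) * (z : ℂ).re - M 0 1)

/-- The universal cover of the pair of pants: the convex subset of the hyperbolic plane bounded by
the axes of the conjugates of the boundary elements. -/
def PantsData.cover (P : PantsData) : Set UpperHalfPlane :=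
  {z | ∀ (w : PantsGroup) (n : Fin 3), side (P.hol (w * bdry n * w⁻¹)) z ≤ 0}

/-- The boundary line of the universal cover which is stable under `c_n`. -/
def PantsData.boundaryLine (P : PantsData) (n : Fin 3) : Set UpperHalfPlane :=
  {z | side (P.hol (bdry n)) z = 0}

/-- `ρ` is the holonomy of a `PSL₂(ℂ)`-surface structure on the pair of pants: there is a smooth
`ρ`-equivariant immersion of the universal cover (a surface with boundary) into hyperbolic
3-space, which maps every boundary component onto a geodesic. -/
def IsPantsHolonomy (ρ : PantsGroup →* G) : Prop :=
  ∃ (P : PantsData) (U : Set ℂ) (F : ℂ → ℂ × ℝ), IsOpen U ∧ (∀ z ∈ P.cover, (z : ℂ) ∈ U) ∧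
    ContDiffOn ℝ ∞ F U ∧
    (∀ z ∈ P.cover, 0 < (F z).2 ∧ Function.Injective (fderiv ℝ F z)) ∧
    (∀ (w : PantsGroup) (g : SL(2, ℂ)), proj g = ρ w → ∀ z ∈ P.cover,
      F ((P.hol w • z : UpperHalfPlane) : ℂ) = poincare g (F z)) ∧
    (∀ n : Fin 3, IsGeodesicLine ((fun z : UpperHalfPlane => F z) '' P.boundaryLine n))

/-! ### Flat pairs of pants (futals) -/

/-- The representation of the fundamental group of the pair of pants with `c_n ↦ γ_n`. -/
def Triples.rep {Γ : Subgroup G} (τ : Triples Γ) : PantsGroup →* Γ :=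
  FreeGroup.lift ![τ.1 0, τ.1 1]

/-- The triple `(γ₁, γ₂, γ₃)` represents an `(R, ε)`-flat "futal" in `Γ \ ℍ³`: the representation
`c_n ↦ γ_n` is injective, it is the holonomy of a `PSL₂(ℂ)`-surface structure on the pair of pants,
the endpoints of the axes of the `γ_n` are pairwise distinct, the complex half-lengths `σ_n` are
the halves of the complex lengths `ℓ_n` (with `-π < Im ℓ_n ≤ π`), and `|σ_n - R/2| ≤ ε`. -/
structure Triples.IsFlatPants {Γ : Subgroup G} (τ : Triples Γ) (R ε : ℝ) : Prop where
  injective : Function.Injective τ.rep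
  holonomy : IsPantsHolonomy (Γ.subtype.comp τ.rep)
  endpoints : ∀ m n : ZMod 3, m ≠ n → ¬ HaveCommonFixedPoint (τ.1 m) (τ.1 n)
  halfLength : ∀ n : ZMod 3, ∃ σ : ℂ, IsHalfLength (τ.1 n) (τ.1 (n + 1)) (τ.1 (n + 2)) σ ∧
    IsComplexLength (τ.1 n) (2 * σ) ∧ ‖σ - ((R / 2 : ℝ) : ℂ)‖ ≤ ε

/-- The set of (marked) `(R, ε)`-flat pairs of pants, as a set of conjugacy classes of triples. -/
def flatPants (Γ : Subgroup G) (R ε : ℝ) : Set (PHat Γ) :=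
  {q | ∃ τ : Triples Γ, q = Quotient.mk _ τ ∧ τ.IsFlatPants R ε}

end KahnMarkovic

end

open KahnMarkovic

/-! Why it holds. Where the density is nonzero, each k has a frame g lying within both bumps, so A_k
= x · turn_k⁻¹ · a_{-r/4} u_k a_{-r/2} w_k a_{-r/4} · turn_k⁻¹ · y⁻¹ with u_k, w_k in SL₂(ℂ) at
distance O(ε) from 1 (`FrameMetric.exists_lift`, `exists_link`). In A_n A_{n+1}⁻¹ the frame y
cancels, and up to conjugation by x there remains the matrix M_n = `boundary r u w n`
(`mul_inv_eq_boundary`). A long diagonal matrix is nearly a multiple of a rank one matrix. Hence M_n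
is a scalar e^r (1 + O(ε)) times a matrix that tends, as r → ∞, to an explicit rank one matrix of
trace 3/4, `limitMatrix n`. So tr M_n = 2 cosh σ_n with σ_n = r - log (4/3) + O(ε)
(`exists_structure`). The size ε enters only through the scalar factor; the remaining conditions are
open at the limit and hold as soon as r is large. This is why D depends on the metric only.

Half-lengths and endpoints. The lifts M_n satisfy M_n M_{n+1} M_{n+2} = -1. With this sign, the
cosine and sine rules of a right-angled skew hexagon give the complex distances between the axes,
and the two feet on the axis of M_n differ by σ_n itself, not by σ_n + iπ (`exists_distances`,
`exists_frame`). The commutators of consecutive M_n are invertible, which excludes common fixed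
points. Normalized, they are half-turns H_k about the common perpendiculars, and H_k H_{k+1} = M_k
(`exists_half_turns`).

Injectivity. In the limit, H_k collapses the projective line onto the ideal vertex `corner k`. Near
the limit the three half-turns play ping-pong around the three vertices
(`injective_of_isNearLimit`).

The immersed surface. The model is the pair of pants doubled from a regular right-angled hexagon. In
the coordinates given by three boundary lines, the reflections in the seams are linear maps of ℝ³,
and the universal cover is tiled by the images of one hexagon. A short ping-pong argument
(`behind_of_reduced`) shows that an equivariant map need only be given near one hexagon, with the
reflection in the k-th mirror matched to the half-turn H_k. Points of ℍ³ are positive definite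
Hermitian matrices up to scale, so they may be averaged: `surf` is a weighted sum of points that
slide along the three boundary geodesics, and only the j-th one survives on the side x_j = 0. The
result is an immersion for two reasons. Near a mirror only two geodesics contribute, and both points
slide in the same sense (`stripIndep_of_trace`). Away from the mirrors the map is a perturbation,
over a compact set, of the case where the six endpoints merge into the three vertices of an ideal
triangle (`injective_fderiv_limit`, `eventually_injective_fderiv`). -/

open scoped MatrixGroups ContDiff Matrix
open MeasureTheory

noncomputable section

namespace KahnMarkovic

/-! ### Hermitian matrices and the upper half-space -/

/-- Hermitian `2 × 2` matrices `(a, b; b̄, c)`, written as `(a, c, b)`. -/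
abbrev Herm : Type := ℝ × ℝ × ℂ

/-- The determinant of a Hermitian matrix. -/
def hdet (M : Herm) : ℝ := M.1 * M.2.1 - Complex.normSq M.2.2

/-- The rank one Hermitian matrix `P P*`. -/
def nul (P : Fin 2 → ℂ) : Herm :=
  (Complex.normSq (P 0), Complex.normSq (P 1), P 0 * (starRingEnd ℂ) (P 1))

/-- The action `M ↦ g M g*` on Hermitian matrices. -/
def hact (g : SL(2, ℂ)) (M : Herm) : Herm :=
  (Complex.normSq (g 0 0) * M.1 + Complex.normSq (g 0 1) * M.2.1
      + 2 * (g 0 0 * (starRingEnd ℂ) (g 0 1) * M.2.2).re,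
    Complex.normSq (g 1 0) * M.1 + Complex.normSq (g 1 1) * M.2.1
      + 2 * (g 1 0 * (starRingEnd ℂ) (g 1 1) * M.2.2).re,
    g 0 0 * (starRingEnd ℂ) (g 1 0) * (M.1 : ℂ) + g 0 1 * (starRingEnd ℂ) (g 1 1) * (M.2.1 : ℂ)
      + g 0 0 * (starRingEnd ℂ) (g 1 1) * M.2.2
      + g 0 1 * (starRingEnd ℂ) (g 1 0) * (starRingEnd ℂ) M.2.2)

lemma hact_add (g : SL(2, ℂ)) (M N : Herm) : hact g (M + N) = hact g M + hact g N := by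
  ext <;> simp [hact] <;> ring

lemma hact_smul (g : SL(2, ℂ)) (c : ℝ) (M : Herm) : hact g (c • M) = c • hact g M := by
  ext <;> simp [hact] <;> ring

/-- `hact g` as a linear map. -/
def hactL (g : SL(2, ℂ)) : Herm →L[ℝ] Herm :=
  LinearMap.toContinuousLinearMap
    { toFun := hact g
      map_add' := hact_add g
      map_smul' := hact_smul g }

@[simp] lemma hactL_apply (g : SL(2, ℂ)) (M : Herm) : hactL g M = hact g M := rfl

lemma sl_mul_apply (g h : SL(2, ℂ)) (i j : Fin 2) :
    (g * h) i j = g i 0 * h 0 j + g i 1 * h 1 j := by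
  simp [Matrix.mul_apply, Fin.sum_univ_two]

lemma hact_mul (g h : SL(2, ℂ)) (M : Herm) : hact (g * h) M = hact g (hact h M) := by
  obtain ⟨a, c, b⟩ := M
  simp only [hact, sl_mul_apply]
  generalize g 0 0 = g00
  generalize g 0 1 = g01
  generalize g 1 0 = g10
  generalize g 1 1 = g11
  generalize h 0 0 = h00
  generalize h 0 1 = h01
  generalize h 1 0 = h10
  generalize h 1 1 = h11
  refine Prod.ext ?_ (Prod.ext ?_ (Complex.ext ?_ ?_)) <;>
    simp [Complex.normSq_apply] <;> ring

lemma hact_one (M : Herm) : hact 1 M = M := by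
  ext <;> simp [hact]

lemma hact_neg (g : SL(2, ℂ)) (M : Herm) : hact (-g) M = hact g M := by
  ext <;> simp [hact]

lemma hact_inv_hact (g : SL(2, ℂ)) (M : Herm) : hact g⁻¹ (hact g M) = M := by
  rw [← hact_mul]; simp [hact_one]

lemma hact_hact_inv (g : SL(2, ℂ)) (M : Herm) : hact g (hact g⁻¹ M) = M := by
  rw [← hact_mul]; simp [hact_one]

lemma hact_nul (g : SL(2, ℂ)) (P : Fin 2 → ℂ) :
    hact g (nul P) = nul ((g : Matrix (Fin 2) (Fin 2) ℂ) *ᵥ P) := by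
  simp only [hact, nul, Matrix.mulVec, dotProduct, Fin.sum_univ_two]
  generalize g 0 0 = g00
  generalize g 0 1 = g01
  generalize g 1 0 = g10
  generalize g 1 1 = g11
  refine Prod.ext ?_ (Prod.ext ?_ (Complex.ext ?_ ?_)) <;>
    simp [Complex.normSq_apply] <;> ring

lemma nul_smul (c : ℂ) (P : Fin 2 → ℂ) : nul (c • P) = Complex.normSq c • nul P := by
  refine Prod.ext ?_ (Prod.ext ?_ (Complex.ext ?_ ?_)) <;>
    simp [nul, Complex.normSq_apply] <;> ring

lemma sl_det (g : SL(2, ℂ)) : g 0 0 * g 1 1 - g 0 1 * g 1 0 = 1 := by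
  have := g.det_coe
  rwa [Matrix.det_fin_two] at this

lemma hdet_hact (g : SL(2, ℂ)) (M : Herm) : hdet (hact g M) = hdet M := by
  obtain ⟨a, c, b⟩ := M
  have h := sl_det g
  have h2 : Complex.normSq (g 0 0 * g 1 1 - g 0 1 * g 1 0) = 1 := by rw [h]; simp
  have key : hdet (hact g (a, c, b))
      = Complex.normSq (g 0 0 * g 1 1 - g 0 1 * g 1 0) * hdet (a, c, b) := by
    simp only [hdet, hact]
    generalize g 0 0 = g00
    generalize g 0 1 = g01
    generalize g 1 0 = g10
    generalize g 1 1 = g11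
    simp [Complex.normSq_apply]
    ring
  rw [key, h2, one_mul]

/-- Positive definite Hermitian matrices. -/
def HPos (M : Herm) : Prop := 0 < M.2.1 ∧ 0 < hdet M

lemma HPos.fst {M : Herm} (h : HPos M) : 0 < M.1 := by
  obtain ⟨h1, h2⟩ := h
  have := Complex.normSq_nonneg M.2.2
  unfold hdet at h2
  by_contra h3
  push Not at h3
  nlinarith

/-- Completing the square in the lower right entry writes it as a square plus a multiple of the
determinant, and the two cannot vanish together because `g` is invertible. -/
lemma HPos.hact {M : Herm} (h : HPos M) (g : SL(2, ℂ)) : HPos (hact g M) := by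
  refine ⟨?_, by rw [hdet_hact]; exact h.2⟩
  have h1 := h.fst
  obtain ⟨a, c, b⟩ := M
  obtain ⟨hc, hd⟩ := h
  simp only [hdet] at hd hc h1
  have key : a * (KahnMarkovic.hact g (a, c, b)).2.1
      = Complex.normSq (g 1 0 * a + g 1 1 * (starRingEnd ℂ) b)
        + Complex.normSq (g 1 1) * (a * c - Complex.normSq b) := by
    simp only [KahnMarkovic.hact]
    generalize g 1 0 = g10
    generalize g 1 1 = g11
    simp [Complex.normSq_apply]
    ring
  have h4 : 0 < a * (KahnMarkovic.hact g (a, c, b)).2.1 := by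
    rw [key]
    by_cases h0 : g 1 1 = 0
    · have h5 : g 1 0 ≠ 0 := by
        intro h6
        have := sl_det g
        rw [h0, h6] at this
        simp at this
      have : 0 < Complex.normSq (g 1 0 * a + g 1 1 * (starRingEnd ℂ) b) := by
        rw [Complex.normSq_pos, h0]
        simp [h5, h1.ne']
      rw [h0] at *
      simpa using this
    · have := Complex.normSq_nonneg (g 1 0 * a + g 1 1 * (starRingEnd ℂ) b)
      have := Complex.normSq_pos.2 h0
      positivity
  exact pos_of_mul_pos_right h4 h1.le

/-- Convexity of the positive cone: the mixed term of the determinant is positive by a reverse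
Cauchy–Schwarz inequality. This is what permits weighted averages of points of ℍ³. -/
lemma HPos.add {M N : Herm} (h : HPos M) (h' : HPos N) : HPos (M + N) := by
  have ha := h.fst
  have ha' := h'.fst
  obtain ⟨a, c, b⟩ := M
  obtain ⟨a', c', b'⟩ := N
  obtain ⟨h1, h2⟩ := h
  obtain ⟨h3, h4⟩ := h'
  simp only [hdet, Complex.normSq_apply] at *
  refine ⟨by simpa using add_pos h1 h3, ?_⟩
  simp only [hdet, Prod.mk_add_mk, Complex.normSq_apply, Complex.add_re, Complex.add_im]
  set u := b.re; set v := b.im; set u' := b'.re; set v' := b'.im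
  have e1 : 0 < a * a' * (a * c' + c * a' - 2 * (u * u' + v * v')) := by
    have : a * a' * (a * c' + c * a' - 2 * (u * u' + v * v'))
      = a ^ 2 * (a' * c' - (u' * u' + v' * v')) + a' ^ 2 * (a * c - (u * u + v * v))
        + ((a * u' - a' * u) ^ 2 + (a * v' - a' * v) ^ 2) := by ring
    rw [this]; positivity
  have e2 := pos_of_mul_pos_right e1 (by positivity)
  nlinarith

/-- The point of the upper half-space defined by a positive definite Hermitian matrix. -/
def uhs (M : Herm) : ℂ × ℝ := (M.2.2 / (M.2.1 : ℂ), Real.sqrt (hdet M) / M.2.1)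

/-- The Hermitian matrix of a point of the upper half-space. -/
def hmat (p : ℂ × ℝ) : Herm := (Complex.normSq p.1 + p.2 ^ 2, 1, p.1)

lemma uhs_pos {M : Herm} (h : HPos M) : 0 < (uhs M).2 :=
  div_pos (Real.sqrt_pos.2 h.2) h.1

lemma smul_hmat_uhs {M : Herm} (h : HPos M) : M.2.1 • hmat (uhs M) = M := by
  obtain ⟨a, c, b⟩ := M
  obtain ⟨h1, h2⟩ := h
  simp only at h1
  have h2' := h2
  simp only [hdet] at h2'
  refine Prod.ext ?_ (Prod.ext ?_ ?_)
  · simp only [hmat, uhs, Prod.smul_fst, smul_eq_mul, div_pow, Real.sq_sqrt h2.le,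
      Complex.normSq_div, Complex.normSq_ofReal]
    simp only [hdet]
    field_simp
    ring
  · simp [hmat]
  · simp [hmat, uhs]
    have : (c : ℂ) ≠ 0 := by exact_mod_cast h1.ne'
    field_simp

lemma uhs_hmat {p : ℂ × ℝ} (h : 0 < p.2) : uhs (hmat p) = p := by
  refine Prod.ext ?_ ?_
  · simp [uhs, hmat]
  · simp [uhs, hmat, hdet, Real.sqrt_sq h.le]

lemma hpos_hmat {p : ℂ × ℝ} (h : 0 < p.2) : HPos (hmat p) := by
  refine ⟨by simp [hmat], ?_⟩
  simp [hdet, hmat]; positivity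

lemma uhs_smul {c : ℝ} (hc : 0 < c) (M : Herm) : uhs (c • M) = uhs M := by
  have : hdet (c • M) = c ^ 2 * hdet M := by
    simp [hdet, Complex.normSq_apply]; ring
  have hc' : (c : ℂ) ≠ 0 := by exact_mod_cast hc.ne'
  refine Prod.ext ?_ ?_
  · simp [uhs, mul_div_mul_left _ _ hc']
  · simp only [uhs, this]
    rw [Real.sqrt_mul (by positivity), Real.sqrt_sq hc.le]
    simp [mul_div_mul_left _ _ hc.ne']

lemma hact_hmat (g : SL(2, ℂ)) {p : ℂ × ℝ} (h : 0 < p.2) :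
    ∃ N : ℝ, 0 < N ∧ hact g (hmat p) = N • hmat (poincare g p) ∧ 0 < (poincare g p).2 := by
  have hpos := (hpos_hmat h).hact g
  have hN : (KahnMarkovic.hact g (hmat p)).2.1
      = ‖g 1 0 * p.1 + g 1 1‖ ^ 2 + ‖g 1 0‖ ^ 2 * p.2 ^ 2 := by
    simp only [KahnMarkovic.hact, hmat, ← Complex.normSq_eq_norm_sq]
    generalize g 1 0 = g10
    generalize g 1 1 = g11
    simp [Complex.normSq_apply]
    ring
  have hN0 : 0 < ‖g 1 0 * p.1 + g 1 1‖ ^ 2 + ‖g 1 0‖ ^ 2 * p.2 ^ 2 := hN ▸ hpos.1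
  have key : uhs (KahnMarkovic.hact g (hmat p)) = poincare g p := by
    refine Prod.ext ?_ ?_
    · simp only [uhs, poincare, hN]
      congr 1
      simp only [KahnMarkovic.hact, hmat]
      rw [Complex.ofReal_add, ← Complex.mul_conj]
      simp
      ring
    · simp only [uhs, poincare, hN, hdet_hact]
      congr 1
      simp [hdet, hmat, Real.sqrt_sq h.le]
  refine ⟨_, hpos.1, ?_, ?_⟩
  · rw [← key, smul_hmat_uhs hpos]
  · rw [← key]; exact uhs_pos hpos

/-- The dictionary of the whole construction: the Poincaré extension is the linear action on
positive definite Hermitian matrices, read up to positive factors. -/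
lemma poincare_uhs (g : SL(2, ℂ)) {M : Herm} (h : HPos M) :
    poincare g (uhs M) = uhs (hact g M) := by
  obtain ⟨N, hN, h1, h2⟩ := hact_hmat g (uhs_pos h)
  rw [← smul_hmat_uhs h, hact_smul, uhs_smul h.1, uhs_smul h.1, h1, uhs_smul hN, uhs_hmat h2,
    uhs_hmat (uhs_pos h)]

lemma poincare_mul (g h : SL(2, ℂ)) {p : ℂ × ℝ} (hp : 0 < p.2) :
    poincare (g * h) p = poincare g (poincare h p) := by
  rw [← uhs_hmat hp, poincare_uhs _ (hpos_hmat hp), poincare_uhs _ (hpos_hmat hp),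
    poincare_uhs _ ((hpos_hmat hp).hact h), hact_mul]

lemma poincare_neg (g : SL(2, ℂ)) {p : ℂ × ℝ} (hp : 0 < p.2) :
    poincare (-g) p = poincare g p := by
  rw [← uhs_hmat hp, poincare_uhs _ (hpos_hmat hp), poincare_uhs _ (hpos_hmat hp), hact_neg]

lemma contDiffAt_hdet (M : Herm) : ContDiffAt ℝ ∞ hdet M := by
  have : ContDiff ℝ ∞ fun M : Herm =>
      M.1 * M.2.1 - (M.2.2.re * M.2.2.re + M.2.2.im * M.2.2.im) := by
    have h1 : ContDiff ℝ ∞ fun M : Herm => M.2.2.re :=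
      Complex.reCLM.contDiff.comp (contDiff_snd.comp contDiff_snd)
    have h2 : ContDiff ℝ ∞ fun M : Herm => M.2.2.im :=
      Complex.imCLM.contDiff.comp (contDiff_snd.comp contDiff_snd)
    fun_prop
  exact this.contDiffAt

lemma contDiffAt_uhs {M : Herm} (h : HPos M) : ContDiffAt ℝ ∞ uhs M := by
  have h1 : ContDiffAt ℝ ∞ (fun M : Herm => M.2.1) M := by fun_prop
  have h3 : ContDiffAt ℝ ∞ (fun M : Herm => M.2.2) M := by fun_prop
  have h2 : ContDiffAt ℝ ∞ (fun M : Herm => (M.2.1 : ℂ)) M :=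
    Complex.ofRealCLM.contDiff.contDiffAt.comp M h1
  have h4 : (M.2.1 : ℂ) ≠ 0 := Complex.ofReal_ne_zero.2 h.1.ne'
  have h5 : ContDiffAt ℝ ∞ (fun M : Herm => M.2.2 / (M.2.1 : ℂ)) M := by
    simp only [div_eq_mul_inv]
    exact h3.mul (h2.inv h4)
  refine ContDiffAt.prodMk h5 ?_
  exact ((contDiffAt_hdet M).sqrt h.2.ne').div h1 h.1.ne'

/-- The derivative of `uhs` is injective modulo the radial direction. -/
lemma exists_smul_of_fderiv_uhs {E : Type*} [NormedAddCommGroup E] [NormedSpace ℝ E]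
    {f : E → Herm} {x v : E} (hf : DifferentiableAt ℝ f x) (hpos : ∀ᶠ y in nhds x, HPos (f y))
    (hv : fderiv ℝ (fun y => uhs (f y)) x v = 0) : ∃ c : ℝ, fderiv ℝ f x v = c • f x := by
  have hx := hpos.self_of_nhds
  have h1 : DifferentiableAt ℝ (fun y => uhs (f y)) x :=
    ((contDiffAt_uhs hx).differentiableAt (by simp)).comp x hf
  have h2 : DifferentiableAt ℝ (fun y => (f y).2.1) x := by fun_prop
  have h3 : HasFDerivAt hmat (fderiv ℝ hmat (uhs (f x))) (uhs (f x)) := by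
    have : DifferentiableAt ℝ hmat (uhs (f x)) := by
      unfold hmat
      have h1 : Differentiable ℝ fun p : ℂ × ℝ => p.1.re :=
        Complex.reCLM.differentiable.comp differentiable_fst
      have h2 : Differentiable ℝ fun p : ℂ × ℝ => p.1.im :=
        Complex.imCLM.differentiable.comp differentiable_fst
      simp only [Complex.normSq_apply]
      fun_prop
    exact this.hasFDerivAt
  have h4 := h2.hasFDerivAt.smul (h3.comp x h1.hasFDerivAt)
  -- `f` is a positive scalar function times a function of `uhs ∘ f`; where the derivative of the
  -- latter vanishes, only the scalar varies.
  have h5 : f =ᶠ[nhds x] fun y => (f y).2.1 • hmat (uhs (f y)) := by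
    filter_upwards [hpos] with y hy
    rw [smul_hmat_uhs hy]
  have h6 := (h4.congr_of_eventuallyEq h5).fderiv
  refine ⟨(fderiv ℝ (fun y => (f y).2.1) x v) / (f x).2.1, ?_⟩
  rw [h6]
  have h7 : ∀ d : ℝ, (d / (f x).2.1) • f x = d • hmat (uhs (f x)) := fun d => by
    conv_lhs => enter [2]; rw [← smul_hmat_uhs hx]
    rw [smul_smul, div_mul_cancel₀ _ hx.1.ne']
  rw [h7]
  simp [hv]

/-! ### A reflection group acting on `ℝ³` -/

/-- The linear reflection `x_k ↦ 4 (x_{k+1} + x_{k+2}) - x_k`. -/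
def refl (k : Fin 3) (x : Fin 3 → ℝ) : Fin 3 → ℝ :=
  Function.update x k (4 * (x (k + 1) + x (k + 2)) - x k)

@[simp] lemma refl_self (k : Fin 3) (x : Fin 3 → ℝ) :
    refl k x k = 4 * (x (k + 1) + x (k + 2)) - x k := by simp [refl]

lemma refl_of_ne {j k : Fin 3} (h : j ≠ k) (x : Fin 3 → ℝ) : refl k x j = x j := by
  simp [refl, h]

lemma fin_three_cases (k : Fin 3) : k = 0 ∨ k = 1 ∨ k = 2 := by decide +revert

lemma add_one_ne (k : Fin 3) : k + 1 ≠ k := by decide +revert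
lemma add_one_one (k : Fin 3) : k + 1 + 1 = k + 2 := by decide +revert
lemma add_one_two (k : Fin 3) : k + 1 + 2 = k := by decide +revert
lemma add_two_one (k : Fin 3) : k + 2 + 1 = k := by decide +revert
lemma add_two_two (k : Fin 3) : k + 2 + 2 = k + 1 := by decide +revert
lemma eq_or_eq_add (j k : Fin 3) : j = k ∨ j = k + 1 ∨ j = k + 2 := by decide +revert
lemma add_two_ne (k : Fin 3) : k + 2 ≠ k := by decide +revert

@[simp] lemma refl_add_one (k : Fin 3) (x : Fin 3 → ℝ) : refl k x (k + 1) = x (k + 1) :=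
  refl_of_ne (add_one_ne k) x

@[simp] lemma refl_add_two (k : Fin 3) (x : Fin 3 → ℝ) : refl k x (k + 2) = x (k + 2) :=
  refl_of_ne (add_two_ne k) x

lemma refl_refl (k : Fin 3) (x : Fin 3 → ℝ) : refl k (refl k x) = x := by
  funext j
  by_cases h : j = k
  · subst h; simp
  · rw [refl_of_ne h, refl_of_ne h]

/-- `refl k` as a linear map. -/
def reflL (k : Fin 3) : (Fin 3 → ℝ) →L[ℝ] (Fin 3 → ℝ) :=
  LinearMap.toContinuousLinearMap
    { toFun := refl k
      map_add' := fun x y => by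
        funext j
        by_cases h : j = k
        · subst h; simp; ring
        · simp [refl_of_ne h]
      map_smul' := fun c x => by
        funext j
        by_cases h : j = k
        · subst h; simp; ring
        · simp [refl_of_ne h] }

@[simp] lemma reflL_apply (k : Fin 3) (x : Fin 3 → ℝ) : reflL k x = refl k x := rfl

/-- The action of a word in the three reflections. -/
def wact : List (Fin 3) → (Fin 3 → ℝ) →L[ℝ] (Fin 3 → ℝ)
  | [] => ContinuousLinearMap.id ℝ _
  | k :: l => (reflL k).comp (wact l)

@[simp] lemma wact_nil (x : Fin 3 → ℝ) : wact [] x = x := rfl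
@[simp] lemma wact_cons (k : Fin 3) (l : List (Fin 3)) (x : Fin 3 → ℝ) :
    wact (k :: l) x = refl k (wact l x) := rfl

lemma wact_append (l l' : List (Fin 3)) (x : Fin 3 → ℝ) :
    wact (l ++ l') x = wact l (wact l' x) := by
  induction l with
  | nil => rfl
  | cons k l ih => simp [ih]

lemma wact_reverse_wact (l : List (Fin 3)) (x : Fin 3 → ℝ) : wact l.reverse (wact l x) = x := by
  induction l with
  | nil => rfl
  | cons k l ih => simp [wact_append, refl_refl, ih]

/-- The image of a word under the map sending the `k`-th reflection to `H k`. -/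
def wprod (H : Fin 3 → SL(2, ℂ)) (l : List (Fin 3)) : SL(2, ℂ) := (l.map H).prod

@[simp] lemma wprod_nil (H : Fin 3 → SL(2, ℂ)) : wprod H [] = 1 := rfl
@[simp] lemma wprod_cons (H : Fin 3 → SL(2, ℂ)) (k : Fin 3) (l : List (Fin 3)) :
    wprod H (k :: l) = H k * wprod H l := by simp [wprod]
lemma wprod_append (H : Fin 3 → SL(2, ℂ)) (l l' : List (Fin 3)) :
    wprod H (l ++ l') = wprod H l * wprod H l' := by simp [wprod]

lemma hact_half_turn {h : SL(2, ℂ)} (hh : h * h = -1) (M : Herm) : hact h (hact h M) = M := by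
  rw [← hact_mul, hh, hact_neg, hact_one]

lemma hact_wprod_reverse {H : Fin 3 → SL(2, ℂ)} (hH : ∀ k, H k * H k = -1) (l : List (Fin 3))
    (M : Herm) : hact (wprod H l.reverse) (hact (wprod H l) M) = M := by
  induction l with
  | nil => simp [hact_one]
  | cons k l ih => simp [wprod_append, hact_mul, hact_half_turn (hH k), ih]

/-- Every word is equivalent to a reduced word. -/
lemma exists_reduced (H : Fin 3 → SL(2, ℂ)) (hH : ∀ k, H k * H k = -1) (l : List (Fin 3)) :
    ∃ l' : List (Fin 3), l'.IsChain (· ≠ ·) ∧ (∀ x, wact l' x = wact l x) ∧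
      ∀ M, hact (wprod H l') M = hact (wprod H l) M := by
  induction l with
  | nil => exact ⟨[], by simp, fun _ => rfl, fun _ => rfl⟩
  | cons k l ih =>
    obtain ⟨l', h1, h2, h3⟩ := ih
    match l', h1, h2, h3 with
    | [], h1, h2, h3 =>
      exact ⟨[k], by simp, fun x => by simp [← h2], fun M => by
        simp only [wprod_cons, hact_mul, h3]⟩
    | j :: l'', h1, h2, h3 =>
      by_cases hjk : k = j
      · subst hjk
        refine ⟨l'', h1.tail, fun x => ?_, fun M => ?_⟩
        · rw [wact_cons, ← h2, wact_cons, refl_refl]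
        · rw [wprod_cons, hact_mul, ← h3, wprod_cons, hact_mul, hact_half_turn (hH k)]
      · refine ⟨k :: j :: l'', ?_, fun x => ?_, fun M => ?_⟩
        · exact List.IsChain.cons_cons hjk h1
        · rw [wact_cons, h2, wact_cons]
        · rw [wprod_cons, hact_mul, h3, wprod_cons, hact_mul]

/-- A neighbourhood of the fundamental hexagon. -/
def Slack (x : Fin 3 → ℝ) : Prop :=
  ∀ k, 0 < x (k + 1) + x (k + 2) ∧ x k < 2.05 * (x (k + 1) + x (k + 2)) ∧
    -0.01 * (x (k + 1) + x (k + 2)) < x k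

/-- A neighbourhood of the half-space behind the `k`-th mirror. -/
def Behind (k : Fin 3) (x : Fin 3 → ℝ) : Prop :=
  0 < x (k + 1) + x (k + 2) ∧ 1.9 * (x (k + 1) + x (k + 2)) < x k ∧
    -0.02 * x k < x (k + 1) ∧ -0.02 * x k < x (k + 2)

lemma Slack.behind {x : Fin 3 → ℝ} (h : Slack x) (k : Fin 3) : Behind k (refl k x) := by
  have h0 := h 0
  have h1 := h 1
  have h2 := h 2
  simp only [Fin.isValue, Fin.reduceAdd] at h0 h1 h2
  obtain ⟨h01, h02, h03⟩ := h0
  obtain ⟨h11, h12, h13⟩ := h1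
  obtain ⟨h21, h22, h23⟩ := h2
  simp only [Behind, refl_self, refl_add_one, refl_add_two]
  rcases fin_three_cases k with rfl | rfl | rfl <;>
    simp only [Fin.isValue, Fin.reduceAdd] <;>
    refine ⟨?_, ?_, ?_, ?_⟩ <;> linarith

/-- The ping-pong step for reflections. The constants leave a margin, so that an open neighbourhood
of the hexagon, and not only the hexagon, is carried off itself by two different successive
reflections. -/
lemma Behind.refl {j k : Fin 3} (hjk : j ≠ k) {x : Fin 3 → ℝ} (h : Behind k x) :
    Behind j (refl j x) ∧ ¬ Slack (refl j x) := by
  obtain ⟨h1, h2, h3, h4⟩ := h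
  have key : Behind j (KahnMarkovic.refl j x) ∧ 2.05 * (KahnMarkovic.refl j x (j + 1)
      + KahnMarkovic.refl j x (j + 2)) < KahnMarkovic.refl j x j := by
    simp only [Behind, refl_self, refl_add_one, refl_add_two]
    rcases fin_three_cases k with rfl | rfl | rfl <;>
      rcases fin_three_cases j with rfl | rfl | rfl <;>
      first
      | exact absurd rfl hjk
      | (simp only [Fin.isValue, Fin.reduceAdd] at *
         refine ⟨⟨?_, ?_, ?_, ?_⟩, ?_⟩ <;> linarith)
  exact ⟨key.1, fun hs => absurd (hs j).2.1 (not_lt.2 key.2.le)⟩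

lemma behind_of_reduced {x : Fin 3 → ℝ} (h : Slack x) (k : Fin 3) (l : List (Fin 3))
    (hl : (k :: l).IsChain (· ≠ ·)) :
    Behind k (wact (k :: l) x) ∧ (l ≠ [] → ¬ Slack (wact (k :: l) x)) := by
  induction l generalizing k with
  | nil => exact ⟨h.behind k, fun h => absurd rfl h⟩
  | cons j l ih =>
    rw [List.isChain_cons_cons] at hl
    have := (ih j hl.2).1
    exact ⟨(this.refl hl.1).1, fun _ => (this.refl hl.1).2⟩

/-- A map which is equivariant, up to positive factors, under the three reflections near the
mirrors is equivariant under all words. -/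
lemma exists_smul_hact_wprod {H : Fin 3 → SL(2, ℂ)} (hH : ∀ k, H k * H k = -1)
    {f : (Fin 3 → ℝ) → Herm}
    (hf : ∀ k x, Slack x → Slack (refl k x) → ∃ c : ℝ, 0 < c ∧ f (refl k x) = c • hact (H k) (f x))
    (l : List (Fin 3)) {x : Fin 3 → ℝ} (hx : Slack x) (hlx : Slack (wact l x)) :
    ∃ c : ℝ, 0 < c ∧ f (wact l x) = c • hact (wprod H l) (f x) := by
  obtain ⟨l', h1, h2, h3⟩ := exists_reduced H hH l
  rw [← h2] at hlx ⊢
  rw [← h3]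
  match l', h1, hlx with
  | [], _, _ => exact ⟨1, one_pos, by simp [hact_one]⟩
  | [k], _, hlx => simpa using hf k x hx hlx
  -- A reduced word of length at least two never brings a point of `Slack` back to `Slack`, so
  -- equivariance under single reflections is all that has to be checked.
  | k :: j :: l, h1, hlx =>
    exact absurd hlx ((behind_of_reduced hx k (j :: l) h1).2 (by simp))

/-- The fundamental hexagon. -/
def Hexagon (x : Fin 3 → ℝ) : Prop :=
  (∀ k, 0 ≤ x k) ∧ ∀ k, x k ≤ 2 * (x (k + 1) + x (k + 2))

/-- The invariant Lorentzian quadratic form. -/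
def lorentz (x : Fin 3 → ℝ) : ℝ :=
  x 0 ^ 2 + x 1 ^ 2 + x 2 ^ 2 - 4 * (x 0 * x 1 + x 1 * x 2 + x 2 * x 0)

lemma lorentz_refl (k : Fin 3) (x : Fin 3 → ℝ) : lorentz (refl k x) = lorentz x := by
  rcases fin_three_cases k with rfl | rfl | rfl <;> simp [lorentz, refl, Function.update] <;> ring

/-- Reduction to the fundamental hexagon. -/
lemma exists_wact_hexagon {C : (Fin 3 → ℝ) → Prop} {S : Set (Fin 3)}
    (h0 : ∀ x, C x → ∀ k, 0 ≤ x k) (hQ : ∀ x, C x → lorentz x = -18)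
    (hC : ∀ x k, C x → 2 * (x (k + 1) + x (k + 2)) < x k → k ∈ S ∧ C (refl k x))
    {x : Fin 3 → ℝ} (hx : C x) :
    ∃ l : List (Fin 3), (∀ k ∈ l, k ∈ S) ∧ C (wact l x) ∧ Hexagon (wact l x) := by
  -- Termination by induction on a bound `3 ^ n` for the sum of the coordinates; a sum below 1 is
  -- incompatible with `lorentz x = -18`.
  have key : ∀ n : ℕ, ∀ x, C x → x 0 + x 1 + x 2 < 3 ^ n →
      ∃ l : List (Fin 3), (∀ k ∈ l, k ∈ S) ∧ C (wact l x) ∧ Hexagon (wact l x) := by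
    intro n
    induction n with
    | zero =>
      intro x hx hs
      have a0 := h0 x hx 0
      have a1 := h0 x hx 1
      have a2 := h0 x hx 2
      have := hQ x hx
      unfold lorentz at this
      exfalso
      have h1 : (x 0 + x 1 + x 2) ^ 2 < 1 := by
        have : 0 ≤ x 0 + x 1 + x 2 := by positivity
        nlinarith
      nlinarith [mul_nonneg a0 a1, mul_nonneg a1 a2, mul_nonneg a2 a0]
    | succ n ih =>
      intro x hx hs
      by_cases hD : Hexagon x
      · exact ⟨[], by simp, hx, hD⟩
      obtain ⟨k, hk⟩ : ∃ k, 2 * (x (k + 1) + x (k + 2)) < x k := by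
        by_contra! h
        exact hD ⟨h0 x hx, h⟩
      obtain ⟨hkS, hx'⟩ := hC x k hx hk
      by_cases hD' : Hexagon (refl k x)
      · exact ⟨[k], by simp [hkS], hx', hD'⟩
      obtain ⟨j, hj⟩ : ∃ j, 2 * (refl k x (j + 1) + refl k x (j + 2)) < refl k x j := by
        by_contra! h
        exact hD' ⟨h0 _ hx', h⟩
      -- If the reflected point still lies behind some mirror `j`, then `j ≠ k`, and the two
      -- inequalities force `x k` to be so large that the reflection divided the sum by at least 3.
      have hsum : 3 * (refl k x 0 + refl k x 1 + refl k x 2) ≤ x 0 + x 1 + x 2 := by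
        have a0 := h0 _ hx' 0
        have a1 := h0 _ hx' 1
        have a2 := h0 _ hx' 2
        rcases fin_three_cases k with rfl | rfl | rfl <;>
          rcases fin_three_cases j with rfl | rfl | rfl <;>
          simp [refl, Function.update] at a0 a1 a2 hj hk ⊢ <;> linarith
      obtain ⟨l, hl, hl1, hl2⟩ := ih (refl k x) hx' (by rw [pow_succ] at hs; linarith)
      refine ⟨l ++ [k], ?_, ?_, ?_⟩
      · intro i hi
        rcases List.mem_append.1 hi with h | h
        · exact hl i h
        · simp at h; rwa [h]
      · simpa [wact_append] using hl1
      · simpa [wact_append] using hl2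
  obtain ⟨n, hn⟩ := pow_unbounded_of_one_lt (x 0 + x 1 + x 2) (by norm_num : (1 : ℝ) < 3)
  exact key n x hx hn

lemma Hexagon.slack {x : Fin 3 → ℝ} (h : Hexagon x) (h0 : x ≠ 0) : Slack x := by
  have a0 := h.1 0
  have a1 := h.1 1
  have a2 := h.1 2
  have b0 := h.2 0
  have b1 := h.2 1
  have b2 := h.2 2
  simp only [Fin.isValue, Fin.reduceAdd, zero_add] at b0 b1 b2
  have hpos : 0 < x 0 + x 1 + x 2 := by
    by_contra hn
    refine h0 (funext fun k => ?_)
    fin_cases k <;> simp <;> linarith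
  intro k
  rcases fin_three_cases k with rfl | rfl | rfl <;>
    simp only [Fin.isValue, Fin.reduceAdd] <;> refine ⟨?_, ?_, ?_⟩ <;> linarith

/-! ### Profile functions -/

/-- A smooth cutoff function, equal to `1` for `p ≤ 1` and to `0` for `p ≥ 7/5`. -/
def cut (p : ℝ) : ℝ := 1 - Real.smoothTransition ((p - 1) * (5 / 2))

/-- A smooth function which vanishes for `p ≤ 3/4` and increases strictly afterwards. -/
def glide (p : ℝ) : ℝ := (p - 3 / 4) * Real.smoothTransition ((p - 3 / 4) * 4)

/-- A smooth function equal to `glide` for `p ≤ 8/5` and to `T + (p - 2)` for `p ≥ 7/4`. -/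
def reach (T p : ℝ) : ℝ :=
  (1 - Real.smoothTransition ((p - 8 / 5) * (20 / 3))) * glide p
    + Real.smoothTransition ((p - 8 / 5) * (20 / 3)) * (T + (p - 2))

lemma contDiff_transition (a b : ℝ) :
    ContDiff ℝ ∞ fun p : ℝ => Real.smoothTransition ((p - a) * b) :=
  Real.smoothTransition.contDiff.comp (by fun_prop)

lemma contDiff_cut : ContDiff ℝ ∞ cut := contDiff_const.sub (contDiff_transition _ _)

lemma contDiff_glide : ContDiff ℝ ∞ glide :=
  (contDiff_id.sub contDiff_const).mul (contDiff_transition _ _)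

lemma contDiff_reach (T : ℝ) : ContDiff ℝ ∞ (reach T) :=
  ((contDiff_const.sub (contDiff_transition _ _)).mul contDiff_glide).add
    ((contDiff_transition _ _).mul (contDiff_const.add (contDiff_id.sub contDiff_const)))

lemma cut_nonneg (p : ℝ) : 0 ≤ cut p := by
  unfold cut; linarith [Real.smoothTransition.le_one ((p - 1) * (5 / 2))]

lemma cut_eq_one {p : ℝ} (h : p ≤ 1) : cut p = 1 := by
  unfold cut
  rw [Real.smoothTransition.zero_of_nonpos (by linarith)]; ring

lemma cut_eq_zero {p : ℝ} (h : 7 / 5 ≤ p) : cut p = 0 := by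
  unfold cut
  rw [Real.smoothTransition.one_of_one_le (by linarith)]; ring

lemma glide_eq_zero {p : ℝ} (h : p ≤ 3 / 4) : glide p = 0 := by
  unfold glide
  rw [Real.smoothTransition.zero_of_nonpos (by linarith)]; ring

lemma glide_le {p : ℝ} (h : 3 / 4 ≤ p) : glide p ≤ p - 3 / 4 := by
  unfold glide
  have := Real.smoothTransition.le_one ((p - 3 / 4) * 4)
  nlinarith

lemma reach_of_le (T : ℝ) {p : ℝ} (h : p ≤ 8 / 5) : reach T p = glide p := by
  unfold reach
  rw [Real.smoothTransition.zero_of_nonpos (by linarith)]; ring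

lemma reach_of_ge (T : ℝ) {p : ℝ} (h : 7 / 4 ≤ p) : reach T p = T + (p - 2) := by
  unfold reach
  rw [Real.smoothTransition.one_of_one_le (by linarith)]; ring

lemma deriv_nonneg_of_monotone {f : ℝ → ℝ} (hf : Monotone f) (x : ℝ) : 0 ≤ deriv f x := by
  by_cases h : DifferentiableAt ℝ f x
  · exact hf.deriv_nonneg
  · rw [deriv_zero_of_not_differentiableAt h]

lemma exists_deriv_transition (a : ℝ) {b : ℝ} (hb : 0 ≤ b) (p : ℝ) :
    ∃ d, 0 ≤ d ∧ HasDerivAt (fun p : ℝ => Real.smoothTransition ((p - a) * b)) d p := by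
  refine ⟨deriv (fun p : ℝ => Real.smoothTransition ((p - a) * b)) p, ?_, ?_⟩
  · exact deriv_nonneg_of_monotone (fun x y hxy => Real.smoothTransition.monotone (by gcongr)) p
  · exact ((contDiff_transition a b).differentiable (by simp) p).hasDerivAt

lemma exists_deriv_cut (p : ℝ) : ∃ d, 0 ≤ d ∧ HasDerivAt cut (-d) p := by
  obtain ⟨d, hd, h⟩ := exists_deriv_transition 1 (by norm_num : (0 : ℝ) ≤ 5 / 2) p
  exact ⟨d, hd, h.const_sub 1⟩

lemma exists_deriv_glide (p : ℝ) :
    ∃ d, 0 ≤ d ∧ (3 / 4 < p → 0 < d) ∧ HasDerivAt glide d p := by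
  obtain ⟨d, hd, h⟩ := exists_deriv_transition (3 / 4) (by norm_num : (0 : ℝ) ≤ 4) p
  have h1 := ((hasDerivAt_id p).sub_const (3 / 4)).mul h
  have h0 := Real.smoothTransition.nonneg ((p - 3 / 4) * 4)
  rcases le_or_gt p (3 / 4) with hp | hp
  · refine ⟨0, le_rfl, fun h => absurd h (not_lt.2 hp), ?_⟩
    have h2 : HasDerivAt glide (deriv glide p) p :=
      (contDiff_glide.differentiable (by simp) p).hasDerivAt
    have h3 : deriv glide p = 0 := by
      have h4 : HasDerivWithinAt glide 0 (Set.Iic p) p :=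
        (hasDerivWithinAt_const p (Set.Iic p) (0 : ℝ)).congr
          (fun y hy => glide_eq_zero (le_trans hy hp)) (glide_eq_zero hp)
      exact (uniqueDiffWithinAt_Iic p).eq_deriv _ h2.hasDerivWithinAt h4
    rwa [h3] at h2
  · have h2 := Real.smoothTransition.pos_of_pos (by linarith : 0 < (p - 3 / 4) * 4)
    have hd1 : 0 < 1 * Real.smoothTransition ((p - 3 / 4) * 4) + (p - 3 / 4) * d := by
      have : 0 ≤ (p - 3 / 4) * d := mul_nonneg (by linarith) hd
      linarith
    exact ⟨_, hd1.le, fun _ => hd1, h1⟩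

/-- The derivative is a convex combination of `glide'` and 1, plus the derivative of the transition
times `T + (p - 2) - glide p`. The hypothesis `2 ≤ T` and `glide_le` make that last factor positive,
so the interpolation never runs backwards. -/
lemma exists_deriv_reach {T p : ℝ} (hT : 2 ≤ T) (hp : 3 / 4 < p) :
    ∃ d, 0 < d ∧ HasDerivAt (reach T) d p := by
  obtain ⟨d, hd, h⟩ := exists_deriv_transition (8 / 5) (by norm_num : (0 : ℝ) ≤ 20 / 3) p
  obtain ⟨d', -, hd', h'⟩ := exists_deriv_glide p
  have h1 := ((h.const_sub 1).mul h').add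
    (h.mul (((hasDerivAt_id p).sub_const 2).const_add T))
  refine ⟨_, ?_, h1⟩
  have a0 := Real.smoothTransition.nonneg ((p - 8 / 5) * (20 / 3))
  have a1 := Real.smoothTransition.le_one ((p - 8 / 5) * (20 / 3))
  set κ := Real.smoothTransition ((p - 8 / 5) * (20 / 3))
  have h2 := glide_le hp.le
  have h3 := hd' hp
  have h4 : 0 ≤ d * (T + (p - 2) - glide p) := mul_nonneg hd (by linarith)
  have h5 : 0 < (1 - κ) * d' + κ := by
    rcases a0.eq_or_lt with h | h
    · rw [← h]; simpa using h3
    · have : 0 ≤ (1 - κ) * d' := mul_nonneg (by linarith) h3.le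
      linarith
  simp only [id]
  linarith

/-! ### The equivariant surface in a fundamental hexagon -/

/-- The ratio `x_k / (x_{k+1} + x_{k+2})`. -/
def ratio (k : Fin 3) (x : Fin 3 → ℝ) : ℝ := x k / (x (k + 1) + x (k + 2))

/-- The weight of the `j`-th boundary line. -/
def weight (j : Fin 3) (x : Fin 3 → ℝ) : ℝ :=
  cut (ratio j x) * Real.exp (-glide (ratio j x)) * (x (j + 1) * x (j + 2))

/-- The position on the `j`-th boundary line. -/
def position (φ : Fin 3 → Fin 3 → ℝ → ℝ) (j : Fin 3) (x : Fin 3 → ℝ) : ℝ :=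
  φ (j + 1) j (ratio (j + 1) x) - φ (j + 2) j (ratio (j + 2) x)

/-- The weighted sum of points on the geodesics with ideal endpoints `p j`, `q j`. -/
def surf (φ : Fin 3 → Fin 3 → ℝ → ℝ) (c : (Fin 3 → Herm) × (Fin 3 → Herm)) (x : Fin 3 → ℝ) :
    Herm :=
  ∑ j, ((weight j x * Real.exp (position φ j x)) • c.1 j
    + (weight j x * Real.exp (-position φ j x)) • c.2 j)

lemma contDiffAt_ratio (k : Fin 3) {x : Fin 3 → ℝ} (h : x (k + 1) + x (k + 2) ≠ 0) :
    ContDiffAt ℝ ∞ (ratio k) x := by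
  unfold ratio
  exact ContDiffAt.div (by fun_prop) (by fun_prop) h

lemma contDiffAt_weight (j : Fin 3) {x : Fin 3 → ℝ} (h : x (j + 1) + x (j + 2) ≠ 0) :
    ContDiffAt ℝ ∞ (weight j) x := by
  have h1 := contDiffAt_ratio j h
  have h2 := contDiff_cut.contDiffAt.comp x h1
  have h3 := (contDiff_glide.contDiffAt.comp x h1).neg.exp
  exact (h2.mul h3).mul (by fun_prop)

lemma contDiffAt_position {φ : Fin 3 → Fin 3 → ℝ → ℝ} (hφ : ∀ k j, ContDiff ℝ ∞ (φ k j))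
    (j : Fin 3) {x : Fin 3 → ℝ} (h : ∀ k, x (k + 1) + x (k + 2) ≠ 0) :
    ContDiffAt ℝ ∞ (position φ j) x :=
  ((hφ _ _).contDiffAt.comp x (contDiffAt_ratio (j + 1) (h _))).sub
    ((hφ _ _).contDiffAt.comp x (contDiffAt_ratio (j + 2) (h _)))

lemma contDiffAt_surf_prod {φ : Fin 3 → Fin 3 → ℝ → ℝ} (hφ : ∀ k j, ContDiff ℝ ∞ (φ k j))
    (c : (Fin 3 → Herm) × (Fin 3 → Herm)) {x : Fin 3 → ℝ}
    (h : ∀ k, x (k + 1) + x (k + 2) ≠ 0) :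
    ContDiffAt ℝ ∞ (fun e : ((Fin 3 → Herm) × (Fin 3 → Herm)) × (Fin 3 → ℝ) => surf φ e.1 e.2)
      (c, x) := by
  unfold surf
  refine ContDiffAt.sum fun j _ => ?_
  have h2 : ContDiffAt ℝ ∞
      (fun e : ((Fin 3 → Herm) × (Fin 3 → Herm)) × (Fin 3 → ℝ) => weight j e.2) (c, x) :=
    (contDiffAt_weight j (h j)).comp (c, x) contDiffAt_snd
  have h3 : ContDiffAt ℝ ∞
      (fun e : ((Fin 3 → Herm) × (Fin 3 → Herm)) × (Fin 3 → ℝ) => position φ j e.2) (c, x) :=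
    (contDiffAt_position hφ j h).comp (c, x) contDiffAt_snd
  exact ((h2.mul h3.exp).smul (by fun_prop)).add ((h2.mul h3.neg.exp).smul (by fun_prop))

lemma contDiffAt_surf {φ : Fin 3 → Fin 3 → ℝ → ℝ} (hφ : ∀ k j, ContDiff ℝ ∞ (φ k j))
    (c : (Fin 3 → Herm) × (Fin 3 → Herm)) {x : Fin 3 → ℝ}
    (h : ∀ k, x (k + 1) + x (k + 2) ≠ 0) : ContDiffAt ℝ ∞ (surf φ c) x :=
  (contDiffAt_surf_prod hφ c h).comp x (contDiffAt_const.prodMk contDiffAt_id)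

lemma ratio_smul (k : Fin 3) {a : ℝ} (ha : a ≠ 0) (x : Fin 3 → ℝ) :
    ratio k (a • x) = ratio k x := by
  simp only [ratio, Pi.smul_apply, smul_eq_mul, ← mul_add]
  exact mul_div_mul_left _ _ ha

lemma surf_smul (φ : Fin 3 → Fin 3 → ℝ → ℝ) (c : (Fin 3 → Herm) × (Fin 3 → Herm)) {a : ℝ}
    (ha : a ≠ 0) (x : Fin 3 → ℝ) : surf φ c (a • x) = a ^ 2 • surf φ c x := by
  simp only [surf, weight, position, ratio_smul _ ha, Finset.smul_sum, smul_add, smul_smul,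
    Pi.smul_apply, smul_eq_mul]
  refine Finset.sum_congr rfl fun j _ => ?_
  congr 2 <;> ring

/-- Euler's relation for a map homogeneous of degree 2. It accounts for the radial direction in all
injectivity statements below. -/
lemma fderiv_surf_self {φ : Fin 3 → Fin 3 → ℝ → ℝ} (hφ : ∀ k j, ContDiff ℝ ∞ (φ k j))
    (c : (Fin 3 → Herm) × (Fin 3 → Herm)) {x : Fin 3 → ℝ}
    (h : ∀ k, x (k + 1) + x (k + 2) ≠ 0) :
    fderiv ℝ (surf φ c) x x = (2 : ℝ) • surf φ c x := by
  have h1 : HasFDerivAt (surf φ c) (fderiv ℝ (surf φ c) x) ((1 : ℝ) • x) := by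
    rw [one_smul]
    exact ((contDiffAt_surf hφ c h).differentiableAt (by simp)).hasFDerivAt
  have h2 : HasDerivAt (fun t : ℝ => t • x) x 1 := by
    simpa using (hasDerivAt_id (1 : ℝ)).smul_const x
  have h3 := h1.comp_hasDerivAt (1 : ℝ) h2
  have h4 : HasDerivAt (fun t : ℝ => t ^ 2 • surf φ c x) ((2 : ℝ) • surf φ c x) 1 := by
    simpa using (hasDerivAt_pow 2 (1 : ℝ)).smul_const (surf φ c x)
  refine h3.unique (h4.congr_of_eventuallyEq ?_)
  filter_upwards [eventually_ne_nhds (one_ne_zero : (1 : ℝ) ≠ 0)] with t ht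
  exact surf_smul φ c ht x

/-! ### Nondegeneracy over the centre of the hexagon -/

/-- The centre of the hexagon: the hexagon without neighbourhoods of the three mirrors. -/
def centre : Set (Fin 3 → ℝ) :=
  {x | (∀ k, 0 ≤ x k) ∧ x 0 + x 1 + x 2 = 1 ∧ ∀ k, x k ≤ 3 / 2 * (x (k + 1) + x (k + 2))}

lemma isCompact_centre : IsCompact centre := by
  refine Metric.isCompact_of_isClosed_isBounded ?_ ?_
  · have h : centre = (⋂ k, {x : Fin 3 → ℝ | 0 ≤ x k}) ∩ ({x | x 0 + x 1 + x 2 = 1} ∩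
        ⋂ k, {x : Fin 3 → ℝ | x k ≤ 3 / 2 * (x (k + 1) + x (k + 2))}) := by
      ext x; simp [centre]
    rw [h]
    refine (isClosed_iInter fun k => isClosed_le (by fun_prop) (by fun_prop)).inter
      ((isClosed_eq (by fun_prop) (by fun_prop)).inter
        (isClosed_iInter fun k => isClosed_le (by fun_prop) (by fun_prop)))
  · refine (Metric.isBounded_closedBall (x := (0 : Fin 3 → ℝ)) (r := 1)).subset fun x hx => ?_
    obtain ⟨h1, h2, -⟩ := hx
    rw [mem_closedBall_zero_iff, pi_norm_le_iff_of_nonneg zero_le_one]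
    intro k
    rw [Real.norm_of_nonneg (h1 k)]
    have a0 := h1 0
    have a1 := h1 1
    have a2 := h1 2
    rcases fin_three_cases k with rfl | rfl | rfl <;> linarith

/-- A sign argument. Since the `η k` sum to zero, a nonzero `η` has, up to sign, one positive entry
`η k` and two nonpositive ones. Equation `k` then gives `0 ≤ μ`. The sum of the two other equations
minus equation `k` equates a sum of nonpositive terms with `2 * μ * b k`, so every term vanishes, in
particular those in `ν k * η k` and `β k * η k`, against `hs`. -/
lemma center_core {b β ν η : Fin 3 → ℝ} {μ : ℝ} (hb : ∀ k, 0 ≤ b k) (hβ : ∀ k, 0 ≤ β k)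
    (hν : ∀ k, 0 ≤ ν k) (hpos : ∀ k, 0 < b (k + 1) + b (k + 2)) (hs : ∀ k, 0 < ν k ∨ 0 < β k)
    (hη : η 0 + η 1 + η 2 = 0)
    (h : ∀ k, ν k * η k * (b (k + 1) + b (k + 2)) - (β (k + 1) * η (k + 1) + β (k + 2) * η (k + 2))
      = μ * (b (k + 1) + b (k + 2))) : η = 0 := by
  have key : ∀ (η : Fin 3 → ℝ) (μ : ℝ), η 0 + η 1 + η 2 = 0 →
      (∀ k, ν k * η k * (b (k + 1) + b (k + 2)) - (β (k + 1) * η (k + 1) + β (k + 2) * η (k + 2))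
        = μ * (b (k + 1) + b (k + 2))) →
      ∀ k, 0 < η k → η (k + 1) ≤ 0 → η (k + 2) ≤ 0 → False := by
    intro η μ hη h k h1 h2 h3
    have e0 := h k
    have e1 := h (k + 1)
    have e2 := h (k + 2)
    have i1 : k + 1 + 1 = k + 2 := add_one_one k
    have i2 : k + 1 + 2 = k := add_one_two k
    have i3 : k + 2 + 1 = k := add_two_one k
    have i4 : k + 2 + 2 = k + 1 := add_two_two k
    rw [i1, i2] at e1
    rw [i3, i4] at e2
    have p0 := hpos k
    have p1 := hpos (k + 1)
    have p2 := hpos (k + 2)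
    rw [i1, i2] at p1
    rw [i3, i4] at p2
    have hb0 := hb k
    set x := η k
    set y := η (k + 1)
    set z := η (k + 2)
    have t1 : 0 ≤ ν k * x * (b (k + 1) + b (k + 2)) :=
      mul_nonneg (mul_nonneg (hν k) h1.le) p0.le
    have t2 : 0 ≤ β (k + 1) * (-y) := mul_nonneg (hβ _) (by linarith)
    have t3 : 0 ≤ β (k + 2) * (-z) := mul_nonneg (hβ _) (by linarith)
    have t4 : 0 ≤ ν (k + 1) * (-y) * (b (k + 2) + b k) :=
      mul_nonneg (mul_nonneg (hν _) (by linarith)) p1.le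
    have t5 : 0 ≤ ν (k + 2) * (-z) * (b k + b (k + 1)) :=
      mul_nonneg (mul_nonneg (hν _) (by linarith)) p2.le
    have t6 : 0 ≤ β k * x := mul_nonneg (hβ _) h1.le
    have hμ : 0 ≤ μ := by
      by_contra hn
      push Not at hn
      have := mul_neg_of_neg_of_pos hn p0
      linarith
    have t7 : 0 ≤ μ * b k := mul_nonneg hμ hb0
    have s1 : ν k * x * (b (k + 1) + b (k + 2)) = 0 := by linarith
    have s2 : β k * x = 0 := by linarith
    rcases hs k with h | h
    · exact absurd s1 (by positivity)
    · exact absurd s2 (by positivity)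
  have h' : ∀ k, ν k * (-η) k * (b (k + 1) + b (k + 2))
      - (β (k + 1) * (-η) (k + 1) + β (k + 2) * (-η) (k + 2))
        = (-μ) * (b (k + 1) + b (k + 2)) := fun k => by
    have := h k
    simp only [Pi.neg_apply]
    linarith
  have hη' : (-η) 0 + (-η) 1 + (-η) 2 = 0 := by simp only [Pi.neg_apply]; linarith
  have k0 := key η μ hη h 0
  have k1 := key η μ hη h 1
  have k2 := key η μ hη h 2
  have l0 := key (-η) (-μ) hη' h' 0
  have l1 := key (-η) (-μ) hη' h' 1
  have l2 := key (-η) (-μ) hη' h' 2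
  simp only [Pi.neg_apply, Fin.isValue, Fin.reduceAdd] at k0 k1 k2 l0 l1 l2
  have : η 0 = 0 ∧ η 1 = 0 ∧ η 2 = 0 := by
    rcases lt_trichotomy (η 0) 0 with a | a | a <;> rcases lt_trichotomy (η 1) 0 with b | b | b <;>
      rcases lt_trichotomy (η 2) 0 with c | c | c <;>
      first
      | exact ⟨a, b, c⟩
      | (exfalso; linarith)
      | (exfalso; apply k0 <;> linarith)
      | (exfalso; apply k1 <;> linarith)
      | (exfalso; apply k2 <;> linarith)
      | (exfalso; apply l0 <;> linarith)
      | (exfalso; apply l1 <;> linarith)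
      | (exfalso; apply l2 <;> linarith)
  funext k
  rcases fin_three_cases k with rfl | rfl | rfl
  exacts [this.1, this.2.1, this.2.2]

/-- The algebraic form of nondegeneracy in the centre; `V`, `ν V`, `χ`, `-ψ` stand for the weights
and their derivatives, `x`, `η` for the point and the direction. -/
lemma center_alg {x η V ν χ ψ : Fin 3 → ℝ} {μ : ℝ} (hx : ∀ k, 0 ≤ x k)
    (hx2 : ∀ k, 0 < x (k + 1) + x (k + 2))
    (hV : ∀ k, 0 < V k) (hν : ∀ k, 0 ≤ ν k) (hχ : ∀ k, 0 ≤ χ k) (hψ : ∀ k, 0 ≤ ψ k)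
    (hs : ∀ k, 0 < ν k ∨ χ k = 1) (hχ2 : ∀ k, 0 < χ (k + 1) + χ (k + 2))
    (h0 : ∀ k, x k = 0 → χ k = 1 ∧ 0 < ν (k + 1) + ν (k + 2))
    (hη : η 0 + η 1 + η 2 = 0)
    (h : ∀ k, ν k * η k * V k * x k * (χ (k + 2) * x (k + 1) + χ (k + 1) * x (k + 2))
      + V k * η k * (χ (k + 2) * x (k + 1) + χ (k + 1) * x (k + 2))
      + V k * x k * (-ψ (k + 2) * η (k + 2) * x (k + 1) + χ (k + 2) * η (k + 1)
        + (-ψ (k + 1) * η (k + 1) * x (k + 2) + χ (k + 1) * η (k + 2)))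
      = μ * (V k * x k * (χ (k + 2) * x (k + 1) + χ (k + 1) * x (k + 2)))) : η = 0 := by
  -- On a side of the hexagon division by `x k` is impossible. There equation `k` reduces to `η k =
  -- 0`, and the difference of the two other equations, with `η (k + 2) = -η (k + 1)`, gives the
  -- rest.
  by_cases hz : ∃ k, x k = 0
  · obtain ⟨k, hk⟩ := hz
    obtain ⟨hχk, hνk⟩ := h0 k hk
    have i1 : k + 1 + 1 = k + 2 := add_one_one k
    have i2 : k + 1 + 2 = k := add_one_two k
    have i3 : k + 2 + 1 = k := add_two_one k
    have i4 : k + 2 + 2 = k + 1 := add_two_two k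
    have a1 : 0 < x (k + 1) := by have := hx2 (k + 2); rw [i3, i4, hk] at this; linarith
    have a2 : 0 < x (k + 2) := by have := hx2 (k + 1); rw [i1, i2, hk] at this; linarith
    have e0 := h k
    have e1 := h (k + 1)
    have e2 := h (k + 2)
    rw [i1, i2] at e1
    rw [i3, i4] at e2
    rw [hk] at e0 e1 e2
    rw [hχk] at e1 e2
    have hηk : η k = 0 := by
      have hS : 0 < χ (k + 2) * x (k + 1) + χ (k + 1) * x (k + 2) := by
        rcases (hχ (k + 2)).eq_or_lt with h5 | h5
        · have := hχ2 k
          rw [← h5] at this ⊢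
          have : 0 < χ (k + 1) := by linarith
          have := mul_pos this a2
          linarith
        · have := mul_pos h5 a1
          have := mul_nonneg (hχ (k + 1)) a2.le
          linarith
      have : V k * η k * (χ (k + 2) * x (k + 1) + χ (k + 1) * x (k + 2)) = 0 := by linarith
      have hVk := (hV k).ne'
      simpa [hVk, hS.ne'] using this
    rw [hηk] at e1 e2
    have hsum : η (k + 2) = -η (k + 1) := by
      have : η k + η (k + 1) + η (k + 2) = 0 := by
        rcases fin_three_cases k with rfl | rfl | rfl <;>
          simp only [Fin.isValue, Fin.reduceAdd, zero_add] <;> linarith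
      linarith
    rw [hsum] at e1 e2
    have v1 := (hV (k + 1)).ne'
    have v2 := (hV (k + 2)).ne'
    have f1 : V (k + 1) * (ν (k + 1) * η (k + 1) * x (k + 1) * x (k + 2)
        + η (k + 1) * x (k + 2) - x (k + 1) * η (k + 1) - μ * x (k + 1) * x (k + 2)) = 0 := by
      linarith
    have f2 : V (k + 2) * (-ν (k + 2) * η (k + 1) * x (k + 1) * x (k + 2)
        - η (k + 1) * x (k + 1) + x (k + 2) * η (k + 1) - μ * x (k + 1) * x (k + 2)) = 0 := by
      linarith
    have g1 := (mul_eq_zero.1 f1).resolve_left v1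
    have g2 := (mul_eq_zero.1 f2).resolve_left v2
    have g3 : (ν (k + 1) + ν (k + 2)) * (x (k + 1) * x (k + 2)) * η (k + 1) = 0 := by linarith
    have hη1 : η (k + 1) = 0 := by
      refine (mul_eq_zero.1 g3).resolve_left ?_
      positivity
    funext j
    rcases eq_or_eq_add j k with rfl | rfl | rfl
    · exact hηk
    · exact hη1
    · rw [hsum, hη1]; simp
  · push Not at hz
    have hx' : ∀ k, 0 < x k := fun k => lt_of_le_of_ne (hx k) (hz k).symm
    have hb : ∀ k, 0 ≤ χ k / x k := fun k => div_nonneg (hχ k) (hx k)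
    -- Division of the `k`-th coefficient by `V k * x 0 * x 1 * x 2` leaves `b (k + 1) + b (k + 2)`
    -- with `b = χ / x`, and `-β` is the derivative of `b`. The removed factor `x 0 * x 1 * x 2`
    -- shifts `μ` by its logarithmic derivative.
    refine center_core (b := fun k => χ k / x k) (β := fun k => ψ k / x k + χ k / x k ^ 2)
      (ν := ν) (μ := μ - (η 0 / x 0 + η 1 / x 1 + η 2 / x 2)) hb
      (fun k => by have := hψ k; have := hχ k; have := hx' k; positivity) hν ?_ ?_ hη ?_
    · intro k
      rcases (hχ (k + 2)).eq_or_lt with h5 | h5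
      · have := hχ2 k
        have : 0 < χ (k + 1) := by linarith
        have := div_pos this (hx' (k + 1))
        linarith [hb (k + 2)]
      · have := div_pos h5 (hx' (k + 2))
        linarith [hb (k + 1)]
    · intro k
      refine (hs k).imp_right fun h1 => ?_
      rw [h1]
      have := hψ k; have := hx' k
      positivity
    · intro k
      have e := h k
      have hsum : η 0 / x 0 + η 1 / x 1 + η 2 / x 2
          = η k / x k + η (k + 1) / x (k + 1) + η (k + 2) / x (k + 2) := by
        rcases fin_three_cases k with rfl | rfl | rfl <;>
          simp only [Fin.isValue, Fin.reduceAdd, zero_add] <;> ring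
      rw [hsum]
      have n0 := (hx' k).ne'
      have n1 := (hx' (k + 1)).ne'
      have n2 := (hx' (k + 2)).ne'
      have nV := (hV k).ne'
      have e' := congrArg (fun t => t / (V k * (x k * x (k + 1) * x (k + 2)))) e
      rw [← sub_eq_zero] at e' ⊢
      rw [← e']
      field_simp
      ring

lemma hasDerivAt_ratio (k : Fin 3) {x : Fin 3 → ℝ} (hx : 0 < x (k + 1) + x (k + 2))
    (hs : x 0 + x 1 + x 2 = 1) {η : Fin 3 → ℝ} (hη : η 0 + η 1 + η 2 = 0) :
    HasDerivAt (fun t : ℝ => ratio k (x + t • η)) (η k / (x (k + 1) + x (k + 2)) ^ 2) 0 := by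
  have h1 : ∀ j, HasDerivAt (fun t : ℝ => (x + t • η) j) (η j) 0 := fun j => by
    simpa using ((hasDerivAt_id (0 : ℝ)).mul_const (η j)).const_add (x j)
  have h2 := (h1 k).fun_div ((h1 (k + 1)).fun_add (h1 (k + 2))) (by simpa using hx.ne')
  refine h2.congr_deriv ?_
  simp only [zero_smul, add_zero]
  congr 1
  have e1 : x k + x (k + 1) + x (k + 2) = 1 := by
    rcases fin_three_cases k with rfl | rfl | rfl <;>
      simp only [Fin.isValue, Fin.reduceAdd, zero_add] <;> linarith
  have e2 : η k + η (k + 1) + η (k + 2) = 0 := by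
    rcases fin_three_cases k with rfl | rfl | rfl <;>
      simp only [Fin.isValue, Fin.reduceAdd, zero_add] <;> linarith
  linear_combination (-x k) * e2 + η k * e1

/-- The coefficients of the limit surface. -/
def limitCoef (k : Fin 3) (x : Fin 3 → ℝ) : ℝ :=
  Real.exp (2 * glide (ratio k x)) * x k
    * (cut (ratio (k + 2) x) * x (k + 1) + cut (ratio (k + 1) x) * x (k + 2))

/-- The common factor of the coefficients of the limit surface. -/
def limitFactor (x : Fin 3 → ℝ) : ℝ :=
  Real.exp (-(glide (ratio 0 x) + glide (ratio 1 x) + glide (ratio 2 x)))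

/-- The factor `exp (-glide)` in `weight` is chosen for this: it completes the exponents to the
symmetric sum of the three glides, which factors out, and the coefficient of `e k` retains only the
exponential of `2 * glide (ratio k x)`. -/
lemma surf_limit (e : Fin 3 → Herm) (x : Fin 3 → ℝ) :
    surf (fun _ _ => glide) (fun j => e (j + 1), fun j => e (j + 2)) x
      = ∑ k, (limitFactor x * limitCoef k x) • e k := by
  have h1 : ∀ a b c q d : ℝ, q * Real.exp (-a) * d * Real.exp (b - c)
      = Real.exp (-(a + b + c)) * (Real.exp (2 * b) * (q * d)) := fun a b c q d => by
    rw [show b - c = a + (-(a + b + c) + 2 * b) by ring, Real.exp_add, Real.exp_add,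
      Real.exp_neg a]
    field_simp
  have h2 : ∀ a b c q d : ℝ, q * Real.exp (-a) * d * Real.exp (-(b - c))
      = Real.exp (-(a + b + c)) * (Real.exp (2 * c) * (q * d)) := fun a b c q d => by
    rw [neg_sub, h1 a c b q d]; ring_nf
  simp only [surf, weight, position, limitCoef, limitFactor, Fin.sum_univ_three, Fin.isValue,
    Fin.reduceAdd, zero_add]
  generalize glide (ratio 0 x) = g0
  generalize glide (ratio 1 x) = g1
  generalize glide (ratio 2 x) = g2
  simp only [h1, h2]
  have e1 : -(g1 + g2 + g0) = -(g0 + g1 + g2) := by ring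
  have e2 : -(g2 + g0 + g1) = -(g0 + g1 + g2) := by ring
  rw [e1, e2]
  module

/-- Independence of the `e k` separates the coefficients. In the slice of coordinate sum 1 the
derivative of each ratio involves only the corresponding `η k`, so `center_alg` applies to
directions tangent to the slice. Euler's relation takes care of the radial direction. -/
lemma injective_fderiv_limit {e : Fin 3 → Herm} (he : LinearIndependent ℝ e) {x : Fin 3 → ℝ}
    (hx : x ∈ centre) :
    Function.Injective
      (fderiv ℝ (surf (fun _ _ => glide) (fun j => e (j + 1), fun j => e (j + 2))) x) := by
  obtain ⟨hx0, hxs, hxc⟩ := hx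
  have hx2 : ∀ k, 0 < x (k + 1) + x (k + 2) := by
    intro k
    have h1 := hxc k
    have h2 : x k + x (k + 1) + x (k + 2) = 1 := by
      rcases fin_three_cases k with rfl | rfl | rfl <;>
        simp only [Fin.isValue, Fin.reduceAdd, zero_add] <;> linarith
    linarith
  set c : (Fin 3 → Herm) × (Fin 3 → Herm) := (fun j => e (j + 1), fun j => e (j + 2)) with hc
  have hφ : ∀ k j : Fin 3, ContDiff ℝ ∞ ((fun _ _ => glide : Fin 3 → Fin 3 → ℝ → ℝ) k j) :=
    fun _ _ => contDiff_glide
  have hself := fderiv_surf_self hφ c (fun k => (hx2 k).ne')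
  have hdiff := ((contDiffAt_surf hφ c (fun k => (hx2 k).ne')).differentiableAt
    (by simp)).hasFDerivAt
  set L := fderiv ℝ (surf (fun _ _ => glide) c) x with hL
  have key : ∀ (η : Fin 3 → ℝ) (μ : ℝ), η 0 + η 1 + η 2 = 0 →
      L η = μ • surf (fun _ _ => glide) c x → η = 0 := by
    intro η μ hη hμ
    choose κ hκ0 hκ using fun k => exists_deriv_cut (ratio k x)
    choose γ hγ0 hγ1 hγ using fun k => exists_deriv_glide (ratio k x)
    set ℓ : ℝ → Fin 3 → ℝ := fun t => x + t • η with hℓ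
    have hℓ0 : ℓ 0 = x := by simp [hℓ]
    have hℓd : HasDerivAt ℓ η 0 := by
      simpa only [one_smul, id_eq] using ((hasDerivAt_id (0 : ℝ)).smul_const η).const_add x
    have hℓj : ∀ j, HasDerivAt (fun t => ℓ t j) (η j) 0 := fun j => by
      change HasDerivAt (fun t => x j + t * η j) (η j) 0
      simpa only [one_mul, id_eq] using
        ((hasDerivAt_id (0 : ℝ)).mul_const (η j)).const_add (x j)
    have hr : ∀ k, HasDerivAt (fun t => ratio k (ℓ t)) (η k / (x (k + 1) + x (k + 2)) ^ 2) 0 :=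
      fun k => hasDerivAt_ratio k (hx2 k) hxs hη
    have hgl : ∀ k, HasDerivAt (fun t => glide (ratio k (ℓ t)))
        (γ k * (η k / (x (k + 1) + x (k + 2)) ^ 2)) 0 := fun k => by
      have h := hγ k
      rw [← hℓ0] at h
      exact HasDerivAt.comp (h₂ := glide) (0 : ℝ) h (hr k)
    have hct : ∀ k, HasDerivAt (fun t => cut (ratio k (ℓ t)))
        (-κ k * (η k / (x (k + 1) + x (k + 2)) ^ 2)) 0 := fun k => by
      have h := hκ k
      rw [← hℓ0] at h
      exact HasDerivAt.comp (h₂ := cut) (0 : ℝ) h (hr k)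
    have hZ := fun k => (((hgl k).const_mul 2).exp.fun_mul (hℓj k)).fun_mul
      (((hct (k + 2)).fun_mul (hℓj (k + 1))).fun_add ((hct (k + 1)).fun_mul (hℓj (k + 2))))
    have hF : HasDerivAt (fun t => limitFactor (ℓ t)) (limitFactor x * -(
        γ 0 * (η 0 / (x (0 + 1) + x (0 + 2)) ^ 2) + γ 1 * (η 1 / (x (1 + 1) + x (1 + 2)) ^ 2)
          + γ 2 * (η 2 / (x (2 + 1) + x (2 + 2)) ^ 2))) 0 := by
      have h := (((hgl 0).fun_add (hgl 1)).fun_add (hgl 2)).fun_neg.exp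
      simp only [hℓ0] at h
      exact h
    have hY := HasDerivAt.fun_sum (u := Finset.univ) fun (k : Fin 3) _ =>
      (hF.fun_mul (hZ k)).smul_const (e k)
    have hcomp : HasDerivAt (fun t => surf (fun _ _ => glide) c (ℓ t)) (L η) 0 := by
      rw [← hℓ0] at hdiff
      exact hdiff.comp_hasDerivAt (0 : ℝ) hℓd
    have hcomp' : HasDerivAt (fun t => ∑ k, (limitFactor (ℓ t) * limitCoef k (ℓ t)) • e k)
        (L η) 0 := by
      simpa only [hc, surf_limit] using hcomp
    have hd := hcomp'.unique hY
    rw [hμ, hc, surf_limit, Finset.smul_sum, ← sub_eq_zero, ← Finset.sum_sub_distrib] at hd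
    simp only [smul_smul, ← sub_smul] at hd
    have hd2 := Fintype.linearIndependent_iff.1 he _ hd
    have hF0 : limitFactor x ≠ 0 := (Real.exp_pos _).ne'
    refine center_alg (x := x) (η := η) (V := fun k => Real.exp (2 * glide (ratio k x)))
      (ν := fun k => 2 * γ k / (x (k + 1) + x (k + 2)) ^ 2) (χ := fun k => cut (ratio k x))
      (ψ := fun k => κ k / (x (k + 1) + x (k + 2)) ^ 2)
      (μ := μ - (-(γ 0 * (η 0 / (x (0 + 1) + x (0 + 2)) ^ 2)
        + γ 1 * (η 1 / (x (1 + 1) + x (1 + 2)) ^ 2)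
        + γ 2 * (η 2 / (x (2 + 1) + x (2 + 2)) ^ 2)))) hx0 hx2 (fun k => Real.exp_pos _)
      (fun k => by have := hγ0 k; have := hx2 k; positivity) (fun k => cut_nonneg _)
      (fun k => by have := hκ0 k; have := hx2 k; positivity) ?_ ?_ ?_ hη ?_
    · intro k
      rcases le_or_gt (ratio k x) (3 / 4) with h | h
      · exact Or.inr (cut_eq_one (by linarith))
      · have := hγ1 k h
        have := hx2 k
        left; positivity
    · intro k
      by_cases h : ratio (k + 1) x ≤ 1
      · have := cut_nonneg (ratio (k + 2) x)
        rw [cut_eq_one h]; linarith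
      · have h3 : ratio (k + 2) x ≤ 1 := by
          push Not at h
          have a1 := hx2 (k + 1)
          have a2 := hx2 (k + 2)
          unfold ratio at h ⊢
          rw [lt_div_iff₀ a1] at h
          rw [div_le_iff₀ a2]
          rw [add_one_one, add_one_two] at h
          rw [add_two_one, add_two_two]
          have := hx0 k
          linarith
        have := cut_nonneg (ratio (k + 1) x)
        rw [cut_eq_one h3]; linarith
    · intro k hk
      have hr0 : ratio k x = 0 := by simp [ratio, hk]
      refine ⟨cut_eq_one (by rw [hr0]; norm_num), ?_⟩
      have a1 := hx2 (k + 1)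
      have a2 := hx2 (k + 2)
      have n1 := hγ0 (k + 1)
      have n2 := hγ0 (k + 2)
      -- With `x k = 0` the two other ratios are inverse to each other, so one of them exceeds 3/4.
      have : 3 / 4 < ratio (k + 1) x ∨ 3 / 4 < ratio (k + 2) x := by
        by_contra! h
        obtain ⟨h1, h2⟩ := h
        unfold ratio at h1 h2
        rw [div_le_iff₀ a1] at h1
        rw [div_le_iff₀ a2] at h2
        rw [add_one_one, add_one_two, hk] at h1
        rw [add_two_one, add_two_two, hk] at h2
        have := hx2 k
        linarith
      rcases this with h | h
      · have := hγ1 _ h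
        positivity
      · have := hγ1 _ h
        positivity
    · intro k
      have e1 := hd2 k
      simp only [hℓ0, limitCoef] at e1
      refine mul_left_cancel₀ hF0 ?_
      linear_combination (-1) * e1
  rw [injective_iff_map_eq_zero]
  intro ξ hξ
  -- Split `ξ` into the radial part `μ • x` and a part of coordinate sum zero.
  set μ := ξ 0 + ξ 1 + ξ 2 with hμ
  have h1 := key (ξ - μ • x) (-(2 * μ)) (by
      simp only [Pi.sub_apply, Pi.smul_apply, smul_eq_mul]
      linear_combination hμ - μ * hxs) (by
      rw [map_sub, map_smul, hself, hξ, zero_sub, smul_smul, neg_smul, mul_comm])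
  have h2 : ξ = μ • x := sub_eq_zero.1 h1
  rw [h2, map_smul, hself, surf_limit, smul_smul, Finset.smul_sum] at hξ
  simp only [smul_smul] at hξ
  have h3 := Fintype.linearIndependent_iff.1 he _ hξ
  -- At the largest coordinate the limit coefficient is positive, because the two other ratios are
  -- at most 1. So the limit surface does not vanish and the radial part is zero.
  obtain ⟨k, hk1, hk2⟩ : ∃ k, x (k + 1) ≤ x k ∧ x (k + 2) ≤ x k := by
    rcases le_total (x 0) (x 1) with a | a <;> rcases le_total (x 1) (x 2) with b | b <;>
      rcases le_total (x 0) (x 2) with d | d <;>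
      first
      | exact ⟨0, a, d⟩
      | exact ⟨1, b, a⟩
      | exact ⟨2, d, b⟩
      | exact ⟨2, a.trans b, b⟩
      | exact ⟨0, a, b.trans a⟩
  have hk3 := hx2 k
  have hk0 : 0 < x k := by linarith
  have c1 : cut (ratio (k + 1) x) = 1 := by
    refine cut_eq_one ?_
    unfold ratio
    rw [div_le_one (hx2 _), add_one_one, add_one_two]
    linarith [hx0 (k + 2)]
  have c2 : cut (ratio (k + 2) x) = 1 := by
    refine cut_eq_one ?_
    unfold ratio
    rw [div_le_one (hx2 _), add_two_one, add_two_two]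
    linarith [hx0 (k + 1)]
  have h4 : 0 < limitFactor x * limitCoef k x := by
    unfold limitFactor limitCoef
    rw [c1, c2, one_mul, one_mul]
    positivity
  have h5 : μ = 0 := by
    have := h3 k
    simpa [h4.ne'] using this
  rw [h2, h5, zero_smul]

lemma contDiffAt_fderiv_surf {φ : Fin 3 → Fin 3 → ℝ → ℝ} (hφ : ∀ i j, ContDiff ℝ ∞ (φ i j))
    (c : (Fin 3 → Herm) × (Fin 3 → Herm)) {x : Fin 3 → ℝ} (hx : ∀ k, x (k + 1) + x (k + 2) ≠ 0) :
    ContDiffAt ℝ ∞ (fun z : ((Fin 3 → Herm) × (Fin 3 → Herm)) × (Fin 3 → ℝ) =>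
      fderiv ℝ (surf φ z.1) z.2) (c, x) := by
  have h1 := contDiffAt_surf_prod hφ c hx
  generalize surf φ = s at h1 ⊢
  have h3 : ContDiffAt ℝ ∞ (fun w : (((Fin 3 → Herm) × (Fin 3 → Herm)) × (Fin 3 → ℝ))
      × (Fin 3 → ℝ) => (w.1.1, w.2)) ((c, x), x) := by fun_prop
  have h4 : ContDiffAt ℝ ∞ (Function.uncurry
      fun z : ((Fin 3 → Herm) × (Fin 3 → Herm)) × (Fin 3 → ℝ) => s z.1) ((c, x), x) :=
    ContDiffAt.comp (g := fun q : ((Fin 3 → Herm) × (Fin 3 → Herm)) × (Fin 3 → ℝ) => s q.1 q.2)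
      ((c, x), x) h1 h3
  exact ContDiffAt.fderiv (x₀ := (c, x)) (g := Prod.snd) h4 contDiffAt_snd (by simp)

/-- Nondegeneracy over the centre persists under perturbation of the ideal endpoints. -/
lemma eventually_injective_fderiv {e : Fin 3 → Herm} (he : LinearIndependent ℝ e) :
    ∀ᶠ c in nhds ((fun j => e (j + 1), fun j => e (j + 2)) : (Fin 3 → Herm) × (Fin 3 → Herm)),
      ∀ x ∈ centre, Function.Injective (fderiv ℝ (surf (fun _ _ => glide) c) x) := by
  refine isCompact_centre.eventually_forall_of_forall_eventually fun x hx => ?_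
  have hx2 : ∀ k, x (k + 1) + x (k + 2) ≠ 0 := by
    obtain ⟨-, hxs, hxc⟩ := hx
    intro k
    have h1 := hxc k
    have h2 : x k + x (k + 1) + x (k + 2) = 1 := by
      rcases fin_three_cases k with rfl | rfl | rfl <;>
        simp only [Fin.isValue, Fin.reduceAdd, zero_add] <;> linarith
    have : 0 < x (k + 1) + x (k + 2) := by linarith
    exact this.ne'
  have h0 := injective_fderiv_limit he hx
  generalize ((fun j => e (j + 1), fun j => e (j + 2)) : (Fin 3 → Herm) × (Fin 3 → Herm)) = c0
    at h0 ⊢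
  have h2 := contDiffAt_fderiv_surf (φ := fun _ _ => glide) (fun _ _ => contDiff_glide) c0 hx2
  exact h2.continuousAt.eventually (ContinuousLinearMap.isOpen_injective.mem_nhds h0)

/-! ### The surface near the mirrors -/

lemma Slack.ratio_le {x : Fin 3 → ℝ} (hx : Slack x) {k : Fin 3} (hk : 7 / 5 ≤ ratio k x) :
    ratio (k + 1) x ≤ 3 / 4 ∧ ratio (k + 2) x ≤ 3 / 4 := by
  have h0 := hx k
  have h1 := hx (k + 1)
  have h2 := hx (k + 2)
  unfold ratio at *
  rw [add_one_one, add_one_two] at *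
  rw [add_two_one, add_two_two] at *
  rw [le_div_iff₀ h0.1] at hk
  rw [div_le_iff₀ h1.1, div_le_iff₀ h2.1]
  obtain ⟨a0, b0, c0⟩ := h0
  obtain ⟨a1, b1, c1⟩ := h1
  obtain ⟨a2, b2, c2⟩ := h2
  norm_num at *
  constructor <;> linarith

/-- Near the `k`-th mirror the cutoff removes the `k`-th geodesic, while the two other ratios are at
most 3/4, where `cut` is 1 and `glide` and `φ` vanish. Only two points remain, and their positions
depend on `ratio k x` alone. -/
lemma surf_strip {φ : Fin 3 → Fin 3 → ℝ → ℝ} (hφ : ∀ i j p, p ≤ 3 / 4 → φ i j p = 0)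
    (c : (Fin 3 → Herm) × (Fin 3 → Herm)) {x : Fin 3 → ℝ} (hx : Slack x) {k : Fin 3}
    (hk : 7 / 5 ≤ ratio k x) :
    surf φ c x = x k • (x (k + 2) • (Real.exp (-φ k (k + 1) (ratio k x)) • c.1 (k + 1)
        + Real.exp (φ k (k + 1) (ratio k x)) • c.2 (k + 1))
      + x (k + 1) • (Real.exp (φ k (k + 2) (ratio k x)) • c.1 (k + 2)
        + Real.exp (-φ k (k + 2) (ratio k x)) • c.2 (k + 2))) := by
  obtain ⟨h1, h2⟩ := hx.ratio_le hk
  have hsum : ∀ f : Fin 3 → Herm, ∑ j, f j = f k + f (k + 1) + f (k + 2) := fun f => by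
    rw [Fin.sum_univ_three]
    rcases fin_three_cases k with rfl | rfl | rfl <;>
      simp only [Fin.isValue, Fin.reduceAdd, zero_add] <;> abel
  have w0 : weight k x = 0 := by simp [weight, cut_eq_zero hk]
  have w1 : weight (k + 1) x = x (k + 2) * x k := by
    simp [weight, cut_eq_one (h1.trans (by norm_num)), glide_eq_zero h1, add_one_one, add_one_two]
  have w2 : weight (k + 2) x = x k * x (k + 1) := by
    simp [weight, cut_eq_one (h2.trans (by norm_num)), glide_eq_zero h2, add_two_one, add_two_two]
  have p1 : position φ (k + 1) x = -φ k (k + 1) (ratio k x) := by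
    simp [position, add_one_one, add_one_two, hφ _ _ _ h2]
  have p2 : position φ (k + 2) x = φ k (k + 2) (ratio k x) := by
    simp [position, add_two_one, add_two_two, hφ _ _ _ h1]
  rw [surf, hsum, w0, w1, w2, p1, p2, neg_neg]
  module

lemma ratio_refl {k : Fin 3} {x : Fin 3 → ℝ} (h : x (k + 1) + x (k + 2) ≠ 0) :
    ratio k (refl k x) = 4 - ratio k x := by
  simp only [ratio, refl_self, refl_add_one, refl_add_two]
  field_simp

/-- The mirror is at ratio 2 and the reflection is `p ↦ 4 - p`; the half-turn acts on positions by
`s ↦ 2 * T - s`. Being affine of slope 1 around 2, `reach` intertwines the two. -/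
lemma reach_reflect (T : ℝ) {p : ℝ} (h1 : 7 / 4 ≤ p) (h2 : p ≤ 9 / 4) :
    reach T (4 - p) = 2 * T - reach T p := by
  rw [reach_of_ge T h1, reach_of_ge T (by linarith)]; ring

lemma reach_eq_zero (T : ℝ) {p : ℝ} (h : p ≤ 3 / 4) : reach T p = 0 := by
  rw [reach_of_le T (by linarith), glide_eq_zero h]

/-- Equivariance of the surface under the reflections. -/
lemma surf_refl {T : Fin 3 → Fin 3 → ℝ} {c : (Fin 3 → Herm) × (Fin 3 → Herm)}
    {H : Fin 3 → SL(2, ℂ)} (hH : ∀ k, H k * H k = -1)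
    (h1 : ∀ k, hact (H k) (c.1 (k + 1)) = Real.exp (2 * T k (k + 1)) • c.2 (k + 1))
    (h2 : ∀ k, hact (H k) (c.2 (k + 2)) = Real.exp (2 * T k (k + 2)) • c.1 (k + 2))
    (k : Fin 3) {x : Fin 3 → ℝ} (hx : Slack x) (hx' : Slack (refl k x)) :
    ∃ a : ℝ, 0 < a ∧ surf (fun k j => reach (T k j)) c (refl k x)
      = a • hact (H k) (surf (fun k j => reach (T k j)) c x) := by
  obtain ⟨s0, s1, s2⟩ := hx k
  obtain ⟨t0, t1, t2⟩ := hx' k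
  simp only [refl_self, refl_add_one, refl_add_two] at t1
  -- That both `x` and its mirror image lie in `Slack` confines the ratio to a small interval around
  -- 2, where `reach` is affine.
  have r1 : 1.95 < ratio k x := by
    unfold ratio; rw [lt_div_iff₀ s0]; linarith
  have r2 : ratio k x < 2.05 := by
    unfold ratio; rwa [div_lt_iff₀ s0]
  have r3 := ratio_refl s0.ne'
  norm_num at r1 r2
  have h1' : ∀ k, hact (H k) (c.2 (k + 1)) = Real.exp (-(2 * T k (k + 1))) • c.1 (k + 1) := by
    intro k
    have := congrArg (hact (H k)) (h1 k)
    rw [hact_half_turn (hH k), hact_smul] at this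
    rw [this, smul_smul, ← Real.exp_add]; simp
  have h2' : ∀ k, hact (H k) (c.1 (k + 2)) = Real.exp (-(2 * T k (k + 2))) • c.2 (k + 2) := by
    intro k
    have := congrArg (hact (H k)) (h2 k)
    rw [hact_half_turn (hH k), hact_smul] at this
    rw [this, smul_smul, ← Real.exp_add]; simp
  have hφ : ∀ i j p, p ≤ 3 / 4 → (fun k j => reach (T k j)) i j p = 0 :=
    fun i j p hp => reach_eq_zero _ hp
  have hxk : 0 < x k := by
    have : 1.95 * (x (k + 1) + x (k + 2)) < x k := by norm_num at t1 ⊢; linarith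
    have : 0 < 1.95 * (x (k + 1) + x (k + 2)) := by positivity
    linarith
  have hxk' : 0 < 4 * (x (k + 1) + x (k + 2)) - x k := by
    norm_num at s1; linarith
  refine ⟨refl k x k / x k, by rw [refl_self]; positivity, ?_⟩
  rw [surf_strip hφ c hx' (k := k) (by rw [r3]; linarith),
    surf_strip hφ c hx (k := k) (by linarith)]
  simp only [refl_add_one, refl_add_two, r3]
  rw [reach_reflect _ (by linarith) (by linarith), reach_reflect _ (by linarith) (by linarith)]
  simp only [hact_smul, hact_add, h1, h2, h1', h2', smul_smul, smul_add]
  set f := reach (T k (k + 1)) (ratio k x)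
  set g := reach (T k (k + 2)) (ratio k x)
  have e1 : Real.exp (-(2 * T k (k + 1) - f)) = Real.exp f * Real.exp (-(2 * T k (k + 1))) := by
    rw [← Real.exp_add]; ring_nf
  have e2 : Real.exp (2 * T k (k + 1) - f) = Real.exp (-f) * Real.exp (2 * T k (k + 1)) := by
    rw [← Real.exp_add]; ring_nf
  have e3 : Real.exp (-(2 * T k (k + 2) - g)) = Real.exp g * Real.exp (-(2 * T k (k + 2))) := by
    rw [← Real.exp_add]; ring_nf
  have e4 : Real.exp (2 * T k (k + 2) - g) = Real.exp (-g) * Real.exp (2 * T k (k + 2)) := by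
    rw [← Real.exp_add]; ring_nf
  rw [e1, e2, e3, e4]
  have e5 : ∀ b : ℝ, refl k x k / x k * (x k * b) = refl k x k * b := fun b => by
    field_simp
  simp only [mul_assoc, e5]
  module

/-- Independence of the points and of the combined velocity of two points moving in the same
direction on two geodesics. -/
def StripIndep (p q p' q' : Herm) : Prop :=
  ∀ s w s' w' u v a b d : ℝ, 0 < s → 0 < w → 0 < s' → 0 < w' → 0 ≤ u → 0 ≤ v → 0 < u + v →
    a • (s • p + w • q) + b • (s' • p' + w' • q')
      + d • (u • (-s • p + w • q) + v • (s' • p' - w' • q')) = 0 → a = 0 ∧ b = 0 ∧ d = 0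

/-- The three directions in the strip are the scalings of the two points and the motion of `ratio
k`. The latter slides the points with speeds proportional to `x (k + 2) * d1` and `x (k + 1) * d2`,
nonnegative and not both zero, which is the situation of `StripIndep`. -/
lemma injective_fderiv_strip {φ : Fin 3 → Fin 3 → ℝ → ℝ} (hφ0 : ∀ i j p, p ≤ 3 / 4 → φ i j p = 0)
    (hφ : ∀ k j, ContDiff ℝ ∞ (φ k j)) {c : (Fin 3 → Herm) × (Fin 3 → Herm)} {k : Fin 3}
    (hc : StripIndep (c.1 (k + 1)) (c.2 (k + 1)) (c.1 (k + 2)) (c.2 (k + 2)))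
    {x : Fin 3 → ℝ} (hx : Slack x) (hx0 : ∀ j, 0 ≤ x j) (hk : 7 / 5 < ratio k x)
    (hφ1 : ∀ j, ∃ d, 0 < d ∧ HasDerivAt (φ k j) d (ratio k x)) :
    Function.Injective (fderiv ℝ (surf φ c) x) := by
  have hx2 := fun k => (hx k).1
  rw [injective_iff_map_eq_zero]
  intro ξ hξ
  obtain ⟨d1, hd1, hf1⟩ := hφ1 (k + 1)
  obtain ⟨d2, hd2, hf2⟩ := hφ1 (k + 2)
  have hdiff := ((contDiffAt_surf hφ c (fun k => (hx2 k).ne')).differentiableAt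
    (by simp)).hasFDerivAt
  set ℓ : ℝ → Fin 3 → ℝ := fun t => x + t • ξ with hℓ
  have hℓ0 : ℓ 0 = x := by simp [hℓ]
  have hℓd : HasDerivAt ℓ ξ 0 := by
    simpa only [one_smul, id_eq] using ((hasDerivAt_id (0 : ℝ)).smul_const ξ).const_add x
  have hℓj : ∀ j, HasDerivAt (fun t => ℓ t j) (ξ j) 0 := fun j => by
    change HasDerivAt (fun t => x j + t * ξ j) (ξ j) 0
    simpa only [one_mul, id_eq] using
      ((hasDerivAt_id (0 : ℝ)).mul_const (ξ j)).const_add (x j)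
  have hr : HasDerivAt (fun t => ratio k (ℓ t))
      ((ξ k * (x (k + 1) + x (k + 2)) - x k * (ξ (k + 1) + ξ (k + 2)))
        / (x (k + 1) + x (k + 2)) ^ 2) 0 := by
    have := (hℓj k).fun_div ((hℓj (k + 1)).fun_add (hℓj (k + 2))) (by rw [hℓ0]; exact (hx2 k).ne')
    simp only [hℓ0] at this
    exact this
  set D := (ξ k * (x (k + 1) + x (k + 2)) - x k * (ξ (k + 1) + ξ (k + 2)))
        / (x (k + 1) + x (k + 2)) ^ 2 with hD
  have hg1 : HasDerivAt (fun t => φ k (k + 1) (ratio k (ℓ t))) (d1 * D) 0 := by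
    rw [← hℓ0] at hf1
    exact HasDerivAt.comp (h₂ := φ k (k + 1)) (0 : ℝ) hf1 hr
  have hg2 : HasDerivAt (fun t => φ k (k + 2) (ratio k (ℓ t))) (d2 * D) 0 := by
    rw [← hℓ0] at hf2
    exact HasDerivAt.comp (h₂ := φ k (k + 2)) (0 : ℝ) hf2 hr
  have hG := (hℓj k).fun_smul (((hℓj (k + 2)).fun_smul
      ((hg1.fun_neg.exp.smul_const (c.1 (k + 1))).fun_add (hg1.exp.smul_const (c.2 (k + 1))))).fun_add
    ((hℓj (k + 1)).fun_smul
      ((hg2.exp.smul_const (c.1 (k + 2))).fun_add (hg2.fun_neg.exp.smul_const (c.2 (k + 2))))))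
  have hcomp : HasDerivAt (fun t => surf φ c (ℓ t)) 0 0 := by
    rw [← hℓ0] at hdiff
    have := hdiff.comp_hasDerivAt (0 : ℝ) hℓd
    rwa [hℓ0, hξ] at this
  have hslack : ∀ᶠ t in nhds (0 : ℝ), Slack (ℓ t) := by
    have hc : ∀ j, ContinuousAt (fun t => ℓ t j) 0 := fun j => (hℓj j).continuousAt
    have h0 : ∀ j, ℓ 0 j = x j := fun j => by rw [hℓ0]
    refine Filter.eventually_all.2 fun j => ?_
    have e0 := hx j
    simp only [← h0] at e0
    refine ((continuousAt_const.eventually_lt ((hc _).add (hc _)) e0.1).and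
      (((hc j).eventually_lt (continuousAt_const.mul ((hc _).add (hc _))) e0.2.1).and
      ((continuousAt_const.mul ((hc _).add (hc _))).eventually_lt (hc j) e0.2.2)))
  have hrk : ∀ᶠ t in nhds (0 : ℝ), 7 / 5 < ratio k (ℓ t) := by
    refine continuousAt_const.eventually_lt hr.continuousAt ?_
    simpa only [hℓ0] using hk
  have huniq := (hcomp.congr_of_eventuallyEq
    (by filter_upwards [hslack, hrk] with t h1 h2 using
      (surf_strip hφ0 c h1 h2.le).symm)).unique hG
  simp only [hℓ0] at huniq
  set e1 := Real.exp (φ k (k + 1) (ratio k x)) with he1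
  set e2 := Real.exp (-φ k (k + 1) (ratio k x)) with he2
  set e3 := Real.exp (φ k (k + 2) (ratio k x)) with he3
  set e4 := Real.exp (-φ k (k + 2) (ratio k x)) with he4
  have hxk : 0 < x k := by
    unfold ratio at hk
    rw [lt_div_iff₀ (hx2 k)] at hk
    have := hx2 k
    linarith
  have hpos := hx2 k
  have key := hc e2 e1 e3 e4 (x (k + 2) * d1) (x (k + 1) * d2)
    (ξ k * x (k + 2) + x k * ξ (k + 2)) (ξ k * x (k + 1) + x k * ξ (k + 1)) (x k * D)
    (Real.exp_pos _) (Real.exp_pos _) (Real.exp_pos _) (Real.exp_pos _)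
    (mul_nonneg (hx0 _) hd1.le) (mul_nonneg (hx0 _) hd2.le) (by
      rcases (hx0 (k + 2)).eq_or_lt with h | h
      · have : 0 < x (k + 1) := by linarith
        have := mul_pos this hd2
        rw [← h]; linarith
      · have := mul_pos h hd1
        have := mul_nonneg (hx0 (k + 1)) hd2.le
        linarith) (by
      rw [huniq]; module)
  obtain ⟨ka, kb, kd⟩ := key
  have hD0 : D = 0 := by simpa [hxk.ne'] using kd
  rw [hD, div_eq_zero_iff] at hD0
  have hD1 := hD0.resolve_right (by positivity)
  have h0 : ξ k = 0 := by
    have : ξ k * (x (k + 1) + x (k + 2)) = 0 := by linarith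
    simpa [hpos.ne'] using this
  have h1 : ξ (k + 1) = 0 := by simpa [h0, hxk.ne'] using kb
  have h2 : ξ (k + 2) = 0 := by simpa [h0, hxk.ne'] using ka
  funext j
  rcases eq_or_eq_add j k with rfl | rfl | rfl
  exacts [h0, h1, h2]

/-- Three real coordinates suffice: in them the endpoints of the first geodesic lie on two
coordinate axes, and those of the second are interchanged, up to scale, by the swap of these axes.
-/
lemma stripIndep_frame {α β c : ℝ} (hc : c ≠ 0) (hαβ : α < β) {p q p' q' : Herm}
    (f : Herm →ₗ[ℝ] ℝ × ℝ × ℝ) {l m l' m' : ℝ} (hl : 0 < l) (hm : 0 < m) (hl' : 0 < l')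
    (hm' : 0 < m') (hp : f p = (l, 0, 0)) (hq : f q = (0, m, 0))
    (hp' : f p' = (l' * α, l' * β, l' * c)) (hq' : f q' = (m' * β, m' * α, m' * c)) :
    StripIndep p q p' q' := by
  intro s w s' w' u v a b d hs hw hs' hw' hu hv huv h
  have h' := congrArg f h
  simp only [map_add, map_sub, map_smul, map_zero, hp, hq, hp', hq', Prod.smul_mk, Prod.mk_add_mk,
    Prod.mk_sub_mk, smul_eq_mul, mul_zero, Prod.mk_eq_zero, add_zero, zero_add] at h'
  obtain ⟨h1, h2, h3⟩ := h'
  set S := s * l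
  set W := w * m
  set S' := s' * l'
  set W' := w' * m'
  have hS : 0 < S := mul_pos hs hl
  have hW : 0 < W := mul_pos hw hm
  have hS' : 0 < S' := mul_pos hs' hl'
  have hW' : 0 < W' := mul_pos hw' hm'
  have g1 : a * S + b * (α * S' + β * W') + d * (-u * S + v * (α * S' - β * W')) = 0 := by
    simp only [S, S', W']; linear_combination h1
  have g2 : a * W + b * (β * S' + α * W') + d * (u * W + v * (β * S' - α * W')) = 0 := by
    simp only [W, S', W']; linear_combination h2
  have g3 : b * (S' + W') + d * v * (S' - W') = 0 := by
    have : c * (b * (S' + W') + d * v * (S' - W')) = 0 := by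
      simp only [S', W']; linear_combination h3
    exact (mul_eq_zero.1 this).resolve_left hc
  -- `W * g1 - S * g2` eliminates `a` and `g3` eliminates `b`. By `α < β` the cofactor of `d` is a
  -- sum of nonnegative terms, not all zero.
  have g4 : d * (2 * v * S' * W' * (β - α) * (W + S) + 2 * u * S * W * (S' + W')) = 0 := by
    linear_combination (-(S' + W')) * (W * g1 - S * g2)
      + (W * (α * S' + β * W') - S * (β * S' + α * W')) * g3
  have hd : d = 0 := by
    refine (mul_eq_zero.1 g4).resolve_right ?_
    have hβ : 0 < β - α := by linarith
    have : 0 < 2 * v * S' * W' * (β - α) * (W + S) + 2 * u * S * W * (S' + W') := by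
      rcases hv.eq_or_lt with h | h
      · have : 0 < u := by linarith
        rw [← h]
        have : 0 < 2 * u * S * W * (S' + W') := by positivity
        linarith
      · have : 0 < 2 * v * S' * W' * (β - α) * (W + S) := by positivity
        have : 0 ≤ 2 * u * S * W * (S' + W') := by positivity
        linarith
    exact this.ne'
  have hb : b = 0 := by
    rw [hd] at g3
    have : b * (S' + W') = 0 := by linarith
    exact (mul_eq_zero.1 this).resolve_right (by positivity)
  refine ⟨?_, hb, hd⟩
  rw [hd, hb] at g1
  have : a * S = 0 := by linarith
  exact (mul_eq_zero.1 this).resolve_right hS.ne'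

/-! ### The hyperbolic pair of pants with half-lengths `log (2 + √3)` -/

/-- The quadratic functions of the upper half-plane, divided by the imaginary part. -/
def qform (α β γ : ℝ) (z : ℂ) : ℝ := (α * Complex.normSq z + β * z.re + γ) / z.im

/-- The functions `qform` are the linear forms of the hyperboloid model, so an isometry acts
linearly on their coefficients. -/
lemma qform_smul (α β γ : ℝ) (g : SL(2, ℝ)) (z : UpperHalfPlane) :
    qform α β γ ((g • z : UpperHalfPlane) : ℂ)
      = qform (α * g 0 0 ^ 2 + β * (g 0 0 * g 1 0) + γ * g 1 0 ^ 2)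
        (2 * α * (g 0 0 * g 0 1) + β * (g 0 0 * g 1 1 + g 0 1 * g 1 0) + 2 * γ * (g 1 0 * g 1 1))
        (α * g 0 1 ^ 2 + β * (g 0 1 * g 1 1) + γ * g 1 1 ^ 2) z := by
  have hdet : g 0 0 * g 1 1 - g 0 1 * g 1 0 = 1 := by
    have := g.det_coe
    rwa [Matrix.det_fin_two] at this
  have hz : z.im ≠ 0 := z.im_pos.ne'
  rw [UpperHalfPlane.specialLinearGroup_apply]
  simp only [Algebra.algebraMap_self, RingHom.id_apply]
  generalize g 0 0 = a at *
  generalize g 0 1 = b at *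
  generalize g 1 0 = c at *
  generalize g 1 1 = d at *
  have hN : Complex.normSq (c * z + d) ≠ 0 := by
    rw [Ne, Complex.normSq_eq_zero]
    intro h
    have h1 := congrArg Complex.im h
    have h2 := congrArg Complex.re h
    simp at h1 h2
    rcases h1 with h1 | h1
    · rw [h1] at h2 hdet
      simp at h2
      rw [h2] at hdet
      simp at hdet
    · exact hz h1
  have him : ((a * z + b) / (c * z + d) : ℂ).im = z.im / Complex.normSq (c * z + d) := by
    rw [Complex.div_im, ← sub_div]
    congr 1
    simp
    linear_combination z.im * hdet
  have hre : ((a * z + b) / (c * z + d) : ℂ).re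
      = (a * c * Complex.normSq z + (a * d + b * c) * z.re + b * d)
        / Complex.normSq (c * z + d) := by
    rw [Complex.div_re, ← add_div]
    congr 1
    simp [Complex.normSq_apply]
    ring
  have hns : Complex.normSq ((a * z + b) / (c * z + d) : ℂ)
      = (a ^ 2 * Complex.normSq z + 2 * a * b * z.re + b ^ 2)
        / Complex.normSq (c * z + d) := by
    rw [Complex.normSq_div]
    congr 1
    simp [Complex.normSq_apply]
    ring
  have hN2 : Complex.normSq (c * z + d) = c ^ 2 * Complex.normSq z + 2 * c * d * z.re + d ^ 2 := by
    simp [Complex.normSq_apply]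
    ring
  unfold qform
  rw [him, hre, hns, UpperHalfPlane.coe_im]
  rw [div_eq_div_iff (div_ne_zero hz hN) hz]
  field_simp
  rw [hN2]
  simp only [UpperHalfPlane.coe_re]
  ring

/-- After division by the imaginary part, `side M` is the trace of `M` times the linear form
attached to its traceless part, hence compatible with conjugation. -/
lemma side_conj (g M : SL(2, ℝ)) (z : UpperHalfPlane) :
    side (g * M * g⁻¹) (g • z) / (g • z).im = side M z / z.im := by
  have key : ∀ (N : SL(2, ℝ)) (z : UpperHalfPlane), side N z / z.im
      = (N 0 0 + N 1 1) * qform (N 1 0) (N 1 1 - N 0 0) (-N 0 1) z := fun N z => by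
    simp only [side, qform, UpperHalfPlane.coe_im]
    ring
  have hdet : g 0 0 * g 1 1 - g 0 1 * g 1 0 = 1 := by
    have := g.det_coe
    rwa [Matrix.det_fin_two] at this
  rw [key, key, qform_smul]
  simp only [Matrix.SpecialLinearGroup.coe_mul, Matrix.SpecialLinearGroup.coe_inv,
    Matrix.adjugate_fin_two, Matrix.mul_apply, Fin.sum_univ_two, Matrix.of_apply,
    Matrix.cons_val_zero, Matrix.cons_val_one, Matrix.cons_val', Matrix.cons_val_fin_one]
  generalize g 0 0 = a at *
  generalize g 0 1 = b at *
  generalize g 1 0 = c at *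
  generalize g 1 1 = d at *
  generalize M 0 0 = m at *
  generalize M 0 1 = n at *
  generalize M 1 0 = p at *
  generalize M 1 1 = q at *
  have e1 : (a * m + b * p) * d + (a * n + b * q) * -c + ((c * m + d * p) * -b
      + (c * n + d * q) * a) = m + q := by
    linear_combination (m + q) * hdet
  rw [e1]
  congr 2
  · linear_combination p * (a * d - b * c + 1) * hdet
  · linear_combination (q - m) * (a * d - b * c + 1) * hdet
  · linear_combination (-n) * (a * d - b * c + 1) * hdet

/-- The three coordinates of the hyperbolic plane given by the boundary lines of a fundamental
hexagon: the coordinate `j` vanishes on the axis of `c_{j+1}`. -/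
def coords (z : ℂ) : Fin 3 → ℝ :=
  ![qform ((√3 + 1) / 2) 0 (-(√3 - 1) / 2) z, qform 2 (-(3 * √2)) 2 z,
    qform (-(√3 - 1) / 2) 0 ((√3 + 1) / 2) z]

lemma sq_sqrt_two : √2 ^ 2 = (2 : ℝ) := Real.sq_sqrt (by norm_num)
lemma sq_sqrt_three : √3 ^ 2 = (3 : ℝ) := Real.sq_sqrt (by norm_num)

lemma two_add_sqrt_inv : (2 + √3)⁻¹ = 2 - √3 := by
  rw [inv_eq_of_mul_eq_one_left]
  linear_combination -sq_sqrt_three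

/-- In a regular right-angled hexagon all sides have hyperbolic cosine 2. Half-lengths and distances
of the boundary components can then be taken equal, and the reflections in the seams get the
integral coefficient 4. -/
lemma cosh_symPants : Real.cosh (Real.log (2 + √3)) = 2 := by
  rw [Real.cosh_log (by positivity), two_add_sqrt_inv]; ring

lemma sinh_symPants : Real.sinh (Real.log (2 + √3)) = √3 := by
  rw [Real.sinh_log (by positivity), two_add_sqrt_inv]; ring

/-- The symmetric pair of pants with half-lengths `log (2 + √3)`. -/
def symPants : PantsData where
  s := Real.log (2 + √3)
  t := Real.log (2 + √3)
  d := Real.log (2 + √3)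
  s_pos := Real.log_pos (by linarith [Real.sqrt_nonneg 3])
  t_pos := Real.log_pos (by linarith [Real.sqrt_nonneg 3])
  d_pos := Real.log_pos (by linarith [Real.sqrt_nonneg 3])
  hyp := by
    rw [cosh_symPants, sinh_symPants]
    linarith [sq_sqrt_three]

lemma exp_half_symPants : Real.exp (Real.log (2 + √3) / 2) = (√3 + 1) * √2 / 2 := by
  rw [Real.exp_half, Real.exp_log (by positivity), Real.sqrt_eq_iff_mul_self_eq (by positivity)
    (by positivity)]
  have h2 := sq_sqrt_two
  have h3 := sq_sqrt_three
  grind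

lemma exp_neg_half_symPants : Real.exp (-(Real.log (2 + √3) / 2)) = (√3 - 1) * √2 / 2 := by
  rw [Real.exp_neg, exp_half_symPants, inv_eq_of_mul_eq_one_left]
  linear_combination (√3 ^ 2 - 1) / 4 * sq_sqrt_two + 1 / 2 * sq_sqrt_three

lemma hol_symPants_zero : (symPants.hol (FreeGroup.of 0) : Matrix (Fin 2) (Fin 2) ℝ)
    = !![2, (3 + √3) * √2 / 2; (3 - √3) * √2 / 2, 2] := by
  have e1 := exp_half_symPants
  have e2 := exp_neg_half_symPants
  ext i j
  fin_cases i <;> fin_cases j <;>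
    simp [PantsData.hol, PantsData.hol₁, symPants, cosh_symPants, sinh_symPants, e1, e2] <;>
    linear_combination √2 / 2 * sq_sqrt_three

lemma hol_symPants_one : (symPants.hol (FreeGroup.of 1) : Matrix (Fin 2) (Fin 2) ℝ)
    = !![2, -((3 - √3) * √2 / 2); -((3 + √3) * √2 / 2), 2] := by
  have e1 := exp_half_symPants
  have e2 := exp_neg_half_symPants
  ext i j
  fin_cases i <;> fin_cases j <;>
    simp [PantsData.hol, PantsData.hol₂, symPants, cosh_symPants, sinh_symPants, e1, e2] <;>
    linear_combination √2 / 2 * sq_sqrt_three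

lemma qform_eq (α β γ : ℝ) (z : ℂ) :
    qform α β γ z = α * (Complex.normSq z / z.im) + β * (z.re / z.im) + γ * (1 / z.im) := by
  unfold qform; ring

/-- The mirrors 0 and 1 are both orthogonal to the boundary line on which coordinate 2 vanishes, so
the product of the two reflections is a translation along this line. -/
lemma coords_hol_zero (z : UpperHalfPlane) :
    coords ((symPants.hol (FreeGroup.of 0) • z : UpperHalfPlane) : ℂ)
      = refl 0 (refl 1 (coords z)) := by
  have h2 := sq_sqrt_two
  have h3 := sq_sqrt_three
  funext j
  rcases fin_three_cases j with rfl | rfl | rfl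
  all_goals
    simp only [coords, qform_smul, hol_symPants_zero]
    simp [refl, Function.update, qform_eq]
    generalize Complex.normSq (z : ℂ) / z.im = n
    generalize z.re / z.im = r
    generalize (z.im)⁻¹ = i
    grind

lemma coords_hol_one (z : UpperHalfPlane) :
    coords ((symPants.hol (FreeGroup.of 1) • z : UpperHalfPlane) : ℂ)
      = refl 1 (refl 2 (coords z)) := by
  have h2 := sq_sqrt_two
  have h3 := sq_sqrt_three
  funext j
  rcases fin_three_cases j with rfl | rfl | rfl
  all_goals
    simp only [coords, qform_smul, hol_symPants_one]
    simp [refl, Function.update, qform_eq]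
    generalize Complex.normSq (z : ℂ) / z.im = n
    generalize z.re / z.im = r
    generalize (z.im)⁻¹ = i
    grind

lemma lorentz_coords (z : UpperHalfPlane) : lorentz (coords z) = -18 := by
  have h2 := sq_sqrt_two
  have h3 := sq_sqrt_three
  have hz : (z : ℂ).im ≠ 0 := z.im_pos.ne'
  simp [lorentz, coords, qform, Complex.normSq_apply]
  have hz : z.im ≠ 0 := z.im_pos.ne'
  field_simp
  grind

/-- The boundary component corresponding to a coordinate. -/
lemma side_bdry (n : Fin 3) (z : UpperHalfPlane) :
    side (symPants.hol (bdry n)) z / z.im = -(4 * (√2 * √3)) * coords z (n + 2) := by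
  have h2 := sq_sqrt_two
  have h3 := sq_sqrt_three
  rcases fin_three_cases n with rfl | rfl | rfl
  all_goals
    simp [side, bdry, coords, hol_symPants_zero, hol_symPants_one, qform_eq, Matrix.mul_apply,
      Fin.sum_univ_two, Matrix.SpecialLinearGroup.coe_inv, Matrix.adjugate_fin_two]
    rw [div_eq_mul_inv]
    simp only [div_eq_mul_inv]
    generalize z.im⁻¹ = i
    grind

/-! ### Holonomy elements and words in the reflections. -/

lemma coords_inv {w : PantsGroup} {l : List (Fin 3)}
    (h : ∀ z : UpperHalfPlane, coords ((symPants.hol w • z : UpperHalfPlane) : ℂ)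
      = wact l (coords z)) (z : UpperHalfPlane) :
    coords ((symPants.hol w⁻¹ • z : UpperHalfPlane) : ℂ) = wact l.reverse (coords z) := by
  have := h (symPants.hol w⁻¹ • z)
  rw [map_inv, smul_inv_smul] at this
  rw [this, wact_reverse_wact, map_inv]

/-- Elements of the group of the pair of pants act as words in the reflections, compatibly with a
given representation by half-turns. -/
lemma exists_word {H : Fin 3 → SL(2, ℂ)} (hH : ∀ k, H k * H k = -1) {ρ : PantsGroup →* G}
    (h0 : ρ (FreeGroup.of 0) = proj (H 0 * H 1)) (h1 : ρ (FreeGroup.of 1) = proj (H 1 * H 2))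
    (w : PantsGroup) :
    ∃ l : List (Fin 3), proj (wprod H l) = ρ w ∧
      ∀ z : UpperHalfPlane, coords ((symPants.hol w • z : UpperHalfPlane) : ℂ)
        = wact l (coords z) := by
  have hrev : ∀ l : List (Fin 3), proj (wprod H l.reverse) = (proj (wprod H l))⁻¹ := by
    have hneg : proj (-1 : SL(2, ℂ)) = 1 := by
      rw [proj, QuotientGroup.eq_one_iff, Matrix.SpecialLinearGroup.mem_center_iff]
      exact ⟨-1, by simp, by ext i j; fin_cases i <;> fin_cases j <;> simp⟩
    have hmul : ∀ a b : SL(2, ℂ), proj (a * b) = proj a * proj b := fun _ _ => rfl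
    intro l
    induction l with
    | nil => exact (inv_one (G := G)).symm
    | cons k l ih =>
      have hk : proj (H k) = (proj (H k))⁻¹ := by
        rw [eq_inv_iff_mul_eq_one, ← hmul, hH, hneg]
      rw [List.reverse_cons, wprod_append, hmul, ih, wprod_cons, wprod_nil, mul_one, hk,
        wprod_cons, hmul, mul_inv_rev]
  induction w using FreeGroup.induction_on with
  | C1 => exact ⟨[], (map_one ρ).symm, fun z => by simp⟩
  | of i =>
    rcases (by decide +revert : i = 0 ∨ i = 1) with rfl | rfl
    · exact ⟨[0, 1], by simp [h0], fun z => by simpa using coords_hol_zero z⟩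
    · exact ⟨[1, 2], by simp [h1], fun z => by simpa using coords_hol_one z⟩
  | inv_of i ih =>
    obtain ⟨l, h1, h2⟩ := ih
    exact ⟨l.reverse, by rw [hrev, h1, map_inv], coords_inv h2⟩
  | mul v w ihv ihw =>
    obtain ⟨l, h1, h2⟩ := ihv
    obtain ⟨l', h1', h2'⟩ := ihw
    refine ⟨l ++ l', ?_, fun z => ?_⟩
    · rw [wprod_append, map_mul, ← h1, ← h1']; rfl
    · rw [map_mul, mul_smul, h2, h2', wact_append]

lemma exists_hol_pair (i j : Fin 3) : ∃ w : PantsGroup, ∀ z : UpperHalfPlane,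
    coords ((symPants.hol w • z : UpperHalfPlane) : ℂ) = refl i (refl j (coords z)) := by
  have hinv : ∀ {w : PantsGroup} {i j : Fin 3}, (∀ z : UpperHalfPlane,
      coords ((symPants.hol w • z : UpperHalfPlane) : ℂ) = refl i (refl j (coords z))) →
      ∀ z : UpperHalfPlane,
      coords ((symPants.hol w⁻¹ • z : UpperHalfPlane) : ℂ) = refl j (refl i (coords z)) :=
    fun {w i j} h z => coords_inv (l := [i, j]) h z
  have hmul : ∀ {v w : PantsGroup} {i j k : Fin 3}, (∀ z : UpperHalfPlane,
      coords ((symPants.hol v • z : UpperHalfPlane) : ℂ) = refl i (refl j (coords z))) →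
      (∀ z : UpperHalfPlane,
      coords ((symPants.hol w • z : UpperHalfPlane) : ℂ) = refl j (refl k (coords z))) →
      ∀ z : UpperHalfPlane,
      coords ((symPants.hol (v * w) • z : UpperHalfPlane) : ℂ) = refl i (refl k (coords z)) :=
    fun h h' z => by rw [map_mul, mul_smul, h, h', refl_refl]
  rcases fin_three_cases i with rfl | rfl | rfl <;>
    rcases fin_three_cases j with rfl | rfl | rfl
  · exact ⟨1, fun z => by simp [refl_refl]⟩
  · exact ⟨_, coords_hol_zero⟩
  · exact ⟨_, hmul coords_hol_zero coords_hol_one⟩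
  · exact ⟨_, hinv coords_hol_zero⟩
  · exact ⟨1, fun z => by simp [refl_refl]⟩
  · exact ⟨_, coords_hol_one⟩
  · exact ⟨_, hinv (hmul coords_hol_zero coords_hol_one)⟩
  · exact ⟨_, hinv coords_hol_one⟩
  · exact ⟨1, fun z => by simp [refl_refl]⟩

/-- The holonomy group consists of the even words in the reflections; an odd word is made even by
one extra `refl 1`. -/
lemma exists_hol_word (l : List (Fin 3)) : ∃ w : PantsGroup,
    (∀ z : UpperHalfPlane, coords ((symPants.hol w • z : UpperHalfPlane) : ℂ)
      = wact l (coords z)) ∨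
    ∀ z : UpperHalfPlane, coords ((symPants.hol w • z : UpperHalfPlane) : ℂ)
      = refl 1 (wact l (coords z)) := by
  induction l with
  | nil => exact ⟨1, Or.inl fun z => by simp⟩
  | cons k l ih =>
    obtain ⟨w, h | h⟩ := ih
    · obtain ⟨v, hv⟩ := exists_hol_pair 1 k
      exact ⟨v * w, Or.inr fun z => by rw [map_mul, mul_smul, hv, h, wact_cons]⟩
    · obtain ⟨v, hv⟩ := exists_hol_pair k 1
      exact ⟨v * w, Or.inl fun z => by rw [map_mul, mul_smul, hv, h, wact_cons, refl_refl]⟩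

lemma coords_nonneg_of_cover {z : UpperHalfPlane} (hz : z ∈ symPants.cover) (w : PantsGroup)
    (j : Fin 3) : 0 ≤ coords ((symPants.hol w • z : UpperHalfPlane) : ℂ) j := by
  have h1 := hz w⁻¹ (j + 1)
  have h2 := side_conj (symPants.hol w⁻¹) (symPants.hol (bdry (j + 1))) (symPants.hol w • z)
  rw [side_bdry, add_one_two, map_inv, inv_smul_smul, ← map_inv, ← map_mul, ← map_inv, ← map_mul]
    at h2
  have h3 : side (symPants.hol (w⁻¹ * bdry (j + 1) * w⁻¹⁻¹)) z / z.im ≤ 0 :=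
    div_nonpos_of_nonpos_of_nonneg h1 z.im_pos.le
  rw [h2] at h3
  have : 0 < 4 * (√2 * √3) := by positivity
  by_contra h4
  push Not at h4
  nlinarith

lemma wact_coords_nonneg {z : UpperHalfPlane} (hz : z ∈ symPants.cover) (l : List (Fin 3))
    (j : Fin 3) : 0 ≤ wact l (coords z) j := by
  obtain ⟨w, h | h⟩ := exists_hol_word l
  · rw [← h]; exact coords_nonneg_of_cover hz w j
  -- `refl (j + 1)` does not change coordinate `j`, so an odd word may be completed by it without
  -- affecting the sign in question.
  · obtain ⟨v, hv⟩ := exists_hol_pair (j + 1) 1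
    have h1 := coords_nonneg_of_cover hz (v * w) j
    rwa [map_mul, mul_smul, hv, h, refl_refl, refl_of_ne (add_one_ne j).symm] at h1

lemma coords_ne_zero (z : UpperHalfPlane) (l : List (Fin 3)) : wact l (coords z) ≠ 0 := by
  have h : lorentz (wact l (coords z)) = -18 := by
    induction l with
    | nil => exact lorentz_coords z
    | cons k l ih => rw [wact_cons, lorentz_refl, ih]
  intro h0
  rw [h0] at h
  norm_num [lorentz] at h

lemma exists_hexagon_of_cover {z : UpperHalfPlane} (hz : z ∈ symPants.cover) :
    ∃ l : List (Fin 3), Hexagon (wact l (coords z)) := by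
  obtain ⟨l, -, -, h⟩ := exists_wact_hexagon (S := Set.univ)
    (C := fun x => ∃ l, x = wact l (coords z))
    (fun x ⟨l, hl⟩ k => by rw [hl]; exact wact_coords_nonneg hz l k)
    (fun x ⟨l, hl⟩ => by
      rw [hl]
      clear hl
      induction l with
      | nil => exact lorentz_coords z
      | cons k l ih => rw [wact_cons, lorentz_refl, ih])
    (fun x k ⟨l, hl⟩ _ => ⟨trivial, k :: l, by rw [hl, wact_cons]⟩) ⟨[], rfl⟩
  exact ⟨l, h⟩

lemma mem_boundaryLine {n : Fin 3} {z : UpperHalfPlane} :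
    z ∈ symPants.boundaryLine n ↔ coords z (n + 2) = 0 := by
  have h1 := side_bdry n z
  change side (symPants.hol (bdry n)) z = 0 ↔ _
  rw [div_eq_iff z.im_pos.ne'] at h1
  rw [h1]
  simp [z.im_pos.ne']

lemma add_one_ne_add_two (k : Fin 3) : k + 1 ≠ k + 2 := by decide +revert

lemma lorentz_eq (j : Fin 3) (x : Fin 3 → ℝ) : lorentz x = x j ^ 2 + x (j + 1) ^ 2
    + x (j + 2) ^ 2 - 4 * (x j * x (j + 1) + x (j + 1) * x (j + 2) + x (j + 2) * x j) := by
  rcases fin_three_cases j with rfl | rfl | rfl <;>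
    simp only [lorentz, Fin.isValue, Fin.reduceAdd, zero_add] <;> ring

lemma coords_sum_pos (z : UpperHalfPlane) (j : Fin 3) :
    0 < coords z j + coords z (j + 1) + coords z (j + 2) := by
  have h : 0 < coords z 0 + coords z 1 + coords z 2 := by
    have h1 : coords z 0 + coords z 1 + coords z 2
        = (3 * (z.re ^ 2 + z.im ^ 2) - 3 * √2 * z.re + 3) / z.im := by
      simp [coords, qform, Complex.normSq_apply]
      field_simp
      ring
    rw [h1]
    refine div_pos ?_ z.im_pos
    have := sq_sqrt_two
    nlinarith [sq_nonneg (z.re - √2 / 2), sq_nonneg z.im]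
  rcases fin_three_cases j with rfl | rfl | rfl <;>
    simp only [Fin.isValue, Fin.reduceAdd, zero_add] <;> linarith

/-- Points of a boundary line are moved to the hexagon by the two reflections which preserve the
line. -/
lemma exists_hexagon_of_line {j : Fin 3} {z : UpperHalfPlane} (hz : coords z j = 0) :
    ∃ l : List (Fin 3), (∀ k ∈ l, k ≠ j) ∧ Hexagon (wact l (coords z))
      ∧ wact l (coords z) j = 0 := by
  have hsum := coords_sum_pos z j
  obtain ⟨l, h1, h2, h3⟩ := exists_wact_hexagon (S := {k | k ≠ j})
    (C := fun x => x j = 0 ∧ 0 ≤ x (j + 1) ∧ 0 ≤ x (j + 2) ∧ lorentz x = -18)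
    (fun x ⟨h0, h1, h2, _⟩ k => by
      rcases eq_or_eq_add k j with rfl | rfl | rfl
      exacts [h0.ge, h1, h2])
    (fun x h => h.2.2.2)
    (fun x k ⟨h0, h1, h2, h3⟩ hk => by
      have h4 := h3
      rw [lorentz_eq j, h0] at h4
      rcases eq_or_eq_add k j with rfl | rfl | rfl
      · rw [h0] at hk; linarith
      · rw [add_one_one, add_one_two, h0] at hk
        refine ⟨add_one_ne j, ?_, ?_, ?_, by rw [lorentz_refl, h3]⟩
        · rw [refl_of_ne (add_one_ne j).symm, h0]
        · rw [refl_self, add_one_one, add_one_two, h0]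
          have : 0 < x (j + 1) := by linarith
          -- With `x j = 0` the invariant form gives `x (j + 1) * (4 * x (j + 2) - x (j + 1)) = x (j
          -- + 2) ^ 2 + 18`.
          have : 0 ≤ x (j + 1) * (4 * (x (j + 2) + 0) - x (j + 1)) := by
            nlinarith [sq_nonneg (x (j + 2))]
          exact nonneg_of_mul_nonneg_right this ‹_›
        · rw [refl_of_ne (add_one_ne_add_two j).symm]; exact h2
      · rw [add_two_one, add_two_two, h0] at hk
        refine ⟨add_two_ne j, ?_, ?_, ?_, by rw [lorentz_refl, h3]⟩
        · rw [refl_of_ne (add_two_ne j).symm, h0]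
        · rw [refl_of_ne (add_one_ne_add_two j)]; exact h1
        · rw [refl_self, add_two_one, add_two_two, h0]
          have : 0 < x (j + 2) := by linarith
          have : 0 ≤ x (j + 2) * (4 * (0 + x (j + 1)) - x (j + 2)) := by
            nlinarith [sq_nonneg (x (j + 1))]
          exact nonneg_of_mul_nonneg_right this ‹_›)
    (x := coords z) (by
      have h4 := lorentz_coords z
      have h5 := h4
      rw [lorentz_eq j, hz] at h4
      rw [hz] at hsum
      -- On the line, `a ^ 2 + b ^ 2 - 4 * a * b = -18` makes the two other coordinates of equal
      -- sign; the positivity of the coordinate sum selects the sign.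
      have h6 : 0 < coords z (j + 1) * coords z (j + 2) := by
        nlinarith [sq_nonneg (coords z (j + 1)), sq_nonneg (coords z (j + 2))]
      rcases pos_and_pos_or_neg_and_neg_of_mul_pos h6 with h | h
      · exact ⟨hz, h.1.le, h.2.le, h5⟩
      · linarith [h.1, h.2])
  exact ⟨l, h1, h3, h2.1⟩

lemma isConnected_half_circle (c : ℝ) {ρ : ℝ} (hρ : 0 < ρ) :
    IsConnected {z : UpperHalfPlane | (z.re - c) ^ 2 + z.im ^ 2 = ρ} := by
  have hpos : ∀ x ∈ Set.Ioo (c - √ρ) (c + √ρ), 0 < ρ - (x - c) ^ 2 := fun x hx => by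
    have := Real.sq_lt.2 (show -√ρ < x - c ∧ x - c < √ρ by constructor <;> linarith [hx.1, hx.2])
    linarith
  have hs := Real.sqrt_pos.2 hρ
  let f : Set.Ioo (c - √ρ) (c + √ρ) → UpperHalfPlane := fun x =>
    ⟨⟨x, √(ρ - (x - c) ^ 2)⟩, Real.sqrt_pos.2 (hpos x x.2)⟩
  have hf : Continuous f := by
    rw [UpperHalfPlane.isEmbedding_coe.continuous_iff]
    have h : Continuous fun x : Set.Ioo (c - √ρ) (c + √ρ) =>
        ((x : ℝ) : ℂ) + ((√(ρ - (x - c) ^ 2) : ℝ) : ℂ) * Complex.I := by fun_prop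
    refine h.congr fun x => ?_
    apply Complex.ext <;> simp [f]
  have : ConnectedSpace (Set.Ioo (c - √ρ) (c + √ρ)) :=
    Subtype.connectedSpace (isConnected_Ioo (by linarith))
  convert isConnected_range hf
  ext z
  constructor
  · intro hz
    have hz' : (z.re - c) ^ 2 + z.im ^ 2 = ρ := hz
    have h1 : (z.re - c) ^ 2 < ρ := by nlinarith [z.im_pos]
    obtain ⟨h2, h3⟩ := Real.sq_lt.1 h1
    refine ⟨⟨z.re, by linarith, by linarith⟩, UpperHalfPlane.ext ?_⟩
    apply Complex.ext
    · simp [f]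
    · change √(ρ - (z.re - c) ^ 2) = z.im
      rw [← hz', add_sub_cancel_left, Real.sqrt_sq z.im_pos.le]
  · rintro ⟨x, rfl⟩
    change ((x : ℝ) - c) ^ 2 + √(ρ - (x - c) ^ 2) ^ 2 = ρ
    rw [Real.sq_sqrt (hpos x x.2).le]; ring

lemma isConnected_boundaryLine (n : Fin 3) : IsConnected (symPants.boundaryLine n) := by
  have h2 := sq_sqrt_two
  have h3 := sq_sqrt_three
  have h31 : √3 < 2 := by rw [Real.sqrt_lt' (by norm_num)]; norm_num
  have h32 : 1 < √3 := by rw [Real.lt_sqrt (by norm_num)]; norm_num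
  rcases fin_three_cases n with rfl | rfl | rfl
  · convert isConnected_half_circle 0 (ρ := 2 + √3) (by linarith) using 1
    ext z
    rw [mem_boundaryLine]
    simp [coords, qform, Complex.normSq_apply, z.im_pos.ne']
    constructor
    · intro h
      have : (√3 - 1) * (z.re ^ 2 + z.im ^ 2 - (2 + √3)) = 0 := by grind
      have := (mul_eq_zero.1 this).resolve_left (by linarith)
      linarith
    · intro h; grind
  · convert isConnected_half_circle 0 (ρ := 2 - √3) (by linarith) using 1
    ext z
    rw [mem_boundaryLine]
    simp [coords, qform, Complex.normSq_apply, z.im_pos.ne']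
    constructor
    · intro h
      have : (√3 + 1) * (z.re ^ 2 + z.im ^ 2 - (2 - √3)) = 0 := by grind
      have := (mul_eq_zero.1 this).resolve_left (by linarith)
      linarith
    · intro h; grind
  · convert isConnected_half_circle (3 * √2 / 4) (ρ := 1 / 8) (by norm_num) using 1
    ext z
    rw [mem_boundaryLine]
    simp [coords, qform, Complex.normSq_apply, z.im_pos.ne']
    constructor <;> intro h <;> grind

/-! ### Smoothness and immersivity of the coordinates. -/

lemma contDiffAt_qform (α β γ : ℝ) {z : ℂ} (hz : z.im ≠ 0) :
    ContDiffAt ℝ ∞ (qform α β γ) z := by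
  have h1 : ContDiff ℝ ∞ Complex.re := Complex.reCLM.contDiff
  have h2 : ContDiff ℝ ∞ Complex.im := Complex.imCLM.contDiff
  unfold qform
  simp only [Complex.normSq_apply]
  exact ContDiffAt.div (by fun_prop) h2.contDiffAt hz

lemma contDiffAt_coords {z : ℂ} (hz : z.im ≠ 0) : ContDiffAt ℝ ∞ coords z := by
  rw [contDiffAt_pi]
  intro j
  rcases fin_three_cases j with rfl | rfl | rfl <;> exact contDiffAt_qform _ _ _ hz

/-- The coordinates define an immersion, even modulo scaling. -/
lemma eq_zero_of_fderiv_coords {z v : ℂ} (hz : 0 < z.im) {a : ℝ}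
    (h : fderiv ℝ coords z v = a • coords z) : v = 0 := by
  have h2 := sq_sqrt_two
  have h3 := sq_sqrt_three
  have h20 : √2 ≠ 0 := by positivity
  have h30 : √3 ≠ 0 := by positivity
  set ℓ : ℝ → ℂ := fun t => z + t • v with hℓ
  have hℓ0 : ℓ 0 = z := by simp [hℓ]
  have hd : HasDerivAt ℓ v 0 := by
    simpa only [one_smul, id_eq] using ((hasDerivAt_id (0 : ℝ)).smul_const v).const_add z
  have hc : HasDerivAt (fun t => coords (ℓ t)) (a • coords z) 0 := by
    have h1 : HasFDerivAt coords (fderiv ℝ coords z) (ℓ 0) := by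
      rw [hℓ0]
      exact ((contDiffAt_coords hz.ne').differentiableAt (by simp)).hasFDerivAt
    have := h1.comp_hasDerivAt (0 : ℝ) hd
    rwa [h] at this
  have hj := fun j => (hasDerivAt_pi.1 hc) j
  have hre : HasDerivAt (fun t => (ℓ t).re) v.re 0 := by
    simpa only [hℓ, Complex.add_re, Complex.smul_re, smul_eq_mul, one_mul, id_eq] using
      ((hasDerivAt_id (0 : ℝ)).mul_const v.re).const_add z.re
  have him : HasDerivAt (fun t => (ℓ t).im) v.im 0 := by
    simpa only [hℓ, Complex.add_im, Complex.smul_im, smul_eq_mul, one_mul, id_eq] using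
      ((hasDerivAt_id (0 : ℝ)).mul_const v.im).const_add z.im
  have hq : ∀ α β γ : ℝ, HasDerivAt (fun t => qform α β γ (ℓ t)) (a * qform α β γ z) 0 →
      (α * (2 * (z.re * v.re + z.im * v.im)) + β * v.re) * z.im
        - (α * Complex.normSq z + β * z.re + γ) * v.im
        = a * (α * Complex.normSq z + β * z.re + γ) * z.im := by
    intro α β γ h1
    have h2 := (((((hre.fun_mul hre).fun_add (him.fun_mul him)).const_mul α).fun_add
      (hre.const_mul β)).fun_add (hasDerivAt_const (0 : ℝ) γ)).fun_div him
        (by rw [hℓ0]; exact hz.ne')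
    simp only [hℓ0] at h2
    have h3 := h1.unique h2
    simp only [qform, Complex.normSq_apply] at h3 ⊢
    have hz' := hz.ne'
    field_simp at h3
    linear_combination -h3
  have e0 := hq _ _ _ (hj 0)
  have e1 := hq _ _ _ (hj 1)
  have e2 := hq _ _ _ (hj 2)
  -- The three coordinates form a basis of the linear forms, so the relations can be solved for the
  -- forms with numerators 1, `Re z` and `|z|²`.
  have f1 : v.im + a * z.im = 0 := by grind
  have f2 : v.re * z.im - z.re * v.im = a * z.re * z.im := by grind
  have f3 : 2 * (z.re * v.re + z.im * v.im) * z.im - Complex.normSq z * v.im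
      = a * Complex.normSq z * z.im := by grind
  have g1 : v.re = 0 := by
    have : v.re * z.im = 0 := by linear_combination f2 + z.re * f1
    exact (mul_eq_zero.1 this).resolve_right hz.ne'
  have g2 : v.im = 0 := by
    have : v.im * (2 * z.im * z.im) = 0 := by
      rw [g1] at f3
      linear_combination f3 + Complex.normSq z * f1
    exact (mul_eq_zero.1 this).resolve_right (by positivity)
  exact Complex.ext g1 g2

lemma coords_bdry (n : Fin 3) (z : UpperHalfPlane) :
    coords ((symPants.hol (bdry n) • z : UpperHalfPlane) : ℂ)
      = refl n (refl (n + 1) (coords z)) := by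
  rcases fin_three_cases n with rfl | rfl | rfl
  · exact coords_hol_zero z
  · exact coords_hol_one z
  · have h : ∀ z : UpperHalfPlane, coords ((symPants.hol (FreeGroup.of 0 * FreeGroup.of 1) • z :
        UpperHalfPlane) : ℂ) = wact [0, 2] (coords z) := fun z => by
      rw [map_mul, mul_smul, coords_hol_zero, coords_hol_one, refl_refl]; rfl
    exact coords_inv h z

/-! ### Developing maps of surfaces bounded by geodesics -/

/-- The reflected pieces of surface `reach`. -/
def piece (T : Fin 3 → Fin 3 → ℝ) (P Q : Fin 3 → Fin 2 → ℂ) : (Fin 3 → ℝ) → Herm :=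
  surf (fun k j => reach (T k j)) (fun j => nul (P j), fun j => nul (Q j))

/-- Half-turns about the sides of a right-angled skew hexagon; the three other sides are on the
geodesics with endpoints `P j` and `Q j`. -/
structure IsSkewHexagon (H : Fin 3 → SL(2, ℂ)) (P Q : Fin 3 → Fin 2 → ℂ)
    (T : Fin 3 → Fin 3 → ℝ) : Prop where
  sq : ∀ k, H k * H k = -1
  two_le : ∀ k j, 2 ≤ T k j
  det : ∀ j, P j 0 * Q j 1 - P j 1 * Q j 0 ≠ 0
  act_p : ∀ k, hact (H k) (nul (P (k + 1))) = Real.exp (2 * T k (k + 1)) • nul (Q (k + 1))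
  act_q : ∀ k, hact (H k) (nul (Q (k + 2))) = Real.exp (2 * T k (k + 2)) • nul (P (k + 2))
  strip : ∀ k, StripIndep (nul (P (k + 1))) (nul (Q (k + 1))) (nul (P (k + 2))) (nul (Q (k + 2)))
  centre : ∀ x ∈ centre, Function.Injective
    (fderiv ℝ (surf (fun _ _ => glide) (fun j => nul (P j), fun j => nul (Q j))) x)

/-- The determinant of the combination is `a * b` times the squared modulus of the determinant of
the two vectors. These combinations are the points of the geodesic with endpoints `P` and `Q`. -/
lemma hpos_nul {P Q : Fin 2 → ℂ} (h : P 0 * Q 1 - P 1 * Q 0 ≠ 0) {a b : ℝ} (ha : 0 < a)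
    (hb : 0 < b) : HPos (a • nul P + b • nul Q) := by
  have h1 := Complex.normSq_nonneg (P 1)
  have h2 := Complex.normSq_nonneg (Q 1)
  refine ⟨?_, ?_⟩
  · change 0 < a * Complex.normSq (P 1) + b * Complex.normSq (Q 1)
    by_contra hn
    have h3 : a * Complex.normSq (P 1) = 0 := by
      have := mul_nonneg ha.le h1
      have := mul_nonneg hb.le h2
      linarith
    have h4 : b * Complex.normSq (Q 1) = 0 := by
      have := mul_nonneg ha.le h1
      have := mul_nonneg hb.le h2
      linarith
    simp [ha.ne', hb.ne'] at h3 h4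
    simp [h3, h4] at h
  · have : hdet (a • nul P + b • nul Q) = a * b * Complex.normSq (P 0 * Q 1 - P 1 * Q 0) := by
      simp [hdet, nul, Complex.normSq_apply]; ring
    rw [this]
    have := Complex.normSq_pos.2 h
    positivity

/-- All weights are nonnegative on the hexagon. At the smallest coordinate the ratio is at most 1,
so the cutoff is 1, and the hexagon inequalities make the other two coordinates positive: one weight
is positive, and the cone is convex. -/
lemma Hexagon.piece_pos {T : Fin 3 → Fin 3 → ℝ} {P Q : Fin 3 → Fin 2 → ℂ}
    (hd : ∀ j, P j 0 * Q j 1 - P j 1 * Q j 0 ≠ 0) {x : Fin 3 → ℝ} (hx : Hexagon x)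
    (h0 : x ≠ 0) : HPos (piece T P Q x) := by
  have hw : ∀ j, 0 ≤ weight j x := fun j =>
    mul_nonneg (mul_nonneg (cut_nonneg _) (Real.exp_pos _).le) (mul_nonneg (hx.1 _) (hx.1 _))
  have key : ∀ s : Finset (Fin 3), (∃ j ∈ s, 0 < weight j x) →
      HPos (∑ j ∈ s, ((weight j x * Real.exp (position (fun k j => reach (T k j)) j x)) • nul (P j)
        + (weight j x * Real.exp (-position (fun k j => reach (T k j)) j x)) • nul (Q j))) := by
    intro s
    induction s using Finset.induction_on with
    | empty => simp
    | insert i s hi ih =>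
      intro hex
      rw [Finset.sum_insert hi]
      by_cases hi0 : weight i x = 0
      · obtain ⟨j, hj, hj'⟩ := hex
        rw [hi0]
        simp only [zero_mul, zero_smul, zero_add]
        refine ih ⟨j, ?_, hj'⟩
        rcases Finset.mem_insert.1 hj with rfl | h
        · rw [hi0] at hj'; exact absurd hj' (lt_irrefl _)
        · exact h
      have hi1 : 0 < weight i x := (hw i).lt_of_ne (Ne.symm hi0)
      have h1 := hpos_nul (hd i) (mul_pos hi1 (Real.exp_pos
        (position (fun k j => reach (T k j)) i x))) (mul_pos hi1 (Real.exp_pos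
        (-position (fun k j => reach (T k j)) i x)))
      by_cases hs : ∃ j ∈ s, 0 < weight j x
      · exact h1.add (ih hs)
      · rw [Finset.sum_eq_zero, add_zero]
        · exact h1
        · intro j hj
          push Not at hs
          have : weight j x = 0 := le_antisymm (hs j hj) (hw j)
          simp [this]
  refine key Finset.univ ?_
  obtain ⟨j, hj1, hj2⟩ : ∃ j, x j ≤ x (j + 1) ∧ x j ≤ x (j + 2) := by
    obtain ⟨j, -, hj⟩ := Finset.exists_min_image Finset.univ x ⟨0, Finset.mem_univ _⟩
    exact ⟨j, hj _ (Finset.mem_univ _), hj _ (Finset.mem_univ _)⟩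
  have a0 := hx.1 j
  have b1 := hx.2 (j + 1)
  have b2 := hx.2 (j + 2)
  have b0 := (hx.slack h0 j).1
  rw [add_one_one, add_one_two] at b1
  rw [add_two_one, add_two_two] at b2
  refine ⟨j, Finset.mem_univ _, ?_⟩
  have hr : ratio j x ≤ 1 := by
    unfold ratio; rw [div_le_one b0]; linarith
  unfold weight
  rw [cut_eq_one hr]
  have c1 : 0 < x (j + 1) := by
    by_contra h; linarith
  have c2 : 0 < x (j + 2) := by
    by_contra h; linarith
  have := Real.exp_pos (-glide (ratio j x))
  positivity

lemma isOpen_slack : IsOpen {x : Fin 3 → ℝ | Slack x} := by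
  have : {x : Fin 3 → ℝ | Slack x} = ⋂ k, ({x | 0 < x (k + 1) + x (k + 2)} ∩
      ({x | x k < 2.05 * (x (k + 1) + x (k + 2))} ∩
        {x | -0.01 * (x (k + 1) + x (k + 2)) < x k})) := by
    ext x; simp [Slack]
  rw [this]
  exact isOpen_iInter_of_finite fun k => (isOpen_lt (by fun_prop) (by fun_prop)).inter
    ((isOpen_lt (by fun_prop) (by fun_prop)).inter (isOpen_lt (by fun_prop) (by fun_prop)))

lemma isOpen_hpos : IsOpen {M : Herm | HPos M} := by
  have h1 : Continuous hdet :=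
    continuous_iff_continuousAt.2 fun M => (contDiffAt_hdet M).continuousAt
  have h2 : Continuous fun M : Herm => M.2.1 := by fun_prop
  exact (isOpen_lt continuous_const h2).inter (isOpen_lt continuous_const h1)

lemma Slack.ne {x : Fin 3 → ℝ} (h : Slack x) (k : Fin 3) : x (k + 1) + x (k + 2) ≠ 0 := (h k).1.ne'

lemma contDiffAt_piece (T : Fin 3 → Fin 3 → ℝ) (P Q : Fin 3 → Fin 2 → ℂ) {x : Fin 3 → ℝ}
    (h : Slack x) : ContDiffAt ℝ ∞ (piece T P Q) x :=
  contDiffAt_surf (fun _ _ => contDiff_reach _) _ h.ne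

/-- The points where `piece` defines a surface. -/
def Good (T : Fin 3 → Fin 3 → ℝ) (P Q : Fin 3 → Fin 2 → ℂ) (x : Fin 3 → ℝ) : Prop :=
  Slack x ∧ HPos (piece T P Q x)

lemma Good.eventually {T : Fin 3 → Fin 3 → ℝ} {P Q : Fin 3 → Fin 2 → ℂ} {x : Fin 3 → ℝ}
    (h : Good T P Q x) : ∀ᶠ y in nhds x, Good T P Q y :=
  Filter.Eventually.and (isOpen_slack.mem_nhds h.1)
    ((contDiffAt_piece T P Q h.1).continuousAt.eventually (isOpen_hpos.mem_nhds h.2))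

open Classical in
/-- The developing map. -/
def develop (H : Fin 3 → SL(2, ℂ)) (P Q : Fin 3 → Fin 2 → ℂ) (T : Fin 3 → Fin 3 → ℝ) (z : ℂ) :
    ℂ × ℝ :=
  if h : ∃ l, Good T P Q (wact l (coords z)) then
    uhs (hact (wprod H h.choose.reverse) (piece T P Q (wact h.choose (coords z)))) else 0

section

variable {H : Fin 3 → SL(2, ℂ)} {P Q : Fin 3 → Fin 2 → ℂ} {T : Fin 3 → Fin 3 → ℝ}

/-- Independence of the chosen word: two admissible words differ by a word that carries a point of
`Slack` to a point of `Slack`, so by `exists_smul_hact_wprod` the two values differ by a positive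
factor, which `uhs` ignores. -/
lemma IsSkewHexagon.develop_eq (hS : IsSkewHexagon H P Q T) {z : ℂ} {l : List (Fin 3)}
    (hl : Good T P Q (wact l (coords z))) :
    develop H P Q T z = uhs (hact (wprod H l.reverse) (piece T P Q (wact l (coords z)))) := by
  have h : ∃ l, Good T P Q (wact l (coords z)) := ⟨l, hl⟩
  rw [develop, dif_pos h]
  have h1 := h.choose_spec
  set l' := h.choose
  have e : wact l' (coords z) = wact (l' ++ l.reverse) (wact l (coords z)) := by
    rw [wact_append, wact_reverse_wact]
  obtain ⟨c, hc, h2⟩ := exists_smul_hact_wprod hS.sq (f := piece T P Q)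
    (fun k x => surf_refl hS.sq hS.act_p hS.act_q k) (l' ++ l.reverse) hl.1 (e ▸ h1.1)
  rw [e, h2, hact_smul, uhs_smul hc, wprod_append, hact_mul, hact_wprod_reverse hS.sq]

lemma contDiffAt_wact_coords (l : List (Fin 3)) {z : ℂ} (hz : z.im ≠ 0) :
    ContDiffAt ℝ ∞ (fun z => wact l (coords z)) z :=
  (wact l).contDiff.contDiffAt.comp z (contDiffAt_coords hz)

lemma IsSkewHexagon.develop_eventually (hS : IsSkewHexagon H P Q T) {z : ℂ} (hz : 0 < z.im)
    {l : List (Fin 3)} (hl : Good T P Q (wact l (coords z))) :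
    ∀ᶠ w in nhds z, 0 < w.im ∧ Good T P Q (wact l (coords w)) ∧ develop H P Q T w
      = uhs (hact (wprod H l.reverse) (piece T P Q (wact l (coords w)))) := by
  have h1 : ∀ᶠ w : ℂ in nhds z, 0 < w.im :=
    (isOpen_lt continuous_const Complex.continuous_im).mem_nhds hz
  have h2 := (contDiffAt_wact_coords l hz.ne').continuousAt.eventually hl.eventually
  filter_upwards [h1, h2] with w hw1 hw2
  exact ⟨hw1, hw2, hS.develop_eq hw2⟩

/-- If some ratio exceeds 3/2, the strip lemma applies. Otherwise `reach` agrees with `glide` near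
`x`, the map no longer depends on `T`, and homogeneity moves `x` into the compact set `centre`. -/
lemma IsSkewHexagon.injective_fderiv_piece (hS : IsSkewHexagon H P Q T) {x : Fin 3 → ℝ}
    (hx : Hexagon x) (h0 : x ≠ 0) : Function.Injective (fderiv ℝ (piece T P Q) x) := by
  have hs := hx.slack h0
  by_cases hk : ∃ k, 3 / 2 < ratio k x
  · obtain ⟨k, hk⟩ := hk
    unfold piece
    exact injective_fderiv_strip (φ := fun k j => reach (T k j))
      (fun i j p hp => reach_eq_zero _ hp)
      (fun _ _ => contDiff_reach _) (hS.strip k) hs hx.1 (by linarith)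
      (fun j => exists_deriv_reach (hS.two_le k j) (by linarith))
  push Not at hk
  have e1 : piece T P Q =ᶠ[nhds x]
      surf (fun _ _ => glide) (fun j => nul (P j), fun j => nul (Q j)) := by
    have : ∀ᶠ y in nhds x, ∀ k, ratio k y < 8 / 5 := by
      refine Filter.eventually_all.2 fun k => ?_
      exact (contDiffAt_ratio k (hs.ne k)).continuousAt.eventually_lt continuousAt_const
        (by have := hk k; linarith)
    filter_upwards [this] with y hy
    simp only [piece, surf, position, reach_of_le _ (hy _).le]
  rw [e1.fderiv_eq]
  set f := surf (fun _ _ => glide) (fun j => nul (P j), fun j => nul (Q j)) with hf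
  have hsum : 0 < x 0 + x 1 + x 2 := by
    have h1 := (hs 0).1
    have h2 := hx.1 0
    simp only [Fin.isValue, zero_add] at h1
    linarith
  set a := (x 0 + x 1 + x 2)⁻¹ with ha
  have ha0 : 0 < a := inv_pos.2 hsum
  have hc : a • x ∈ KahnMarkovic.centre := by
    refine ⟨fun k => mul_nonneg ha0.le (hx.1 k), ?_, fun k => ?_⟩
    · simp only [Pi.smul_apply, smul_eq_mul, ← mul_add]
      exact inv_mul_cancel₀ hsum.ne'
    · have := hk k
      unfold ratio at this
      rw [div_le_iff₀ (hs k).1] at this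
      simp only [Pi.smul_apply, smul_eq_mul, ← mul_add]
      have := mul_le_mul_of_nonneg_left this ha0.le
      linarith
  have h1 := hS.centre _ hc
  have hd : DifferentiableAt ℝ f (a • x) :=
    (contDiffAt_surf (fun _ _ => contDiff_glide) _ (fun k => by
      simp only [Pi.smul_apply, smul_eq_mul, ← mul_add]
      exact mul_ne_zero ha0.ne' (hs.ne k))).differentiableAt (by simp)
  have hd' : DifferentiableAt ℝ f x :=
    (contDiffAt_surf (fun _ _ => contDiff_glide) _ hs.ne).differentiableAt (by simp)
  have h2 : HasFDerivAt (fun y => f (a • y))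
      ((fderiv ℝ f (a • x)).comp (a • ContinuousLinearMap.id ℝ (Fin 3 → ℝ))) x :=
    HasFDerivAt.comp x (g := f) hd.hasFDerivAt ((hasFDerivAt_id x).const_smul a)
  have h3 : HasFDerivAt (fun y => f (a • y)) (a ^ 2 • fderiv ℝ f x) x := by
    have : (fun y => f (a • y)) = fun y => a ^ 2 • f y :=
      funext fun y => surf_smul _ _ ha0.ne' y
    rw [this]
    exact hd'.hasFDerivAt.const_smul (a ^ 2)
  have h4 := h2.unique h3
  rw [injective_iff_map_eq_zero] at h1 ⊢
  intro v hv
  refine h1 v ?_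
  have h5 : fderiv ℝ f (a • x) (a • v) = a ^ 2 • fderiv ℝ f x v :=
    congrArg (fun L : (Fin 3 → ℝ) →L[ℝ] Herm => L v) h4
  rw [hv, smul_zero, map_smul, smul_eq_zero] at h5
  exact h5.resolve_left ha0.ne'

/-- A vector killed by the derivative moves the Hermitian matrix radially. By Euler's relation and
injectivity for `piece` it moves the coordinates radially, and the coordinates are immersive even
modulo scaling. -/
lemma IsSkewHexagon.injective_fderiv_develop (hS : IsSkewHexagon H P Q T) {z : ℂ} (hz : 0 < z.im)
    {l : List (Fin 3)} (hx : Hexagon (wact l (coords z))) (h0 : wact l (coords z) ≠ 0) :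
    Function.Injective (fderiv ℝ (develop H P Q T) z) := by
  have hg : Good T P Q (wact l (coords z)) := ⟨hx.slack h0, hx.piece_pos hS.det h0⟩
  have hev := hS.develop_eventually hz hg
  have e1 : develop H P Q T =ᶠ[nhds z] fun w =>
      uhs (hact (wprod H l.reverse) (piece T P Q (wact l (coords w)))) := by
    filter_upwards [hev] with w hw using hw.2.2
  rw [e1.fderiv_eq, injective_iff_map_eq_zero]
  intro v hv
  have hc := ((contDiffAt_coords hz.ne').differentiableAt (by simp)).hasFDerivAt
  have hp := ((contDiffAt_piece T P Q hg.1).differentiableAt (by simp)).hasFDerivAt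
  have hf : HasFDerivAt (fun w => hact (wprod H l.reverse) (piece T P Q (wact l (coords w))))
      ((hactL (wprod H l.reverse)).comp ((fderiv ℝ (piece T P Q) (wact l (coords z))).comp
        ((wact l).comp (fderiv ℝ coords z)))) z :=
    (hactL (wprod H l.reverse)).hasFDerivAt.comp z (hp.comp z ((wact l).hasFDerivAt.comp z hc))
  obtain ⟨c, h1⟩ := exists_smul_of_fderiv_uhs hf.differentiableAt
    (by filter_upwards [hev] with w hw using hw.2.1.2.hact _) hv
  rw [hf.fderiv] at h1
  simp only [ContinuousLinearMap.comp_apply, hactL_apply] at h1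
  rw [← hact_smul] at h1
  have h2 := congrArg (hact (wprod H l.reverse)⁻¹) h1
  rw [hact_inv_hact, hact_inv_hact] at h2
  have h3 : c • piece T P Q (wact l (coords z))
      = fderiv ℝ (piece T P Q) (wact l (coords z)) ((c / 2) • wact l (coords z)) := by
    rw [map_smul, piece, fderiv_surf_self (fun _ _ => contDiff_reach _) _ hg.1.ne, smul_smul]
    congr 1; ring
  rw [h3] at h2
  have h4 := hS.injective_fderiv_piece hx h0 h2
  rw [← map_smul] at h4
  have h5 := congrArg (wact l.reverse) h4
  rw [wact_reverse_wact, wact_reverse_wact] at h5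
  exact eq_zero_of_fderiv_coords hz h5

lemma proj_eq_proj {g h : SL(2, ℂ)} : proj g = proj h ↔ g = h ∨ g = -h := by
  rw [proj, proj, eq_comm, QuotientGroup.eq, Matrix.SpecialLinearGroup.mem_center_iff]
  constructor
  · rintro ⟨r, hr, h1⟩
    have h2 : g = h * (h⁻¹ * g) := by group
    simp only [Fintype.card_fin] at hr
    rw [sq, mul_self_eq_one_iff] at hr
    rcases hr with rfl | rfl
    · left
      have h3 : h⁻¹ * g = 1 := Subtype.ext (h1.symm.trans (map_one _))
      rw [h2, h3, mul_one]
    · right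
      have h3 : h⁻¹ * g = -1 := Subtype.ext (h1.symm.trans (by rw [map_neg, map_one]; rfl))
      rw [h2, h3, mul_neg_one]
  · rintro (rfl | rfl)
    · exact ⟨1, by simp, by ext i j; fin_cases i <;> fin_cases j <;> simp⟩
    · exact ⟨-1, by simp, by ext i j; fin_cases i <;> fin_cases j <;> simp⟩

lemma poincare_congr {g h : SL(2, ℂ)} (e : proj g = proj h) {p : ℂ × ℝ} (hp : 0 < p.2) :
    poincare g p = poincare h p := by
  rcases proj_eq_proj.1 e with rfl | rfl
  · rfl
  · exact poincare_neg _ hp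

lemma IsSkewHexagon.develop_equivariant (hS : IsSkewHexagon H P Q T) {ρ : PantsGroup →* G}
    (h0 : ρ (FreeGroup.of 0) = proj (H 0 * H 1)) (h1 : ρ (FreeGroup.of 1) = proj (H 1 * H 2))
    (w : PantsGroup) {g : SL(2, ℂ)} (hg : proj g = ρ w) {z : UpperHalfPlane} {l : List (Fin 3)}
    (hl : Good T P Q (wact l (coords z))) :
    develop H P Q T ((symPants.hol w • z : UpperHalfPlane) : ℂ)
      = poincare g (develop H P Q T z) := by
  obtain ⟨m, hm1, hm2⟩ := exists_word hS.sq h0 h1 w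
  have e : wact (l ++ m.reverse) (coords ((symPants.hol w • z : UpperHalfPlane) : ℂ))
      = wact l (coords z) := by
    rw [hm2, wact_append, wact_reverse_wact]
  have hpos := hl.2.hact (wprod H l.reverse)
  rw [hS.develop_eq (l := l ++ m.reverse) (by rw [e]; exact hl), e, hS.develop_eq hl,
    poincare_congr (hg.trans hm1.symm) (uhs_pos hpos), poincare_uhs _ hpos, List.reverse_append,
    List.reverse_reverse, wprod_append, hact_mul]

/-- The positive cone of the `j`-th boundary geodesic. -/
def cone (P Q : Fin 3 → Fin 2 → ℂ) (j : Fin 3) : Set Herm :=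
  {M | ∃ a b : ℝ, 0 < a ∧ 0 < b ∧ M = a • nul (P j) + b • nul (Q j)}

lemma IsSkewHexagon.act_q' (hS : IsSkewHexagon H P Q T) (k : Fin 3) :
    hact (H k) (nul (Q (k + 1))) = Real.exp (-(2 * T k (k + 1))) • nul (P (k + 1)) := by
  have := congrArg (hact (H k)) (hS.act_p k)
  rw [hact_half_turn (hS.sq k), hact_smul] at this
  rw [this, smul_smul, ← Real.exp_add]; simp

lemma IsSkewHexagon.act_p' (hS : IsSkewHexagon H P Q T) (k : Fin 3) :
    hact (H k) (nul (P (k + 2))) = Real.exp (-(2 * T k (k + 2))) • nul (Q (k + 2)) := by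
  have := congrArg (hact (H k)) (hS.act_q k)
  rw [hact_half_turn (hS.sq k), hact_smul] at this
  rw [this, smul_smul, ← Real.exp_add]; simp

lemma IsSkewHexagon.hact_mem_cone (hS : IsSkewHexagon H P Q T) {j k : Fin 3} (hk : k ≠ j)
    {M : Herm} (hM : M ∈ cone P Q j) : hact (H k) M ∈ cone P Q j := by
  obtain ⟨a, b, ha, hb, rfl⟩ := hM
  rcases eq_or_eq_add j k with rfl | rfl | rfl
  · exact absurd rfl hk
  · refine ⟨b * Real.exp (-(2 * T k (k + 1))), a * Real.exp (2 * T k (k + 1)),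
      mul_pos hb (Real.exp_pos _), mul_pos ha (Real.exp_pos _), ?_⟩
    rw [hact_add, hact_smul, hact_smul, hS.act_p, hS.act_q', smul_smul, smul_smul, add_comm]
  · refine ⟨b * Real.exp (2 * T k (k + 2)), a * Real.exp (-(2 * T k (k + 2))),
      mul_pos hb (Real.exp_pos _), mul_pos ha (Real.exp_pos _), ?_⟩
    rw [hact_add, hact_smul, hact_smul, hS.act_p', hS.act_q, smul_smul, smul_smul, add_comm]

lemma IsSkewHexagon.hact_wprod_mem_cone (hS : IsSkewHexagon H P Q T) {j : Fin 3}
    {l : List (Fin 3)} (hl : ∀ k ∈ l, k ≠ j) {M : Herm} (hM : M ∈ cone P Q j) :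
    hact (wprod H l) M ∈ cone P Q j := by
  induction l with
  | nil => simpa [hact_one] using hM
  | cons k l ih =>
    rw [wprod_cons, hact_mul]
    exact hS.hact_mem_cone (hl k (by simp)) (ih fun i hi => hl i (by simp [hi]))

lemma Hexagon.piece_mem_cone {x : Fin 3 → ℝ} (hx : Hexagon x) (h0 : x ≠ 0) {j : Fin 3}
    (hj : x j = 0) : piece T P Q x ∈ cone P Q j := by
  have hs := (hx.slack h0 j).1
  have b1 := hx.2 (j + 1)
  have b2 := hx.2 (j + 2)
  rw [add_one_one, add_one_two, hj] at b1
  rw [add_two_one, add_two_two, hj] at b2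
  have c1 : 0 < x (j + 1) := by by_contra h; linarith
  have c2 : 0 < x (j + 2) := by by_contra h; linarith
  have hr : ratio j x = 0 := by simp [ratio, hj]
  have w0 : weight j x = x (j + 1) * x (j + 2) := by
    simp [weight, hr, cut_eq_one, glide_eq_zero (show (0 : ℝ) ≤ 3 / 4 by norm_num)]
  have w1 : weight (j + 1) x = 0 := by simp [weight, add_one_two, hj]
  have w2 : weight (j + 2) x = 0 := by simp [weight, add_two_one, hj]
  have hw : 0 < weight j x := by rw [w0]; positivity
  refine ⟨weight j x * Real.exp (position (fun k j => reach (T k j)) j x),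
    weight j x * Real.exp (-position (fun k j => reach (T k j)) j x),
    mul_pos hw (Real.exp_pos _), mul_pos hw (Real.exp_pos _), ?_⟩
  rw [piece, surf, Finset.sum_eq_single j]
  · intro i _ hi
    rcases eq_or_eq_add i j with rfl | rfl | rfl
    · exact absurd rfl hi
    · simp [w1]
    · simp [w2]
  · simp

/-- The boundary lines are developed onto geodesics. -/
lemma IsSkewHexagon.develop_boundaryLine (hS : IsSkewHexagon H P Q T) {ρ : PantsGroup →* G}
    (h0 : ρ (FreeGroup.of 0) = proj (H 0 * H 1)) (h1 : ρ (FreeGroup.of 1) = proj (H 1 * H 2))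
    (n : Fin 3) : IsGeodesicLine
      ((fun z : UpperHalfPlane => develop H P Q T z) '' symPants.boundaryLine n) := by
  set j := n + 2 with hj
  set δ := P j 0 * Q j 1 - P j 1 * Q j 0 with hδ
  have hδ0 : δ ≠ 0 := hS.det j
  let g : SL(2, ℂ) := ⟨!![P j 0, Q j 0 / δ; P j 1, Q j 1 / δ], by
    rw [Matrix.det_fin_two_of]; field_simp; rw [hδ]; ring⟩
  have hg : ∀ t : ℝ, hact g (hmat ((0 : ℂ), t))
      = t ^ 2 • nul (P j) + (1 / Complex.normSq δ) • nul (Q j) := by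
    intro t
    have e1 : hmat ((0 : ℂ), t) = t ^ 2 • nul ![1, 0] + (1 : ℝ) • nul ![0, 1] := by
      simp [hmat, nul]
    rw [e1, hact_add, hact_smul, hact_smul, hact_nul, hact_nul, one_smul]
    congr 2
    · congr 1; ext i; fin_cases i <;> simp [g, Matrix.mulVec, dotProduct, Fin.sum_univ_two]
    · have : ((g : Matrix (Fin 2) (Fin 2) ℂ) *ᵥ ![0, 1]) = δ⁻¹ • Q j := by
        ext i; fin_cases i <;>
          simp [g, Matrix.mulVec, dotProduct, Fin.sum_univ_two, div_eq_inv_mul]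
      rw [this, nul_smul, map_inv₀, one_div]
  have hN : 0 < Complex.normSq δ := Complex.normSq_pos.2 hδ0
  have hcone : ∀ M ∈ cone P Q j, ∃ t : ℝ, 0 < t ∧ uhs M = poincare g (0, t) := by
    rintro M ⟨a, b, ha, hb, rfl⟩
    refine ⟨√(a / (b * Complex.normSq δ)), Real.sqrt_pos.2 (by positivity), ?_⟩
    have ht : (0 : ℝ) < ((0 : ℂ), √(a / (b * Complex.normSq δ))).2 :=
      Real.sqrt_pos.2 (by positivity)
    rw [← uhs_hmat (p := (0, √(a / (b * Complex.normSq δ)))) ht, poincare_uhs _ (hpos_hmat ht), hg,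
      Real.sq_sqrt (by positivity)]
    have e : a • nul (P j) + b • nul (Q j) = (b * Complex.normSq δ) •
        ((a / (b * Complex.normSq δ)) • nul (P j) + (1 / Complex.normSq δ) • nul (Q j)) := by
      rw [smul_add, smul_smul, smul_smul]
      congr 2 <;> field_simp
    rw [e, uhs_smul (by positivity)]
  have hline : ∀ z ∈ symPants.boundaryLine n, ∃ l, Good T P Q (wact l (coords z)) ∧
      develop H P Q T z ∈ uhs '' cone P Q j := by
    intro z hz
    rw [mem_boundaryLine] at hz
    obtain ⟨l, hl, hx, hxj⟩ := exists_hexagon_of_line hz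
    have hx0 := coords_ne_zero z l
    have hgood : Good T P Q (wact l (coords z)) := ⟨hx.slack hx0, hx.piece_pos hS.det hx0⟩
    refine ⟨l, hgood, _, ?_, (hS.develop_eq hgood).symm⟩
    exact hS.hact_wprod_mem_cone (fun k hk => hl k (by simpa using hk)) (hx.piece_mem_cone hx0 hxj)
  have hdev : ∀ z ∈ symPants.boundaryLine n, ∃ t : ℝ, 0 < t ∧
      develop H P Q T z = poincare g (0, t) := by
    intro z hz
    obtain ⟨-, -, M, hM, e⟩ := hline z hz
    obtain ⟨t, ht, e'⟩ := hcone M hM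
    exact ⟨t, ht, e.symm.trans e'⟩
  -- The height in the frame `g`, in which the geodesic is vertical, is a continuous parameter on
  -- the developed line.
  set τ : UpperHalfPlane → ℝ := fun z => (poincare g⁻¹ (develop H P Q T z)).2 with hτ
  have hτ1 : ∀ z ∈ symPants.boundaryLine n, 0 < τ z ∧
      develop H P Q T z = poincare g (0, τ z) := by
    intro z hz
    obtain ⟨t, ht, e⟩ := hdev z hz
    have : τ z = t := by
      have ht' : (0 : ℝ) < ((0 : ℂ), t).2 := ht
      simp only [hτ]
      rw [e, ← poincare_mul _ _ ht', inv_mul_cancel, ← uhs_hmat ht',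
        poincare_uhs _ (hpos_hmat ht'), hact_one, uhs_hmat ht']
    rw [this]
    exact ⟨ht, e⟩
  have hcont : ContinuousOn τ (symPants.boundaryLine n) := by
    intro z hz
    obtain ⟨l, hl, -⟩ := hline z hz
    refine ContinuousAt.continuousWithinAt ?_
    have e1 : τ =ᶠ[nhds z] fun w : UpperHalfPlane =>
        (uhs (hact g⁻¹ (hact (wprod H l.reverse) (piece T P Q (wact l (coords w)))))).2 := by
      have := UpperHalfPlane.continuous_coe.continuousAt.eventually
        (hS.develop_eventually z.im_pos hl)
      filter_upwards [this] with w hw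
      simp only [hτ]
      rw [hw.2.2, poincare_uhs _ (hw.2.1.2.hact _)]
    refine ContinuousAt.congr ?_ e1.symm
    refine continuous_snd.continuousAt.comp ?_
    refine ContinuousAt.comp (g := uhs) (contDiffAt_uhs ((hl.2.hact _).hact _)).continuousAt ?_
    refine (hactL g⁻¹).continuous.continuousAt.comp ((hactL _).continuous.continuousAt.comp ?_)
    refine ContinuousAt.comp (g := piece T P Q) (contDiffAt_piece T P Q hl.1).continuousAt ?_
    exact ContinuousAt.comp (g := fun z => wact l (coords z))
      (contDiffAt_wact_coords l z.im_pos.ne').continuousAt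
      UpperHalfPlane.continuous_coe.continuousAt
  have hρ : proj (H n * H (n + 1)) = ρ (bdry n) := by
    rcases fin_three_cases n with rfl | rfl | rfl
    · exact h0.symm
    · exact h1.symm
    · have e : ρ (bdry 2) = (ρ (FreeGroup.of 0) * ρ (FreeGroup.of 1))⁻¹ := by
        simp [bdry]
      rw [e, h0, h1]
      change _ = proj (H 0 * H 1 * (H 1 * H 2))⁻¹
      refine proj_eq_proj.2 (Or.inr ?_)
      -- `H 0 * H 1 * (H 1 * H 2)` is `-(H 0 * H 2)`, whose inverse is `H 2 * H 0` up to sign; the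
      -- sign disappears in PSL₂.
      rw [← inv_neg, eq_inv_iff_mul_eq_one]
      have e1 : H 2 * H (2 + 1) * -(H 0 * H 1 * (H 1 * H 2))
          = -(H 2 * ((H 0 * H 0) * (H 1 * H 1) * H 2)) := by
        simp only [Fin.isValue, Fin.reduceAdd, mul_neg, mul_assoc]
      rw [e1, hS.sq, hS.sq]
      simp [hS.sq]
  -- Two half-turns about feet on the same geodesic compose to a translation along it, here
  -- multiplication of the height by `exp S` with `S > 0`.
  set S := 2 * T (n + 1) (n + 1 + 1) + 2 * T n (n + 2) with hSdef
  have hact1 : hact (H n * H (n + 1)) (nul (P j)) = Real.exp S • nul (P j) := by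
    rw [hact_mul, hj, ← add_one_one, hS.act_p, hact_smul, add_one_one, hS.act_q, smul_smul,
      ← Real.exp_add, hSdef, add_one_one]
  have hact2 : hact (H n * H (n + 1)) (nul (Q j)) = Real.exp (-S) • nul (Q j) := by
    rw [hact_mul, hj, ← add_one_one, hS.act_q', hact_smul, add_one_one, hS.act_p', smul_smul,
      ← Real.exp_add, hSdef, add_one_one]
    congr 2; ring
  have hS0 : 0 < S := by
    have := hS.two_le (n + 1) (n + 1 + 1)
    have := hS.two_le n (n + 2)
    linarith
  have hmul : ∀ t : ℝ, 0 < t → poincare (H n * H (n + 1)) (poincare g (0, t))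
      = poincare g (0, Real.exp S * t) := by
    intro t ht
    have ht' : (0 : ℝ) < ((0 : ℂ), t).2 := ht
    have ht2 : (0 : ℝ) < ((0 : ℂ), Real.exp S * t).2 := mul_pos (Real.exp_pos _) ht
    rw [← uhs_hmat ht', ← uhs_hmat ht2, poincare_uhs _ (hpos_hmat ht'),
      poincare_uhs _ (hpos_hmat ht2), poincare_uhs _ ((hpos_hmat ht').hact _), hg, hg, hact_add,
      hact_smul, hact_smul, hact1, hact2, ← uhs_smul (Real.exp_pos S), smul_add]
    simp only [smul_smul]
    have e1 : Real.exp S * (t ^ 2 * Real.exp S) = (Real.exp S * t) ^ 2 := by ring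
    have e2 : Real.exp S * (1 / Complex.normSq δ * Real.exp (-S)) = 1 / Complex.normSq δ := by
      rw [Real.exp_neg]; field_simp
    rw [e1, e2]
  have hstep : ∀ z ∈ symPants.boundaryLine n,
      (symPants.hol (bdry n) • z) ∈ symPants.boundaryLine n ∧
        τ (symPants.hol (bdry n) • z) = Real.exp S * τ z := by
    intro z hz
    obtain ⟨l, hl, -⟩ := hline z hz
    have hz' : symPants.hol (bdry n) • z ∈ symPants.boundaryLine n := by
      rw [mem_boundaryLine] at hz ⊢
      rw [coords_bdry, refl_of_ne (add_two_ne n), refl_of_ne (add_one_ne_add_two n).symm, hz]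
    refine ⟨hz', ?_⟩
    have e1 := hS.develop_equivariant h0 h1 (bdry n) hρ hl
    obtain ⟨p1, p2⟩ := hτ1 z hz
    have p3 : (0 : ℝ) < ((0 : ℂ), Real.exp S * τ z).2 := mul_pos (Real.exp_pos _) p1
    rw [p2, hmul _ p1] at e1
    have : τ (symPants.hol (bdry n) • z)
        = (poincare g⁻¹ (poincare g (0, Real.exp S * τ z))).2 := by
      rw [← e1]
    rw [this, ← poincare_mul _ _ p3, inv_mul_cancel, ← uhs_hmat p3, poincare_uhs _ (hpos_hmat p3),
      hact_one, uhs_hmat p3]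
  have hstep' : ∀ z ∈ symPants.boundaryLine n, ∃ w ∈ symPants.boundaryLine n,
      τ w = Real.exp (-S) * τ z := by
    intro z hz
    have hz' : (symPants.hol (bdry n))⁻¹ • z ∈ symPants.boundaryLine n := by
      rw [mem_boundaryLine] at hz ⊢
      have := coords_bdry n ((symPants.hol (bdry n))⁻¹ • z)
      rw [smul_inv_smul] at this
      rw [this, refl_of_ne (add_two_ne n), refl_of_ne (add_one_ne_add_two n).symm] at hz
      exact hz
    refine ⟨_, hz', ?_⟩
    have := (hstep _ hz').2
    rw [smul_inv_smul] at this
    rw [this, ← mul_assoc, ← Real.exp_add]; simp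
  have hup : ∀ (z : UpperHalfPlane), z ∈ symPants.boundaryLine n → ∀ m : ℕ,
      (∃ w ∈ symPants.boundaryLine n, τ w = Real.exp S ^ m * τ z) ∧
      ∃ w ∈ symPants.boundaryLine n, τ w = Real.exp (-S) ^ m * τ z := by
    intro z hz m
    induction m with
    | zero => exact ⟨⟨z, hz, by simp⟩, ⟨z, hz, by simp⟩⟩
    | succ m ih =>
      obtain ⟨⟨w, hw, e⟩, ⟨w', hw', e'⟩⟩ := ih
      obtain ⟨a, b⟩ := hstep w hw
      obtain ⟨v, a', b'⟩ := hstep' w' hw'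
      exact ⟨⟨_, a, by rw [b, e, pow_succ]; ring⟩, ⟨v, a', by rw [b', e', pow_succ]; ring⟩⟩
  have hconn := isConnected_boundaryLine n
  -- The set of heights is an interval by connectedness and is stable under multiplication by `exp
  -- S` and `exp (-S)`, hence it is the whole half-line: the image is the complete geodesic.
  have hord : (τ '' symPants.boundaryLine n).OrdConnected :=
    (hconn.isPreconnected.image τ hcont).ordConnected
  refine ⟨g, Set.Subset.antisymm ?_ ?_⟩
  · rintro _ ⟨z, hz, rfl⟩
    obtain ⟨h2, h3⟩ := hτ1 z hz
    exact ⟨(0, τ z), ⟨rfl, h2⟩, h3.symm⟩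
  · rintro _ ⟨⟨c, t⟩, ⟨hc, ht⟩, rfl⟩
    simp only at hc ht
    subst hc
    obtain ⟨z, hz⟩ := hconn.nonempty
    have hz1 := (hτ1 z hz).1
    have hexp : 1 < Real.exp S := Real.one_lt_exp_iff.2 hS0
    obtain ⟨m, hm⟩ := pow_unbounded_of_one_lt (t / τ z) hexp
    obtain ⟨k, hk⟩ := pow_unbounded_of_one_lt (τ z / t) hexp
    obtain ⟨w, hw, ew⟩ := (hup z hz m).1
    obtain ⟨w', hw', ew'⟩ := (hup z hz k).2
    have l1 : t ≤ τ w := by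
      rw [ew]; rw [div_lt_iff₀ hz1] at hm; exact hm.le
    have l2 : τ w' ≤ t := by
      rw [ew', Real.exp_neg, inv_pow, inv_mul_le_iff₀ (by positivity)]
      rw [div_lt_iff₀ ht] at hk; exact hk.le
    obtain ⟨y, hy, ey⟩ := hord.out ⟨w', hw', rfl⟩ ⟨w, hw, rfl⟩ ⟨l2, l1⟩
    exact ⟨y, hy, by rw [← ey]; exact (hτ1 y hy).2⟩

/-- A skew hexagon whose half-turns generate `ρ` defines a surface with holonomy `ρ`. -/
theorem IsSkewHexagon.isPantsHolonomy (hS : IsSkewHexagon H P Q T) {ρ : PantsGroup →* G}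
    (h0 : ρ (FreeGroup.of 0) = proj (H 0 * H 1)) (h1 : ρ (FreeGroup.of 1) = proj (H 1 * H 2)) :
    IsPantsHolonomy ρ := by
  have hcov : ∀ z ∈ symPants.cover, ∃ l, Hexagon (wact l (coords z)) ∧
      Good T P Q (wact l (coords z)) := by
    intro z hz
    obtain ⟨l, hl⟩ := exists_hexagon_of_cover hz
    have hx0 := coords_ne_zero z l
    exact ⟨l, hl, hl.slack hx0, hl.piece_pos hS.det hx0⟩
  refine ⟨symPants, {z | 0 < z.im ∧ ∃ l, Good T P Q (wact l (coords z))}, develop H P Q T, ?_, ?_,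
    ?_, ?_, ?_, hS.develop_boundaryLine h0 h1⟩
  · rw [isOpen_iff_eventually]
    rintro z ⟨hz, l, hl⟩
    filter_upwards [hS.develop_eventually hz hl] with w hw using ⟨hw.1, l, hw.2.1⟩
  · intro z hz
    obtain ⟨l, -, hl⟩ := hcov z hz
    exact ⟨z.im_pos, l, hl⟩
  · rintro z ⟨hz, l, hl⟩
    refine ContDiffAt.contDiffWithinAt ?_
    have e1 : develop H P Q T =ᶠ[nhds z] fun w =>
        uhs (hact (wprod H l.reverse) (piece T P Q (wact l (coords w)))) := by
      filter_upwards [hS.develop_eventually hz hl] with w hw using hw.2.2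
    refine ContDiffAt.congr_of_eventuallyEq ?_ e1
    refine ContDiffAt.comp z (g := uhs) (contDiffAt_uhs (hl.2.hact _)) ?_
    refine (hactL (wprod H l.reverse)).contDiff.contDiffAt.comp z ?_
    exact ContDiffAt.comp z (g := piece T P Q) (contDiffAt_piece T P Q hl.1)
      (contDiffAt_wact_coords l hz.ne')
  · intro z hz
    obtain ⟨l, hl, hg⟩ := hcov z hz
    refine ⟨?_, hS.injective_fderiv_develop z.im_pos hl (coords_ne_zero z l)⟩
    rw [hS.develop_eq hg]
    exact uhs_pos (hg.2.hact _)
  · intro w g hg z hz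
    obtain ⟨l, -, hl⟩ := hcov z hz
    exact hS.develop_equivariant h0 h1 w hg hl

end

/-! ### Frames along the axes of a triple with product `-1` -/

/-- Translation and rotation about the geodesic directed by the second vector. -/
def turnSL (η : ℂ) : SL(2, ℂ) :=
  ⟨!![Complex.cosh (η / 2), Complex.sinh (η / 2); Complex.sinh (η / 2), Complex.cosh (η / 2)], by
    rw [Matrix.det_fin_two_of]
    linear_combination Complex.cosh_sq_sub_sinh_sq (η / 2)⟩

lemma sl_ext {g h : SL(2, ℂ)} (h00 : g 0 0 = h 0 0) (h01 : g 0 1 = h 0 1) (h10 : g 1 0 = h 1 0)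
    (h11 : g 1 1 = h 1 1) : g = h := by
  ext i j
  fin_cases i <;> fin_cases j <;> assumption

lemma sl_inv_apply (g : SL(2, ℂ)) : (g⁻¹ 0 0 = g 1 1 ∧ g⁻¹ 0 1 = -g 0 1) ∧
    g⁻¹ 1 0 = -g 1 0 ∧ g⁻¹ 1 1 = g 0 0 := by
  simp [Matrix.SpecialLinearGroup.coe_inv, Matrix.adjugate_fin_two]

lemma cosh_add_sinh_half (l : ℂ) : Complex.exp (2 * l / 2) = Complex.cosh l + Complex.sinh l := by
  rw [Complex.cosh_add_sinh]; congr 1; ring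

lemma cosh_sub_sinh_half (l : ℂ) :
    Complex.exp (-(2 * l / 2)) = Complex.cosh l - Complex.sinh l := by
  rw [Complex.cosh_sub_sinh]; congr 1; ring

lemma cosh_eq_half (η : ℂ) :
    Complex.cosh η = Complex.cosh (η / 2) ^ 2 + Complex.sinh (η / 2) ^ 2 := by
  rw [← Complex.cosh_two_mul]; congr 1; ring

lemma sinh_eq_half (η : ℂ) :
    Complex.sinh η = 2 * Complex.sinh (η / 2) * Complex.cosh (η / 2) := by
  rw [← Complex.sinh_two_mul]; congr 1; ring

/-- The translation of length `2l` along the image of the axis of `diagSL` by `turnSL η`. -/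
lemma turn_diag_turn (η l : ℂ) :
    ((turnSL η * diagSL (2 * l) * (turnSL η)⁻¹) 0 0
        = Complex.cosh l + Complex.sinh l * Complex.cosh η ∧
      (turnSL η * diagSL (2 * l) * (turnSL η)⁻¹) 0 1 = -(Complex.sinh l * Complex.sinh η)) ∧
    (turnSL η * diagSL (2 * l) * (turnSL η)⁻¹) 1 0 = Complex.sinh l * Complex.sinh η ∧
    (turnSL η * diagSL (2 * l) * (turnSL η)⁻¹) 1 1
        = Complex.cosh l - Complex.sinh l * Complex.cosh η := by
  obtain ⟨⟨i1, i2⟩, i3, i4⟩ := sl_inv_apply (turnSL η)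
  have h := Complex.cosh_sq_sub_sinh_sq (η / 2)
  simp only [sl_mul_apply, i1, i2, i3, i4, cosh_eq_half η, sinh_eq_half η]
  simp only [turnSL, diagSL, Matrix.SpecialLinearGroup.coe_mk, Matrix.of_apply,
    Matrix.cons_val_zero, Matrix.cons_val_one, Matrix.cons_val', Matrix.cons_val_fin_one,
    cosh_add_sinh_half, cosh_sub_sinh_half]
  generalize Complex.cosh (η / 2) = c at *
  generalize Complex.sinh (η / 2) = d at *
  refine ⟨⟨?_, ?_⟩, ?_, ?_⟩
  · linear_combination Complex.cosh l * h
  · ring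
  · ring
  · linear_combination Complex.cosh l * h

lemma exists_eigenvector (M : SL(2, ℂ)) {x : ℂ} (hx : x ≠ 0) (ht : M 0 0 + M 1 1 = x + x⁻¹) :
    ∃ v : Fin 2 → ℂ, v ≠ 0 ∧ M 0 0 * v 0 + M 0 1 * v 1 = x * v 0 ∧
      M 1 0 * v 0 + M 1 1 * v 1 = x * v 1 := by
  have hdet : (!![M 0 0 - x, M 0 1; M 1 0, M 1 1 - x]).det = 0 := by
    rw [Matrix.det_fin_two_of]
    have h1 : x * x⁻¹ = 1 := mul_inv_cancel₀ hx
    linear_combination sl_det M - x * ht - h1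
  obtain ⟨v, hv, h⟩ := Matrix.exists_mulVec_eq_zero_iff.2 hdet
  refine ⟨v, hv, ?_, ?_⟩
  · have := congrFun h 0
    simp [Matrix.mulVec, dotProduct, Fin.sum_univ_two] at this
    linear_combination this
  · have := congrFun h 1
    simp [Matrix.mulVec, dotProduct, Fin.sum_univ_two] at this
    linear_combination this

/-- `sinh s ≠ 0` makes the eigenvalues `exp s` and `exp (-s)` distinct, so eigenvectors for them
form a basis. -/
lemma exists_diag {M : SL(2, ℂ)} {s : ℂ} (hs : Complex.sinh s ≠ 0)
    (ht : M 0 0 + M 1 1 = 2 * Complex.cosh s) :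
    ∃ g : SL(2, ℂ), M = g * diagSL (2 * s) * g⁻¹ := by
  have e1 : Complex.exp s = Complex.cosh s + Complex.sinh s := (Complex.cosh_add_sinh s).symm
  have e2 : Complex.exp (-s) = Complex.cosh s - Complex.sinh s := (Complex.cosh_sub_sinh s).symm
  obtain ⟨v, hv, v0, v1⟩ := exists_eigenvector M (Complex.exp_ne_zero s)
    (by rw [ht, ← Complex.exp_neg, e1, e2]; ring)
  obtain ⟨w, hw, w0, w1⟩ := exists_eigenvector M (Complex.exp_ne_zero (-s))
    (by rw [ht, ← Complex.exp_neg, neg_neg, e1, e2]; ring)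
  have hδ : v 0 * w 1 - v 1 * w 0 ≠ 0 := by
    intro h
    have hxy : Complex.exp s - Complex.exp (-s) ≠ 0 := by
      rw [e1, e2]; intro h; exact hs (by linear_combination h / 2)
    obtain ⟨c, hc⟩ : ∃ c : ℂ, w = c • v := by
      by_cases h0 : v 0 = 0
      · have h1 : v 1 ≠ 0 := fun h1 => hv (by ext i; fin_cases i <;> simp [h0, h1])
        refine ⟨w 1 / v 1, ?_⟩
        rw [h0] at h
        have h2 : w 0 = 0 := by
          have : v 1 * w 0 = 0 := by linear_combination -h
          exact (mul_eq_zero.1 this).resolve_left h1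
        ext i; fin_cases i <;> simp [h0, h1, h2]
      · refine ⟨w 0 / v 0, ?_⟩
        ext i; fin_cases i
        · simp [h0]
        · simp; field_simp; linear_combination h
    have hc0 : c ≠ 0 := by rintro rfl; exact hw (by simpa using hc)
    refine hv ?_
    rw [hc] at w0 w1
    simp only [Pi.smul_apply, smul_eq_mul] at w0 w1
    have g0 : c * (Complex.exp s - Complex.exp (-s)) * v 0 = 0 := by
      linear_combination w0 - c * v0
    have g1 : c * (Complex.exp s - Complex.exp (-s)) * v 1 = 0 := by
      linear_combination w1 - c * v1
    ext i; fin_cases i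
    · simpa [hc0, hxy] using g0
    · simpa [hc0, hxy] using g1
  let g : SL(2, ℂ) := ⟨!![v 0, w 0 / (v 0 * w 1 - v 1 * w 0);
    v 1, w 1 / (v 0 * w 1 - v 1 * w 0)], by
    rw [Matrix.det_fin_two_of]; field_simp⟩
  refine ⟨g, ?_⟩
  rw [eq_mul_inv_iff_mul_eq]
  have d1 : diagSL (2 * s) 0 0 = Complex.exp s := by simp [diagSL]
  have d2 : diagSL (2 * s) 1 1 = Complex.exp (-s) := by simp [diagSL]
  have d3 : diagSL (2 * s) 0 1 = 0 := by simp [diagSL]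
  have d4 : diagSL (2 * s) 1 0 = 0 := by simp [diagSL]
  have g1 : g 0 0 = v 0 := rfl
  have g2 : g 0 1 = w 0 / (v 0 * w 1 - v 1 * w 0) := rfl
  have g3 : g 1 0 = v 1 := rfl
  have g4 : g 1 1 = w 1 / (v 0 * w 1 - v 1 * w 0) := rfl
  apply sl_ext <;> simp only [sl_mul_apply, d1, d2, d3, d4, g1, g2, g3, g4]
  · linear_combination v0
  · linear_combination w0 / (v 0 * w 1 - v 1 * w 0)
  · linear_combination v1
  · linear_combination w1 / (v 0 * w 1 - v 1 * w 0)

lemma trace_conj (g M : SL(2, ℂ)) :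
    (g⁻¹ * M * g) 0 0 + (g⁻¹ * M * g) 1 1 = M 0 0 + M 1 1 := by
  obtain ⟨⟨i1, i2⟩, i3, i4⟩ := sl_inv_apply g
  simp only [sl_mul_apply, i1, i2, i3, i4]
  linear_combination (M 0 0 + M 1 1) * sl_det g

/-- In a suitable frame along the axis of `M`, the axes of `M'` and `M''` are obtained by moving
along the common perpendiculars, starting at points at distance `s`. -/
lemma exists_frame {M M' M'' : SL(2, ℂ)} {s l t η θ : ℂ} (h : M * M' * M'' = -1)
    (hM : M 0 0 + M 1 1 = 2 * Complex.cosh s) (hM' : M' 0 0 + M' 1 1 = 2 * Complex.cosh l)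
    (hM'' : M'' 0 0 + M'' 1 1 = 2 * Complex.cosh t) (hs : Complex.sinh s ≠ 0)
    (hη : Complex.sinh s * Complex.sinh l * Complex.cosh η
      = -(Complex.cosh t + Complex.cosh s * Complex.cosh l))
    (hθ : Complex.sinh s * Complex.sinh t * Complex.cosh θ
      = -(Complex.cosh l + Complex.cosh s * Complex.cosh t))
    (hηθ : Complex.sinh t * Complex.sinh θ = Complex.sinh l * Complex.sinh η)
    (h0 : Complex.sinh l * Complex.sinh η ≠ 0) :
    ∃ g : SL(2, ℂ), M = g * diagSL (2 * s) * g⁻¹ ∧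
      M' = g * (turnSL η * diagSL (2 * l) * (turnSL η)⁻¹) * g⁻¹ ∧
      M'' = g * diagSL s * (turnSL θ * diagSL (2 * t) * (turnSL θ)⁻¹) * (g * diagSL s)⁻¹ := by
  obtain ⟨g, hg⟩ := exists_diag hs hM
  have d1 : diagSL (2 * s) 0 0 = Complex.exp s := by simp [diagSL]
  have d2 : diagSL (2 * s) 1 1 = Complex.exp (-s) := by simp [diagSL]
  have d3 : diagSL (2 * s) 0 1 = 0 := by simp [diagSL]
  have d4 : diagSL (2 * s) 1 0 = 0 := by simp [diagSL]
  have e1 : Complex.exp s = Complex.cosh s + Complex.sinh s := (Complex.cosh_add_sinh s).symm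
  have e2 : Complex.exp (-s) = Complex.cosh s - Complex.sinh s := (Complex.cosh_sub_sinh s).symm
  have hss := Complex.cosh_sq_sub_sinh_sq s
  have hll := Complex.cosh_sq_sub_sinh_sq l
  have hηη := Complex.cosh_sq_sub_sinh_sq η
  set m := g⁻¹ * M' * g with hm
  have t1 : m 0 0 + m 1 1 = 2 * Complex.cosh l := by rw [hm, trace_conj, hM']
  have hM2 : M'' = -(M * M')⁻¹ := by
    rw [eq_inv_mul_of_mul_eq h, mul_neg_one]
  -- Since `M'' = -(M * M')⁻¹`, its trace is minus that of `M * M'`. Together with the trace of `M'`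
  -- this determines the diagonal of `m`, and the determinant then gives the product of the
  -- off-diagonal entries.
  have t2 : Complex.exp s * m 0 0 + Complex.exp (-s) * m 1 1 = -(2 * Complex.cosh t) := by
    have hc : g⁻¹ * (M * M') * g = diagSL (2 * s) * m := by rw [hg, hm]; group
    have := trace_conj g (M * M')
    rw [hc] at this
    simp only [sl_mul_apply (diagSL (2 * s)), d1, d2, d3, d4] at this
    obtain ⟨⟨i1, i2⟩, i3, i4⟩ := sl_inv_apply (M * M')
    have e3 : M'' 0 0 = -(M * M') 1 1 := by rw [hM2, ← i1]; rfl
    have e4 : M'' 1 1 = -(M * M') 0 0 := by rw [hM2, ← i4]; rfl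
    rw [e3, e4] at hM''
    linear_combination this - hM''
  have m00 : m 0 0 = Complex.cosh l + Complex.sinh l * Complex.cosh η := by
    have : Complex.sinh s * (m 0 0 - (Complex.cosh l + Complex.sinh l * Complex.cosh η)) = 0 := by
      rw [e1, e2] at t2
      linear_combination t2 / 2 - (Complex.cosh s - Complex.sinh s) / 2 * t1 - hη
    linear_combination (mul_eq_zero.1 this).resolve_left hs
  have m11 : m 1 1 = Complex.cosh l - Complex.sinh l * Complex.cosh η := by
    linear_combination t1 - m00
  have m01 : m 0 1 * m 1 0 = -(Complex.sinh l * Complex.sinh η) ^ 2 := by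
    have := sl_det m
    rw [m00, m11] at this
    linear_combination hll - this - Complex.sinh l ^ 2 * hηη
  have hm01 : m 0 1 ≠ 0 := by
    intro h
    rw [h, zero_mul, zero_eq_neg] at m01
    exact h0 (pow_eq_zero_iff (two_ne_zero) |>.1 m01)
  -- Conjugation by diagonal matrices is still free: it fixes `M` and rescales the off-diagonal
  -- entries of `m` inversely to each other, so a square root brings them to the wanted values.
  obtain ⟨z, hz⟩ := IsAlgClosed.exists_pow_nat_eq
    (m 0 1 / -(Complex.sinh l * Complex.sinh η)) two_pos
  have hz0 : z ≠ 0 := by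
    rintro rfl
    rw [zero_pow two_ne_zero, eq_comm, div_eq_zero_iff] at hz
    rcases hz with h | h
    · exact hm01 h
    · exact h0 (neg_eq_zero.1 h)
  let Z : SL(2, ℂ) := ⟨!![z, 0; 0, z⁻¹], by rw [Matrix.det_fin_two_of]; simp [hz0]⟩
  obtain ⟨⟨i1, i2⟩, i3, i4⟩ := sl_inv_apply Z
  have z1 : Z 0 0 = z := rfl
  have z2 : Z 0 1 = 0 := rfl
  have z3 : Z 1 0 = 0 := rfl
  have z4 : Z 1 1 = z⁻¹ := rfl
  have hz' : z ^ 2 * -(Complex.sinh l * Complex.sinh η) = m 0 1 := by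
    rw [hz, div_mul_cancel₀ _ (neg_ne_zero.2 h0)]
  obtain ⟨⟨k1, k2⟩, k3, k4⟩ := turn_diag_turn η l
  have hdiag : Z * diagSL (2 * s) * Z⁻¹ = diagSL (2 * s) := by
    apply sl_ext <;> simp only [sl_mul_apply, i1, i2, i3, i4, z1, z2, z3, z4, d1, d2, d3, d4] <;>
      field_simp <;> ring
  have hZm : m = Z * (turnSL η * diagSL (2 * l) * (turnSL η)⁻¹) * Z⁻¹ := by
    rw [eq_mul_inv_iff_mul_eq]
    apply sl_ext <;> rw [sl_mul_apply m, sl_mul_apply Z] <;>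
      simp only [k1, k2, k3, k4, z1, z2, z3, z4]
    · linear_combination z * m00
    · field_simp
      linear_combination -hz'
    · have : m 1 0 * z ^ 2 = Complex.sinh l * Complex.sinh η := by
        have h3 : -(Complex.sinh l * Complex.sinh η) * (m 1 0 * z ^ 2
            - Complex.sinh l * Complex.sinh η) = 0 := by
          linear_combination m 1 0 * hz' + m01
        linear_combination (mul_eq_zero.1 h3).resolve_left (neg_ne_zero.2 h0)
      field_simp
      linear_combination this
    · linear_combination z⁻¹ * m11
  have f1 : M = g * Z * diagSL (2 * s) * (g * Z)⁻¹ := by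
    calc M = g * (Z * diagSL (2 * s) * Z⁻¹) * g⁻¹ := by rw [hdiag, hg]
      _ = _ := by group
  have f2 : M' = g * Z * (turnSL η * diagSL (2 * l) * (turnSL η)⁻¹) * (g * Z)⁻¹ := by
    calc M' = g * m * g⁻¹ := by rw [hm]; group
      _ = _ := by rw [hZm]; group
  refine ⟨g * Z, f1, f2, ?_⟩
  obtain ⟨⟨q1, q2⟩, q3, q4⟩ := turn_diag_turn θ t
  set W := turnSL η * diagSL (2 * l) * (turnSL η)⁻¹ with hW
  obtain ⟨⟨j1, j2⟩, j3, j4⟩ := sl_inv_apply W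
  have c1 : diagSL s 0 0 = Complex.exp (s / 2) := by simp [diagSL]
  have c2 : diagSL s 1 1 = Complex.exp (-(s / 2)) := by simp [diagSL]
  have c3 : diagSL s 0 1 = 0 := by simp [diagSL]
  have c4 : diagSL s 1 0 = 0 := by simp [diagSL]
  obtain ⟨⟨b1, b2⟩, b3, b4⟩ := sl_inv_apply (diagSL s)
  have hx1 : Complex.exp (-(s / 2)) * Complex.exp (s / 2) = 1 := by
    rw [← Complex.exp_add]; simp
  have hx2 : Complex.exp (-(s / 2)) * Complex.exp (-(s / 2)) = Complex.cosh s - Complex.sinh s := by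
    rw [← e2, ← Complex.exp_add]; congr 1; ring
  have hx3 : Complex.exp (s / 2) * Complex.exp (s / 2) = Complex.cosh s + Complex.sinh s := by
    rw [← e1, ← Complex.exp_add]; congr 1; ring
  have hD : diagSL (2 * s) = diagSL s * diagSL s := by
    apply sl_ext <;> simp only [sl_mul_apply, c1, c2, c3, c4, d1, d2, d3, d4]
    · linear_combination e1 - hx3
    · ring
    · ring
    · linear_combination e2 - hx2
  -- Splitting `diagSL (2 * s)` into two equal factors turns `M''` into a conjugate by `g * diagSL
  -- s`. The second cosine rule `hθ` gives the diagonal entries and the sine rule `hηθ` the others;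
  -- the minus sign is the sign of the product of the triple.
  have key : turnSL θ * diagSL (2 * t) * (turnSL θ)⁻¹ = -((diagSL s)⁻¹ * W⁻¹ * (diagSL s)⁻¹) := by
    have hneg : ∀ X : SL(2, ℂ), ∀ i j, (-X) i j = -(X i j) := fun X i j => rfl
    have hent : ∀ i j, ((diagSL s)⁻¹ * W⁻¹ * (diagSL s)⁻¹) i j
        = ((diagSL s)⁻¹ i 0 * W⁻¹ 0 0 + (diagSL s)⁻¹ i 1 * W⁻¹ 1 0) * (diagSL s)⁻¹ 0 j
          + ((diagSL s)⁻¹ i 0 * W⁻¹ 0 1 + (diagSL s)⁻¹ i 1 * W⁻¹ 1 1) * (diagSL s)⁻¹ 1 j :=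
      fun i j => by simp only [sl_mul_apply]
    apply sl_ext
    · rw [q1, hneg, hent]
      simp only [b1, b2, b3, j1, j2, j3, j4, k1, k2, k3, k4, c2, c3, c4]
      refine mul_left_cancel₀ hs ?_
      linear_combination hθ
        + Complex.sinh s * (Complex.cosh l - Complex.sinh l * Complex.cosh η) * hx2
        - (Complex.cosh s - Complex.sinh s) * hη + Complex.cosh l * hss
    · rw [q2, hneg, hent]
      simp only [b1, b2, b4, j1, j2, j3, j4, k1, k2, k3, k4, c1, c2, c3]
      linear_combination -hηθ + Complex.sinh l * Complex.sinh η * hx1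
    · rw [q3, hneg, hent]
      simp only [b1, b3, b4, j1, j2, j3, j4, k1, k2, k3, k4, c1, c2, c4]
      linear_combination hηθ - Complex.sinh l * Complex.sinh η * hx1
    · rw [q4, hneg, hent]
      simp only [b2, b3, b4, j1, j2, j3, j4, k1, k2, k3, k4, c1, c3, c4]
      refine mul_left_cancel₀ hs ?_
      linear_combination -hθ
        + Complex.sinh s * (Complex.cosh l + Complex.sinh l * Complex.cosh η) * hx3
        + (Complex.cosh s + Complex.sinh s) * hη - Complex.cosh l * hss
  have hneg : ∀ X Y Z : SL(2, ℂ), X * -Y * Z = -(X * Y * Z) := fun X Y Z => by simp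
  rw [hM2, key, f1, f2, hD, hneg]
  congr 1
  group

/-! ### Estimates of arguments -/

/-- Complex numbers with an argument of absolute value at most `t`. -/
def Sector (t : ℝ) (z : ℂ) : Prop := ∃ ζ : ℂ, Complex.exp ζ = z ∧ |ζ.im| ≤ t

lemma Sector.mul {t u : ℝ} {z w : ℂ} (h : Sector t z) (h' : Sector u w) :
    Sector (t + u) (z * w) := by
  obtain ⟨a, rfl, ha⟩ := h
  obtain ⟨b, rfl, hb⟩ := h'
  exact ⟨a + b, Complex.exp_add a b, (abs_add_le _ _).trans (add_le_add ha hb)⟩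

lemma Sector.div {t u : ℝ} {z w : ℂ} (h : Sector t z) (h' : Sector u w) :
    Sector (t + u) (z / w) := by
  obtain ⟨a, rfl, ha⟩ := h
  obtain ⟨b, rfl, hb⟩ := h'
  exact ⟨a - b, Complex.exp_sub a b, (abs_sub _ _).trans (add_le_add ha hb)⟩

lemma Sector.mono {t u : ℝ} {z : ℂ} (h : Sector t z) (htu : t ≤ u) : Sector u z :=
  let ⟨a, ha, hb⟩ := h; ⟨a, ha, hb.trans htu⟩

lemma Sector.ne_zero {t : ℝ} {z : ℂ} (h : Sector t z) : z ≠ 0 := by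
  obtain ⟨a, rfl, -⟩ := h
  exact Complex.exp_ne_zero a

lemma Sector.exists_sq {t : ℝ} {z : ℂ} (h : Sector t z) : ∃ w, w ^ 2 = z ∧ Sector (t / 2) w := by
  obtain ⟨a, rfl, ha⟩ := h
  refine ⟨Complex.exp (a / 2), ?_, a / 2, rfl, ?_⟩
  · rw [sq, ← Complex.exp_add]; congr 1; ring
  · rw [Complex.div_ofNat_im, abs_div, abs_of_pos (by norm_num : (0 : ℝ) < 2)]
    linarith

lemma Sector.re_pos {t : ℝ} {z : ℂ} (h : Sector t z) (ht : t ≤ 1) : 0 < z.re := by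
  obtain ⟨a, rfl, ha⟩ := h
  rw [Complex.exp_re]
  refine mul_pos (Real.exp_pos _) (Real.cos_pos_of_mem_Ioo ?_)
  have h1 := Real.pi_gt_three
  obtain ⟨h2, h3⟩ := abs_le.1 ha
  constructor <;> linarith

lemma sector_ofReal {x : ℝ} (hx : 0 < x) : Sector 0 (x : ℂ) :=
  ⟨(Real.log x : ℝ), by rw [← Complex.ofReal_exp, Real.exp_log hx], by simp⟩

lemma sector_one_add {w : ℂ} {t : ℝ} (hw : ‖w‖ ≤ t) (ht : t ≤ 1 / 2) :
    Sector (3 / 2 * t) (1 + w) := by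
  refine ⟨Complex.log (1 + w), Complex.exp_log ?_, ?_⟩
  · intro h
    have : ‖w‖ = 1 := by rw [show w = -1 by linear_combination h]; simp
    linarith
  · exact (Complex.abs_im_le_norm _).trans
      ((Complex.norm_log_one_add_half_le_self (hw.trans ht)).trans (by linarith))

/-- Half-lengths with large real part and small imaginary part. -/
def Tame (s : ℂ) : Prop := 10 ≤ s.re ∧ |s.im| ≤ 1 / 20

lemma exp_neg_ten : Real.exp (-10) ≤ 1 / 1024 := by
  rw [Real.exp_neg, inv_eq_one_div]
  refine one_div_le_one_div_of_le (by norm_num) ?_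
  have h1 : (2 : ℝ) ≤ Real.exp 1 := by linarith [Real.add_one_le_exp (1 : ℝ)]
  calc (1024 : ℝ) = 2 ^ 10 := by norm_num
    _ ≤ Real.exp 1 ^ 10 := by gcongr
    _ = Real.exp 10 := by rw [← Real.exp_nat_mul]; norm_num

lemma Tame.norm_exp_neg {s : ℂ} (h : Tame s) : ‖Complex.exp (-s)‖ ≤ 1 / 1024 := by
  rw [Complex.norm_exp]
  refine le_trans (Real.exp_le_exp.2 ?_) exp_neg_ten
  have := h.1
  simp; linarith

lemma Tame.exists_sinh {s : ℂ} (h : Tame s) :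
    ∃ w : ℂ, ‖w‖ ≤ 1 / 1000 ∧ Complex.sinh s = Complex.exp s * ((1 / 2 : ℝ) : ℂ) * (1 + w) := by
  refine ⟨-(Complex.exp (-s) * Complex.exp (-s)), ?_, ?_⟩
  · rw [norm_neg, norm_mul]
    have := h.norm_exp_neg
    nlinarith [norm_nonneg (Complex.exp (-s))]
  · have : Complex.exp s * Complex.exp (-s) = 1 := by rw [← Complex.exp_add]; simp
    rw [Complex.sinh]
    push_cast
    linear_combination Complex.exp (-s) / 2 * this

lemma Tame.sector_exp {s : ℂ} (h : Tame s) : Sector (1 / 20) (Complex.exp s) := ⟨s, rfl, h.2⟩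

lemma Tame.sector_sinh {s : ℂ} (h : Tame s) : Sector (3 / 50) (Complex.sinh s) := by
  obtain ⟨w, hw, e⟩ := h.exists_sinh
  rw [e]
  exact ((h.sector_exp.mul (sector_ofReal (by norm_num))).mul
    (sector_one_add hw (by norm_num))).mono (by norm_num)

/-- `cosh (s - l)` has modulus at most 3 and is negligible against `exp t / 2`. -/
lemma exists_sum_cosh {s l t : ℂ} (ht : Tame t) (hsl : |s.re - l.re| ≤ 1) :
    ∃ w : ℂ, ‖w‖ ≤ 1 / 100 ∧ Complex.cosh t + Complex.cosh (s - l)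
      = Complex.exp t * ((1 / 2 : ℝ) : ℂ) * (1 + w) := by
  refine ⟨Complex.exp (-t) * Complex.exp (-t) + 2 * Complex.exp (-t) * Complex.cosh (s - l), ?_, ?_⟩
  · have h1 := ht.norm_exp_neg
    have h2 : ‖Complex.cosh (s - l)‖ ≤ 3 := by
      have h3 : ∀ z : ℂ, |z.re| ≤ 1 → ‖Complex.exp z‖ ≤ 3 := fun z hz => by
        rw [Complex.norm_exp]
        refine (Real.exp_le_exp.2 ((le_abs_self _).trans hz)).trans ?_
        linarith [Real.exp_one_lt_d9]
      rw [Complex.cosh, norm_div]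
      have h4 := h3 (s - l) (by simpa using hsl)
      have h5 := h3 (-(s - l)) (by rw [Complex.neg_re, abs_neg]; simpa using hsl)
      have h6 := norm_add_le (Complex.exp (s - l)) (Complex.exp (-(s - l)))
      rw [Complex.norm_two, div_le_iff₀ two_pos]
      linarith
    calc _ ≤ ‖Complex.exp (-t) * Complex.exp (-t)‖
          + ‖2 * Complex.exp (-t) * Complex.cosh (s - l)‖ :=
          norm_add_le _ _
      _ = ‖Complex.exp (-t)‖ * ‖Complex.exp (-t)‖
          + 2 * ‖Complex.exp (-t)‖ * ‖Complex.cosh (s - l)‖ := by simp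
      _ ≤ 1 / 1024 * (1 / 1024) + 2 * (1 / 1024) * 3 := by gcongr
      _ ≤ 1 / 100 := by norm_num
  · have : Complex.exp t * Complex.exp (-t) = 1 := by rw [← Complex.exp_add]; simp
    rw [Complex.cosh]
    push_cast
    linear_combination (-Complex.exp (-t) / 2 - Complex.cosh (s - l)) * this

/-- Take a logarithm of `-(1 + κ + S)`; by `h` the inverse of this number is `-(1 + κ) + S`. Its
real part is below -1, which gives both sign conditions. -/
lemma exists_arcosh {κ S : ℂ} (hκ : 0 < κ.re) (hS : 0 < S.re) (h : S ^ 2 = κ * (2 + κ)) :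
    ∃ η : ℂ, Complex.cosh η = -(1 + κ) ∧ Complex.sinh η = -S ∧ 0 < η.re
      ∧ (Complex.exp η).re < 0 := by
  have hre : (-(1 + κ + S)).re < -1 := by
    simp; linarith
  have h0 : -(1 + κ + S) ≠ 0 := by
    intro h; rw [h] at hre; simp at hre; linarith
  have e1 := Complex.exp_log h0
  have e2 : Complex.exp (-Complex.log (-(1 + κ + S))) = -(1 + κ) + S := by
    rw [Complex.exp_neg, e1, inv_eq_of_mul_eq_one_left]
    linear_combination -h
  refine ⟨Complex.log (-(1 + κ + S)), ?_, ?_, ?_, ?_⟩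
  · rw [Complex.cosh, e1, e2]; ring
  · rw [Complex.sinh, e1, e2]; ring
  · rw [Complex.log_re]
    refine Real.log_pos ?_
    have := Complex.abs_re_le_norm (-(1 + κ + S))
    have := neg_abs_le (-(1 + κ + S)).re
    linarith
  · rw [e1]; linarith

/-- Each hyperbolic function is half an exponential up to a factor near 1, so the arguments add up
to little, and the modulus is of order `exp (t.re - s.re - l.re)`. -/
lemma sector_kappa {s l t : ℂ} (hs : Tame s) (hl : Tame l) (ht : Tame t)
    (hsl : |s.re - l.re| ≤ 1) (hst : |s.re - t.re| ≤ 1) :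
    Sector (1 / 5) ((Complex.cosh t + Complex.cosh (s - l)) / (Complex.sinh s * Complex.sinh l)) ∧
    ‖(Complex.cosh t + Complex.cosh (s - l)) / (Complex.sinh s * Complex.sinh l)‖ ≤ 1 / 10 := by
  obtain ⟨w, hw, e⟩ := exists_sum_cosh ht hsl
  constructor
  · have h1 : Sector (3 / 40) (Complex.cosh t + Complex.cosh (s - l)) := by
      rw [e]
      exact ((ht.sector_exp.mul (sector_ofReal (by norm_num))).mul
        (sector_one_add hw (by norm_num))).mono (by norm_num)
    exact (h1.div (hs.sector_sinh.mul hl.sector_sinh)).mono (by norm_num)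
  · obtain ⟨a, ha, ea⟩ := hs.exists_sinh
    obtain ⟨b, hb, eb⟩ := hl.exists_sinh
    have hlow : ∀ a : ℂ, ‖a‖ ≤ 1 / 1000 → 9 / 10 ≤ ‖1 + a‖ := fun a ha => by
      have := norm_sub_norm_le (1 : ℂ) (-a)
      rw [sub_neg_eq_add, norm_neg, norm_one] at this
      linarith
    have h1 := hlow a ha
    have h2 := hlow b hb
    have h3 : ‖1 + w‖ ≤ 2 := (norm_add_le _ _).trans (by rw [norm_one]; linarith)
    have h4 : ‖Complex.exp t‖ ≤ 3 / 1024 * (‖Complex.exp s‖ * ‖Complex.exp l‖) := by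
      simp only [Complex.norm_exp]
      have h5 : t.re ≤ 1 + (-10) + (s.re + l.re) := by
        have := (abs_le.1 hst).1
        have := hl.1
        linarith
      calc Real.exp t.re ≤ Real.exp (1 + (-10) + (s.re + l.re)) := Real.exp_le_exp.2 h5
        _ = Real.exp 1 * Real.exp (-10) * (Real.exp s.re * Real.exp l.re) := by
          rw [Real.exp_add, Real.exp_add, Real.exp_add s.re]
        _ ≤ 3 * (1 / 1024) * (Real.exp s.re * Real.exp l.re) := by
          have := exp_neg_ten
          have := Real.exp_one_lt_d9
          gcongr
          linarith
        _ = _ := by ring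
    rw [e, ea, eb, norm_div, div_le_iff₀ (by
      have := Complex.exp_ne_zero s
      have := Complex.exp_ne_zero l
      simp only [norm_mul]
      have : (0 : ℝ) < ‖1 + a‖ := by linarith
      have : (0 : ℝ) < ‖1 + b‖ := by linarith
      have : 0 < ‖((1 / 2 : ℝ) : ℂ)‖ := by simp
      positivity)]
    simp only [norm_mul, Complex.norm_real, Real.norm_eq_abs]
    rw [abs_of_pos (by norm_num : (0 : ℝ) < 1 / 2)]
    have h5 := norm_nonneg (Complex.exp s)
    have h6 := norm_nonneg (Complex.exp l)
    have h7 : (9 / 10) * (9 / 10) ≤ ‖1 + a‖ * ‖1 + b‖ := by gcongr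
    have h8 : ‖Complex.exp t‖ * ‖1 + w‖ ≤ 3 / 1024 * (‖Complex.exp s‖ * ‖Complex.exp l‖) * 2 := by
      gcongr
    have h9 := mul_le_mul_of_nonneg_left h7 (mul_nonneg h5 h6)
    nlinarith

/-- The complex distances between the axes of a triple with product `-1`. -/
lemma exists_distances {s l t : ℂ} (hs : Tame s) (hl : Tame l) (ht : Tame t)
    (hsl : |s.re - l.re| ≤ 1) (hst : |s.re - t.re| ≤ 1) :
    ∃ η θ : ℂ, 0 < η.re ∧ (Complex.exp η).re < 0 ∧ 0 < θ.re ∧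
      Complex.sinh s * Complex.sinh l * Complex.cosh η
        = -(Complex.cosh t + Complex.cosh s * Complex.cosh l) ∧
      Complex.sinh s * Complex.sinh t * Complex.cosh θ
        = -(Complex.cosh l + Complex.cosh s * Complex.cosh t) ∧
      Complex.sinh t * Complex.sinh θ = Complex.sinh l * Complex.sinh η ∧
      Complex.sinh l * Complex.sinh η ≠ 0 := by
  obtain ⟨k1, k2⟩ := sector_kappa hs hl ht hsl hst
  obtain ⟨k1', -⟩ := sector_kappa hs ht hl hst hsl
  have s0 := hs.sector_sinh.ne_zero
  have l0 := hl.sector_sinh.ne_zero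
  have t0 := ht.sector_sinh.ne_zero
  set κ := (Complex.cosh t + Complex.cosh (s - l)) / (Complex.sinh s * Complex.sinh l) with hκ
  set κ' := (Complex.cosh l + Complex.cosh (s - t)) / (Complex.sinh s * Complex.sinh t) with hκ'
  have e1 : Complex.sinh s * Complex.sinh l * κ = Complex.cosh t + Complex.cosh (s - l) := by
    rw [hκ]; field_simp
  have e2 : Complex.sinh s * Complex.sinh t * κ' = Complex.cosh l + Complex.cosh (s - t) := by
    rw [hκ']; field_simp
  rw [Complex.cosh_sub] at e1 e2
  have h2 : Sector (3 / 40) (2 + κ) := by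
    have : 2 + κ = ((2 : ℝ) : ℂ) * (1 + κ / 2) := by push_cast; ring
    rw [this]
    refine ((sector_ofReal two_pos).mul (sector_one_add (t := 1 / 20) ?_ (by norm_num))).mono
      (by norm_num)
    rw [norm_div, Complex.norm_two]; linarith
  -- The cosine rule reads `cosh η = -(1 + κ)`, so `sinh η` is a square root of `κ * (2 + κ)`. The
  -- sine rule then dictates the root for `θ`. Both roots need positive real part, which is why the
  -- arguments have been controlled.
  obtain ⟨S, hS, hS'⟩ := (k1.mul h2).exists_sq
  have hS2 : Sector 1 (S * Complex.sinh l / Complex.sinh t) :=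
    ((hS'.mul hl.sector_sinh).div ht.sector_sinh).mono (by norm_num)
  have hss := Complex.cosh_sq_sub_sinh_sq s
  have hll := Complex.cosh_sq_sub_sinh_sq l
  have htt := Complex.cosh_sq_sub_sinh_sq t
  have hsq : (S * Complex.sinh l / Complex.sinh t) ^ 2 = κ' * (2 + κ') := by
    rw [div_pow, mul_pow, hS, div_eq_iff (pow_ne_zero 2 t0)]
    refine mul_left_cancel₀ (pow_ne_zero 2 s0) ?_
    generalize Complex.sinh s = ss at *
    generalize Complex.cosh s = cs at *
    generalize Complex.sinh l = sl at *
    generalize Complex.cosh l = cl at *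
    generalize Complex.sinh t = st at *
    generalize Complex.cosh t = ct at *
    linear_combination (ss * sl * κ + 2 * ss * sl + ct + (cs * cl - ss * sl)) * e1
      - (ss * st * κ' + 2 * ss * st + cl + (cs * ct - ss * st)) * e2
      - (ct ^ 2 - cl ^ 2) * hss - ss ^ 2 * (htt - hll)
  obtain ⟨η, a1, a2, a3, a4⟩ :=
    exists_arcosh (k1.re_pos (by norm_num)) (hS'.re_pos (by norm_num)) hS
  obtain ⟨θ, b1, b2, b3, -⟩ := exists_arcosh (k1'.re_pos (by norm_num)) (hS2.re_pos le_rfl) hsq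
  refine ⟨η, θ, a3, a4, b3, ?_, ?_, ?_, ?_⟩
  · rw [a1]; linear_combination -e1
  · rw [b1]; linear_combination -e2
  · rw [a2, b2]; field_simp
  · rw [a2]; exact mul_ne_zero l0 (neg_ne_zero.2 hS'.ne_zero)

lemma turnSL_eq (δ θ : ℝ) : turnSL (δ - θ * Complex.I) = transSL δ * rotSL θ := by
  have e : ((δ : ℂ) - θ * Complex.I) / 2 = (δ : ℂ) / 2 - (θ : ℂ) / 2 * Complex.I := by ring
  apply sl_ext <;> rw [sl_mul_apply] <;>
    simp only [turnSL, transSL, rotSL, Matrix.SpecialLinearGroup.coe_mk,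
      Matrix.of_apply, Matrix.cons_val_zero, Matrix.cons_val_one, Matrix.cons_val',
      Matrix.cons_val_fin_one, e, Complex.cosh_sub, Complex.sinh_sub, Complex.cosh_mul_I,
      Complex.sinh_mul_I] <;> ring

lemma proj_turnSL (η : ℂ) : proj (turnSL η) = B η.re * R (-η.im) := by
  have : η = (η.re : ℝ) - ((-η.im : ℝ) : ℂ) * Complex.I := by
    push_cast; rw [neg_mul, sub_neg_eq_add, Complex.re_add_im]
  conv_lhs => rw [this]
  rw [turnSL_eq]; rfl

/-- Half-lengths of the boundary components of a triple with product `-1`. -/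
lemma isHalfLength_of_trace {M M' M'' : SL(2, ℂ)} {s l t : ℂ} (h : M * M' * M'' = -1)
    (hM : M 0 0 + M 1 1 = 2 * Complex.cosh s) (hM' : M' 0 0 + M' 1 1 = 2 * Complex.cosh l)
    (hM'' : M'' 0 0 + M'' 1 1 = 2 * Complex.cosh t) (hs : Tame s) (hl : Tame l) (ht : Tame t)
    (hsl : |s.re - l.re| ≤ 1) (hst : |s.re - t.re| ≤ 1) :
    IsHalfLength (proj M) (proj M') (proj M'') s ∧ IsComplexLength (proj M) (2 * s) := by
  obtain ⟨η, θ, a1, -, a3, e1, e2, e3, e4⟩ := exists_distances hs hl ht hsl hst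
  obtain ⟨g, f1, f2, f3⟩ := exists_frame h hM hM' hM'' hs.sector_sinh.ne_zero e1 e2 e3 e4
  have hmul : ∀ a b : SL(2, ℂ), proj (a * b) = proj a * proj b := fun _ _ => rfl
  have hinv : ∀ a : SL(2, ℂ), proj a⁻¹ = (proj a)⁻¹ := fun _ => rfl
  have hd : ∀ z : ℂ, proj (diagSL z) = A z := fun _ => rfl
  have hpos : ∀ {z : ℂ}, Tame z → 0 < (2 * z).re := fun {z} hz => by
    have := hz.1
    simp; linarith
  have g1 : proj M = proj g * A (2 * s) * (proj g)⁻¹ := by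
    rw [f1, hmul, hmul, hinv, hd]
  have g2 : proj M' = proj g * B η.re * R (-η.im) * A (2 * l)
      * (proj g * B η.re * R (-η.im))⁻¹ := by
    rw [f2]
    simp only [hmul, hinv, hd, proj_turnSL]
    group
  have g3 : proj M'' = proj g * A s * B θ.re * R (-θ.im) * A (2 * t)
      * (proj g * A s * B θ.re * R (-θ.im))⁻¹ := by
    rw [f3]
    simp only [hmul, hinv, hd, proj_turnSL]
    group
  -- `A s` commutes with the translation along the axis, so the frame moved by `A s` is again a
  -- frame on the axis of `M`.
  have g4 : proj M = proj g * A s * A (2 * s) * (proj g * A s)⁻¹ := by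
    have : A s * A (2 * s) = A (2 * s) * A s := by
      rw [← hd, ← hd, ← hmul, ← hmul]
      congr 1
      apply sl_ext <;> rw [sl_mul_apply, sl_mul_apply] <;> simp [diagSL, mul_comm]
    rw [mul_assoc (proj g), this, g1]
    group
  refine ⟨⟨by have := hs.1; linarith, proj g, Or.inl ⟨⟨⟨2 * s, hpos hs, g1⟩, η.re, -η.im, a1,
    2 * l, hpos hl, g2⟩, ⟨2 * s, hpos hs, g4⟩, θ.re, -θ.im, a3, 2 * t, hpos ht, g3⟩⟩,
    hpos hs, ?_, ?_, proj g, g1⟩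
  all_goals
    have h1 := Real.pi_gt_three
    obtain ⟨h2, h3⟩ := abs_le.1 hs.2
    simp
    linarith

lemma fin_two_cases (i : Fin 2) : i = 0 ∨ i = 1 := by decide +revert

lemma eigen_eq_smul {g : SL(2, ℂ)} {s : ℂ} (hs : Complex.sinh s ≠ 0) {v : Fin 2 → ℂ}
    (i : Fin 2)
    (hv : ((g * diagSL (2 * s) * g⁻¹ : SL(2, ℂ)) : Matrix (Fin 2) (Fin 2) ℂ) *ᵥ v
      = diagSL (2 * s) i i • v) :
    ∃ c : ℂ, v = c • ((g : Matrix (Fin 2) (Fin 2) ℂ) *ᵥ Pi.single i 1) := by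
  set w := ((g⁻¹ : SL(2, ℂ)) : Matrix (Fin 2) (Fin 2) ℂ) *ᵥ v with hw
  have h1 : ((diagSL (2 * s)) : Matrix (Fin 2) (Fin 2) ℂ) *ᵥ w = diagSL (2 * s) i i • w := by
    have := congrArg (fun x => ((g⁻¹ : SL(2, ℂ)) : Matrix (Fin 2) (Fin 2) ℂ) *ᵥ x) hv
    simp only [Matrix.mulVec_mulVec, Matrix.mulVec_smul,
      ← Matrix.SpecialLinearGroup.coe_mul] at this
    have e : g⁻¹ * (g * diagSL (2 * s) * g⁻¹) = diagSL (2 * s) * g⁻¹ := by group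
    rw [e] at this
    rw [hw, Matrix.mulVec_mulVec, ← Matrix.SpecialLinearGroup.coe_mul, this]
  have hv2 : v = (g : Matrix (Fin 2) (Fin 2) ℂ) *ᵥ w := by
    rw [hw, Matrix.mulVec_mulVec, ← Matrix.SpecialLinearGroup.coe_mul]; simp
  have hne : Complex.exp s - Complex.exp (-s) ≠ 0 := by
    intro h; apply hs; rw [Complex.sinh, h, zero_div]
  refine ⟨w i, ?_⟩
  rw [hv2, ← Matrix.mulVec_smul]
  congr 1
  have h2 := congrFun h1 0
  have h3 := congrFun h1 1
  rcases fin_two_cases i with rfl | rfl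
  · have : w 1 = 0 := by
      simp [Matrix.mulVec, dotProduct, Fin.sum_univ_two, diagSL] at h3
      rcases h3 with h | h
      · exact absurd (by rw [h]; ring) hne
      · exact h
    ext j; fin_cases j <;> simp [this]
  · have : w 0 = 0 := by
      simp [Matrix.mulVec, dotProduct, Fin.sum_univ_two, diagSL] at h2
      rcases h2 with h | h
      · exact absurd (by rw [h]; ring) hne
      · exact h
    ext j; fin_cases j <;> simp [this]

/-- Independence for the axes of two elements of a triple with product `-1`. -/
lemma stripIndep_of_trace {M M' M'' : SL(2, ℂ)} {s l t : ℂ} (h : M * M' * M'' = -1)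
    (hM : M 0 0 + M 1 1 = 2 * Complex.cosh s) (hM' : M' 0 0 + M' 1 1 = 2 * Complex.cosh l)
    (hM'' : M'' 0 0 + M'' 1 1 = 2 * Complex.cosh t) (hs : Tame s) (hl : Tame l) (ht : Tame t)
    (hsl : |s.re - l.re| ≤ 1) (hst : |s.re - t.re| ≤ 1) {p q p' q' : Fin 2 → ℂ}
    (hp0 : p ≠ 0) (hq0 : q ≠ 0) (hp0' : p' ≠ 0) (hq0' : q' ≠ 0)
    (hp : (M : Matrix (Fin 2) (Fin 2) ℂ) *ᵥ p = Complex.exp s • p)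
    (hq : (M : Matrix (Fin 2) (Fin 2) ℂ) *ᵥ q = Complex.exp (-s) • q)
    (hp' : (M' : Matrix (Fin 2) (Fin 2) ℂ) *ᵥ p' = Complex.exp l • p')
    (hq' : (M' : Matrix (Fin 2) (Fin 2) ℂ) *ᵥ q' = Complex.exp (-l) • q') :
    StripIndep (nul p) (nul q) (nul p') (nul q') := by
  obtain ⟨η, θ, a1, a2, a3, e1, e2, e3, e4⟩ := exists_distances hs hl ht hsl hst
  obtain ⟨g, f1, f2, -⟩ := exists_frame h hM hM' hM'' hs.sector_sinh.ne_zero e1 e2 e3 e4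
  have d1 : ∀ s : ℂ, diagSL (2 * s) 0 0 = Complex.exp s := fun s => by simp [diagSL]
  have d2 : ∀ s : ℂ, diagSL (2 * s) 1 1 = Complex.exp (-s) := fun s => by simp [diagSL]
  have f2' : M' = g * turnSL η * diagSL (2 * l) * (g * turnSL η)⁻¹ := by rw [f2]; group
  rw [f1, ← d1] at hp
  rw [f1, ← d2] at hq
  rw [f2', ← d1] at hp'
  rw [f2', ← d2] at hq'
  obtain ⟨c1, k1⟩ := eigen_eq_smul hs.sector_sinh.ne_zero 0 hp
  obtain ⟨c2, k2⟩ := eigen_eq_smul hs.sector_sinh.ne_zero 1 hq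
  obtain ⟨c3, k3⟩ := eigen_eq_smul hl.sector_sinh.ne_zero 0 hp'
  obtain ⟨c4, k4⟩ := eigen_eq_smul hl.sector_sinh.ne_zero 1 hq'
  have hc : ∀ {c : ℂ} {v w : Fin 2 → ℂ}, v ≠ 0 → v = c • w → 0 < Complex.normSq c :=
    fun {c v w} h1 h2 => Complex.normSq_pos.2 (by rintro rfl; exact h1 (by simpa using h2))
  have hη : Complex.exp η = (Complex.cosh (η / 2) + Complex.sinh (η / 2)) ^ 2 := by
    rw [Complex.cosh_add_sinh, ← Complex.exp_nat_mul]; congr 1; push_cast; ring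
  have hcs := Complex.cosh_sq_sub_sinh_sq (η / 2)
  set c := Complex.cosh (η / 2) with hcdef
  set d := Complex.sinh (η / 2) with hddef
  -- The diagonal entries and the real part of the off-diagonal entry, read in the frame `g`, where
  -- the first axis has endpoints `(1, 0)` and `(0, 1)`.
  let f : Herm →ₗ[ℝ] ℝ × ℝ × ℝ :=
    { toFun := fun X => ((hact g⁻¹ X).1, (hact g⁻¹ X).2.1, (hact g⁻¹ X).2.2.re)
      map_add' := fun X Y => by simp [hact_add]
      map_smul' := fun a X => by simp [hact_smul] }
  have hf : ∀ (w : ℂ) (v : Fin 2 → ℂ), f (nul (w • ((g : Matrix (Fin 2) (Fin 2) ℂ) *ᵥ v)))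
      = Complex.normSq w • (Complex.normSq (v 0), Complex.normSq (v 1),
        (v 0 * (starRingEnd ℂ) (v 1)).re) := by
    intro w v
    have : hact g⁻¹ (nul (w • ((g : Matrix (Fin 2) (Fin 2) ℂ) *ᵥ v)))
        = Complex.normSq w • nul v := by
      rw [nul_smul, hact_smul, ← hact_nul, hact_inv_hact]
    change ((hact g⁻¹ _).1, (hact g⁻¹ _).2.1, (hact g⁻¹ _).2.2.re) = _
    rw [this]
    simp [nul]
  have t0 : ∀ i, ((g * turnSL η : SL(2, ℂ)) : Matrix (Fin 2) (Fin 2) ℂ) *ᵥ Pi.single i 1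
      = (g : Matrix (Fin 2) (Fin 2) ℂ) *ᵥ ((turnSL η : Matrix (Fin 2) (Fin 2) ℂ) *ᵥ Pi.single i 1) :=
    fun i => by rw [Matrix.mulVec_mulVec, Matrix.SpecialLinearGroup.coe_mul]
  have t1 : (turnSL η : Matrix (Fin 2) (Fin 2) ℂ) *ᵥ Pi.single 0 1 = ![c, d] := by
    ext i; fin_cases i <;> simp [turnSL, hcdef, hddef]
  have t2 : (turnSL η : Matrix (Fin 2) (Fin 2) ℂ) *ᵥ Pi.single 1 1 = ![d, c] := by
    ext i; fin_cases i <;> simp [turnSL, hcdef, hddef]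
  rw [t0, t1] at k3
  rw [t0, t2] at k4
  have hα : Complex.normSq c < Complex.normSq d ∧ (c * (starRingEnd ℂ) d).re ≠ 0 := by
    have n1 : ‖Complex.exp η‖ = Complex.normSq (c + d) := by
      rw [hη, norm_pow, Complex.normSq_eq_norm_sq]
    have n2 : 1 < ‖Complex.exp η‖ := by rw [Complex.norm_exp]; exact Real.one_lt_exp_iff.2 a1
    have n3 : Complex.normSq (c + d) * Complex.normSq (c - d) = 1 := by
      rw [← map_mul, show (c + d) * (c - d) = 1 by linear_combination hcs, map_one]
    rw [n1] at n2
    rw [hη] at a2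
    have n4 : Complex.normSq (c - d) < 1 := by
      nlinarith [Complex.normSq_nonneg (c - d)]
    -- `c + d` is the inverse of `c - d`, that is `conj (c - d) * |c + d|²`, so the real part of its
    -- square is governed by `|c|² - |d|²`. The negative real part of `exp η` therefore yields `α <
    -- β`.
    have n5 : ((c + d) ^ 2).re
        = Complex.normSq (c + d) * (Complex.normSq c - Complex.normSq d) := by
      have h1 := congrArg Complex.re hcs
      have h2 := congrArg Complex.im hcs
      simp only [sq, Complex.sub_re, Complex.sub_im, Complex.mul_re, Complex.mul_im,
        Complex.add_re, Complex.add_im, Complex.one_re, Complex.one_im, Complex.normSq_apply] at *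
      generalize c.re = cr at *
      generalize c.im = ci at *
      generalize d.re = dr at *
      generalize d.im = di at *
      grind
    constructor
    · rw [n5] at a2
      by_contra hn
      push Not at hn
      have := mul_nonneg (zero_le_one.trans n2.le) (sub_nonneg.2 hn)
      linarith
    · intro h0
      have h1 : Complex.normSq (c + d) = Complex.normSq (c - d) := by
        rw [Complex.normSq_add, Complex.normSq_sub, h0]; ring
      linarith
  refine stripIndep_frame (α := Complex.normSq c) (β := Complex.normSq d)
    (c := (c * (starRingEnd ℂ) d).re) hα.2 hα.1 f (hc hp0 k1) (hc hq0 k2) (hc hp0' k3)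
    (hc hq0' k4) ?_ ?_ ?_ ?_
  · rw [k1, hf]; simp
  · rw [k2, hf]; simp
  · rw [k3, hf]; simp
  · rw [k4, hf]
    have : (d * (starRingEnd ℂ) c).re = (c * (starRingEnd ℂ) d).re := by simp; ring
    simp [this]

/-! ### Triples of loxodromic elements with product `-1` -/

/-- A triple with product `-1` and traces `2 cosh σ`, where the `σ` are nearly equal and have large
real part and small imaginary part. -/
structure IsTameTriple (M : Fin 3 → SL(2, ℂ)) (σ : Fin 3 → ℂ) : Prop where
  prod : ∀ k, M k * M (k + 1) * M (k + 2) = -1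
  trace : ∀ k, M k 0 0 + M k 1 1 = 2 * Complex.cosh (σ k)
  tame : ∀ k, Tame (σ k)
  close : ∀ j k, |(σ j).re - (σ k).re| ≤ 1

/-- The commutators of consecutive matrices of a triple. -/
def comm (N : Fin 3 → Matrix (Fin 2) (Fin 2) ℂ) (k : Fin 3) : Matrix (Fin 2) (Fin 2) ℂ :=
  N (k + 2) * N k - N k * N (k + 2)

lemma entries_of_prod {a b c : SL(2, ℂ)} (h : a * b * c = -1) :
    (c 0 0 = -(a 1 0 * b 0 1 + a 1 1 * b 1 1) ∧ c 0 1 = a 0 0 * b 0 1 + a 0 1 * b 1 1) ∧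
    c 1 0 = a 1 0 * b 0 0 + a 1 1 * b 1 0 ∧ c 1 1 = -(a 0 0 * b 0 0 + a 0 1 * b 1 0) := by
  have e : c = -(a * b)⁻¹ := by
    have : c = (a * b)⁻¹ * (a * b * c) := by group
    rw [this, h, mul_neg, mul_one]
  obtain ⟨⟨i1, i2⟩, i3, i4⟩ := sl_inv_apply (a * b)
  rw [e]
  simp only [Matrix.SpecialLinearGroup.coe_neg, Matrix.neg_apply, i1, i2, i3, i4, sl_mul_apply,
    neg_neg]
  exact ⟨⟨trivial, trivial⟩, trivial, trivial⟩

lemma mul_sub_mul_apply (a b : Matrix (Fin 2) (Fin 2) ℂ) (i j : Fin 2) :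
    (a * b - b * a) i j = a i 0 * b 0 j + a i 1 * b 1 j - (b i 0 * a 0 j + b i 1 * a 1 j) := by
  simp [Matrix.mul_apply, Fin.sum_univ_two]

/-- Substitute `c = -b⁻¹ * a⁻¹` and `b⁻¹ = tr b - b`. -/
lemma comm_mul_of_prod {a b c : SL(2, ℂ)} (h : a * b * c = -1) :
    (a * b - b * a : Matrix (Fin 2) (Fin 2) ℂ)
      = -((c * a - a * c : Matrix (Fin 2) (Fin 2) ℂ) * a) := by
  obtain ⟨⟨c1, c2⟩, c3, c4⟩ := entries_of_prod h
  have ha := sl_det a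
  have hb := sl_det b
  ext i j
  rcases fin_two_cases i with rfl | rfl <;> rcases fin_two_cases j with rfl | rfl <;>
    simp only [mul_sub_mul_apply, Matrix.neg_apply, Matrix.mul_apply, Fin.sum_univ_two,
      c1, c2, c3, c4] <;> grind

/-- Fricke's trace identity, since the determinant is 2 minus the trace of the group commutator; the
product being `-1` fixes the sign of the cubic term. -/
lemma det_comm_of_prod {a b c : SL(2, ℂ)} (h : a * b * c = -1) :
    (c * a - a * c : Matrix (Fin 2) (Fin 2) ℂ).det = 4 - (a 0 0 + a 1 1) ^ 2 - (b 0 0 + b 1 1) ^ 2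
      - (c 0 0 + c 1 1) ^ 2 - (a 0 0 + a 1 1) * (b 0 0 + b 1 1) * (c 0 0 + c 1 1) := by
  obtain ⟨⟨c1, c2⟩, c3, c4⟩ := entries_of_prod h
  have ha := sl_det a
  have hb := sl_det b
  rw [Matrix.det_fin_two]
  simp only [mul_sub_mul_apply, c1, c2, c3, c4]
  generalize a 0 0 = a1 at *
  generalize a 0 1 = a2 at *
  generalize a 1 0 = a3 at *
  generalize a 1 1 = a4 at *
  generalize b 0 0 = b1 at *
  generalize b 0 1 = b2 at *
  generalize b 1 0 = b3 at *
  generalize b 1 1 = b4 at *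
  grind

namespace IsTameTriple

variable {M : Fin 3 → SL(2, ℂ)} {σ : Fin 3 → ℂ}

/-- By the cosine rule the determinant is -4 times the square of `sinh σ_k * sinh σ_{k+1} * sinh η`.
-/
lemma det_comm_ne_zero (h : IsTameTriple M σ) (k : Fin 3) :
    (comm (fun n => (M n : Matrix (Fin 2) (Fin 2) ℂ)) k).det ≠ 0 := by
  obtain ⟨η, θ, a1, -, a3, e1, e2, e3, e4⟩ := exists_distances (h.tame k) (h.tame (k + 1))
    (h.tame (k + 2)) (h.close _ _) (h.close _ _)
  have hs := (h.tame k).sector_sinh.ne_zero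
  rw [comm, det_comm_of_prod (h.prod k), h.trace, h.trace, h.trace]
  have h1 := Complex.cosh_sq_sub_sinh_sq (σ k)
  have h2 := Complex.cosh_sq_sub_sinh_sq (σ (k + 1))
  have h3 := Complex.cosh_sq_sub_sinh_sq η
  have key : Complex.sinh (σ k) * (Complex.sinh (σ (k + 1)) * Complex.sinh η) ≠ 0 :=
    mul_ne_zero hs e4
  intro h0
  apply key
  rw [← pow_eq_zero_iff (two_ne_zero)]
  generalize Complex.sinh (σ k) = s at *
  generalize Complex.sinh (σ (k + 1)) = l at *
  generalize Complex.sinh η = y at *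
  generalize Complex.cosh (σ k) = cs at *
  generalize Complex.cosh (σ (k + 1)) = cl at *
  generalize Complex.cosh (σ (k + 2)) = ct at *
  generalize Complex.cosh η = cy at *
  have e1' : s ^ 2 * l ^ 2 * cy ^ 2 = (ct + cs * cl) ^ 2 := by
    linear_combination (s * l * cy - (ct + cs * cl)) * e1
  have e5 : s ^ 2 * l ^ 2 = (cs ^ 2 - 1) * (cl ^ 2 - 1) := by
    rw [show s ^ 2 = cs ^ 2 - 1 by linear_combination -h1,
      show l ^ 2 = cl ^ 2 - 1 by linear_combination -h2]
  linear_combination (-1/4) * h0 + e1' - e5 - s ^ 2 * l ^ 2 * h3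

lemma det_comm_succ (h : IsTameTriple M σ) (k : Fin 3) :
    (comm (fun n => (M n : Matrix (Fin 2) (Fin 2) ℂ)) (k + 1)).det
      = (comm (fun n => (M n : Matrix (Fin 2) (Fin 2) ℂ)) k).det := by
  rw [comm, add_one_two, comm_mul_of_prod (h.prod k), Matrix.det_neg, Matrix.det_mul, comm]
  simp

/-- A traceless matrix squares to minus its determinant, so dividing by a square root `δ` of the
determinant gives a half-turn. The determinants agree, so one `δ` serves for all three. By
`comm_mul_of_prod` the consecutive products are then exactly the `M k`, without a sign ambiguity. -/
lemma exists_half_turns (h : IsTameTriple M σ) :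
    ∃ (δ : ℂ) (H : Fin 3 → SL(2, ℂ)), δ ≠ 0 ∧
      (∀ k, (H k : Matrix (Fin 2) (Fin 2) ℂ)
        = δ⁻¹ • comm (fun n => (M n : Matrix (Fin 2) (Fin 2) ℂ)) k) ∧
      (∀ k, δ ^ 2 = (comm (fun n => (M n : Matrix (Fin 2) (Fin 2) ℂ)) k).det) ∧
      (∀ k, H k * H k = -1) ∧ ∀ k, H k * H (k + 1) = M k := by
  obtain ⟨δ, hδ⟩ := IsAlgClosed.exists_pow_nat_eq
    (comm (fun n => (M n : Matrix (Fin 2) (Fin 2) ℂ)) 0).det two_pos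
  have hδ0 : δ ≠ 0 := by
    rintro rfl
    exact h.det_comm_ne_zero 0 (by rw [← hδ]; simp)
  have hk : ∀ k, δ ^ 2 = (comm (fun n => (M n : Matrix (Fin 2) (Fin 2) ℂ)) k).det := by
    have h1 := h.det_comm_succ 0
    have h2 := h.det_comm_succ 1
    intro k
    rcases fin_three_cases k with rfl | rfl | rfl
    · exact hδ
    · exact hδ.trans h1.symm
    · exact hδ.trans (h1.symm.trans h2.symm)
  have hsq : ∀ k, comm (fun n => (M n : Matrix (Fin 2) (Fin 2) ℂ)) k *
      comm (fun n => (M n : Matrix (Fin 2) (Fin 2) ℂ)) k = -(δ ^ 2) • (1 : Matrix _ _ ℂ) := by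
    intro k
    rw [hk k, comm, Matrix.det_fin_two]
    ext i j
    rcases fin_two_cases i with rfl | rfl <;> rcases fin_two_cases j with rfl | rfl <;>
      simp [Matrix.mul_apply, Fin.sum_univ_two] <;> ring
  let H : Fin 3 → SL(2, ℂ) := fun k =>
    ⟨δ⁻¹ • comm (fun n => (M n : Matrix (Fin 2) (Fin 2) ℂ)) k, by
      rw [Matrix.det_smul, ← hk k]
      simp [hδ0]⟩
  have hH : ∀ k, (H k : Matrix (Fin 2) (Fin 2) ℂ)
        = δ⁻¹ • comm (fun n => (M n : Matrix (Fin 2) (Fin 2) ℂ)) k := fun _ => rfl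
  refine ⟨δ, H, hδ0, hH, hk, fun k => ?_, fun k => ?_⟩
  · apply Subtype.ext
    rw [Matrix.SpecialLinearGroup.coe_mul, hH, Matrix.smul_mul, Matrix.mul_smul, hsq, smul_smul,
      smul_smul, Matrix.SpecialLinearGroup.coe_neg, Matrix.SpecialLinearGroup.coe_one]
    rw [show δ⁻¹ * δ⁻¹ * -δ ^ 2 = -1 by field_simp, neg_one_smul]
  · apply Subtype.ext
    have e : comm (fun n => (M n : Matrix (Fin 2) (Fin 2) ℂ)) (k + 1)
        = -(comm (fun n => (M n : Matrix (Fin 2) (Fin 2) ℂ)) k * M k) := by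
      rw [comm, add_one_two]; exact comm_mul_of_prod (h.prod k)
    rw [Matrix.SpecialLinearGroup.coe_mul, hH, hH, e, Matrix.smul_mul, Matrix.mul_smul,
      Matrix.mul_neg, ← Matrix.mul_assoc, hsq, smul_smul, Matrix.smul_mul, Matrix.one_mul,
      ← neg_smul, neg_neg, smul_smul]
    rw [show δ⁻¹ * δ⁻¹ * δ ^ 2 = 1 by field_simp, one_smul]

/-- A common eigenvector lies in the kernel of the commutator, which is invertible. -/
lemma not_haveCommonFixedPoint_add_two (h : IsTameTriple M σ) (k : Fin 3) :
    ¬ HaveCommonFixedPoint (proj (M (k + 2))) (proj (M k)) := by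
  rintro ⟨v, hv, ⟨g, hg, a, ha⟩, ⟨g', hg', a', ha'⟩⟩
  have h1 : ∀ {g M : SL(2, ℂ)} {a : ℂ}, proj g = proj M →
      (g : Matrix (Fin 2) (Fin 2) ℂ) *ᵥ v = a • v →
      ∃ b : ℂ, (M : Matrix (Fin 2) (Fin 2) ℂ) *ᵥ v = b • v := by
    intro g M a hg ha
    rcases proj_eq_proj.1 hg with rfl | rfl
    · exact ⟨a, ha⟩
    · refine ⟨-a, ?_⟩
      rw [neg_smul, ← ha, Matrix.SpecialLinearGroup.coe_neg, Matrix.neg_mulVec, neg_neg]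
  obtain ⟨b, hb⟩ := h1 hg ha
  obtain ⟨b', hb'⟩ := h1 hg' ha'
  refine h.det_comm_ne_zero k (Matrix.exists_mulVec_eq_zero_iff.1 ⟨v, hv, ?_⟩)
  rw [comm, Matrix.sub_mulVec, ← Matrix.mulVec_mulVec, ← Matrix.mulVec_mulVec, hb, hb',
    Matrix.mulVec_smul, Matrix.mulVec_smul, hb, hb', smul_comm, sub_self]

lemma not_haveCommonFixedPoint (h : IsTameTriple M σ) {m n : Fin 3} (hmn : m ≠ n) :
    ¬ HaveCommonFixedPoint (proj (M m)) (proj (M n)) := by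
  rcases eq_or_eq_add m n with rfl | rfl | rfl
  · exact absurd rfl hmn
  · have := h.not_haveCommonFixedPoint_add_two (n + 1)
    rw [add_one_two] at this
    rintro ⟨v, hv, h1, h2⟩
    exact this ⟨v, hv, h2, h1⟩
  · exact h.not_haveCommonFixedPoint_add_two n

lemma isHalfLength (h : IsTameTriple M σ) (k : Fin 3) :
    IsHalfLength (proj (M k)) (proj (M (k + 1))) (proj (M (k + 2))) (σ k) ∧
      IsComplexLength (proj (M k)) (2 * σ k) :=
  isHalfLength_of_trace (h.prod k) (h.trace _) (h.trace _) (h.trace _) (h.tame _) (h.tame _)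
    (h.tame _) (h.close _ _) (h.close _ _)

end IsTameTriple

/-! ### Ping-pong -/

/-- Nonzero vectors of `ℂ²`. -/
def NonzeroVec : Type := {v : Fin 2 → ℂ // v ≠ 0}

lemma mulVec_ne_zero (g : SL(2, ℂ)) {v : Fin 2 → ℂ} (hv : v ≠ 0) :
    (g : Matrix (Fin 2) (Fin 2) ℂ) *ᵥ v ≠ 0 := by
  intro h
  apply hv
  have : ((g⁻¹ : SL(2, ℂ)) : Matrix (Fin 2) (Fin 2) ℂ) *ᵥ ((g : Matrix (Fin 2) (Fin 2) ℂ) *ᵥ v)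
      = v := by
    rw [Matrix.mulVec_mulVec, ← Matrix.SpecialLinearGroup.coe_mul]; simp
  rw [← this, h, Matrix.mulVec_zero]

instance : MulAction SL(2, ℂ) NonzeroVec where
  smul g v := ⟨(g : Matrix (Fin 2) (Fin 2) ℂ) *ᵥ v.1, mulVec_ne_zero g v.2⟩
  one_smul v := Subtype.ext (by
    change ((1 : SL(2, ℂ)) : Matrix (Fin 2) (Fin 2) ℂ) *ᵥ v.1 = v.1
    simp)
  mul_smul g h v := Subtype.ext (by
    change ((g * h : SL(2, ℂ)) : Matrix (Fin 2) (Fin 2) ℂ) *ᵥ v.1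
      = (g : Matrix (Fin 2) (Fin 2) ℂ) *ᵥ ((h : Matrix (Fin 2) (Fin 2) ℂ) *ᵥ v.1)
    rw [Matrix.mulVec_mulVec, Matrix.SpecialLinearGroup.coe_mul])

open Pointwise in
/-- Ping-pong for the products of three half-turns. -/
lemma injective_lift_half_turns {H : Fin 3 → SL(2, ℂ)} (hH : ∀ k, H k * H k = -1)
    {U : Fin 3 → Set NonzeroVec} (hne : ∀ k, (U k).Nonempty)
    (hneg : ∀ k v, v ∈ U k → (-1 : SL(2, ℂ)) • v ∈ U k) (hU : ∀ j k, j ≠ k → Disjoint (U j) (U k))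
    (hHU : ∀ k v, v ∉ U k → H k • v ∈ U k) :
    Function.Injective (FreeGroup.lift ![H 0 * H 1, H 1 * H 2]) := by
  have hinv : ∀ k, (H k)⁻¹ = -1 * H k := fun k => by
    rw [inv_eq_iff_mul_eq_one, neg_one_mul, mul_neg, hH, neg_neg]
  have hsub : ∀ j k v, j ≠ k → H j • v ∈ U k → v ∈ U j := fun j k v hjk hv => by
    by_contra h
    exact Set.disjoint_left.1 (hU j k hjk) (hHU j v h) hv
  -- `H 0 * H 1` attracts to `U 0` and its inverse to the translate of `U 0` by `H 1`; `H 1 * H 2`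
  -- attracts to the translate of `U 2` and its inverse to `U 2`.
  refine FreeGroup.injective_lift_of_ping_pong (a := ![H 0 * H 1, H 1 * H 2])
    (X := ![U 0, {v | H 1 • v ∈ U 2}]) (Y := ![{v | H 1 • v ∈ U 0}, U 2]) ?_ ?_ ?_ ?_ ?_ ?_
  · intro i
    rcases fin_two_cases i with rfl | rfl
    · exact hne 0
    · obtain ⟨v, hv⟩ := hne 2
      exact ⟨(H 1)⁻¹ • v, by simpa using hv⟩
  · intro i j hij
    rcases fin_two_cases i with rfl | rfl <;> rcases fin_two_cases j with rfl | rfl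
    · exact absurd rfl hij
    · exact Set.disjoint_left.2 fun v h1 h2 =>
        Set.disjoint_left.1 (hU 0 1 (by decide)) h1 (hsub 1 2 v (by decide) h2)
    · exact Set.disjoint_left.2 fun v h2 h1 =>
        Set.disjoint_left.1 (hU 0 1 (by decide)) h1 (hsub 1 2 v (by decide) h2)
    · exact absurd rfl hij
  · intro i j hij
    rcases fin_two_cases i with rfl | rfl <;> rcases fin_two_cases j with rfl | rfl
    · exact absurd rfl hij
    · exact Set.disjoint_left.2 fun v h1 h2 =>
        Set.disjoint_left.1 (hU 1 2 (by decide)) (hsub 1 0 v (by decide) h1) h2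
    · exact Set.disjoint_left.2 fun v h2 h1 =>
        Set.disjoint_left.1 (hU 1 2 (by decide)) (hsub 1 0 v (by decide) h1) h2
    · exact absurd rfl hij
  · intro i j
    rcases fin_two_cases i with rfl | rfl <;> rcases fin_two_cases j with rfl | rfl
    · exact Set.disjoint_left.2 fun v h1 h2 =>
        Set.disjoint_left.1 (hU 0 1 (by decide)) h1 (hsub 1 0 v (by decide) h2)
    · exact hU 0 2 (by decide)
    · exact Set.disjoint_left.2 fun v h1 h2 => Set.disjoint_left.1 (hU 2 0 (by decide)) h1 h2
    · exact Set.disjoint_left.2 fun v h1 h2 =>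
        Set.disjoint_left.1 (hU 1 2 (by decide)) (hsub 1 2 v (by decide) h1) h2
  · intro i
    rcases fin_two_cases i with rfl | rfl
    · rintro _ ⟨v, hv, rfl⟩
      change (H 0 * H 1) • v ∈ U 0
      rw [mul_smul]
      exact hHU 0 _ hv
    · rintro _ ⟨v, hv, rfl⟩
      change H 1 • (H 1 * H 2) • v ∈ U 2
      rw [← mul_smul, ← mul_assoc, hH, mul_smul]
      exact hneg 2 _ (hHU 2 v hv)
  · intro i
    rcases fin_two_cases i with rfl | rfl
    · rintro _ ⟨v, hv, rfl⟩
      change H 1 • (H 0 * H 1)⁻¹ • v ∈ U 0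
      rw [← mul_smul, mul_inv_rev, mul_inv_cancel_left, hinv, mul_smul]
      exact hneg 0 _ (hHU 0 v hv)
    · rintro _ ⟨v, hv, rfl⟩
      change (H 1 * H 2)⁻¹ • v ∈ U 2
      have e : (H 1 * H 2)⁻¹ = H 2 * H 1 := by
        rw [mul_inv_rev, hinv, hinv]; simp
      rw [e, mul_smul]
      exact hHU 2 _ hv

/-- A word that becomes trivial in PSL₂ maps to `±1`, so its square maps to 1. Free groups are
torsion free. -/
lemma injective_lift_proj {a : Fin 2 → SL(2, ℂ)} (ha : Function.Injective (FreeGroup.lift a)) :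
    Function.Injective (FreeGroup.lift fun i => proj (a i)) := by
  have e : FreeGroup.lift (fun i => proj (a i))
      = (QuotientGroup.mk' (Subgroup.center SL(2, ℂ))).comp (FreeGroup.lift a) := by
    ext i
    simp [proj]
  rw [injective_iff_map_eq_one]
  intro w hw
  have h1 : proj (FreeGroup.lift a w) = proj 1 := by
    rw [e] at hw
    exact hw
  have h2 : FreeGroup.lift a (w ^ 2) = FreeGroup.lift a 1 := by
    rw [map_pow, map_one]
    rcases proj_eq_proj.1 h1 with h | h <;> rw [h] <;> simp
  exact (pow_eq_one_iff_left two_ne_zero).1 (ha h2)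

/-! ### The limit of a triple of matrices, and its neighbours -/

/-- `i√3/2` -/
def halfRoot : ℂ := (Real.sqrt 3 / 2 : ℝ) * Complex.I

lemma halfRoot_sq : halfRoot ^ 2 = -(3 / 4) := by
  have h : (Real.sqrt 3 : ℝ) ^ 2 = 3 := Real.sq_sqrt (by norm_num)
  rw [halfRoot, mul_pow, Complex.I_sq, ← Complex.ofReal_pow, div_pow, h]
  norm_num

lemma halfRoot_ne_zero : halfRoot ≠ 0 := by
  intro h
  have := halfRoot_sq
  rw [h] at this
  norm_num at this

lemma normSq_halfRoot : Complex.normSq halfRoot = 3 / 4 := by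
  have h := congrArg (fun z : ℂ => ‖z‖) halfRoot_sq
  simp only [norm_pow, norm_neg] at h
  rw [Complex.normSq_eq_norm_sq, h]
  norm_num

/-- Vectors over the ideal vertices of the limiting ideal triangle. -/
def corner : Fin 3 → Fin 2 → ℂ := ![![0, 1], ![-halfRoot, -(1 / 2)], ![halfRoot, -(1 / 2)]]

/-- The determinant of two vectors. -/
def cross (u v : Fin 2 → ℂ) : ℂ := u 0 * v 1 - u 1 * v 0

/-- The square of the Hermitian norm. -/
def len (v : Fin 2 → ℂ) : ℝ := Complex.normSq (v 0) + Complex.normSq (v 1)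

lemma cross_corner (k : Fin 3) : cross (corner k) (corner (k + 1)) = halfRoot := by
  rcases fin_three_cases k with rfl | rfl | rfl <;> simp [cross, corner]
  ring

lemma cross_corner_two (k : Fin 3) : cross (corner k) (corner (k + 2)) = -halfRoot := by
  have := cross_corner (k + 2)
  rw [add_two_one] at this
  rw [← this, cross, cross]; ring

lemma cross_self (v : Fin 2 → ℂ) : cross v v = 0 := by rw [cross]; ring

lemma cross_smul (c : ℂ) (u v : Fin 2 → ℂ) : cross (c • u) v = c * cross u v := by
  simp [cross]; ring

lemma len_smul (c : ℂ) (v : Fin 2 → ℂ) : len (c • v) = Complex.normSq c * len v := by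
  simp [len]; ring

lemma len_corner (k : Fin 3) : len (corner k) = 1 := by
  have h := normSq_halfRoot
  rcases fin_three_cases k with rfl | rfl | rfl <;> simp [len, corner, h] <;> norm_num

lemma len_pos {v : Fin 2 → ℂ} (hv : v ≠ 0) : 0 < len v := by
  by_contra h
  apply hv
  have h0 := Complex.normSq_nonneg (v 0)
  have h1 := Complex.normSq_nonneg (v 1)
  rw [len] at h
  funext i
  rcases fin_two_cases i with rfl | rfl
  · exact Complex.normSq_eq_zero.1 (by linarith)
  · exact Complex.normSq_eq_zero.1 (by linarith)

lemma continuous_len : Continuous len := by unfold len; fun_prop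

/-- The limiting rank one matrices. -/
def limitMatrix (n : Fin 3) : Matrix (Fin 2) (Fin 2) ℂ :=
  Matrix.of fun i j => -halfRoot * corner n i * ![corner (n + 1) 1, -corner (n + 1) 0] j

lemma limitMatrix_mulVec (n : Fin 3) (v : Fin 2 → ℂ) :
    limitMatrix n *ᵥ v = (-halfRoot * cross v (corner (n + 1))) • corner n := by
  funext i
  simp [limitMatrix, Matrix.mulVec, dotProduct, Fin.sum_univ_two, cross]
  ring

lemma limitMatrix_trace (n : Fin 3) : limitMatrix n 0 0 + limitMatrix n 1 1 = 3 / 4 := by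
  have h := cross_corner n
  have h2 := halfRoot_sq
  rw [cross] at h
  simp [limitMatrix]
  linear_combination -halfRoot * h - h2

/-- The limit of the `k`-th half-turn, up to scale, is nilpotent of rank one with image and kernel
spanned by `corner k`: in the limit the mirror escapes to this ideal vertex and everything else is
attracted to it. -/
lemma comm_limitMatrix_mulVec (k : Fin 3) (v : Fin 2 → ℂ) :
    comm limitMatrix k *ᵥ v = (halfRoot ^ 3 * cross v (corner k)) • corner k := by
  rw [comm, Matrix.sub_mulVec, ← Matrix.mulVec_mulVec, ← Matrix.mulVec_mulVec]
  simp only [limitMatrix_mulVec, cross_smul, add_two_one, cross_self]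
  have := cross_corner_two (k + 1)
  rw [show k + 1 + 2 = k by rw [add_one_two]] at this
  have e : cross (corner (k + 2)) (corner (k + 1)) = -halfRoot := by
    have := cross_corner (k + 1)
    rw [add_one_one] at this
    rw [← this, cross, cross]; ring
  rw [e]
  simp
  congr 1; ring

lemma det_comm_limitMatrix (k : Fin 3) : (comm limitMatrix k).det = 0 :=
  Matrix.exists_mulVec_eq_zero_iff.1 ⟨corner k, fun h => by
    have := len_corner k
    rw [h] at this
    simp [len] at this, by rw [comm_limitMatrix_mulVec, cross_self, mul_zero, zero_smul]⟩

/-- An eigenvector of `N (j + 1)` for the large eigenvalue, if `z` is the small one. -/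
def largeEigenvector (N : Fin 3 → Matrix (Fin 2) (Fin 2) ℂ) (z : Fin 3 → ℂ) (j : Fin 3) :
    Fin 2 → ℂ :=
  (4 / 3 : ℂ) • (N (j + 1) *ᵥ corner (j + 1) - z (j + 1) • corner (j + 1))

/-- An eigenvector of `N (j + 1)` for the small eigenvalue `z`. -/
def smallEigenvector (N : Fin 3 → Matrix (Fin 2) (Fin 2) ℂ) (z : Fin 3 → ℂ) (j : Fin 3) :
    Fin 2 → ℂ :=
  (-(4 / 3) : ℂ) • (N (j + 1) *ᵥ corner (j + 2)
    - (N (j + 1) 0 0 + N (j + 1) 1 1 - z (j + 1)) • corner (j + 2))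

lemma largeEigenvector_limit (j : Fin 3) :
    largeEigenvector limitMatrix 0 j = corner (j + 1) := by
  rw [largeEigenvector, limitMatrix_mulVec, cross_corner, Pi.zero_apply, zero_smul, sub_zero,
    smul_smul, show (4 / 3 : ℂ) * (-halfRoot * halfRoot) = 1 by
      linear_combination (-(4 / 3) : ℂ) * halfRoot_sq, one_smul]

lemma smallEigenvector_limit (j : Fin 3) :
    smallEigenvector limitMatrix 0 j = corner (j + 2) := by
  rw [smallEigenvector, limitMatrix_mulVec, add_one_one, cross_self, limitMatrix_trace,
    Pi.zero_apply, mul_zero, zero_smul, zero_sub, sub_zero, smul_neg, smul_smul, ← neg_smul]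
  norm_num

/-- The open conditions satisfied by the limiting matrices that are used for the construction of an
equivariant surface and for the injectivity of the representation. -/
structure IsNearLimit (N : Fin 3 → Matrix (Fin 2) (Fin 2) ℂ) (z : Fin 3 → ℂ) : Prop where
  det : ∀ j, cross (largeEigenvector N z j) (smallEigenvector N z j) ≠ 0
  centre : ∀ x ∈ centre, Function.Injective (fderiv ℝ (surf (fun _ _ => glide)
    (fun j => nul (largeEigenvector N z j), fun j => nul (smallEigenvector N z j))) x)
  expand_large : ∀ k, Real.exp 4 * ‖(comm N k).det‖ * len (smallEigenvector N z (k + 1))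
    < len (comm N k *ᵥ largeEigenvector N z (k + 1))
  expand_small : ∀ k, Real.exp 4 * ‖(comm N k).det‖ * len (largeEigenvector N z (k + 2))
    < len (comm N k *ᵥ smallEigenvector N z (k + 2))
  ping : ∀ k v, v ≠ 0 → len v ≤ 8 * Complex.normSq (cross v (corner k)) →
    8 * Complex.normSq (cross (comm N k *ᵥ v) (corner k)) < len (comm N k *ᵥ v)

lemma continuous_comm (k : Fin 3) :
    Continuous fun N : Fin 3 → Matrix (Fin 2) (Fin 2) ℂ => comm N k := by
  unfold comm; fun_prop

lemma continuous_largeEigenvector (j : Fin 3) :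
    Continuous fun p : (Fin 3 → Matrix (Fin 2) (Fin 2) ℂ) × (Fin 3 → ℂ) =>
      largeEigenvector p.1 p.2 j := by
  unfold largeEigenvector; fun_prop

lemma continuous_smallEigenvector (j : Fin 3) :
    Continuous fun p : (Fin 3 → Matrix (Fin 2) (Fin 2) ℂ) × (Fin 3 → ℂ) =>
      smallEigenvector p.1 p.2 j := by
  unfold smallEigenvector; fun_prop

lemma continuous_nul : Continuous nul := by unfold nul; fun_prop

lemma linearIndependent_nul_corner : LinearIndependent ℝ fun j => nul (corner j) := by
  rw [Fintype.linearIndependent_iff]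
  intro g hg
  rw [Fin.sum_univ_three] at hg
  have h3 : (0 : ℝ) < Real.sqrt 3 := Real.sqrt_pos.2 (by norm_num)
  have hI : halfRoot.re = 0 ∧ halfRoot.im = Real.sqrt 3 / 2 := by
    constructor <;> simp [halfRoot]
  have h0 := congrArg (fun x => x.1) hg
  have h1 := congrArg (fun x => x.2.1) hg
  have h2 := congrArg (fun x => x.2.2.im) hg
  simp [nul, corner, normSq_halfRoot, hI.2] at h0 h1 h2
  have e1 : g 1 = g 2 := by nlinarith
  have e2 : g 1 = 0 := by linarith
  have e3 : g 0 = 0 := by linarith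
  intro i
  rcases fin_three_cases i with rfl | rfl | rfl
  · exact e3
  · exact e2
  · exact e1 ▸ e2

/-- Both sides are homogeneous of degree 2 in `v`, so `v` may be taken in a compact part of the unit
sphere. At the limit the left side vanishes there and the right side is positive. -/
lemma eventually_ping (k : Fin 3) :
    ∀ᶠ N in nhds limitMatrix, ∀ v, v ≠ 0 → len v ≤ 8 * Complex.normSq (cross v (corner k)) →
    8 * Complex.normSq (cross (comm N k *ᵥ v) (corner k)) < len (comm N k *ᵥ v) := by
  have hc : Continuous fun v : Fin 2 → ℂ => cross v (corner k) := by unfold cross; fun_prop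
  have hK : IsCompact {v : Fin 2 → ℂ |
      len v = 1 ∧ 1 ≤ 8 * Complex.normSq (cross v (corner k))} := by
    refine Metric.isCompact_of_isClosed_isBounded ?_ ?_
    · exact (isClosed_eq continuous_len continuous_const).inter
        (isClosed_le continuous_const (continuous_const.mul (Complex.continuous_normSq.comp hc)))
    · refine (Metric.isBounded_closedBall (x := (0 : Fin 2 → ℂ)) (r := 1)).subset ?_
      rintro v ⟨hv, -⟩
      rw [mem_closedBall_zero_iff, pi_norm_le_iff_of_nonneg zero_le_one]
      intro i
      have h0 := Complex.normSq_nonneg (v 0)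
      have h1 := Complex.normSq_nonneg (v 1)
      rw [len] at hv
      rw [← abs_of_nonneg (norm_nonneg (v i)), ← sq_le_one_iff_abs_le_one,
        ← Complex.normSq_eq_norm_sq]
      rcases fin_two_cases i with rfl | rfl <;> linarith
  have key : ∀ᶠ N in nhds limitMatrix, ∀ v ∈ {v : Fin 2 → ℂ | len v = 1 ∧
      1 ≤ 8 * Complex.normSq (cross v (corner k))},
      8 * Complex.normSq (cross (comm N k *ᵥ v) (corner k)) < len (comm N k *ᵥ v) := by
    refine hK.eventually_forall_of_forall_eventually fun v hv => ?_
    have hm : Continuous fun p : (Fin 3 → Matrix (Fin 2) (Fin 2) ℂ) × (Fin 2 → ℂ) =>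
        comm p.1 k *ᵥ p.2 := ((continuous_comm k).comp continuous_fst).matrix_mulVec continuous_snd
    refine (ContinuousAt.eventually_lt
      (f := fun p : (Fin 3 → Matrix (Fin 2) (Fin 2) ℂ) × (Fin 2 → ℂ) =>
        8 * Complex.normSq (cross (comm p.1 k *ᵥ p.2) (corner k)))
      (g := fun p => len (comm p.1 k *ᵥ p.2)) (x₀ := (limitMatrix, v)) ?_ ?_ ?_)
    · exact (continuous_const.mul (Complex.continuous_normSq.comp (hc.comp hm))).continuousAt
    · exact (continuous_len.comp hm).continuousAt
    · have h0 : cross v (corner k) ≠ 0 := by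
        intro h
        have := hv.2
        rw [h] at this
        norm_num at this
      simp only [comm_limitMatrix_mulVec, cross_smul, cross_self, len_smul, len_corner]
      simp [halfRoot_ne_zero, h0]
  filter_upwards [key] with N hN v hv hvc
  have hl := len_pos hv
  set c : ℂ := (((Real.sqrt (len v))⁻¹ : ℝ) : ℂ) with hcdef
  have hcn : Complex.normSq c * len v = 1 := by
    rw [hcdef, Complex.normSq_ofReal, ← mul_inv, Real.mul_self_sqrt hl.le, inv_mul_cancel₀ hl.ne']
  have hcp : 0 < Complex.normSq c := by
    by_contra h
    nlinarith [Complex.normSq_nonneg c]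
  have := hN (c • v) ⟨by rw [len_smul, hcn], by
    rw [cross_smul, Complex.normSq_mul]; nlinarith⟩
  rw [Matrix.mulVec_smul, cross_smul, len_smul, Complex.normSq_mul] at this
  nlinarith

/-- Every condition is open. The expansion inequalities hold at the limit because the determinants
of the commutators vanish there while the right sides stay positive. -/
lemma eventually_isNearLimit :
    ∀ᶠ p in nhds ((limitMatrix, 0) : (Fin 3 → Matrix (Fin 2) (Fin 2) ℂ) × (Fin 3 → ℂ)),
      IsNearLimit p.1 p.2 := by
  have hL := continuous_largeEigenvector
  have hS := continuous_smallEigenvector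
  have hdet : ∀ k, Continuous fun p : (Fin 3 → Matrix (Fin 2) (Fin 2) ℂ) × (Fin 3 → ℂ) =>
      Real.exp 4 * ‖(comm p.1 k).det‖ := fun k =>
    continuous_const.mul ((((continuous_comm k).comp continuous_fst).matrix_det).norm)
  have h1 : ∀ᶠ p in nhds ((limitMatrix, 0) : (Fin 3 → Matrix (Fin 2) (Fin 2) ℂ) × (Fin 3 → ℂ)),
      ∀ j, cross (largeEigenvector p.1 p.2 j) (smallEigenvector p.1 p.2 j) ≠ 0 := by
    rw [Filter.eventually_all]
    intro j
    refine ContinuousAt.eventually_ne (g := fun p : (Fin 3 → Matrix (Fin 2) (Fin 2) ℂ) × (Fin 3 → ℂ)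
      => cross (largeEigenvector p.1 p.2 j) (smallEigenvector p.1 p.2 j)) ?_ ?_
    · have := hL j
      have := hS j
      unfold cross
      fun_prop
    · simp only [largeEigenvector_limit, smallEigenvector_limit]
      have := cross_corner (j + 1)
      rw [add_one_one] at this
      rw [this]
      exact halfRoot_ne_zero
  have h2 : ∀ᶠ p in nhds ((limitMatrix, 0) : (Fin 3 → Matrix (Fin 2) (Fin 2) ℂ) × (Fin 3 → ℂ)),
      ∀ x ∈ KahnMarkovic.centre, Function.Injective (fderiv ℝ (surf (fun _ _ => glide)
        (fun j => nul (largeEigenvector p.1 p.2 j),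
          fun j => nul (smallEigenvector p.1 p.2 j))) x) := by
    have hc : Continuous fun p : (Fin 3 → Matrix (Fin 2) (Fin 2) ℂ) × (Fin 3 → ℂ) =>
        ((fun j => nul (largeEigenvector p.1 p.2 j), fun j => nul (smallEigenvector p.1 p.2 j)) :
          (Fin 3 → Herm) × (Fin 3 → Herm)) :=
      (continuous_pi fun j => continuous_nul.comp (hL j)).prodMk
        (continuous_pi fun j => continuous_nul.comp (hS j))
    have h := hc.tendsto (limitMatrix, 0)
    simp only [largeEigenvector_limit, smallEigenvector_limit] at h
    exact h.eventually (eventually_injective_fderiv linearIndependent_nul_corner)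
  have h3 : ∀ᶠ p in nhds ((limitMatrix, 0) : (Fin 3 → Matrix (Fin 2) (Fin 2) ℂ) × (Fin 3 → ℂ)),
      ∀ k, Real.exp 4 * ‖(comm p.1 k).det‖ * len (smallEigenvector p.1 p.2 (k + 1))
        < len (comm p.1 k *ᵥ largeEigenvector p.1 p.2 (k + 1)) := by
    rw [Filter.eventually_all]
    intro k
    refine ContinuousAt.eventually_lt ?_ ?_ ?_
    · exact ((hdet k).mul (continuous_len.comp (hS _))).continuousAt
    · exact (continuous_len.comp
        (((continuous_comm k).comp continuous_fst).matrix_mulVec (hL _))).continuousAt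
    · simp only [largeEigenvector_limit, det_comm_limitMatrix, add_one_one, comm_limitMatrix_mulVec,
        len_smul, len_corner]
      have := cross_corner (k + 2)
      rw [add_two_one] at this
      rw [this]
      simp [halfRoot_ne_zero]
  have h4 : ∀ᶠ p in nhds ((limitMatrix, 0) : (Fin 3 → Matrix (Fin 2) (Fin 2) ℂ) × (Fin 3 → ℂ)),
      ∀ k, Real.exp 4 * ‖(comm p.1 k).det‖ * len (largeEigenvector p.1 p.2 (k + 2))
        < len (comm p.1 k *ᵥ smallEigenvector p.1 p.2 (k + 2)) := by
    rw [Filter.eventually_all]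
    intro k
    refine ContinuousAt.eventually_lt ?_ ?_ ?_
    · exact ((hdet k).mul (continuous_len.comp (hL _))).continuousAt
    · exact (continuous_len.comp
        (((continuous_comm k).comp continuous_fst).matrix_mulVec (hS _))).continuousAt
    · simp only [smallEigenvector_limit, det_comm_limitMatrix, add_two_two, comm_limitMatrix_mulVec,
        len_smul, len_corner]
      have := cross_corner_two (k + 1)
      rw [add_one_two] at this
      rw [this]
      simp [halfRoot_ne_zero]
  have h5 : ∀ᶠ p in nhds ((limitMatrix, 0) : (Fin 3 → Matrix (Fin 2) (Fin 2) ℂ) × (Fin 3 → ℂ)),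
      ∀ k v, v ≠ 0 → len v ≤ 8 * Complex.normSq (cross v (corner k)) →
        8 * Complex.normSq (cross (comm p.1 k *ᵥ v) (corner k)) < len (comm p.1 k *ᵥ v) := by
    rw [Filter.eventually_all]
    intro k
    exact (continuous_fst.tendsto ((limitMatrix, 0) :
      (Fin 3 → Matrix (Fin 2) (Fin 2) ℂ) × (Fin 3 → ℂ))).eventually (eventually_ping k)
  filter_upwards [h1, h2, h3, h4, h5] with p a1 a2 a3 a4 a5
  exact ⟨a1, a2, a3, a4, a5⟩

/-! ### Flatness of triples near the limit -/

lemma cross_mulVec (g : SL(2, ℂ)) (u v : Fin 2 → ℂ) :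
    cross ((g : Matrix (Fin 2) (Fin 2) ℂ) *ᵥ u) ((g : Matrix (Fin 2) (Fin 2) ℂ) *ᵥ v)
      = cross u v := by
  simp only [cross, Matrix.mulVec, dotProduct, Fin.sum_univ_two]
  linear_combination (u 0 * v 1 - u 1 * v 0) * sl_det g

/-- `g` preserves the determinant of two vectors, whereas eigenvectors multiply it by `x * x ≠ 1`.
-/
lemma cross_eq_zero_of_eigenvectors {g : SL(2, ℂ)} {x : ℂ} (hx : x * x ≠ 1) {u v : Fin 2 → ℂ}
    (hu : (g : Matrix (Fin 2) (Fin 2) ℂ) *ᵥ u = x • u)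
    (hv : (g : Matrix (Fin 2) (Fin 2) ℂ) *ᵥ v = x • v) : cross u v = 0 := by
  have h := cross_mulVec g u v
  rw [hu, hv] at h
  have e : cross (x • u) (x • v) = x * x * cross u v := by simp [cross]; ring
  rw [e] at h
  by_contra h0
  exact hx (mul_right_cancel₀ h0 (by rw [h, one_mul]))

lemma exists_smul_of_cross_eq_zero {u v : Fin 2 → ℂ} (hv : v ≠ 0) (h : cross u v = 0) :
    ∃ c : ℂ, u = c • v := by
  rw [cross] at h
  by_cases h0 : v 0 = 0
  · have h1 : v 1 ≠ 0 := fun h1 => hv (by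
      funext i; rcases fin_two_cases i with rfl | rfl <;> assumption)
    refine ⟨u 1 / v 1, ?_⟩
    funext i
    rcases fin_two_cases i with rfl | rfl
    · have : u 0 = 0 := by
        rw [h0, mul_zero, sub_zero] at h
        exact (mul_eq_zero.1 h).resolve_right h1
      simp [h0, this]
    · simp [h1]
  · refine ⟨u 0 / v 0, ?_⟩
    funext i
    rcases fin_two_cases i with rfl | rfl
    · simp [h0]
    · simp only [Pi.smul_apply, smul_eq_mul]
      field_simp
      linear_combination -h

/-- Cayley–Hamilton: the image of `g - y` consists of eigenvectors for the other eigenvalue `x`. -/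
lemma mulVec_mulVec_sub (g : SL(2, ℂ)) {x y : ℂ} (h : x * y = 1) (ht : g 0 0 + g 1 1 = x + y)
    (f : Fin 2 → ℂ) :
    (g : Matrix (Fin 2) (Fin 2) ℂ) *ᵥ ((g : Matrix (Fin 2) (Fin 2) ℂ) *ᵥ f - y • f)
      = x • ((g : Matrix (Fin 2) (Fin 2) ℂ) *ᵥ f - y • f) := by
  have hd := sl_det g
  funext i
  rcases fin_two_cases i with rfl | rfl <;>
    simp only [Matrix.mulVec, dotProduct, Fin.sum_univ_two, Pi.sub_apply, Pi.smul_apply,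
      smul_eq_mul] <;> grind

section

variable {M : Fin 3 → SL(2, ℂ)} {σ : Fin 3 → ℂ} {N : Fin 3 → Matrix (Fin 2) (Fin 2) ℂ}
  {z c : Fin 3 → ℂ}

lemma exp_mul_exp_neg (s : ℂ) : Complex.exp s * Complex.exp (-s) = 1 := by
  rw [← Complex.exp_add]; simp

lemma IsTameTriple.trace_exp (h : IsTameTriple M σ) (k : Fin 3) :
    M k 0 0 + M k 1 1 = Complex.exp (σ k) + Complex.exp (-σ k) := by
  rw [h.trace, Complex.cosh]; ring

lemma ne_zero_of_eq_smul {g : SL(2, ℂ)} {N : Matrix (Fin 2) (Fin 2) ℂ} {c : ℂ}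
    (h : (g : Matrix (Fin 2) (Fin 2) ℂ) = c • N) : c ≠ 0 := by
  rintro rfl
  have := g.det_coe
  rw [h] at this
  simp at this

lemma IsTameTriple.mulVec_largeEigenvector (h : IsTameTriple M σ)
    (hM : ∀ n, (M n : Matrix (Fin 2) (Fin 2) ℂ) = c n • N n)
    (hz : ∀ n, Complex.exp (-σ n) = c n * z n) (j : Fin 3) :
    (M (j + 1) : Matrix (Fin 2) (Fin 2) ℂ) *ᵥ largeEigenvector N z j
      = Complex.exp (σ (j + 1)) • largeEigenvector N z j := by
  have hc := ne_zero_of_eq_smul (hM (j + 1))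
  have e : largeEigenvector N z j = (4 / 3 * (c (j + 1))⁻¹ : ℂ) •
      ((M (j + 1) : Matrix (Fin 2) (Fin 2) ℂ) *ᵥ corner (j + 1)
        - Complex.exp (-σ (j + 1)) • corner (j + 1)) := by
    rw [hM, hz, Matrix.smul_mulVec, mul_smul (c (j + 1)) (z (j + 1)), ← smul_sub, smul_smul,
      inv_mul_cancel_right₀ hc, largeEigenvector]
  rw [e, Matrix.mulVec_smul, mulVec_mulVec_sub _ (exp_mul_exp_neg _) (h.trace_exp _), smul_comm]

lemma IsTameTriple.mulVec_smallEigenvector (h : IsTameTriple M σ)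
    (hM : ∀ n, (M n : Matrix (Fin 2) (Fin 2) ℂ) = c n • N n)
    (hz : ∀ n, Complex.exp (-σ n) = c n * z n) (j : Fin 3) :
    (M (j + 1) : Matrix (Fin 2) (Fin 2) ℂ) *ᵥ smallEigenvector N z j
      = Complex.exp (-σ (j + 1)) • smallEigenvector N z j := by
  have hc := ne_zero_of_eq_smul (hM (j + 1))
  have ht := h.trace_exp (j + 1)
  have ht' : c (j + 1) * (N (j + 1) 0 0 + N (j + 1) 1 1 - z (j + 1)) = Complex.exp (σ (j + 1)) := by
    rw [hM] at ht
    simp only [Matrix.smul_apply, smul_eq_mul] at ht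
    linear_combination ht + hz (j + 1)
  have e : smallEigenvector N z j = (-(4 / 3) * (c (j + 1))⁻¹ : ℂ) •
      ((M (j + 1) : Matrix (Fin 2) (Fin 2) ℂ) *ᵥ corner (j + 2)
        - Complex.exp (σ (j + 1)) • corner (j + 2)) := by
    rw [hM, ← ht', Matrix.smul_mulVec, mul_smul (c (j + 1)), ← smul_sub, smul_smul,
      inv_mul_cancel_right₀ hc, smallEigenvector]
  rw [e, Matrix.mulVec_smul, mulVec_mulVec_sub _ (by rw [mul_comm]; exact exp_mul_exp_neg _)
    (by rw [add_comm (Complex.exp _)]; exact h.trace_exp _), smul_comm]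

lemma Tame.exp_sq_ne_one {s : ℂ} (h : Tame s) : Complex.exp s * Complex.exp s ≠ 1 ∧
    Complex.exp (-s) * Complex.exp (-s) ≠ 1 := by
  have h1 := h.sector_sinh.ne_zero
  have h2 := exp_mul_exp_neg s
  rw [Complex.sinh] at h1
  constructor <;> intro h3 <;> apply h1 <;> grind

lemma comm_eq_smul (hM : ∀ n, (M n : Matrix (Fin 2) (Fin 2) ℂ) = c n • N n) (k : Fin 3) :
    comm (fun n => (M n : Matrix (Fin 2) (Fin 2) ℂ)) k = (c (k + 2) * c k) • comm N k := by
  simp only [comm, hM, Matrix.smul_mul, Matrix.mul_smul, smul_smul, smul_sub]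
  rw [mul_comm (c (k + 2))]

/-- The half-turns of a triple near the limit. -/
lemma IsTameTriple.exists_half_turns_smul (h : IsTameTriple M σ)
    (hM : ∀ n, (M n : Matrix (Fin 2) (Fin 2) ℂ) = c n • N n) :
    ∃ (H : Fin 3 → SL(2, ℂ)) (κ : Fin 3 → ℂ), (∀ k, H k * H k = -1) ∧
      (∀ k, H k * H (k + 1) = M k) ∧
      (∀ k, (H k : Matrix (Fin 2) (Fin 2) ℂ) = κ k • comm N k) ∧
      ∀ k, Complex.normSq (κ k) * ‖(comm N k).det‖ = 1 := by
  obtain ⟨δ, H, hδ, h1, h2, h3, h4⟩ := h.exists_half_turns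
  refine ⟨H, fun k => δ⁻¹ * (c (k + 2) * c k), h3, h4, fun k => ?_, fun k => ?_⟩
  · rw [h1, comm_eq_smul hM, smul_smul]
  · have e := (H k).det_coe
    rw [h1, comm_eq_smul hM, smul_smul, Matrix.det_smul, Fintype.card_fin] at e
    rw [Complex.normSq_eq_norm_sq, ← norm_pow, ← norm_mul, e, norm_one]

lemma IsNearLimit.large_ne_zero (hN : IsNearLimit N z) (j : Fin 3) :
    largeEigenvector N z j ≠ 0 := fun h => hN.det j (by rw [h]; simp [cross])

lemma IsNearLimit.small_ne_zero (hN : IsNearLimit N z) (j : Fin 3) :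
    smallEigenvector N z j ≠ 0 := fun h => hN.det j (by rw [h]; simp [cross])

/-- A half-turn near the limit moves the endpoint `u` far towards the opposite endpoint `w`. -/
lemma exists_expansion {H g : SL(2, ℂ)} {X : Matrix (Fin 2) (Fin 2) ℂ} {κ x : ℂ}
    (hx : x * x ≠ 1) (hHX : (H : Matrix (Fin 2) (Fin 2) ℂ) = κ • X)
    (hκ : Complex.normSq κ * ‖X.det‖ = 1) (hHg : g * H = H * g⁻¹) {u w : Fin 2 → ℂ} {y : ℂ}
    (hxy : x * y = 1) (hw0 : w ≠ 0) (hu : (g : Matrix (Fin 2) (Fin 2) ℂ) *ᵥ u = y • u)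
    (hw : (g : Matrix (Fin 2) (Fin 2) ℂ) *ᵥ w = x • w)
    (hexp : Real.exp 4 * ‖X.det‖ * len w < len (X *ᵥ u)) :
    ∃ T : ℝ, 2 ≤ T ∧ hact H (nul u) = Real.exp (2 * T) • nul w := by
  have hgu : ((g⁻¹ : SL(2, ℂ)) : Matrix (Fin 2) (Fin 2) ℂ) *ᵥ u = x • u := by
    have : ((g⁻¹ : SL(2, ℂ)) : Matrix (Fin 2) (Fin 2) ℂ)
        *ᵥ (x • (g : Matrix (Fin 2) (Fin 2) ℂ) *ᵥ u)
        = x • u := by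
      rw [Matrix.mulVec_smul, Matrix.mulVec_mulVec, ← Matrix.SpecialLinearGroup.coe_mul]; simp
    rwa [hu, smul_smul, hxy, one_smul] at this
  -- The half-turn inverts `g`, so it exchanges the two eigenlines of `g`.
  have h1 : (g : Matrix (Fin 2) (Fin 2) ℂ) *ᵥ ((H : Matrix (Fin 2) (Fin 2) ℂ) *ᵥ u)
      = x • ((H : Matrix (Fin 2) (Fin 2) ℂ) *ᵥ u) := by
    rw [Matrix.mulVec_mulVec, ← Matrix.SpecialLinearGroup.coe_mul, hHg,
      Matrix.SpecialLinearGroup.coe_mul, ← Matrix.mulVec_mulVec, hgu, Matrix.mulVec_smul]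
  obtain ⟨d, hd⟩ := exists_smul_of_cross_eq_zero hw0 (cross_eq_zero_of_eigenvectors hx h1 hw)
  have hlw := len_pos hw0
  have h2 : Complex.normSq κ * len (X *ᵥ u) = Complex.normSq d * len w := by
    rw [← len_smul, ← len_smul, ← hd, hHX, Matrix.smul_mulVec]
  have hκ0 : 0 < Complex.normSq κ := by
    by_contra h
    have : Complex.normSq κ = 0 := le_antisymm (not_lt.1 h) (Complex.normSq_nonneg _)
    rw [this, zero_mul] at hκ
    exact zero_ne_one hκ
  have h3 : Real.exp 4 ≤ Complex.normSq d := by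
    have h4 : Real.exp 4 * len w ≤ Complex.normSq d * len w := by
      rw [← h2]
      calc Real.exp 4 * len w = Complex.normSq κ * (Real.exp 4 * ‖X.det‖ * len w) := by
            linear_combination (-(Real.exp 4 * len w)) * hκ
        _ ≤ _ := by gcongr
    exact le_of_mul_le_mul_right h4 hlw
  refine ⟨Real.log (Complex.normSq d) / 2, ?_, ?_⟩
  · have := (Real.le_log_iff_exp_le ((Real.exp_pos _).trans_le h3)).2 h3
    linarith
  · rw [hact_nul, hd, nul_smul, mul_div_cancel₀ _ two_ne_zero,
      Real.exp_log ((Real.exp_pos _).trans_le h3)]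

/-- The `j`-th geodesic is the axis of `M (j + 1)`, with attracting endpoint `P j` and repelling
endpoint `Q j`. The half-turn `H k` inverts `M k` and `M (k + 2)`, so it swaps the endpoints of
their axes, and near the limit it does so with a factor at least `exp 4`, that is `T ≥ 2`. -/
lemma exists_isSkewHexagon (h : IsTameTriple M σ) (hN : IsNearLimit N z)
    (hM : ∀ n, (M n : Matrix (Fin 2) (Fin 2) ℂ) = c n • N n)
    (hz : ∀ n, Complex.exp (-σ n) = c n * z n) :
    ∃ H P Q T, IsSkewHexagon H P Q T ∧ ∀ k, H k * H (k + 1) = M k := by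
  obtain ⟨H, κ, h1, h2, h3, h4⟩ := h.exists_half_turns_smul hM
  have hP := h.mulVec_largeEigenvector hM hz
  have hQ := h.mulVec_smallEigenvector hM hz
  have hinv : ∀ k, (H k)⁻¹ = -H k := fun k => by
    rw [inv_eq_iff_mul_eq_one, mul_neg, h1, neg_neg]
  have e1 : ∀ k, M (k + 2) * H k = H k * (M (k + 2))⁻¹ := fun k => by
    have : M (k + 2) = H (k + 2) * H k := by rw [← h2, add_two_one]
    rw [this, mul_inv_rev, hinv, hinv, neg_mul_neg, mul_assoc, h1, ← mul_assoc, h1]; simp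
  have e2 : ∀ k, M k * H k = H k * (M k)⁻¹ := fun k => by
    rw [← h2, mul_inv_rev, hinv, hinv, neg_mul_neg, mul_assoc]
  choose Tp hTp hTp' using fun k => exists_expansion (x := Complex.exp (-σ (k + 2)))
    (y := Complex.exp (σ (k + 2))) (h.tame (k + 2)).exp_sq_ne_one.2 (h3 k) (h4 k) (e1 k)
    (by rw [mul_comm]; exact exp_mul_exp_neg _) (hN.small_ne_zero (k + 1))
    (by have := hP (k + 1); rwa [add_one_one] at this)
    (by have := hQ (k + 1); rwa [add_one_one] at this) (hN.expand_large k)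
  choose Tq hTq hTq' using fun k => exists_expansion (x := Complex.exp (σ k))
    (y := Complex.exp (-σ k)) (h.tame k).exp_sq_ne_one.1 (h3 k) (h4 k) (e2 k)
    (exp_mul_exp_neg _) (hN.large_ne_zero (k + 2))
    (by have := hQ (k + 2); rwa [add_two_one] at this)
    (by have := hP (k + 2); rwa [add_two_one] at this) (hN.expand_small k)
  -- Only the values of `T k j` with `j ≠ k` carry meaning; the remaining one only has to be at
  -- least 2.
  refine ⟨H, largeEigenvector N z, smallEigenvector N z,
    fun k j => if j = k + 1 then Tp k else Tq k, ?_, h2⟩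
  · refine ⟨h1, fun k j => ?_, hN.det, fun k => ?_, fun k => ?_, fun k => ?_, hN.centre⟩
    · split_ifs
      · exact hTp k
      · exact hTq k
    · rw [if_pos rfl]
      exact hTp' k
    · rw [if_neg (add_one_ne_add_two k).symm]
      exact hTq' k
    · have p1 := h.prod (k + 2)
      rw [add_two_one, add_two_two] at p1
      have a1 := hP (k + 1)
      have a2 := hQ (k + 1)
      have a3 := hP (k + 2)
      have a4 := hQ (k + 2)
      rw [add_one_one] at a1 a2
      rw [add_two_one] at a3 a4
      exact stripIndep_of_trace p1 (h.trace _) (h.trace _) (h.trace _) (h.tame _) (h.tame _)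
        (h.tame _) (h.close _ _) (h.close _ _) (hN.large_ne_zero _) (hN.small_ne_zero _)
        (hN.large_ne_zero _) (hN.small_ne_zero _) a1 a2 a3 a4
-- Injectivity of the representation.
lemma cross_sub (v : Fin 2 → ℂ) (j : Fin 3) : halfRoot • v
    = cross v (corner (j + 1)) • corner j - cross v (corner j) • corner (j + 1) := by
  rw [← cross_corner j]
  funext i
  rcases fin_two_cases i with rfl | rfl <;> simp [cross] <;> ring

lemma len_sub_le (u v : Fin 2 → ℂ) : len (u - v) ≤ 2 * len u + 2 * len v := by
  have h : ∀ a b : ℂ, Complex.normSq (a - b) ≤ 2 * Complex.normSq a + 2 * Complex.normSq b := by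
    intro a b
    have := Complex.normSq_nonneg (a + b)
    simp only [Complex.normSq_apply, Complex.sub_re, Complex.sub_im, Complex.add_re,
      Complex.add_im] at *
    nlinarith
  have h0 := h (u 0) (v 0)
  have h1 := h (u 1) (v 1)
  simp only [len, Pi.sub_apply]
  linarith

/-- Ping-pong with cones around the three corners: by `ping` the half-turn `H k` sends the
complement of the `k`-th cone into this cone. -/
lemma injective_of_isNearLimit (h : IsTameTriple M σ) (hN : IsNearLimit N z)
    (hM : ∀ n, (M n : Matrix (Fin 2) (Fin 2) ℂ) = c n • N n) :
    Function.Injective (FreeGroup.lift ![proj (M 0), proj (M 1)]) := by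
  obtain ⟨H, κ, h1, h2, h3, h4⟩ := h.exists_half_turns_smul hM
  -- The constant 8 makes the cones disjoint: expanding `v` in two corners, a common vector would
  -- satisfy `3/4 * len v < (2/8 + 2/8) * len v`.
  have hdisj : ∀ (j : Fin 3) (v : NonzeroVec), 8 * Complex.normSq (cross v.1 (corner j)) < len v.1 →
      ¬ 8 * Complex.normSq (cross v.1 (corner (j + 1))) < len v.1 := by
    intro j v a1 a2
    have e := congrArg len (cross_sub v.1 j)
    have := len_sub_le (cross v.1 (corner (j + 1)) • corner j)
      (cross v.1 (corner j) • corner (j + 1))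
    rw [← e] at this
    simp only [len_smul, len_corner, normSq_halfRoot] at this
    have := len_pos v.2
    linarith
  have key := injective_lift_half_turns h1
    (U := fun k => {v : NonzeroVec | 8 * Complex.normSq (cross v.1 (corner k)) < len v.1})
    ?_ ?_ ?_ ?_
  · have e : ![H 0 * H 1, H 1 * H 2] = ![M 0, M 1] := by rw [← h2, ← h2]; rfl
    rw [e] at key
    have e' : (fun i => proj (![M 0, M 1] i)) = ![proj (M 0), proj (M 1)] := by
      funext i
      rcases fin_two_cases i with rfl | rfl <;> rfl
    rw [← e']
    exact injective_lift_proj key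
  · intro k
    refine ⟨⟨corner k, fun h => ?_⟩, ?_⟩
    · have := len_corner k
      rw [h] at this
      simp [len] at this
    · change 8 * Complex.normSq (cross (corner k) (corner k)) < len (corner k)
      rw [cross_self, len_corner]
      simp
  · intro k v hv
    have e : ((-1 : SL(2, ℂ)) • v).1 = (-1 : ℂ) • v.1 := by
      change ((-1 : SL(2, ℂ)) : Matrix (Fin 2) (Fin 2) ℂ) *ᵥ v.1 = _
      rw [Matrix.SpecialLinearGroup.coe_neg, Matrix.SpecialLinearGroup.coe_one, Matrix.neg_mulVec,
        Matrix.one_mulVec, neg_one_smul]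
    change 8 * Complex.normSq (cross ((-1 : SL(2, ℂ)) • v).1 (corner k))
      < len ((-1 : SL(2, ℂ)) • v).1
    rw [e, cross_smul, len_smul, Complex.normSq_mul]
    simpa using hv
  · intro j k hjk
    refine Set.disjoint_left.2 fun v a1 a2 => ?_
    rcases eq_or_eq_add j k with rfl | rfl | rfl
    · exact hjk rfl
    · exact hdisj k v a2 a1
    · exact hdisj (k + 2) v a1 (by rw [add_two_one]; exact a2)
  · intro k v hv
    have e : (H k • v).1 = κ k • (comm N k *ᵥ v.1) := by
      change (H k : Matrix (Fin 2) (Fin 2) ℂ) *ᵥ v.1 = _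
      rw [h3, Matrix.smul_mulVec]
    have hκ0 : 0 < Complex.normSq (κ k) := by
      by_contra h
      have h0 : Complex.normSq (κ k) = 0 := le_antisymm (not_lt.1 h) (Complex.normSq_nonneg _)
      have := h4 k
      rw [h0, zero_mul] at this
      exact zero_ne_one this
    have := hN.ping k v.1 v.2 (not_lt.1 hv)
    change 8 * Complex.normSq (cross (H k • v).1 (corner k)) < len (H k • v).1
    rw [e, cross_smul, len_smul, Complex.normSq_mul]
    nlinarith

end

/-! ### Conjugation -/

/-- The action of an element of `SL₂(ℂ)` on Hermitian matrices, as a linear equivalence. -/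
def hactEquiv (g : SL(2, ℂ)) : Herm ≃L[ℝ] Herm :=
  ContinuousLinearEquiv.equivOfInverse (hactL g) (hactL g⁻¹)
    (fun x => by rw [hactL_apply, hactL_apply]; exact hact_inv_hact g x)
    (fun x => by rw [hactL_apply, hactL_apply]; exact hact_hact_inv g x)

lemma hactEquiv_apply (g : SL(2, ℂ)) (x : Herm) : hactEquiv g x = hact g x := rfl

lemma hact_injective (g : SL(2, ℂ)) : Function.Injective (hact g) :=
  (hactEquiv g).injective

lemma hact_zero (g : SL(2, ℂ)) : hact g 0 = 0 := (hactL g).map_zero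

lemma hact_neg' (g : SL(2, ℂ)) (x : Herm) : hact g (-x) = -hact g x := (hactL g).map_neg x

lemma StripIndep.hact {p q p' q' : Herm} (h : StripIndep p q p' q') (g : SL(2, ℂ)) :
    StripIndep (hact g p) (hact g q) (hact g p') (hact g q') := by
  intro s w s' w' u v a b d h1 h2 h3 h4 h5 h6 h7 e
  refine h s w s' w' u v a b d h1 h2 h3 h4 h5 h6 h7 ?_
  apply hact_injective g
  rw [hact_zero, ← e]
  simp only [hact_add, hact_smul, hact_neg', sub_eq_add_neg]

lemma surf_hact (φ : Fin 3 → Fin 3 → ℝ → ℝ) (P Q : Fin 3 → Fin 2 → ℂ) (g : SL(2, ℂ)) :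
    surf φ (fun j => nul ((g : Matrix (Fin 2) (Fin 2) ℂ) *ᵥ P j),
      fun j => nul ((g : Matrix (Fin 2) (Fin 2) ℂ) *ᵥ Q j))
      = hactEquiv g ∘ surf φ (fun j => nul (P j), fun j => nul (Q j)) := by
  funext x
  simp only [surf, Function.comp_apply, map_sum, map_add, map_smul, hactEquiv_apply, hact_nul]

lemma IsSkewHexagon.conj {H : Fin 3 → SL(2, ℂ)} {P Q : Fin 3 → Fin 2 → ℂ} {T : Fin 3 → Fin 3 → ℝ}
    (h : IsSkewHexagon H P Q T) (g : SL(2, ℂ)) :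
    IsSkewHexagon (fun k => g * H k * g⁻¹) (fun j => (g : Matrix (Fin 2) (Fin 2) ℂ) *ᵥ P j)
      (fun j => (g : Matrix (Fin 2) (Fin 2) ℂ) *ᵥ Q j) T where
  sq k := by
    have e : g * H k * g⁻¹ * (g * H k * g⁻¹) = g * (H k * H k) * g⁻¹ := by group
    rw [e, h.sq]; simp
  two_le := h.two_le
  det j := by
    have := cross_mulVec g (P j) (Q j)
    simp only [cross] at this
    rw [this]
    exact h.det j
  act_p k := by
    rw [← hact_nul, ← hact_nul, ← hact_mul, inv_mul_cancel_right, hact_mul, h.act_p, hact_smul]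
  act_q k := by
    rw [← hact_nul, ← hact_nul, ← hact_mul, inv_mul_cancel_right, hact_mul, h.act_q, hact_smul]
  strip k := by
    simp only [← hact_nul]
    exact (h.strip k).hact g
  centre x hx := by
    rw [surf_hact, ContinuousLinearEquiv.comp_fderiv]
    exact (hactEquiv g).injective.comp (h.centre x hx)

lemma lift_conj {K : Type*} [Group K] (x a b : K) :
    FreeGroup.lift ![x * a * x⁻¹, x * b * x⁻¹]
      = (MulAut.conj x).toMonoidHom.comp (FreeGroup.lift ![a, b]) := by
  ext i
  rcases fin_two_cases i with rfl | rfl <;> simp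

lemma IsTameTriple.conj {M : Fin 3 → SL(2, ℂ)} {σ : Fin 3 → ℂ} (h : IsTameTriple M σ)
    (g : SL(2, ℂ)) : IsTameTriple (fun k => g * M k * g⁻¹) σ where
  prod k := by
    have e : g * M k * g⁻¹ * (g * M (k + 1) * g⁻¹) * (g * M (k + 2) * g⁻¹)
        = g * (M k * M (k + 1) * M (k + 2)) * g⁻¹ := by group
    rw [e, h.prod]; simp
  trace k := by
    have := trace_conj g⁻¹ (M k)
    rw [inv_inv] at this
    rw [this, h.trace]
  tame := h.tame
  close := h.close

/-! ### Short paths -/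

section

open scoped Topology

lemma continuous_quadraticForm {E : Type*} [NormedAddCommGroup E] [NormedSpace ℝ E]
    [FiniteDimensional ℝ E] (Q : QuadraticForm ℝ E) : Continuous Q := by
  let L : E →ₗ[ℝ] (E →L[ℝ] ℝ) :=
    (LinearMap.toContinuousLinearMap (𝕜 := ℝ) (E := E) (F' := ℝ)).toLinearMap ∘ₗ
      (QuadraticMap.associated Q)
  have hL : Continuous L := L.continuous_of_finiteDimensional
  have e : (Q : E → ℝ) = fun x => L x x := by
    funext x
    exact (QuadraticMap.associated_eq_self_apply ℝ Q x).symm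
  rw [e]
  exact hL.clm_apply continuous_id

lemma FrameMetric.continuous_Q (m : FrameMetric) :
    Continuous fun X : Fin 2 → Fin 2 → ℂ => m.Q (Matrix.of X) :=
  continuous_quadraticForm
    (m.Q.comp ((Matrix.ofLinearEquiv ℝ : (Fin 2 → Fin 2 → ℂ) ≃ₗ[ℝ] Matrix (Fin 2) (Fin 2) ℂ) :
      (Fin 2 → Fin 2 → ℂ) →ₗ[ℝ] Matrix (Fin 2) (Fin 2) ℂ))

/-- The metric bounds the entries of traceless matrices. -/
lemma FrameMetric.exists_bound (m : FrameMetric) :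
    ∃ K : ℝ, 0 < K ∧ ∀ X : Matrix (Fin 2) (Fin 2) ℂ, X 0 0 + X 1 1 = 0 →
      ∀ i j, ‖X i j‖ ≤ K * Real.sqrt (m.Q X) := by
  have hK : IsCompact {X : Fin 2 → Fin 2 → ℂ | ‖X‖ = 1 ∧ X 0 0 + X 1 1 = 0} := by
    refine Metric.isCompact_of_isClosed_isBounded ?_ ?_
    · exact (isClosed_eq continuous_norm continuous_const).inter
        (isClosed_eq (by fun_prop) continuous_const)
    · refine (Metric.isBounded_closedBall (x := (0 : Fin 2 → Fin 2 → ℂ)) (r := 1)).subset ?_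
      rintro v ⟨hv, -⟩
      rw [mem_closedBall_zero_iff, hv]
  obtain ⟨q, hq0, hq⟩ : ∃ q : ℝ, 0 < q ∧ ∀ X : Fin 2 → Fin 2 → ℂ, ‖X‖ = 1 → X 0 0 + X 1 1 = 0 →
      q ≤ m.Q (Matrix.of X) := by
    rcases Set.eq_empty_or_nonempty
      {X : Fin 2 → Fin 2 → ℂ | ‖X‖ = 1 ∧ X 0 0 + X 1 1 = 0} with he | hne
    · exact ⟨1, one_pos, fun X h1 h2 => absurd (show X ∈ {X : Fin 2 → Fin 2 → ℂ |
        ‖X‖ = 1 ∧ X 0 0 + X 1 1 = 0} from ⟨h1, h2⟩) (by rw [he]; simp)⟩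
    · obtain ⟨X, ⟨hX1, hX2⟩, hX⟩ := hK.exists_isMinOn hne m.continuous_Q.continuousOn
      refine ⟨m.Q (Matrix.of X), m.pos _ ?_ ?_, fun Y h1 h2 => hX ⟨h1, h2⟩⟩
      · rw [Matrix.trace_fin_two]; exact hX2
      · intro h
        have : X = 0 := h
        rw [this] at hX1
        simp at hX1
  refine ⟨(Real.sqrt q)⁻¹, by positivity, fun X hX i j => ?_⟩
  have h1 : ‖X i j‖ ≤ ‖(fun i j => X i j : Fin 2 → Fin 2 → ℂ)‖ :=
    (norm_le_pi_norm (X i) j).trans (norm_le_pi_norm (fun i j => X i j : Fin 2 → Fin 2 → ℂ) i)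
  refine h1.trans ?_
  set N := ‖(fun i j => X i j : Fin 2 → Fin 2 → ℂ)‖ with hN
  have hN0 : 0 ≤ N := norm_nonneg _
  rcases hN0.eq_or_lt with h0 | h0
  · rw [← h0]
    positivity
  have h0' := h0.ne'
  have h2 := hq (N⁻¹ • (fun i j => X i j)) (by
    rw [norm_smul, norm_inv, Real.norm_of_nonneg h0.le, inv_mul_cancel₀ h0.ne']) (by
    simp only [Pi.smul_apply, ← smul_add, hX, smul_zero])
  have h3 : m.Q (Matrix.of (N⁻¹ • (fun i j => X i j : Fin 2 → Fin 2 → ℂ))) = N⁻¹ * N⁻¹ * m.Q X :=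
    m.Q.map_smul N⁻¹ X
  rw [h3] at h2
  have h4 : q * (N * N) ≤ m.Q X := by
    calc q * (N * N) ≤ N⁻¹ * N⁻¹ * m.Q X * (N * N) := by gcongr
      _ = m.Q X := by field_simp
  rw [inv_mul_eq_div, le_div_iff₀ (Real.sqrt_pos.2 hq0)]
  refine Real.le_sqrt_of_sq_le ?_
  rw [mul_pow, Real.sq_sqrt hq0.le]
  linarith

lemma IsC1Path.mul {c d : ℝ → SL(2, ℂ)} (hc : IsC1Path c) (hd : IsC1Path d) :
    IsC1Path fun t => c t * d t := by
  intro i j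
  simp only [sl_mul_apply]
  exact ((hc _ _).mul (hd _ _)).add ((hc _ _).mul (hd _ _))

/-- Upper triangular unipotent matrices. -/
def upperSL (a : ℂ) : SL(2, ℂ) := ⟨!![1, a; 0, 1], by simp⟩

/-- Lower triangular unipotent matrices. -/
def lowerSL (a : ℂ) : SL(2, ℂ) := ⟨!![1, 0; a, 1], by simp⟩

lemma isC1Path_upper (a : ℂ) : IsC1Path fun t => upperSL (t * a) := by
  intro i j
  rcases fin_two_cases i with rfl | rfl <;> rcases fin_two_cases j with rfl | rfl <;>
    simp [upperSL] <;> first | exact contDiff_const | skip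
  exact Complex.ofRealCLM.contDiff.mul contDiff_const

lemma isC1Path_lower (a : ℂ) : IsC1Path fun t => lowerSL (t * a) := by
  intro i j
  rcases fin_two_cases i with rfl | rfl <;> rcases fin_two_cases j with rfl | rfl <;>
    simp [lowerSL] <;> first | exact contDiff_const | skip
  exact Complex.ofRealCLM.contDiff.mul contDiff_const

/-- If the lower left entry is nonzero, `g` is a product of an upper, a lower and an upper unipotent
matrix, each of which contracts to 1. Otherwise one more lower factor creates such an entry. -/
lemma exists_isC1Path (g : SL(2, ℂ)) : ∃ c : ℝ → SL(2, ℂ), IsC1Path c ∧ c 0 = 1 ∧ c 1 = g := by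
  have hu : upperSL 0 = 1 := by apply sl_ext <;> simp [upperSL]
  have hl : lowerSL 0 = 1 := by apply sl_ext <;> simp [lowerSL]
  have key : ∀ g : SL(2, ℂ), g 1 0 ≠ 0 → ∃ c : ℝ → SL(2, ℂ), IsC1Path c ∧ c 0 = 1 ∧ c 1 = g := by
    intro g h
    refine ⟨fun t => upperSL (t * ((g 0 0 - 1) / g 1 0)) * lowerSL (t * g 1 0)
      * upperSL (t * ((g 1 1 - 1) / g 1 0)),
      ((isC1Path_upper _).mul (isC1Path_lower _)).mul (isC1Path_upper _), ?_, ?_⟩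
    · simp [hu, hl]
    · have hd := sl_det g
      apply sl_ext <;> simp only [sl_mul_apply] <;> simp [upperSL, lowerSL] <;> field_simp <;>
        grind
  by_cases h : g 1 0 = 0
  · have h0 : (lowerSL 1 * g) 1 0 ≠ 0 := by
      rw [sl_mul_apply]
      have hd := sl_det g
      simp only [lowerSL, Matrix.SpecialLinearGroup.coe_mk, Matrix.of_apply, Matrix.cons_val_zero,
        Matrix.cons_val_one, Matrix.cons_val', Matrix.cons_val_fin_one, h]
      intro h1
      rw [h] at hd
      simp at h1
      rw [h1] at hd
      simp at hd
    obtain ⟨c, hc, c0, c1⟩ := key _ h0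
    refine ⟨fun t => lowerSL (t * (-1)) * c t, (isC1Path_lower _).mul hc, ?_, ?_⟩
    · simp [hl, c0]
    · have e : lowerSL (-1) * lowerSL 1 = 1 := by
        apply sl_ext <;> simp only [sl_mul_apply] <;> simp [lowerSL]
      simp only [c1, Complex.ofReal_one, one_mul]
      rw [← mul_assoc, e, one_mul]
  · exact key g h

lemma IsC1Path.hasDerivAt {c : ℝ → SL(2, ℂ)} (hc : IsC1Path c) (i j : Fin 2) (t : ℝ) :
    HasDerivAt (fun s => c s i j) (deriv (fun s => c s i j) t) t :=
  (((hc i j).differentiable (by simp)) t).hasDerivAt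

lemma IsC1Path.continuous_deriv {c : ℝ → SL(2, ℂ)} (hc : IsC1Path c) (i j : Fin 2) :
    Continuous (deriv fun s => c s i j) := (hc i j).continuous_deriv (by simp)

/-- The left logarithmic derivative of a path. -/
def velocityAt (c : ℝ → SL(2, ℂ)) (t : ℝ) : Matrix (Fin 2) (Fin 2) ℂ :=
  (((c t)⁻¹ : SL(2, ℂ)) : Matrix (Fin 2) (Fin 2) ℂ) *
      Matrix.of fun i j => deriv (fun s => (c s : Matrix (Fin 2) (Fin 2) ℂ) i j) t

lemma velocityAt_apply (c : ℝ → SL(2, ℂ)) (t : ℝ) (i j : Fin 2) :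
    velocityAt c t i j = (c t)⁻¹ i 0 * deriv (fun s => c s 0 j) t
      + (c t)⁻¹ i 1 * deriv (fun s => c s 1 j) t := by
  rw [velocityAt, Matrix.mul_apply, Fin.sum_univ_two]
  rfl

/-- Differentiate `det = 1`. -/
lemma IsC1Path.velocityAt_trace {c : ℝ → SL(2, ℂ)} (hc : IsC1Path c) (t : ℝ) :
    velocityAt c t 0 0 + velocityAt c t 1 1 = 0 := by
  have h := ((hc.hasDerivAt 0 0 t).mul (hc.hasDerivAt 1 1 t)).sub
    ((hc.hasDerivAt 0 1 t).mul (hc.hasDerivAt 1 0 t))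
  have e : (fun s => c s 0 0) * (fun s => c s 1 1) - (fun s => c s 0 1) * (fun s => c s 1 0)
      = fun _ => (1 : ℂ) := by
    funext s
    exact sl_det (c s)
  rw [e] at h
  have h2 := h.unique (hasDerivAt_const t (1 : ℂ))
  obtain ⟨⟨i1, i2⟩, i3, i4⟩ := sl_inv_apply (c t)
  rw [velocityAt_apply, velocityAt_apply, i1, i2, i3, i4]
  linear_combination h2

lemma deriv_eq_mul_velocityAt (c : ℝ → SL(2, ℂ)) (t : ℝ) (i j : Fin 2) :
    deriv (fun s => c s i j) t = c t i 0 * velocityAt c t 0 j + c t i 1 * velocityAt c t 1 j := by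
  obtain ⟨⟨i1, i2⟩, i3, i4⟩ := sl_inv_apply (c t)
  have hd := sl_det (c t)
  rw [velocityAt_apply, velocityAt_apply, i1, i2, i3, i4]
  rcases fin_two_cases i with rfl | rfl
  · linear_combination (-deriv (fun s => c s 0 j) t) * hd
  · linear_combination (-deriv (fun s => c s 1 j) t) * hd

lemma IsC1Path.continuous_speed (m : FrameMetric) {c : ℝ → SL(2, ℂ)} (hc : IsC1Path c) :
    Continuous fun t => Real.sqrt (m.Q (velocityAt c t)) := by
  have h : ∀ i j, Continuous fun t => velocityAt c t i j := by
    have h1 : ∀ i j, Continuous fun t => c t i j := fun i j => (hc i j).continuous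
    have h2 := hc.continuous_deriv
    have h3 : ∀ i j, Continuous fun t => (c t)⁻¹ i j := by
      intro i j
      have e : ∀ t, (c t)⁻¹ i j = (c t : Matrix (Fin 2) (Fin 2) ℂ).adjugate i j := fun t => by
        rw [Matrix.SpecialLinearGroup.coe_inv]
      simp only [e, Matrix.adjugate_fin_two]
      rcases fin_two_cases i with rfl | rfl <;> rcases fin_two_cases j with rfl | rfl
      · exact h1 1 1
      · exact (h1 0 1).neg
      · exact (h1 1 0).neg
      · exact h1 0 0
    intro i j
    simp only [velocityAt_apply]
    exact ((h3 _ _).mul (h2 _ _)).add ((h3 _ _).mul (h2 _ _))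
  exact Real.continuous_sqrt.comp (m.continuous_Q.comp
    (continuous_pi fun i => continuous_pi fun j => h i j))

/-- Entries of a short path stay close to the initial ones. -/
lemma IsC1Path.norm_sub_le {m : FrameMetric} {K : ℝ} (hK : 0 < K)
    (hKm : ∀ X : Matrix (Fin 2) (Fin 2) ℂ, X 0 0 + X 1 1 = 0 →
      ∀ i j, ‖X i j‖ ≤ K * Real.sqrt (m.Q X))
    {c : ℝ → SL(2, ℂ)} (hc : IsC1Path c) (h0 : ∀ i j, ‖c 0 i j‖ ≤ 1)
    (hl : 4 * K * pathLength m c ≤ 1) (i j : Fin 2) :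
    ‖c 1 i j - c 0 i j‖ ≤ 4 * K * pathLength m c := by
  have hlen : pathLength m c = ∫ t in (0 : ℝ)..1, Real.sqrt (m.Q (velocityAt c t)) := rfl
  set l := pathLength m c with hldef
  let D : ℝ → Fin 2 → Fin 2 → ℂ := fun t i j => c t i j - c 0 i j
  have hD : Continuous fun t => ‖D t‖ :=
    (continuous_pi fun i => continuous_pi fun j => (hc i j).continuous.sub continuous_const).norm
  obtain ⟨t₀, ht₀, hmax⟩ := isCompact_Icc.exists_isMaxOn (s := Set.Icc (0 : ℝ) 1)
    ⟨0, by simp⟩ hD.continuousOn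
  set B := ‖D t₀‖ with hB
  have hB0 : 0 ≤ B := norm_nonneg _
  have hDij : ∀ t ∈ Set.Icc (0 : ℝ) 1, ∀ i j, ‖c t i j - c 0 i j‖ ≤ B := fun t ht i j =>
    ((norm_le_pi_norm (D t i) j).trans (norm_le_pi_norm (D t) i)).trans (hmax ht)
  have hbd : ∀ t ∈ Set.Icc (0 : ℝ) 1, ∀ i j, ‖c t i j‖ ≤ 1 + B := fun t ht i j => by
    have h1 := norm_add_le (c 0 i j) (c t i j - c 0 i j)
    rw [add_sub_cancel] at h1
    linarith [h0 i j, hDij t ht i j]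
  have hcs := hc.continuous_speed m
  have key : ∀ t ∈ Set.Icc (0 : ℝ) 1, ∀ i j, ‖D t i j‖ ≤ 2 * (1 + B) * K * l := by
    intro t ht i j
    have e : ∫ s in (0 : ℝ)..t, deriv (fun s => c s i j) s = D t i j :=
      intervalIntegral.integral_eq_sub_of_hasDerivAt (fun s _ => hc.hasDerivAt i j s)
        ((hc.continuous_deriv i j).intervalIntegrable _ _)
    rw [← e]
    have h1 : ‖∫ s in (0 : ℝ)..t, deriv (fun s => c s i j) s‖
        ≤ ∫ s in (0 : ℝ)..t, 2 * (1 + B) * K * Real.sqrt (m.Q (velocityAt c s)) := by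
      refine intervalIntegral.norm_integral_le_of_norm_le ht.1 ?_
        ((continuous_const.mul hcs).intervalIntegrable _ _)
      refine Filter.Eventually.of_forall fun s hs => ?_
      have hs' : s ∈ Set.Icc (0 : ℝ) 1 := ⟨hs.1.le, hs.2.trans ht.2⟩
      rw [deriv_eq_mul_velocityAt]
      refine (norm_add_le _ _).trans ?_
      rw [norm_mul, norm_mul]
      have a1 := hKm _ (hc.velocityAt_trace s) 0 j
      have a2 := hKm _ (hc.velocityAt_trace s) 1 j
      have a3 := mul_le_mul (hbd s hs' i 0) a1 (norm_nonneg _) (by linarith)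
      have a4 := mul_le_mul (hbd s hs' i 1) a2 (norm_nonneg _) (by linarith)
      linarith
    refine h1.trans ?_
    rw [intervalIntegral.integral_const_mul, hlen]
    refine mul_le_mul_of_nonneg_left ?_ (by positivity)
    exact intervalIntegral.integral_mono_interval le_rfl ht.1 ht.2
      (Filter.Eventually.of_forall fun s => Real.sqrt_nonneg _) (hcs.intervalIntegrable _ _)
  have hl0 : 0 ≤ l := by
    rw [hlen]
    exact intervalIntegral.integral_nonneg zero_le_one fun _ _ => Real.sqrt_nonneg _
  -- A bootstrap on the maximal deviation `B`: the velocity is bounded in terms of the entries,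
  -- which are at most `1 + B`. Since `4 * K * l ≤ 1`, the inequality absorbs to `B ≤ 4 * K * l`.
  have hBl : B ≤ 2 * (1 + B) * K * l := by
    have h2 : 0 ≤ 2 * (1 + B) * K * l := by positivity
    rw [hB, pi_norm_le_iff_of_nonneg h2]
    intro i
    rw [pi_norm_le_iff_of_nonneg h2]
    exact key t₀ ht₀ i
  have h1 := hDij 1 (by simp) i j
  nlinarith

/-- A path of length less than `2 * ε` from a lift of 1 keeps its entries within `C * ε`. If the
path starts at `-1`, its endpoint is replaced by the opposite matrix. -/
lemma FrameMetric.exists_lift (m : FrameMetric) : ∃ C : ℝ, 0 < C ∧ ∀ ε : ℝ, 0 < ε → C * ε ≤ 1 →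
    ∀ g : G, m.dist 1 g ≤ ε →
      ∃ V : SL(2, ℂ), proj V = g ∧ ∀ i j, ‖V i j - (1 : SL(2, ℂ)) i j‖ ≤ C * ε := by
  obtain ⟨K, hK, hKm⟩ := m.exists_bound
  refine ⟨8 * K, by positivity, fun ε hε hCε g hg => ?_⟩
  obtain ⟨V, rfl⟩ : ∃ V, proj V = g := QuotientGroup.mk_surjective g
  -- The infimum of the empty set would be 0, so a bound on the distance says something only once
  -- some path is known to exist.
  have hne : {L | ∃ c : ℝ → SL(2, ℂ), IsC1Path c ∧ proj (c 0) = 1 ∧ proj (c 1) = proj V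
      ∧ L = pathLength m c}.Nonempty := by
    obtain ⟨c, hc, c0, c1⟩ := exists_isC1Path V
    exact ⟨_, c, hc, by rw [c0]; rfl, by rw [c1], rfl⟩
  obtain ⟨L, ⟨c, hc, c0, c1, rfl⟩, hL⟩ := exists_lt_of_csInf_lt hne
    (show sInf _ < 2 * ε from lt_of_le_of_lt hg (by linarith))
  have hKL : 4 * K * pathLength m c ≤ 8 * K * ε := by nlinarith
  have e0 : c 0 = 1 ∨ c 0 = -1 := proj_eq_proj.1 c0
  have one_le : ∀ i j, ‖(1 : SL(2, ℂ)) i j‖ ≤ 1 := by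
    intro i j
    rcases fin_two_cases i with rfl | rfl <;> rcases fin_two_cases j with rfl | rfl <;> simp
  have h0 : ∀ i j, ‖c 0 i j‖ ≤ 1 := by
    intro i j
    rcases e0 with e | e <;> rw [e]
    · exact one_le i j
    · rw [Matrix.SpecialLinearGroup.coe_neg, Matrix.neg_apply, norm_neg]
      exact one_le i j
  have key := hc.norm_sub_le hK hKm h0 (hKL.trans hCε)
  rcases e0 with e | e
  · refine ⟨c 1, c1, fun i j => ?_⟩
    rw [← e]
    exact (key i j).trans hKL
  · refine ⟨-c 1, ?_, fun i j => ?_⟩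
    · rw [← c1]
      exact proj_eq_proj.2 (Or.inr rfl)
    · have h1 := key i j
      rw [e, Matrix.SpecialLinearGroup.coe_neg, Matrix.neg_apply] at h1
      rw [Matrix.SpecialLinearGroup.coe_neg, Matrix.neg_apply, ← norm_neg]
      refine le_trans (le_of_eq ?_) (h1.trans hKL)
      congr 1; ring

end

/-! ### Triples built from two frames and three short connections -/

section

variable {u w : Fin 3 → SL(2, ℂ)} {r κ : ℝ}

lemma cos_sin_third : Complex.cos (((2 * Real.pi / 3 : ℝ) : ℂ) / 2) = 1 / 2 ∧
    -Complex.I * Complex.sin (((2 * Real.pi / 3 : ℝ) : ℂ) / 2) = -halfRoot := by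
  have e : ((2 * Real.pi / 3 : ℝ) : ℂ) / 2 = ((Real.pi / 3 : ℝ) : ℂ) := by push_cast; ring
  rw [e, ← Complex.ofReal_cos, ← Complex.ofReal_sin, Real.cos_pi_div_three,
    Real.sin_pi_div_three, halfRoot]
  constructor
  · push_cast; ring
  · ring

/-- The rotation of angle `2π/3`. -/
def thirdTurn : SL(2, ℂ) := rotSL (2 * Real.pi / 3)

lemma thirdTurn_apply : (thirdTurn 0 0 = 1 / 2 ∧ thirdTurn 0 1 = -halfRoot) ∧
    thirdTurn 1 0 = -halfRoot ∧ thirdTurn 1 1 = 1 / 2 := by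
  obtain ⟨h1, h2⟩ := cos_sin_third
  exact ⟨⟨h1, h2⟩, h2, h1⟩

lemma thirdTurn_cube : thirdTurn * thirdTurn * thirdTurn = -1 := by
  obtain ⟨⟨h1, h2⟩, h3, h4⟩ := thirdTurn_apply
  have h := halfRoot_sq
  apply sl_ext <;> simp only [sl_mul_apply, h1, h2, h3, h4, Matrix.SpecialLinearGroup.coe_neg,
    Matrix.neg_apply] <;> simp <;> grind

/-- The powers of `-thirdTurn`, which is of order three. -/
def turn : Fin 3 → SL(2, ℂ) := ![1, -thirdTurn, (-thirdTurn)⁻¹]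

lemma turn_succ (n : Fin 3) : turn (n + 1) = turn n * -thirdTurn := by
  have h : (-thirdTurn)⁻¹ = -thirdTurn * -thirdTurn := by
    rw [inv_eq_iff_mul_eq_one, neg_mul_neg, neg_mul, ← mul_assoc, thirdTurn_cube, neg_neg]
  rcases fin_three_cases n with rfl | rfl | rfl
  · simp [turn]
  · change (-thirdTurn)⁻¹ = -thirdTurn * -thirdTurn
    exact h
  · change 1 = (-thirdTurn)⁻¹ * -thirdTurn
    simp

/-- The matrix which corresponds to a boundary component, in terms of the connections. -/
def joint (F : Fin 3 → Fin 2 → Fin 2 → ℂ) (n : Fin 3) : Matrix (Fin 2) (Fin 2) ℂ :=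
  ((turn n)⁻¹ : SL(2, ℂ)) * Matrix.of (F n) * (thirdTurn : Matrix (Fin 2) (Fin 2) ℂ)
    * (Matrix.of (F (n + 1))).adjugate * (turn (n + 1) : Matrix (Fin 2) (Fin 2) ℂ)

/-- The limit of normalized connections. -/
def corank : Fin 2 → Fin 2 → ℂ := ![![0, 0], ![0, 1]]

lemma continuous_joint : Continuous joint := by
  refine continuous_pi fun n => ?_
  have h : ∀ n, Continuous fun F : Fin 3 → Fin 2 → Fin 2 → ℂ => Matrix.of (F n) := fun n =>
    continuous_apply n
  exact (((continuous_const.matrix_mul (h n)).matrix_mul continuous_const).matrix_mul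
    (h (n + 1)).matrix_adjugate).matrix_mul continuous_const

lemma mul_corank_mul (a b c : Matrix (Fin 2) (Fin 2) ℂ) (i j : Fin 2) :
    (a * Matrix.of corank * b * (Matrix.of corank).adjugate * c) i j = a i 1 * b 1 0 * c 0 j := by
  simp [corank, Matrix.mul_apply, Fin.sum_univ_two, Matrix.adjugate_fin_two]

/-- Between `corank` and its adjugate only one entry of the rotation survives, `-halfRoot`; the
result is a column of `(turn n)⁻¹` times a row of `turn (n + 1)`. -/
lemma joint_corank : joint (fun _ => corank) = limitMatrix := by
  obtain ⟨⟨h1, h2⟩, h3, h4⟩ := thirdTurn_apply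
  obtain ⟨⟨i1, i2⟩, i3, i4⟩ := sl_inv_apply thirdTurn
  funext n
  ext i j
  rw [joint, mul_corank_mul, h3]
  rcases fin_three_cases n with rfl | rfl | rfl <;> rcases fin_two_cases i with rfl | rfl <;>
    rcases fin_two_cases j with rfl | rfl <;>
    simp [turn, limitMatrix, corner, i1, i2, i4, h1, h2, h4, mul_comm halfRoot,
      -Matrix.SpecialLinearGroup.coe_inv]

lemma exists_near_corank {ε : ℝ} (hε : 0 < ε) : ∃ δ > 0, ∀ (F : Fin 3 → Fin 2 → Fin 2 → ℂ)
    (z : Fin 3 → ℂ), (∀ n i j, ‖F n i j - corank i j‖ < δ) → (∀ n, ‖z n‖ < δ) →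
    IsNearLimit (joint F) z ∧ ∀ n, ‖4 / 3 * (joint F n 0 0 + joint F n 1 1) - 1‖ < ε := by
  have hc : Continuous fun p : (Fin 3 → Fin 2 → Fin 2 → ℂ) × (Fin 3 → ℂ) => (joint p.1, p.2) :=
    (continuous_joint.comp continuous_fst).prodMk continuous_snd
  have h1 := hc.tendsto ((fun _ => corank), 0)
  simp only [joint_corank] at h1
  have h2 := h1.eventually eventually_isNearLimit
  have h3 : ∀ᶠ p in nhds (((fun _ => corank), 0) : (Fin 3 → Fin 2 → Fin 2 → ℂ) × (Fin 3 → ℂ)),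
      ∀ n, ‖4 / 3 * (joint p.1 n 0 0 + joint p.1 n 1 1) - 1‖ < ε := by
    rw [Filter.eventually_all]
    intro n
    have hj : ∀ i j, Continuous fun p : (Fin 3 → Fin 2 → Fin 2 → ℂ) × (Fin 3 → ℂ) =>
        joint p.1 n i j := fun i j =>
      (((continuous_apply n).comp continuous_joint).matrix_elem i j).comp continuous_fst
    refine ContinuousAt.eventually_lt
      (((continuous_const.mul ((hj 0 0).add (hj 1 1))).sub continuous_const).norm.continuousAt)
      continuousAt_const ?_
    simp only [joint_corank, limitMatrix_trace]
    norm_num [hε]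
  obtain ⟨δ, hδ, h⟩ := Metric.eventually_nhds_iff.1 (h2.and h3)
  refine ⟨δ, hδ, fun F z hF hz => h (y := (F, z)) ?_⟩
  rw [Prod.dist_eq, max_lt_iff]
  refine ⟨(dist_pi_lt_iff hδ).2 fun n => (dist_pi_lt_iff hδ).2 fun i =>
    (dist_pi_lt_iff hδ).2 fun j => ?_, (dist_pi_lt_iff hδ).2 fun n => ?_⟩
  · rw [dist_eq_norm]; exact hF n i j
  · rw [dist_eq_norm]
    change ‖z n - 0‖ < δ
    rw [sub_zero]
    exact hz n

lemma exists_norm_ge_one (t : ℂ) : ∃ x : ℂ, 1 ≤ ‖x‖ ∧ x + x⁻¹ = t := by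
  obtain ⟨s, hs⟩ := IsAlgClosed.exists_pow_nat_eq (t ^ 2 / 4 - 1) two_pos
  have h : (t / 2 + s) * (t / 2 - s) = 1 := by linear_combination -hs
  have h1 : (t / 2 + s)⁻¹ = t / 2 - s := inv_eq_of_mul_eq_one_right h
  rcases le_total 1 ‖t / 2 + s‖ with h2 | h2
  · exact ⟨t / 2 + s, h2, by rw [h1]; ring⟩
  · refine ⟨t / 2 - s, ?_, by rw [← h1, inv_inv, h1]; ring⟩
    have h3 := congrArg norm h
    rw [norm_mul, norm_one] at h3
    nlinarith [norm_nonneg (t / 2 - s)]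

/-- Half-lengths of elements with large trace. -/
lemma exists_half_length {t ζ : ℂ} {ρ e : ℝ} (hρ : 0 < ρ) (ht : t = ρ * (1 + ζ)) (hζ : ‖ζ‖ ≤ e)
    (hρe : ρ⁻¹ ≤ e) (he : e ≤ 1 / 4) :
    ∃ σ : ℂ, 2 * Complex.cosh σ = t ∧ ‖σ - (Real.log ρ : ℝ)‖ ≤ 3 * e := by
  obtain ⟨x, hx, hxt⟩ := exists_norm_ge_one t
  have hρ0 : (ρ : ℂ) ≠ 0 := by exact_mod_cast hρ.ne'
  have hx0 : x ≠ 0 := by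
    rintro rfl
    simp at hx
    linarith
  -- For the root with `1 ≤ ‖x‖` the term `x⁻¹` is negligible against `ρ`, so `x / ρ` is near 1 and
  -- its principal logarithm is small. This also fixes the imaginary part of `σ` near 0.
  have h1 : ‖x / ρ - 1‖ ≤ 2 * e := by
    have e1 : x / ρ - 1 = ζ - x⁻¹ * (ρ : ℂ)⁻¹ := by
      have : x = ρ * (1 + ζ) - x⁻¹ := by rw [← ht, ← hxt]; ring
      rw [div_eq_mul_inv]
      nth_rewrite 1 [this]
      field_simp
      ring
    rw [e1]
    refine (norm_sub_le _ _).trans ?_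
    have h2 : ‖x⁻¹ * (ρ : ℂ)⁻¹‖ ≤ e := by
      rw [norm_mul, norm_inv, norm_inv, Complex.norm_real, Real.norm_of_nonneg hρ.le]
      have : ‖x‖⁻¹ ≤ 1 := inv_le_one_of_one_le₀ hx
      have h3 : 0 ≤ ρ⁻¹ := by positivity
      nlinarith
    linarith
  have h2 : 1 + (x / ρ - 1) ≠ 0 := by
    rw [add_sub_cancel]
    exact div_ne_zero hx0 hρ0
  have h3 : Complex.exp ((Real.log ρ : ℝ) + Complex.log (1 + (x / ρ - 1))) = x := by
    rw [Complex.exp_add, Complex.exp_log h2, ← Complex.ofReal_exp, Real.exp_log hρ]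
    field_simp
    ring
  refine ⟨(Real.log ρ : ℝ) + Complex.log (1 + (x / ρ - 1)), ?_, ?_⟩
  · rw [Complex.cosh, Complex.exp_neg, h3, hxt]
    ring
  · rw [add_sub_cancel_left]
    have := Complex.norm_log_one_add_half_le_self (h1.trans (by linarith : 2 * e ≤ 1 / 2))
    linarith

/-- A connection between two frames: short elements `u` and `w` and long translations. -/
def link (r : ℝ) (u w : SL(2, ℂ)) : SL(2, ℂ) :=
  diagSL ((-r / 4 : ℝ) : ℂ) * u * diagSL ((-(r / 2) : ℝ) : ℂ) * w * diagSL ((-r / 4 : ℝ) : ℂ)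

lemma link_apply {q : ℝ} (hq : q = Real.exp (-r / 8)) (u w : SL(2, ℂ)) :
    ((q : ℂ) ^ 4 * link r u w 0 0 = q ^ 4 * (u 0 1 * w 1 0) + q ^ 8 * (u 0 0 * w 0 0) ∧
     (q : ℂ) ^ 4 * link r u w 0 1 = q ^ 2 * (u 0 1 * w 1 1) + q ^ 6 * (u 0 0 * w 0 1)) ∧
    (q : ℂ) ^ 4 * link r u w 1 0 = q ^ 2 * (u 1 1 * w 1 0) + q ^ 6 * (u 1 0 * w 0 0) ∧
    (q : ℂ) ^ 4 * link r u w 1 1 = u 1 1 * w 1 1 + q ^ 4 * (u 1 0 * w 0 1) := by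
  have hq0 : (q : ℂ) ≠ 0 := by rw [hq]; exact_mod_cast (Real.exp_pos _).ne'
  have e1 : Complex.exp (((-r / 4 : ℝ) : ℂ) / 2) = q := by
    rw [hq, Complex.ofReal_exp]; congr 1; push_cast; ring
  have e2 : Complex.exp (((-(r / 2) : ℝ) : ℂ) / 2) = (q : ℂ) ^ 2 := by
    rw [hq, Complex.ofReal_exp, ← Complex.exp_nat_mul]; congr 1; push_cast; ring
  have e3 : Complex.exp (-(((-r / 4 : ℝ) : ℂ) / 2)) = (q : ℂ)⁻¹ := by rw [Complex.exp_neg, e1]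
  have e4 : Complex.exp (-(((-(r / 2) : ℝ) : ℂ) / 2)) = ((q : ℂ) ^ 2)⁻¹ := by
    rw [Complex.exp_neg, e2]
  have d1 : (diagSL ((-r / 4 : ℝ) : ℂ) 0 0 = q ∧ diagSL ((-r / 4 : ℝ) : ℂ) 0 1 = 0) ∧
      diagSL ((-r / 4 : ℝ) : ℂ) 1 0 = 0 ∧ diagSL ((-r / 4 : ℝ) : ℂ) 1 1 = (q : ℂ)⁻¹ :=
    ⟨⟨e1, rfl⟩, rfl, e3⟩
  have d2 : (diagSL ((-(r / 2) : ℝ) : ℂ) 0 0 = (q : ℂ) ^ 2 ∧ diagSL ((-(r / 2) : ℝ) : ℂ) 0 1 = 0) ∧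
      diagSL ((-(r / 2) : ℝ) : ℂ) 1 0 = 0 ∧ diagSL ((-(r / 2) : ℝ) : ℂ) 1 1 = ((q : ℂ) ^ 2)⁻¹ :=
    ⟨⟨e2, rfl⟩, rfl, e4⟩
  obtain ⟨⟨a1, a2⟩, a3, a4⟩ := d1
  obtain ⟨⟨b1, b2⟩, b3, b4⟩ := d2
  refine ⟨⟨?_, ?_⟩, ?_, ?_⟩ <;>
    simp only [link, sl_mul_apply, a1, a2, a3, a4, b1, b2, b3, b4] <;> field_simp <;> ring

/-- Closeness to the identity, entry by entry. -/
def NearOne (κ : ℝ) (u : SL(2, ℂ)) : Prop := ∀ i j, ‖u i j - (1 : SL(2, ℂ)) i j‖ ≤ κ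

lemma NearOne.inv {u : SL(2, ℂ)} (h : NearOne κ u) : NearOne κ u⁻¹ := by
  obtain ⟨⟨i1, i2⟩, i3, i4⟩ := sl_inv_apply u
  intro i j
  rcases fin_two_cases i with rfl | rfl <;> rcases fin_two_cases j with rfl | rfl
  · rw [i1]; simpa using h 1 1
  · rw [i2]; simpa using h 0 1
  · rw [i3]; simpa using h 1 0
  · rw [i4]; simpa using h 0 0

lemma NearOne.norm_le {u : SL(2, ℂ)} (h : NearOne κ u) (hκ : κ ≤ 1 / 600) (i j : Fin 2) :
    ‖u i j‖ ≤ 11 / 10 := by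
  have h1 := norm_add_le ((1 : SL(2, ℂ)) i j) (u i j - (1 : SL(2, ℂ)) i j)
  rw [add_sub_cancel] at h1
  have h2 : ‖(1 : SL(2, ℂ)) i j‖ ≤ 1 := by
    rcases fin_two_cases i with rfl | rfl <;> rcases fin_two_cases j with rfl | rfl <;> simp
  linarith [h i j]

/-- Only the lower right entry has order `exp (r / 2)`. Relative to it the others are `O(exp (-r /
4))` whatever `κ` is, so the perturbation survives in the scalar `μ` alone. -/
lemma link_bounds {u w : SL(2, ℂ)} (hu : NearOne κ u) (hw : NearOne κ w) (hκ0 : 0 < κ)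
    (hκ : κ ≤ 1 / 600) (hr : Real.exp (-r / 4) ≤ 1 / 2) :
    ∃ μ : ℂ, ‖μ - 1‖ ≤ 3 * κ ∧ link r u w 1 1 = Real.exp (r / 2) * μ ∧
      ∀ i j, ‖link r u w i j / link r u w 1 1 - corank i j‖ ≤ 4 * Real.exp (-r / 4) := by
  set q : ℝ := Real.exp (-r / 8) with hq
  have hq0 : 0 < q := Real.exp_pos _
  have hQ : Real.exp (-r / 4) = q ^ 2 := by
    rw [hq, ← Real.exp_nat_mul]; congr 1; push_cast; ring
  have hR : Real.exp (r / 2) = (q ^ 4)⁻¹ := by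
    rw [hq, ← Real.exp_nat_mul, ← Real.exp_neg]; congr 1; push_cast; ring
  obtain ⟨⟨l1, l2⟩, l3, l4⟩ := link_apply hq u w
  rw [hQ] at hr ⊢
  rw [hR]
  have hq4 : q ^ 4 ≤ 1 / 4 := by nlinarith
  have hqc : (q : ℂ) ^ 4 ≠ 0 := pow_ne_zero _ (by exact_mod_cast hq0.ne')
  set μ : ℂ := u 1 1 * w 1 1 + q ^ 4 * (u 1 0 * w 0 1) with hμ
  have nq : ∀ n : ℕ, ‖(q : ℂ) ^ n‖ = q ^ n := fun n => by
    rw [norm_pow, Complex.norm_real, Real.norm_of_nonneg hq0.le]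
  have hub := hu.norm_le hκ
  have hwb := hw.norm_le hκ
  have hprod : ∀ i j k l, ‖u i j * w k l‖ ≤ 5 / 4 := fun i j k l => by
    rw [norm_mul]
    calc ‖u i j‖ * ‖w k l‖ ≤ 11 / 10 * (11 / 10) := by gcongr; exacts [hub i j, hwb k l]
      _ ≤ 5 / 4 := by norm_num
  have hμ1 : ‖μ - 1‖ ≤ 3 * κ := by
    have e : μ - 1 = (u 1 1 - 1) * w 1 1 + (w 1 1 - 1) + q ^ 4 * (u 1 0 * w 0 1) := by
      rw [hμ]; ring
    have a1 : ‖u 1 1 - 1‖ ≤ κ := by simpa using hu 1 1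
    have a2 : ‖w 1 1 - 1‖ ≤ κ := by simpa using hw 1 1
    have a3 : ‖u 1 0‖ ≤ κ := by simpa using hu 1 0
    have a4 := hwb 1 1
    have a5 := hwb 0 1
    rw [e]
    refine (norm_add₃_le).trans ?_
    rw [norm_mul, norm_mul, norm_mul, nq]
    have b1 : ‖u 1 1 - 1‖ * ‖w 1 1‖ ≤ κ * (11 / 10) := by gcongr
    have b2 : q ^ 4 * (‖u 1 0‖ * ‖w 0 1‖) ≤ 1 / 4 * (κ * (11 / 10)) := by gcongr
    linarith
  have hμ2 : 99 / 100 ≤ ‖μ‖ := by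
    have := norm_sub_norm_le (1 : ℂ) (1 - μ)
    rw [sub_sub_cancel, norm_one, norm_sub_rev] at this
    linarith
  have hμ0 : μ ≠ 0 := by
    intro h
    rw [h, norm_zero] at hμ2
    norm_num at hμ2
  refine ⟨μ, hμ1, ?_, ?_⟩
  · push_cast
    rw [inv_mul_eq_div, eq_div_iff hqc, mul_comm, l4]
  · have hdiv : ∀ i j, link r u w i j / link r u w 1 1 = q ^ 4 * link r u w i j / μ := fun i j => by
      rw [← l4, mul_div_mul_left _ _ hqc]
    have hsmall : ∀ (x : ℂ), ‖x‖ ≤ 5 / 2 * q ^ 2 → ‖x / μ - 0‖ ≤ 4 * q ^ 2 := fun x hx => by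
      rw [sub_zero, norm_div, div_le_iff₀ (by linarith)]
      nlinarith [sq_nonneg q]
    have hsum : ∀ (m n : ℕ) (x y : ℂ), 2 ≤ m → 2 ≤ n → ‖x‖ ≤ 5 / 4 → ‖y‖ ≤ 5 / 4 →
        ‖(q : ℂ) ^ m * x + q ^ n * y‖ ≤ 5 / 2 * q ^ 2 := fun m n x y hm hn hx hy => by
      have hq1 : q ≤ 1 := by nlinarith
      have c1 : q ^ m ≤ q ^ 2 := pow_le_pow_of_le_one hq0.le hq1 hm
      have c2 : q ^ n ≤ q ^ 2 := pow_le_pow_of_le_one hq0.le hq1 hn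
      refine (norm_add_le _ _).trans ?_
      rw [norm_mul, norm_mul, nq, nq]
      have d1 : q ^ m * ‖x‖ ≤ q ^ 2 * (5 / 4) := by gcongr
      have d2 : q ^ n * ‖y‖ ≤ q ^ 2 * (5 / 4) := by gcongr
      linarith
    intro i j
    rw [hdiv]
    rcases fin_two_cases i with rfl | rfl <;> rcases fin_two_cases j with rfl | rfl
    · rw [l1]
      exact hsmall _ (hsum _ _ _ _ (by norm_num) (by norm_num) (hprod _ _ _ _) (hprod _ _ _ _))
    · rw [l2]
      exact hsmall _ (hsum _ _ _ _ (by norm_num) (by norm_num) (hprod _ _ _ _) (hprod _ _ _ _))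
    · rw [l3]
      exact hsmall _ (hsum _ _ _ _ (by norm_num) (by norm_num) (hprod _ _ _ _) (hprod _ _ _ _))
    · rw [l4, div_self hμ0]
      simp only [corank]
      simp
      positivity

/-- The boundary elements of a triple of connections. -/
def boundary (r : ℝ) (u w : Fin 3 → SL(2, ℂ)) (n : Fin 3) : SL(2, ℂ) :=
  (turn n)⁻¹ * link r (u n) (w n) * thirdTurn * (link r (u (n + 1)) (w (n + 1)))⁻¹ * turn (n + 1)

/-- The links and turns telescope and leave the cube of the rotation by `2π/3`, whose lift to SL₂
has cube `-1`. -/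
lemma boundary_prod (r : ℝ) (u w : Fin 3 → SL(2, ℂ)) (k : Fin 3) :
    boundary r u w k * boundary r u w (k + 1) * boundary r u w (k + 2) = -1 := by
  have e : boundary r u w k * boundary r u w (k + 1) * boundary r u w (k + 2)
      = (turn k)⁻¹ * link r (u k) (w k) * (thirdTurn * thirdTurn * thirdTurn)
        * (link r (u k) (w k))⁻¹ * turn k := by
    simp only [boundary, add_one_one, add_two_one]
    group
  rw [e, thirdTurn_cube]
  simp

lemma boundary_eq_smul {F : Fin 3 → Fin 2 → Fin 2 → ℂ} {μ : Fin 3 → ℂ}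
    (h : ∀ n i j, link r (u n) (w n) i j = μ n * F n i j) (n : Fin 3) :
    (boundary r u w n : Matrix (Fin 2) (Fin 2) ℂ) = (μ n * μ (n + 1)) • joint F n := by
  have e : ∀ n, (link r (u n) (w n) : Matrix (Fin 2) (Fin 2) ℂ) = μ n • Matrix.of (F n) := by
    intro n; ext i j; exact h n i j
  simp only [boundary, joint, Matrix.SpecialLinearGroup.coe_mul, Matrix.SpecialLinearGroup.coe_inv,
    e, Matrix.adjugate_smul, Fintype.card_fin, Matrix.smul_mul, Matrix.mul_smul, smul_smul]
  norm_num
  rw [mul_comm]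

/-- Normalized by their lower right entries, the links converge to `corank` as `r` grows, so the
normalized boundary matrices enter the neighbourhood of the limit. The scalars have size `exp r` up
to `O(κ)`, and with the limiting trace 3/4 this gives `log ρ = r - log (4 / 3)`. -/
lemma exists_structure (hκ0 : 0 < κ) (hκ : κ ≤ 1 / 600) : ∃ r₀ : ℝ, 0 < r₀ ∧ ∀ r, r₀ ≤ r →
    ∀ u w : Fin 3 → SL(2, ℂ), (∀ n, NearOne κ (u n)) → (∀ n, NearOne κ (w n)) →
    ∃ (σ : Fin 3 → ℂ) (N : Fin 3 → Matrix (Fin 2) (Fin 2) ℂ) (z c : Fin 3 → ℂ),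
      IsTameTriple (boundary r u w) σ ∧ IsNearLimit N z ∧
      (∀ n, (boundary r u w n : Matrix (Fin 2) (Fin 2) ℂ) = c n • N n) ∧
      (∀ n, Complex.exp (-σ n) = c n * z n) ∧
      ∀ n, ‖σ n - ((r - Real.log (4 / 3) : ℝ) : ℂ)‖ ≤ 24 * κ := by
  obtain ⟨δ, hδ, hδF⟩ := exists_near_corank hκ0
  -- The threshold for `exp (-r / 4)`: below `δ / 8` for the neighbourhood of the limit, below `κ`
  -- for the bound on `ρ⁻¹`, below 1/2 for `link_bounds`. The bound `r ≥ 12` keeps the real parts of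
  -- the half-lengths above 10.
  set η : ℝ := min (min (δ / 8) κ) (1 / 2) with hη
  have hη0 : 0 < η := by positivity
  refine ⟨max 12 (-4 * Real.log η), by positivity, fun r hr u w hu hw => ?_⟩
  have hr12 : 12 ≤ r := (le_max_left _ _).trans hr
  have hrη : Real.exp (-r / 4) ≤ η := by
    have := (le_max_right _ _).trans hr
    rw [← Real.le_log_iff_exp_le hη0]
    linarith
  have hQ1 : Real.exp (-r / 4) ≤ δ / 8 := hrη.trans ((min_le_left _ _).trans (min_le_left _ _))
  have hQ2 : Real.exp (-r / 4) ≤ κ := hrη.trans ((min_le_left _ _).trans (min_le_right _ _))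
  have hQ3 : Real.exp (-r / 4) ≤ 1 / 2 := hrη.trans (min_le_right _ _)
  choose μ hμ1 hμ2 hμ3 using fun n => link_bounds (hu n) (hw n) hκ0 hκ hQ3
  have hlow : ∀ n, 1 / 2 ≤ ‖μ n‖ := fun n => by
    have := norm_sub_norm_le (1 : ℂ) (1 - μ n)
    rw [sub_sub_cancel, norm_one, norm_sub_rev] at this
    linarith [hμ1 n]
  have hl0 : ∀ n, link r (u n) (w n) 1 1 ≠ 0 := fun n => by
    rw [hμ2, ← norm_ne_zero_iff, norm_mul, Complex.norm_real]
    have := hlow n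
    have h2 : 0 < ‖Real.exp (r / 2)‖ := norm_pos_iff.2 (Real.exp_pos _).ne'
    positivity
  set F : Fin 3 → Fin 2 → Fin 2 → ℂ :=
    fun n i j => link r (u n) (w n) i j / link r (u n) (w n) 1 1 with hF
  set c : Fin 3 → ℂ := fun n => link r (u n) (w n) 1 1 * link r (u (n + 1)) (w (n + 1)) 1 1 with hc
  have hM : ∀ n, (boundary r u w n : Matrix (Fin 2) (Fin 2) ℂ) = c n • joint F n :=
    boundary_eq_smul (μ := fun n => link r (u n) (w n) 1 1) fun n i j => by
      rw [hF]; field_simp [hl0 n]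
  have hFδ : ∀ n i j, ‖F n i j - corank i j‖ < δ := fun n i j =>
    (hμ3 n i j).trans_lt (by linarith)
  have hcr : ∀ n, c n = Real.exp r * (μ n * μ (n + 1)) := fun n => by
    simp only [hc, hμ2]
    have : Real.exp r = Real.exp (r / 2) * Real.exp (r / 2) := by
      rw [← Real.exp_add]; congr 1; ring
    rw [this]; push_cast; ring
  have hc0 : ∀ n, c n ≠ 0 := fun n => mul_ne_zero (hl0 n) (hl0 (n + 1))
  have htr := (hδF F 0 hFδ (fun n => by simpa using hδ)).2
  set ρ : ℝ := 3 / 4 * Real.exp r with hρ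
  have hρ0 : 0 < ρ := by positivity
  have hlogρ : Real.log ρ = r - Real.log (4 / 3) := by
    rw [hρ, Real.log_mul (by norm_num) (Real.exp_pos r).ne', Real.log_exp,
      show (3 / 4 : ℝ) = (4 / 3)⁻¹ by norm_num, Real.log_inv]
    ring
  have hexp4 : Real.exp (-r) ≤ Real.exp (-r / 4) := Real.exp_le_exp.2 (by linarith)
  have hσ : ∀ n, ∃ σ : ℂ, 2 * Complex.cosh σ = boundary r u w n 0 0 + boundary r u w n 1 1 ∧
      ‖σ - (Real.log ρ : ℝ)‖ ≤ 3 * (8 * κ) := fun n => by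
    refine exists_half_length
      -- The relative error of the trace collects `3κ + 3κ + κ` from two scalars and the limiting
      -- trace, at most `8κ` with the cross terms. Tripled it is `24κ`, at most 1/25 for `κ ≤
      -- 1/600`, within the bounds of `Tame`.
      (ζ := μ n * μ (n + 1) * (4 / 3 * (joint F n 0 0 + joint F n 1 1)) - 1) hρ0 ?_ ?_ ?_ ?_
    · rw [hM, Matrix.smul_apply, Matrix.smul_apply, hcr, hρ]
      simp only [smul_eq_mul]
      push_cast
      ring
    · set a := μ n - 1 with ha
      set b := μ (n + 1) - 1 with hb
      set d := 4 / 3 * (joint F n 0 0 + joint F n 1 1) - 1 with hd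
      have e : μ n * μ (n + 1) * (4 / 3 * (joint F n 0 0 + joint F n 1 1)) - 1
          = a * ((1 + b) * (1 + d)) + (b * (1 + d) + d) := by rw [ha, hb, hd]; ring
      have na : ‖a‖ ≤ 3 * κ := hμ1 n
      have nb : ‖b‖ ≤ 3 * κ := hμ1 (n + 1)
      have nd : ‖d‖ ≤ κ := (htr n).le
      have n1 : ∀ x : ℂ, ‖x‖ ≤ 3 * κ → ‖1 + x‖ ≤ 51 / 50 := fun x hx => by
        have := norm_add_le (1 : ℂ) x
        rw [norm_one] at this
        linarith
      have n2 := n1 b nb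
      have n3 := n1 d (nd.trans (by linarith))
      rw [e]
      refine (norm_add_le _ _).trans ?_
      refine (add_le_add le_rfl (norm_add_le _ _)).trans ?_
      rw [norm_mul, norm_mul, norm_mul]
      have p1 : ‖a‖ * (‖1 + b‖ * ‖1 + d‖) ≤ 3 * κ * (51 / 50 * (51 / 50)) := by gcongr
      have p2 : ‖b‖ * ‖1 + d‖ ≤ 3 * κ * (51 / 50) := by gcongr
      linarith
    · rw [hρ, mul_inv, ← Real.exp_neg]
      linarith
    · linarith
  choose σ hσ1 hσ2 using hσ
  have hσre : ∀ n, |(σ n).re - Real.log ρ| ≤ 24 * κ := fun n => by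
    have := (Complex.abs_re_le_norm (σ n - (Real.log ρ : ℝ))).trans (hσ2 n)
    rw [Complex.sub_re, Complex.ofReal_re] at this
    linarith
  have hσim : ∀ n, |(σ n).im| ≤ 24 * κ := fun n => by
    have := (Complex.abs_im_le_norm (σ n - (Real.log ρ : ℝ))).trans (hσ2 n)
    rw [Complex.sub_im, Complex.ofReal_im, sub_zero] at this
    linarith
  have hlog : Real.log (4 / 3) ≤ 1 / 3 := by
    have := Real.log_le_sub_one_of_pos (show (0 : ℝ) < 4 / 3 by norm_num)
    linarith
  have htame : IsTameTriple (boundary r u w) σ := by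
    refine ⟨boundary_prod r u w, fun k => (hσ1 k).symm, fun k => ⟨?_, ?_⟩, fun j k => ?_⟩
    · have := (abs_le.1 (hσre k)).1
      linarith
    · linarith [hσim k]
    · have h1 := abs_le.1 (hσre j)
      have h2 := abs_le.1 (hσre k)
      rw [abs_le]
      constructor <;> linarith
  have hz : ∀ n, ‖Complex.exp (-σ n) / c n‖ < δ := fun n => by
    rw [norm_div, hcr, norm_mul, norm_mul, Complex.norm_real,
      Real.norm_of_nonneg (Real.exp_pos r).le]
    have h1 : ‖Complex.exp (-σ n)‖ ≤ 1 := by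
      have := (htame.tame n).norm_exp_neg
      linarith
    have h2 : 1 / 4 ≤ ‖μ n‖ * ‖μ (n + 1)‖ := by
      nlinarith [hlow n, hlow (n + 1)]
    have h3 : Real.exp r * Real.exp (-r) = 1 := by rw [← Real.exp_add]; simp
    have h4 := Real.exp_pos r
    rw [div_lt_iff₀ (by positivity)]
    have h5 : 8 * Real.exp (-r) ≤ δ := by linarith
    calc ‖Complex.exp (-σ n)‖ ≤ 1 := h1
      _ < 8 * Real.exp (-r) * (Real.exp r * (1 / 4)) := by linarith
      _ ≤ δ * (Real.exp r * (‖μ n‖ * ‖μ (n + 1)‖)) := by gcongr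
  refine ⟨σ, joint F, fun n => Complex.exp (-σ n) / c n, c, htame, (hδF F _ hFδ hz).1, hM,
    fun n => ?_, fun n => ?_⟩
  · rw [mul_div_cancel₀ _ (hc0 n)]
  · rw [← hlogρ]
    linarith [hσ2 n]

end

/-! ### Support of the measure -/

lemma rotSL_mul (a b : ℝ) : rotSL a * rotSL b = rotSL (a + b) := by
  have e : ((a + b : ℝ) : ℂ) / 2 = (a : ℂ) / 2 + (b : ℂ) / 2 := by push_cast; ring
  have hI := Complex.I_sq
  apply sl_ext <;> rw [sl_mul_apply] <;>
    simp only [rotSL, Matrix.SpecialLinearGroup.coe_mk, Matrix.of_apply, Matrix.cons_val_zero,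
      Matrix.cons_val_one, Matrix.cons_val', Matrix.cons_val_fin_one, e, Complex.cos_add,
      Complex.sin_add] <;> grind

lemma proj_mul (g h : SL(2, ℂ)) : proj (g * h) = proj g * proj h := rfl

lemma proj_inv (g : SL(2, ℂ)) : proj g⁻¹ = (proj g)⁻¹ := rfl

lemma proj_neg (g : SL(2, ℂ)) : proj (-g) = proj g := proj_eq_proj.2 (Or.inr rfl)

lemma inv_neg_thirdTurn : (-thirdTurn)⁻¹ = rotSL (4 * Real.pi / 3) := by
  rw [inv_eq_iff_mul_eq_one, show 4 * Real.pi / 3 = 2 * Real.pi / 3 + 2 * Real.pi / 3 by ring,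
    ← rotSL_mul]
  change -thirdTurn * (thirdTurn * thirdTurn) = 1
  rw [neg_mul, ← mul_assoc, thirdTurn_cube, neg_neg]

lemma R_eq_turn (k : ZMod 3) : R (2 * (k.val : ℝ) * Real.pi / 3) = proj (turn k) := by
  have h : k = 0 ∨ k = 1 ∨ k = 2 := by decide +revert
  rcases h with rfl | rfl | rfl
  · have e : (2 * ((0 : ZMod 3).val : ℝ) * Real.pi / 3) = 0 := by simp
    rw [e]
    have : rotSL 0 = 1 := by apply sl_ext <;> simp [rotSL]
    rw [R, this]
    rfl
  · have e : (2 * ((1 : ZMod 3).val : ℝ) * Real.pi / 3) = 2 * Real.pi / 3 := by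
      rw [show (1 : ZMod 3).val = 1 from rfl]; simp
    rw [e]
    exact (proj_neg _).symm
  · have e : (2 * ((2 : ZMod 3).val : ℝ) * Real.pi / 3) = 4 * Real.pi / 3 := by
      rw [show (2 : ZMod 3).val = 2 from rfl]; push_cast; ring
    rw [e, R, ← inv_neg_thirdTurn]
    rfl

lemma R_neg_eq_turn (k : ZMod 3) : R (2 * ((-k).val : ℝ) * Real.pi / 3) = (proj (turn k))⁻¹ := by
  rw [R_eq_turn, ← proj_inv]
  have h : k = 0 ∨ k = 1 ∨ k = 2 := by decide +revert
  rcases h with rfl | rfl | rfl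
  · change proj 1 = proj 1⁻¹
    rw [inv_one]
  · rfl
  · change proj (-thirdTurn) = proj ((-thirdTurn)⁻¹)⁻¹
    rw [inv_inv]

lemma A_inv (t : ℝ) : (A (t : ℂ))⁻¹ = A ((-t : ℝ) : ℂ) := by
  rw [A, A, ← proj_inv]
  congr 1
  rw [inv_eq_iff_mul_eq_one]
  apply sl_ext <;> rw [sl_mul_apply] <;> simp [diagSL, ← Complex.exp_add, neg_div]

/-- A nonzero value of the kernel yields a connection. -/
lemma exists_link {m : FrameMetric} {ν : Measure G} {ε κ : ℝ} {χ : G → ℝ} (hχ : IsBump m ν ε χ)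
    (hm : ∀ g : G, m.dist 1 g ≤ ε / 2 → ∃ V : SL(2, ℂ), proj V = g ∧ NearOne κ V)
    {x y a : G} {k : ZMod 3} {r : ℝ}
    (h : kernel ν χ (r / 2) (leg x (-k) (-r)) (a * leg y k r) ≠ 0) :
    ∃ u w : SL(2, ℂ), NearOne κ u ∧ NearOne κ w ∧
      a = x * proj ((turn k)⁻¹ * link r u w * (turn k)⁻¹) * y⁻¹ := by
  -- A nonzero integral has a point where both bumps are nonzero; the two support conditions give
  -- the two short elements.
  obtain ⟨g, hg⟩ : ∃ g, χ ((leg x (-k) (-r))⁻¹ * (g * A ((r / 2 : ℝ) : ℂ)))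
      * χ ((a * leg y k r)⁻¹ * g) ≠ 0 := by
    by_contra hn
    push Not at hn
    apply h
    rw [kernel]
    simp only [hn, integral_zero]
  obtain ⟨u, hu, hu1⟩ := hm _ (hχ.support _ (left_ne_zero_of_mul hg))
  obtain ⟨v, hv, hv1⟩ := hm _ (hχ.support _ (right_ne_zero_of_mul hg))
  refine ⟨u, v⁻¹, hu1, hv1.inv, ?_⟩
  have e1 : g = a * leg y k r * proj v := by rw [hv]; group
  have e2 : a * leg y k r = leg x (-k) (-r) * proj u * (A ((r / 2 : ℝ) : ℂ))⁻¹ * (proj v)⁻¹ := by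
    rw [hu, e1]; group
  have e3 : a = leg x (-k) (-r) * proj u * (A ((r / 2 : ℝ) : ℂ))⁻¹ * (proj v)⁻¹
      * (leg y k r)⁻¹ := by
    rw [← e2, mul_inv_cancel_right]
  have e4 : (A ((r / 4 : ℝ) : ℂ))⁻¹ = A ((-r / 4 : ℝ) : ℂ) := by rw [A_inv, neg_div]
  rw [e3, leg, leg, R_neg_eq_turn, R_eq_turn, mul_inv_rev, mul_inv_rev, e4, A_inv]
  simp only [link, proj_mul, proj_inv, A, mul_assoc]

/-- Triples of connections between two frames give conjugates of the boundary elements. -/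
lemma mul_inv_eq_boundary {x y : G} {a : Fin 3 → G} {u w : Fin 3 → SL(2, ℂ)} {r : ℝ}
    (ha : ∀ k, a k = x * proj ((turn k)⁻¹ * link r (u k) (w k) * (turn k)⁻¹) * y⁻¹) (n : Fin 3) :
    a n * (a (n + 1))⁻¹ = x * proj (boundary r u w n) * x⁻¹ := by
  rw [ha, ha]
  have e : x * proj ((turn n)⁻¹ * link r (u n) (w n) * (turn n)⁻¹) * y⁻¹ *
      (x * proj ((turn (n + 1))⁻¹ * link r (u (n + 1)) (w (n + 1)) * (turn (n + 1))⁻¹) * y⁻¹)⁻¹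
      = x * proj ((turn n)⁻¹ * link r (u n) (w n) * ((turn n)⁻¹ * turn (n + 1))
        * (link r (u (n + 1)) (w (n + 1)))⁻¹ * turn (n + 1)) * x⁻¹ := by
    simp only [proj_mul, proj_inv]
    group
  -- The sign is invisible in PSL₂; dropping it selects the lifts with product `-1` and traces close
  -- in direction to the positive reals.
  have e2 : (turn n)⁻¹ * turn (n + 1) = -thirdTurn := by rw [turn_succ, inv_mul_cancel_left]
  rw [e, e2, boundary, mul_neg, neg_mul, neg_mul, proj_neg]

/-- All the conditions have been established for the matrices `M n`; conjugation by a lift of `x`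
transports them to the elements of `Γ`. -/
lemma isFlatPants_of_connections {Γ : Subgroup G} {κ : ℝ} {M : Fin 3 → SL(2, ℂ)} {σ : Fin 3 → ℂ}
    {N : Fin 3 → Matrix (Fin 2) (Fin 2) ℂ} {z c : Fin 3 → ℂ} (h : IsTameTriple M σ)
    (hN : IsNearLimit N z) (hM : ∀ n, (M n : Matrix (Fin 2) (Fin 2) ℂ) = c n • N n)
    (hz : ∀ n, Complex.exp (-σ n) = c n * z n) {ℓ : ℝ} (hσ : ∀ n, ‖σ n - ((ℓ / 2 : ℝ) : ℂ)‖ ≤ κ)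
    (τ : Triples Γ) (X : SL(2, ℂ)) (hτ : ∀ n : Fin 3, (τ.1 n : G) = proj (X * M n * X⁻¹)) :
    τ.IsFlatPants ℓ κ := by
  have hrep : Γ.subtype.comp τ.rep
      = FreeGroup.lift ![proj (X * M 0 * X⁻¹), proj (X * M 1 * X⁻¹)] := by
    ext i
    rcases fin_two_cases i with rfl | rfl
    · rw [FreeGroup.lift_apply_of]
      change ((FreeGroup.lift ![τ.1 0, τ.1 1] (FreeGroup.of 0) : Γ) : G) = _
      rw [FreeGroup.lift_apply_of]
      exact hτ 0
    · rw [FreeGroup.lift_apply_of]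
      change ((FreeGroup.lift ![τ.1 0, τ.1 1] (FreeGroup.of 1) : Γ) : G) = _
      rw [FreeGroup.lift_apply_of]
      exact hτ 1
  have hX := h.conj X
  refine ⟨?_, ?_, fun m n hmn => ?_, fun n => ?_⟩
  · have e : FreeGroup.lift ![proj (X * M 0 * X⁻¹), proj (X * M 1 * X⁻¹)]
        = (MulAut.conj (proj X)).toMonoidHom.comp (FreeGroup.lift ![proj (M 0), proj (M 1)]) := by
      simp only [proj_mul, proj_inv]
      exact lift_conj (proj X) (proj (M 0)) (proj (M 1))
    have h1 : Function.Injective (Γ.subtype.comp τ.rep) := by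
      rw [hrep, e]
      exact (MulAut.conj (proj X)).injective.comp (injective_of_isNearLimit h hN hM)
    exact Function.Injective.of_comp (f := Γ.subtype) h1
  · rw [hrep]
    obtain ⟨H, P, Q, T, hS, hH⟩ := exists_isSkewHexagon h hN hM hz
    have e : ∀ k, X * H k * X⁻¹ * (X * H (k + 1) * X⁻¹) = X * M k * X⁻¹ := fun k => by
      rw [← hH k]; group
    refine (hS.conj X).isPantsHolonomy ?_ ?_
    · rw [FreeGroup.lift_apply_of]
      exact congrArg proj (e 0).symm
    · rw [FreeGroup.lift_apply_of]
      exact congrArg proj (e 1).symm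
  · rw [show (τ.1 m : G) = _ from hτ m, show (τ.1 n : G) = _ from hτ n]
    exact hX.not_haveCommonFixedPoint (m := m) (n := n) hmn
  · refine ⟨σ n, ?_, ?_, hσ n⟩
    · rw [show (τ.1 n : G) = _ from hτ n,
        show (τ.1 (n + 1) : G) = _ from hτ ((show Fin 3 from n) + 1),
        show (τ.1 (n + 2) : G) = _ from hτ ((show Fin 3 from n) + 2)]
      exact (hX.isHalfLength n).1
    · rw [show (τ.1 n : G) = _ from hτ n]
      exact (hX.isHalfLength n).2

/-- A discrete subspace of a second countable space is countable. This makes every set of triples of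
elements of `Γ` measurable. -/
lemma countable_of_isClosedHyperbolic {Γ : Subgroup G} (h : IsClosedHyperbolic Γ) :
    Countable Γ := by
  have := h.discrete
  have : SecondCountableTopology (Matrix (Fin 2) (Fin 2) ℂ) :=
    inferInstanceAs (SecondCountableTopology (Fin 2 → Fin 2 → ℂ))
  have : SecondCountableTopology SL(2, ℂ) := TopologicalSpace.Subtype.secondCountableTopology _
  have : SecondCountableTopology Γ := inferInstance
  exact TopologicalSpace.separableSpace_iff_countable.1 inferInstance

/-- The preimage of `Sᶜ` depends only on the triple `a`, hence is measurable, and there some kernel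
factor of the density vanishes. Restriction to a fundamental domain can only decrease the measure.
-/
lemma map_Phi_eq_zero {Γ : Subgroup G} (hΓ : IsClosedHyperbolic Γ) {ν : Measure G} {χ : G → ℝ}
    {r : ℝ} {β : Measure (MulAction.orbitRel.Quotient Γ (FramePairs Γ))}
    (hβ : IsInducedMeasure Γ (betaHat Γ ν χ r) β) {S : Set (PHat Γ)}
    (hS : ∀ (x y : G) (a : ZMod 3 → Γ), (∀ k, kernel ν χ (r / 2) (leg x (-k) (-r))
      ((a k : G) * leg y k r) ≠ 0) → (Quotient.mk _ (tripleOf Γ a) : PHat Γ) ∈ S) :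
    β.map (Phi Γ) Sᶜ = 0 := by
  obtain ⟨F, -, rfl⟩ := hβ
  have := hΓ.discrete
  have := countable_of_isClosedHyperbolic hΓ
  have : DiscreteMeasurableSpace Γ := ⟨fun s => (isOpen_discrete s).measurableSet⟩
  have hmk : Measurable fun p : FramePairs Γ =>
      (Quotient.mk _ p : MulAction.orbitRel.Quotient Γ (FramePairs Γ)) :=
    measurable_from_quotient.1 measurable_id
  have hproj : Measurable fun p : G × G × (ZMod 3 → Γ) => p.2.2 :=
    measurable_snd.comp measurable_snd
  have hf : Measurable fun a : ZMod 3 → Γ => (Quotient.mk _ (tripleOf Γ a) : PHat Γ) :=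
    Measurable.of_discrete
  have hcomp : Measurable (Phi Γ ∘ fun p : FramePairs Γ =>
      (Quotient.mk _ p : MulAction.orbitRel.Quotient Γ (FramePairs Γ))) := hf.comp hproj
  have hPhi : Measurable (Phi Γ) := measurable_from_quotient.2 hcomp
  have hmeas : ∀ s : Set (PHat Γ), MeasurableSet s := fun s => trivial
  rw [Measure.map_map hPhi hmk, Measure.map_apply hcomp (hmeas _)]
  refine le_antisymm ((Measure.restrict_apply_le F _).trans ?_) bot_le
  have hT : MeasurableSet {p : G × G × (ZMod 3 → Γ) |
      (Quotient.mk _ (tripleOf Γ p.2.2) : PHat Γ) ∈ Sᶜ} := hcomp (hmeas _)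
  refine le_of_eq ((withDensity_apply (μ := ν.prod (ν.prod (Measure.count : Measure (ZMod 3 → Γ))))
    _ hT).trans ((setLIntegral_congr_fun hT (g := fun _ => 0) fun p hp => ?_).trans (by simp)))
  by_contra h0
  refine hp (hS p.1 p.2.1 p.2.2 fun k hk => h0 ?_)
  simp only
  rw [Finset.prod_eq_zero (Finset.mem_univ k) hk, ENNReal.ofReal_zero]

end KahnMarkovic

end

/-! ### The proposition: choice of the constant. -/

open KahnMarkovic
theorem propositionP (m : FrameMetric) :
    ∃ D : ℝ, 0 < D ∧
      ∀ (Γ : Subgroup G), IsClosedHyperbolic Γ →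
      ∀ (ν : MeasureTheory.Measure G), IsNormalizedHaar Γ ν →
      ∀ ε : ℝ, 0 < ε → D * ε ≤ 1 →
      ∀ χ : G → ℝ, IsBump m ν ε χ →
      ∃ r₀ : ℝ, 0 < r₀ ∧ ∀ r : ℝ, r₀ ≤ r →
      ∀ β : MeasureTheory.Measure (MulAction.orbitRel.Quotient Γ (FramePairs Γ)),
        IsInducedMeasure Γ (betaHat Γ ν χ r) β →
        (β.map (Phi Γ)) (flatPants Γ (2 * r - 2 * Real.log (4 / 3)) (D * ε))ᶜ = 0 := by
  obtain ⟨C, hC, hlift⟩ := m.exists_lift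
  -- With `κ = C * ε`, the condition `D * ε ≤ 1` becomes `κ ≤ 1/600`, as `exists_structure`
  -- requires, and its bound `24 * κ` is at most `D * ε`.
  refine ⟨600 * C, by positivity, fun Γ hΓ ν _ ε hε hDε χ hχ => ?_⟩
  have hCε : 0 < C * ε := by positivity
  have hm : ∀ g : G, m.dist 1 g ≤ ε / 2 → ∃ V : Matrix.SpecialLinearGroup (Fin 2) ℂ,
      proj V = g ∧ NearOne (C * ε) V := fun g hg => by
    obtain ⟨V, hV, hV1⟩ := hlift (ε / 2) (by positivity) (by linarith) g hg
    exact ⟨V, hV, fun i j => (hV1 i j).trans (by linarith)⟩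
  obtain ⟨r₀, hr₀, h⟩ := exists_structure hCε (by linarith)
  refine ⟨r₀, hr₀, fun r hr β hβ => map_Phi_eq_zero hΓ hβ fun x y a hk => ?_⟩
  choose u w hu hw ha using fun k : ZMod 3 => exists_link hχ hm (hk k)
  obtain ⟨σ, N, z, c, h1, h2, h3, h4, h5⟩ := h r hr u w hu hw
  obtain ⟨X, rfl⟩ : ∃ X, proj X = x := QuotientGroup.mk_surjective x
  refine ⟨tripleOf Γ a, rfl, isFlatPants_of_connections h1 h2 h3 h4 (fun n => ?_) _ X fun n => ?_⟩
  · rw [show (2 * r - 2 * Real.log (4 / 3)) / 2 = r - Real.log (4 / 3) by ring]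
    exact (h5 n).trans (by linarith)
  · exact mul_inv_eq_boundary (a := fun k => (a k : G)) ha n
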